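/- **Setting.** Let $a<b$, $\alpha>0$, and let $U\in C^\infty([a,b];\mathbb R)$. For $c\in\mathbb C$ and $\epsilon\ge 0$ put $$P_{c,\epsilon}=i\alpha^{-1}\epsilon^2(\partial_x^2-\alpha^2)^2+(U-c)(\partial_x^2-\alpha^2)-U''.$$ For $\epsilon>0$ let $\Sigma_\epsilon$ be the set of $c\in\mathbb C$ such that $P_{c,\epsilon}:H^4(a,b)\cap H^2_0(a,b)\to L^2(a,b)$ is not invertible. The multiplicity of $c\in\Sigma_\epsilon$ is the dimension of the smallest subspace $S$ of $C^\infty([a,b])$ such that $\psi\in S$ whenever $\psi\in C^\infty([a,b])$, $\psi(a)=\psi(b)=\partial_x\psi(a)=\partial_x\psi(b)=0$ and $P_{c,\epsilon}\psi=(\partial_x^2-\alpha^2)\varphi$ for some $\varphi\in S$. Let $c_0\in\mathbb R$ be a regular value of $U$ (i.e. $U'(x)\ne0$ whenever $x\in[a,b]$ and $U(x)=c_0$) with $c_0\notin\{U(a),U(b)\}$, and assume that $U$ is real analytic near $U^{-1}(\{c_0\})$. Let $K\subset(a,b)$ be a compact set that contains $U^{-1}(\{c_0\})$, let $0<r<\mathrm{dist}(K,\{a,b\})$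 be such that $U$ extends holomorphically to the complex $r$-neighbourhood of $K$ (the extension is still denoted by $U$), and let $m_0:\mathbb R\to\mathbb R$ be a $C^\infty$ function supported in $K\setminus\{U'=0\}$ such that $m_0U'\le0$ on $K$ and $m_0U'<0$ on $U^{-1}(\{c_0\})$. For $\tau>0$ small let $m=\tau m_0$ and $M_{a,b}=\{x+im(x):x\in(a,b)\}$. In the parameter $x$, the derivative along $\overline M_{a,b}$ is $\partial=(1+im'(x))^{-1}\frac{d}{dx}$ (also written $\partial_x$); with $U$ restricted to $\overline M_{a,b}$, this defines $P_{c,\epsilon}$ on $\overline M_{a,b}$. For $\delta>0$ let $$\mathcal R=\{c:\ |\mathrm{Re}\,c-c_0|<\delta,\ \mathrm{Im}\,c>-\delta,\ P_{c,0}:H^2(M_{a,b})\cap H^1_0(M_{a,b})\to L^2(M_{a,b})\text{ is not invertible}\}.$$ The resonant states at $c_1\in\mathcal R$ are the elements of the smallest subspace $S$ of $C^\infty(\overline M_{a,b})$ such that $\psi\in S$ whenever $\psi\in C^\infty(\overline M_{a,b})$, $\psi(a)=\psi(b)=0$ and $P_{c_1,0}\psi=(\partial^2-\alpha^2)\varphi$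 for some $\varphi\in S$ (the generalized eigenvectors); the multiplicity of $c_1$ is $\dim S$, and $c_1$ is simple if $\dim S=1$. **Proposition 4.6.** There is $\tau_0>0$ such that for every $\tau\in(0,\tau_0)$ there is $\delta>0$ with the following properties. If $|\mathrm{Re}\,c-c_0|<\delta$ and $\mathrm{Im}\,c>-\delta$, then $U-c$ does not vanish on $\overline M_{a,b}$; also $U(a),U(b)\notin(c_0-\delta,c_0+\delta)$. Let $c_1\in\mathcal R$ be simple. Then there are $\nu,\epsilon_0>0$ such that for every $\epsilon\in(0,\epsilon_0)$ the set $\Sigma_\epsilon$ has exactly one element $c(\epsilon)$ in the disk of centre $c_1$ and radius $\nu$, and its multiplicity is $1$. Moreover, for every non-zero resonant state $\psi_0$ at $c_1$, $$\int_{M_{a,b}}\psi_0\,\frac{(\partial^2-\alpha^2)\psi_0}{U-c_1}\,dz\neq0,\qquad c(\epsilon)=c_1+\dot c(0)\,\epsilon+\mathcal O(\epsilon^2)\quad(\epsilon\to0^+),$$ $$\dot c(0)=\frac{\lambda\,(\partial\psi_0(a))^2-\mu\,(\partial\psi_0(b))^2}{\int_{M_{a,b}}\psi_0\,\frac{(\partial^2-\alpha^2)\psi_0}{U-c_1}\,dz},\qquad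 \lambda=\frac1{\sqrt{i\alpha(U(a)-c_1)}},\quad \mu=\frac1{\sqrt{i\alpha(U(b)-c_1)}},$$ where the square roots in $\lambda$ and $\mu$ have respectively negative and positive real part. -/

import Mathlib

open Set Filter MeasureTheory Asymptotics Topology
open scoped ContDiff

noncomputable section

/-- Hypotheses on the profile `U` on `[a, b]` near the real number `c₀`: `c₀` is a regular value of
`U`, it is not a boundary value of `U`, and `U` is real analytic near `U ⁻¹' {c₀}`. -/
structure ProfileHypothesis (a b : ℝ) (U : ℝ → ℝ) (c₀ : ℝ) : Prop where
  regular : ∀ x ∈ Icc a b, U x = c₀ → derivWithin U (Icc a b) x ≠ 0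
  ne_left : U a ≠ c₀
  ne_right : U b ≠ c₀
  analytic : ∀ x ∈ Icc a b, U x = c₀ → AnalyticAt ℝ U x

/-- Data of a complex deformation `x ↦ x + i τ m₀(x)` of `[a, b]` adapted to `U` and `c₀`: a compact
set `K ⊆ (a, b)` containing `U ⁻¹' {c₀}`, a radius `r`, the (unique) holomorphic extension `V` of
`U` to the complex `r`-neighbourhood of `K`, and a smooth real function `m₀`, supported in
`K \ {U' = 0}`, with `m₀ U' ≤ 0` on `K` and `m₀ U' < 0` on `U ⁻¹' {c₀}`. -/
structure DeformationData (a b : ℝ) (U : ℝ → ℝ) (c₀ : ℝ) where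
  K : Set ℝ
  isCompact_K : IsCompact K
  level_subset : ∀ x ∈ Icc a b, U x = c₀ → x ∈ K
  r : ℝ
  r_pos : 0 < r
  K_inside : ∀ x ∈ K, a < x - r ∧ x + r < b
  V : ℂ → ℂ
  V_eq : ∀ x ∈ Icc a b, V (x : ℂ) = (U x : ℂ)
  V_holo : DifferentiableOn ℂ V (Metric.thickening r ((fun x : ℝ => (x : ℂ)) '' K))
  m₀ : ℝ → ℝ
  m₀_smooth : ContDiff ℝ ∞ m₀
  m₀_support : tsupport m₀ ⊆ K \ {x | deriv U x = 0}
  m₀_sign : ∀ x ∈ K, m₀ x * deriv U x ≤ 0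
  m₀_sign_level : ∀ x ∈ Icc a b, U x = c₀ → m₀ x * deriv U x < 0

namespace DeformationData

variable {a b : ℝ} {U : ℝ → ℝ} {c₀ : ℝ}

/-- The height function `m = τ m₀` of the deformed segment. -/
def height (D : DeformationData a b U c₀) (τ : ℝ) : ℝ → ℝ := fun x => τ * D.m₀ x

/-- The profile `U` on the deformed segment, as a function of the parameter `x ∈ [a, b]`. -/
def profile (D : DeformationData a b U c₀) (τ : ℝ) : ℝ → ℂ :=
  fun x => D.V ((x : ℂ) + Complex.I * (D.height τ x : ℂ))

end DeformationData

/-! Functions on the curve `{x + i m(x) : x ∈ [a, b]}` are written as functions of the parameter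
`x ∈ [a, b]`. For `m = 0` the curve is the segment `[a, b]`. -/

/-- The derivative along the curve: `∂ = (1 + i m')⁻¹ d/dx`. -/
def curveDeriv (a b : ℝ) (m : ℝ → ℝ) (f : ℝ → ℂ) : ℝ → ℂ :=
  fun x => (1 + Complex.I * ((deriv m x : ℝ) : ℂ))⁻¹ * derivWithin f (Icc a b) x

/-- The operator `∂² - α²` along the curve. -/
def curveLaplace (a b : ℝ) (m : ℝ → ℝ) (α : ℝ) (f : ℝ → ℂ) : ℝ → ℂ :=
  fun x => curveDeriv a b m (curveDeriv a b m f) x - (α : ℂ) ^ 2 * f x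

/-- `P_{c,ε} = i α⁻¹ ε² (∂² - α²)² + (W - c)(∂² - α²) - W''` along the curve, where `W` is the
profile along the curve. For `ε = 0` this is the Rayleigh operator. -/
def orrSommerfeldOp (a b : ℝ) (m : ℝ → ℝ) (α : ℝ) (W : ℝ → ℂ) (c : ℂ) (ε : ℝ) (f : ℝ → ℂ) :
    ℝ → ℂ :=
  fun x => Complex.I * (α : ℂ)⁻¹ * (ε : ℂ) ^ 2 * curveLaplace a b m α (curveLaplace a b m α f) x
    + (W x - c) * curveLaplace a b m α f x - curveDeriv a b m (curveDeriv a b m W) x * f x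

/-- The Sobolev space `H^n` of the curve: `f, ∂f, …, ∂^{n-1} f` are absolutely continuous on
`[a, b]` and `∂^n f` is square integrable. -/
def MemCurveSobolev (a b : ℝ) (m : ℝ → ℝ) (n : ℕ) (f : ℝ → ℂ) : Prop :=
  (∀ j < n, AbsolutelyContinuousOnInterval ((curveDeriv a b m)^[j] f) a b) ∧
    MemLp ((curveDeriv a b m)^[n] f) 2 (volume.restrict (Icc a b))

/-- Dirichlet boundary condition. -/
def DirichletBC (a b : ℝ) (f : ℝ → ℂ) : Prop := f a = 0 ∧ f b = 0

/-- Dirichlet and Neumann boundary conditions. -/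
def DirichletNeumannBC (a b : ℝ) (m : ℝ → ℝ) (f : ℝ → ℂ) : Prop :=
  DirichletBC a b f ∧ curveDeriv a b m f a = 0 ∧ curveDeriv a b m f b = 0

/-- `P`, defined on the functions on `[a, b]` that satisfy `dom`, is invertible onto `L²`: for every
`f ∈ L²` there is exactly one `ψ` in the domain with `P ψ = f` almost everywhere. (For a bounded
operator between Banach spaces this is invertibility, by the open mapping theorem.) -/
def IsInvertibleOntoL2 (a b : ℝ) (dom : (ℝ → ℂ) → Prop) (P : (ℝ → ℂ) → ℝ → ℂ) : Prop :=
  ∀ f : ℝ → ℂ, MemLp f 2 (volume.restrict (Icc a b)) →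
    ∃ ψ : ℝ → ℂ, dom ψ ∧ P ψ =ᵐ[volume.restrict (Icc a b)] f ∧
      ∀ φ : ℝ → ℂ, dom φ → P φ =ᵐ[volume.restrict (Icc a b)] f → EqOn φ ψ (Icc a b)

/-- `Σ_ε`: the set of `c` such that `P_{c,ε} : H⁴(a,b) ∩ H²₀(a,b) → L²(a,b)` is not invertible. -/
def orrSommerfeldSpectrum (a b : ℝ) (U : ℝ → ℝ) (α ε : ℝ) : Set ℂ :=
  {c | ¬ IsInvertibleOntoL2 a b
    (fun ψ => MemCurveSobolev a b 0 4 ψ ∧ DirichletNeumannBC a b 0 ψ)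
    (orrSommerfeldOp a b 0 α (fun x => (U x : ℂ)) c ε)}

/-- The half-strip `(c₀ - δ, c₀ + δ) + i (-δ, +∞)`. -/
def halfStrip (c₀ δ : ℝ) : Set ℂ := {c | |c.re - c₀| < δ ∧ -δ < c.im}

/-- The set `𝓡` of resonances: the `c` in the half-strip such that the Rayleigh operator
`P_{c,0} : H² ∩ H¹₀ → L²` on the deformed segment is not invertible. -/
def resonances {a b : ℝ} {U : ℝ → ℝ} {c₀ : ℝ} (D : DeformationData a b U c₀) (α τ δ : ℝ) : Set ℂ :=
  {c | c ∈ halfStrip c₀ δ ∧ ¬ IsInvertibleOntoL2 a b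
    (fun ψ => MemCurveSobolev a b (D.height τ) 2 ψ ∧ DirichletBC a b ψ)
    (orrSommerfeldOp a b (D.height τ) α (D.profile τ) c 0)}

/-- The smallest space `S` of functions on `[a, b]` such that every smooth `ψ` that satisfies the
boundary condition `bc` and `P ψ = (∂² - α²) φ` for some smooth `φ ∈ S` belongs to `S`. -/
def generalizedEigenspace (a b : ℝ) (m : ℝ → ℝ) (α : ℝ) (bc : (ℝ → ℂ) → Prop)
    (P : (ℝ → ℂ) → ℝ → ℂ) : Submodule ℂ (Icc a b → ℂ) :=
  sInf {S | ∀ ψ φ : ℝ → ℂ, ContDiffOn ℝ ∞ ψ (Icc a b) → ContDiffOn ℝ ∞ φ (Icc a b) → bc ψ →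
    (Icc a b).domRestrict φ ∈ S → EqOn (P ψ) (curveLaplace a b m α φ) (Icc a b) →
    (Icc a b).domRestrict ψ ∈ S}

/-- The generalized eigenspace of `c` for the Orr–Sommerfeld problem on `[a, b]`; its dimension is
the multiplicity of `c` as an element of `Σ_ε`. -/
def orrSommerfeldEigenspace (a b : ℝ) (U : ℝ → ℝ) (α ε : ℝ) (c : ℂ) : Submodule ℂ (Icc a b → ℂ) :=
  generalizedEigenspace a b 0 α (DirichletNeumannBC a b 0)
    (orrSommerfeldOp a b 0 α (fun x => (U x : ℂ)) c ε)

/-- The space of resonant states (generalized eigenvectors of the Rayleigh problem on the deformed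
segment) at `c`; its dimension is the multiplicity of the resonance `c`. -/
def resonantStates {a b : ℝ} {U : ℝ → ℝ} {c₀ : ℝ} (D : DeformationData a b U c₀) (α τ : ℝ)
    (c : ℂ) : Submodule ℂ (Icc a b → ℂ) :=
  generalizedEigenspace a b (D.height τ) α (DirichletBC a b)
    (orrSommerfeldOp a b (D.height τ) α (D.profile τ) c 0)

/-- The contour integral `∫ f dz` over the curve `z = x + i m(x)`, `x ∈ [a, b]`. -/
def graphIntegral (a b : ℝ) (m : ℝ → ℝ) (f : ℝ → ℂ) : ℂ :=
  ∫ x in a..b, f x * (1 + Complex.I * ((deriv m x : ℝ) : ℂ))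

end

/-!
On the deformed curve `M = {x + i m(x)}` with speed `s = 1 + i m'` the Orr–Sommerfeld equation for
`Ω = (∂² - α²)ψ` is, to leading order, `ε² d²Ω/dx² = s² iα (W - c) Ω`, where `W` is `U` on `M`. The
sign condition on `m₀ U'` keeps the coefficient off the negative real axis for `c` in a half-strip
around `c₀` (`DeformationData.eventually_elliptic`): there is no critical layer, and only boundary
layers of width `ε` at the two endpoints, near which `m = 0`, obstruct a regular limit `ε → 0`.

*A priori estimate.* Let `ψ` vanish to first order at both endpoints and put `Ω = (∂² - α²)ψ`.
Multiplying `P_{c,ε}ψ` by `ζ conj Ω`, where `ζ` is a square root of the inverse of `s² iα(W - c₁)`,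
controls `√ε ‖Ω‖` by the boundary values of `Ω` and `∂Ω` and by the data
(`RayleighResonance.energy_estimate`). Pairing with the boundary layer `exp (κ (x - p) / ε)`, where
`κ² = iα(W(p) - c₁)`, gives a Robin condition `ε ∂Ω(p) ≈ κ Ω(p)`
(`RayleighResonance.robin_estimate`); pairing with slowly varying functions expresses `ε² ∂Ω(p)`
through `ψ` (`RayleighResonance.slow_estimate`). Finally, solving the Rayleigh equation with a
right-hand side orthogonal to the resonant state `ψ₀` shows by duality that the component of `ψ`
transversal to `ψ₀` is small (`RayleighResonance.dual_estimate`). Together,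
`RayleighResonance.apriori_estimate` bounds `ψ` by its coefficient `coord ψ` along `ψ₀` and by
`P_{c,ε}ψ`, uniformly for `c` near `c₁` and small `ε`.

*Reduction to one equation.* Hence the bordered problem `P_{c,ε}ψ = η h`, `coord ψ = 1` is uniquely
solvable for `c` near `c₁`, and `c` is an eigenvalue iff `η = 0`. The function `ψ₀ / (W - c₁)` is
annihilated by the adjoint of the Rayleigh operator at `c₁`; testing with it shows that `η(c)` is
close to an affine function of slope `-∫ ψ₀ (∂² - α²)ψ₀ / (W - c₁) dz`
(`RayleighResonance.bordered_estimate`). Where this integral does not vanish, Newton's map is a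
contraction, which gives exactly one eigenvalue, with a one-dimensional eigenspace and without
Jordan chains (`RayleighResonance.exists_eigenvalue_branch`). If the integral vanished,
`P_{c₁,0}ψ₁ = (∂² - α²)ψ₀` would be solvable with Dirichlet conditions and the resonance would not be
simple (`exists_state_of_finrank_eq_one`).

*Expansion.* Testing the eigenvalue equation with `ψ₀ / (W - c₁)` leaves, at order `ε`, the boundary
values of `ε Ω`. By the Robin condition they are those of the layer that compensates the slip
`∂ψ₀(p)` (`RayleighResonance.boundary_vorticity`), which produces the formula for `dc/dε`
(`RayleighResonance.eigenvalue_expansion`).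

*Return to the real segment.* The equations `P ψ = 0`, `P ψ₁ = (∂² - α²)ψ` are a first order linear
system for the pair `(ψ, ψ₁)`. Its monodromy along `x ↦ x + t m₀(x)` is holomorphic in `t`, and
constant for real `t`, where the curve is only a reparametrization of `[a, b]`; so it is the same for
`t = iτ` and `t = 0` (`monodromy_eq`). As the boundary conditions are conditions on the values at the
endpoints, eigenvalues and Jordan chains on the curve and on the segment agree
(`RayleighResonance.transfer`). On the segment, invertibility from `H⁴ ∩ H²₀` onto `L²` amounts to the
absence of classical solutions of the homogeneous problem (`isInvertibleOntoL2_iff`).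
-/

open scoped ComplexConjugate

noncomputable section

/-! ### Linear ordinary differential equations on a compact interval -/

section LinearODE

variable {a b : ℝ} {E : Type*} [NormedAddCommGroup E] [NormedSpace ℂ E]

/-- The pointwise action of an operator-valued continuous function on a vector-valued one, as a
bounded bilinear map. -/
def pointwiseApply (X E : Type*) [TopologicalSpace X] [CompactSpace X] [NormedAddCommGroup E]
    [NormedSpace ℂ E] : C(X, E →L[ℂ] E) →L[ℂ] C(X, E) →L[ℂ] C(X, E) :=
  LinearMap.mkContinuous₂
    (LinearMap.mk₂ ℂ (fun (B : C(X, E →L[ℂ] E)) (y : C(X, E)) =>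
        (⟨fun x => B x (y x), by fun_prop⟩ : C(X, E)))
      (fun _ _ _ => by ext; simp) (fun _ _ _ => by ext; simp)
      (fun _ _ _ => by ext; simp) (fun _ _ _ => by ext; simp)) 1
    (fun B y => by
      rw [one_mul]
      refine (ContinuousMap.norm_le _ (mul_nonneg (norm_nonneg B) (norm_nonneg y))).2 fun x => ?_
      exact ((B x).le_opNorm _).trans
        (mul_le_mul (B.norm_coe_le_norm x) (y.norm_coe_le_norm x) (norm_nonneg _) (norm_nonneg B)))

theorem continuous_IccExtend {F : Type*} [TopologicalSpace F] (hab : a ≤ b) (u : C(Icc a b, F)) :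
    Continuous (IccExtend hab u) := u.continuous.Icc_extend'

/-- The primitive vanishing at the left endpoint, as a bounded operator on continuous functions. -/
def volterra (hab : a ≤ b) (E : Type*) [NormedAddCommGroup E] [NormedSpace ℂ E] :
    C(Icc a b, E) →L[ℂ] C(Icc a b, E) :=
  LinearMap.mkContinuous
    { toFun := fun u => ⟨fun x => ∫ t in a..(x : ℝ), IccExtend hab u t, by
        have := intervalIntegral.continuous_primitive
          (fun c d => (continuous_IccExtend hab u).intervalIntegrable (μ := volume) c d) a
        exact this.comp continuous_subtype_val⟩
      map_add' := fun u v => by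
        ext x
        simp only [ContinuousMap.coe_mk, ContinuousMap.add_apply]
        rw [← intervalIntegral.integral_add
          ((continuous_IccExtend hab u).intervalIntegrable _ _)
          ((continuous_IccExtend hab v).intervalIntegrable _ _)]
        rfl
      map_smul' := fun c u => by
        ext x
        simp only [ContinuousMap.coe_mk, ContinuousMap.smul_apply, RingHom.id_apply]
        rw [← intervalIntegral.integral_smul]
        rfl } (b - a) (fun u => by
      refine (ContinuousMap.norm_le _ (mul_nonneg (by linarith) (norm_nonneg _))).2 fun x => ?_
      have h := intervalIntegral.norm_integral_le_of_norm_le_const (a := a) (b := x)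
        (f := IccExtend hab u) (C := ‖u‖) (fun t _ => u.norm_coe_le_norm _)
      refine h.trans ?_
      rw [mul_comm, abs_of_nonneg (by linarith [x.2.1])]
      exact mul_le_mul_of_nonneg_right (by linarith [x.2.2]) (norm_nonneg _))

/-- The Volterra operator `y ↦ ∫ₐˣ B y` of the linear system `y' = B y`. -/
def systemOp (hab : a ≤ b) (B : C(Icc a b, E →L[ℂ] E)) : C(Icc a b, E) →L[ℂ] C(Icc a b, E) :=
  (volterra hab E).comp (pointwiseApply (Icc a b) E B)

theorem systemOp_apply (hab : a ≤ b) (B : C(Icc a b, E →L[ℂ] E)) (y : C(Icc a b, E))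
    (x : Icc a b) : systemOp hab B y x =
      ∫ t in a..(x : ℝ), B (projIcc a b hab t) (y (projIcc a b hab t)) := rfl

theorem norm_systemOp_pow_apply_le (hab : a ≤ b) (B : C(Icc a b, E →L[ℂ] E)) (n : ℕ)
    (y : C(Icc a b, E)) (x : Icc a b) :
    ‖(systemOp hab B ^ n) y x‖ ≤ (‖B‖ * (x - a)) ^ n / n.factorial * ‖y‖ := by
  induction n generalizing x with
  | zero => simpa using y.norm_coe_le_norm x
  | succ n ih =>
    rw [pow_succ', mul_apply_eq_comp, systemOp_apply]
    have hx : a ≤ (x : ℝ) := x.2.1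
    have hle : ‖∫ t in a..(x : ℝ), B (projIcc a b hab t)
        ((systemOp hab B ^ n) y (projIcc a b hab t))‖ ≤
        ∫ t in a..(x : ℝ), ‖B‖ * ((‖B‖ * (t - a)) ^ n / n.factorial * ‖y‖) := by
      refine intervalIntegral.norm_integral_le_of_norm_le hx ?_ ?_
      · refine Eventually.of_forall fun t ht => ?_
        have htI : t ∈ Icc a b := ⟨ht.1.le, ht.2.trans x.2.2⟩
        rw [projIcc_of_mem hab htI]
        exact ((B _).le_opNorm _).trans
          (mul_le_mul (B.norm_coe_le_norm _) (ih _) (norm_nonneg _) (norm_nonneg B))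
      · exact Continuous.intervalIntegrable (by fun_prop) _ _
    refine hle.trans (le_of_eq ?_)
    have : ∀ t : ℝ, ‖B‖ * ((‖B‖ * (t - a)) ^ n / n.factorial * ‖y‖) =
        (‖B‖ ^ (n + 1) / n.factorial * ‖y‖) * (t - a) ^ n := fun t => by
      rw [mul_pow, pow_succ]; ring
    simp_rw [this]
    rw [intervalIntegral.integral_const_mul,
      intervalIntegral.integral_comp_sub_right (fun t => t ^ n), integral_pow]
    rw [Nat.factorial_succ, mul_pow]
    push_cast
    have h1 : ((n : ℝ) + 1) ≠ 0 := by positivity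
    have h2 : (n.factorial : ℝ) ≠ 0 := by positivity
    field_simp
    simp

/-- Volterra operators are quasi-nilpotent. -/
theorem isUnit_one_sub_systemOp [CompleteSpace E] (hab : a ≤ b) (B : C(Icc a b, E →L[ℂ] E)) :
    IsUnit (1 - systemOp hab B) := by
  set T := systemOp hab B
  have hT : ∀ n, ‖T ^ n‖ ≤ (‖B‖ * (b - a)) ^ n / n.factorial := fun n => by
    have h0 : 0 ≤ ‖B‖ * (b - a) := mul_nonneg (norm_nonneg B) (by linarith)
    refine ContinuousLinearMap.opNorm_le_bound _ (by positivity) fun y => ?_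
    refine (ContinuousMap.norm_le _ (by positivity)).2 fun x => ?_
    refine (norm_systemOp_pow_apply_le hab B n y x).trans ?_
    have : 0 ≤ (x : ℝ) - a := by linarith [x.2.1]
    have h2 : (x : ℝ) - a ≤ b - a := by linarith [x.2.2]
    gcongr
  obtain ⟨n, hn⟩ := ((FloorSemiring.tendsto_pow_div_factorial_atTop
    (‖B‖ * (b - a))).eventually_lt_const one_pos).exists
  have hu : IsUnit (1 - T ^ n) := isUnit_one_sub_of_norm_lt_one (x := T ^ n) ((hT n).trans_lt hn)
  rw [← mul_neg_geom_sum T n] at hu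
  have hc : Commute (1 - T) (∑ i ∈ Finset.range n, T ^ i) :=
    (Commute.sum_right _ _ _ fun i _ =>
      ((Commute.one_left _).sub_left ((Commute.refl T).pow_right i)))
  exact (hc.isUnit_mul_iff.1 hu).1

theorem bijective_sub_systemOp [CompleteSpace E] (hab : a ≤ b) (B : C(Icc a b, E →L[ℂ] E)) :
    Function.Bijective fun y => y - systemOp hab B y :=
  ContinuousLinearMap.isUnit_iff_bijective.1 (isUnit_one_sub_systemOp hab B)

/-- A function on `[a, b]` that is continuous there, as a bundled continuous function. -/
def restrictC {F : Type*} [TopologicalSpace F] (f : ℝ → F) (hf : ContinuousOn f (Icc a b)) :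
    C(Icc a b, F) := ⟨(Icc a b).domRestrict f, hf.domRestrict⟩

variable [CompleteSpace E]

/-- Solvability of the integral equation of a linear system. -/
theorem exists_integral_eq (hab : a ≤ b) {B : ℝ → E →L[ℂ] E} (hB : ContinuousOn B (Icc a b))
    {G : ℝ → E} (hG : ContinuousOn G (Icc a b)) :
    ∃ y : ℝ → E, ContinuousOn y (Icc a b) ∧
      ∀ x ∈ Icc a b, y x = G x + ∫ t in a..x, B t (y t) := by
  obtain ⟨Y, hY⟩ := (bijective_sub_systemOp hab (restrictC B hB)).2 (restrictC G hG)
  refine ⟨IccExtend hab Y, (continuous_IccExtend hab Y).continuousOn, fun x hx => ?_⟩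
  have h := DFunLike.congr_fun hY ⟨x, hx⟩
  rw [ContinuousMap.sub_apply, systemOp_apply, sub_eq_iff_eq_add] at h
  rw [IccExtend_of_mem hab _ hx, h]
  congr 1
  refine intervalIntegral.integral_congr fun t ht => ?_
  rw [uIcc_of_le hx.1] at ht
  have htI : t ∈ Icc a b := ⟨ht.1, ht.2.trans hx.2⟩
  simp only [projIcc_of_mem hab htI, IccExtend_of_mem hab _ htI]
  rfl

theorem eqOn_zero_of_integral_eq (hab : a ≤ b) {B : ℝ → E →L[ℂ] E}
    (hB : ContinuousOn B (Icc a b)) {y : ℝ → E} (hy : ContinuousOn y (Icc a b))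
    (h : ∀ x ∈ Icc a b, y x = ∫ t in a..x, B t (y t)) : ∀ x ∈ Icc a b, y x = 0 := by
  have h1 : restrictC y hy = 0 := by
    refine (bijective_sub_systemOp hab (restrictC B hB)).1 ?_
    simp only [map_zero, sub_zero]
    ext ⟨x, hx⟩
    have : y x - systemOp hab (restrictC B hB) (restrictC y hy) ⟨x, hx⟩ = 0 := by
      rw [systemOp_apply, sub_eq_zero, h x hx]
      refine intervalIntegral.integral_congr fun t ht => ?_
      rw [uIcc_of_le hx.1] at ht
      have htI : t ∈ Icc a b := ⟨ht.1, ht.2.trans hx.2⟩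
      simp only [projIcc_of_mem hab htI]
      rfl
    exact this
  intro x hx
  exact DFunLike.congr_fun h1 ⟨x, hx⟩

/-- `y` solves the linear system `y' = B y` on `[a, b]`. -/
def SolvesOn (a b : ℝ) (B : ℝ → E →L[ℂ] E) (y : ℝ → E) : Prop :=
  ∀ x ∈ Icc a b, HasDerivWithinAt y (B x (y x)) (Icc a b) x

omit [CompleteSpace E] in
theorem SolvesOn.continuousOn {B : ℝ → E →L[ℂ] E} {y : ℝ → E} (h : SolvesOn a b B y) :
    ContinuousOn y (Icc a b) := fun x hx => (h x hx).continuousWithinAt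

/-- The fundamental theorem of calculus for one-sided derivatives on `[a, b]`. -/
theorem integral_eq_sub_of_hasDerivWithinAt_Icc {F : Type*} [NormedAddCommGroup F]
    [NormedSpace ℝ F] [CompleteSpace F] (hab : a ≤ b) {f f' : ℝ → F}
    (h : ∀ x ∈ Icc a b, HasDerivWithinAt f (f' x) (Icc a b) x)
    (hf' : ContinuousOn f' (Icc a b)) : ∫ t in a..b, f' t = f b - f a := by
  refine intervalIntegral.integral_eq_sub_of_hasDerivAt_of_le hab
    (fun x hx => (h x hx).continuousWithinAt)
    (fun x hx => (h x (Ioo_subset_Icc_self hx)).hasDerivAt (Icc_mem_nhds hx.1 hx.2)) ?_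
  exact ContinuousOn.intervalIntegrable (by rwa [uIcc_of_le hab])

theorem hasDerivWithinAt_integral_Icc {F : Type*} [NormedAddCommGroup F]
    [NormedSpace ℝ F] [CompleteSpace F] (hab : a ≤ b) {f : ℝ → F}
    (hf : ContinuousOn f (Icc a b)) {x : ℝ} (hx : x ∈ Icc a b) :
    HasDerivWithinAt (fun x => ∫ t in a..x, f t) (f x) (Icc a b) x := by
  have hc : Continuous (IccExtend hab ((Icc a b).domRestrict f)) :=
    hf.domRestrict.Icc_extend'
  have h := (intervalIntegral.integral_hasDerivAt_right (hc.intervalIntegrable (μ := volume) a x)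
    hc.stronglyMeasurable.stronglyMeasurableAtFilter hc.continuousAt).hasDerivWithinAt (s := Icc a b)
  rw [IccExtend_of_mem hab _ hx] at h
  refine h.congr_of_mem (fun y hy => ?_) hx
  refine intervalIntegral.integral_congr fun t ht => ?_
  rw [uIcc_of_le hy.1] at ht
  have htI : t ∈ Icc a b := ⟨ht.1, ht.2.trans hy.2⟩
  simp only [IccExtend_of_mem hab _ htI]
  rfl

theorem SolvesOn.integral_eq {B : ℝ → E →L[ℂ] E} (hB : ContinuousOn B (Icc a b)) {y : ℝ → E}
    (h : SolvesOn a b B y) {x : ℝ} (hx : x ∈ Icc a b) : y x = y a + ∫ t in a..x, B t (y t) := by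
  have hsub : Icc a x ⊆ Icc a b := Icc_subset_Icc_right hx.2
  rw [integral_eq_sub_of_hasDerivWithinAt_Icc hx.1
    (fun t ht => (h t (hsub ht)).mono hsub) ((hB.clm_apply h.continuousOn).mono hsub)]
  abel

theorem SolvesOn.of_integral_eq (hab : a ≤ b) {B : ℝ → E →L[ℂ] E} (hB : ContinuousOn B (Icc a b))
    {y : ℝ → E} (hy : ContinuousOn y (Icc a b)) {y₀ : E}
    (h : ∀ x ∈ Icc a b, y x = y₀ + ∫ t in a..x, B t (y t)) : SolvesOn a b B y := fun _ hx =>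
  ((hasDerivWithinAt_integral_Icc hab (hB.clm_apply hy) hx).const_add y₀).congr_of_mem h hx

theorem exists_solvesOn (hab : a ≤ b) {B : ℝ → E →L[ℂ] E} (hB : ContinuousOn B (Icc a b))
    (y₀ : E) : ∃ y : ℝ → E, y a = y₀ ∧ SolvesOn a b B y := by
  obtain ⟨y, hy, h⟩ := exists_integral_eq hab hB (continuousOn_const (c := y₀))
  exact ⟨y, by simpa using h a ⟨le_rfl, hab⟩, SolvesOn.of_integral_eq hab hB hy h⟩

theorem SolvesOn.eqOn (hab : a ≤ b) {B : ℝ → E →L[ℂ] E} (hB : ContinuousOn B (Icc a b))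
    {y z : ℝ → E} (hy : SolvesOn a b B y) (hz : SolvesOn a b B z) (h : y a = z a) :
    EqOn y z (Icc a b) := by
  intro x hx
  refine sub_eq_zero.1 (eqOn_zero_of_integral_eq hab hB (y := fun x => y x - z x)
    (hy.continuousOn.sub hz.continuousOn) (fun x hx => ?_) x hx)
  have hd : ∀ x ∈ Icc a b, HasDerivWithinAt (fun x => y x - z x) (B x (y x - z x))
      (Icc a b) x := fun x hx => by
    rw [map_sub]; exact (hy x hx).sub (hz x hx)
  have := SolvesOn.integral_eq hB hd hx
  simpa [h] using this

omit [CompleteSpace E] in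
theorem SolvesOn.contDiffOn (hab : a < b) {B : ℝ → E →L[ℂ] E} (hB : ContDiffOn ℝ ∞ B (Icc a b))
    {y : ℝ → E} (hy : SolvesOn a b B y) : ContDiffOn ℝ ∞ y (Icc a b) := by
  have hu : UniqueDiffOn ℝ (Icc a b) := uniqueDiffOn_Icc hab
  rw [contDiffOn_infty]
  intro n
  induction n with
  | zero => exact contDiffOn_zero.2 hy.continuousOn
  | succ n ih =>
    rw [show ((n + 1 : ℕ) : WithTop ℕ∞) = (n : WithTop ℕ∞) + 1 by push_cast; rfl,
      contDiffOn_succ_iff_derivWithin hu]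
    refine ⟨fun x hx => (hy x hx).differentiableWithinAt, by simp, ?_⟩
    have h1 : ContDiffOn ℝ n (fun x => B x (y x)) (Icc a b) :=
      ContDiffOn.clm_apply (F := E) (G := E)
        ((ContinuousLinearMap.restrictScalarsL ℂ E E ℝ ℝ).contDiff.comp_contDiffOn
          (hB.of_le (by exact_mod_cast le_top))) ih
    exact h1.congr fun x hx => (hy x hx).derivWithin (hu x hx)

end LinearODE

section HolomorphicParameter

/-- A jointly continuous function that is holomorphic in the first variable is a holomorphic
function with values in the space of continuous functions of the second variable. -/
theorem differentiableOn_continuousMap {X F : Type*} [TopologicalSpace X] [CompactSpace X]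
    [NormedAddCommGroup F] [NormedSpace ℂ F] [CompleteSpace F] {R : ℝ} {f : ℂ → C(X, F)}
    (hf : ContinuousOn f (Metric.ball 0 R))
    (hd : ∀ x, DifferentiableOn ℂ (fun t => f t x) (Metric.ball 0 R)) :
    DifferentiableOn ℂ f (Metric.ball 0 R) := by
  intro t ht
  obtain ⟨r, htr, hrR⟩ := exists_between (mem_ball_zero_iff.1 ht)
  have hr : 0 < r := (norm_nonneg t).trans_lt htr
  have hsub : Metric.closedBall (0 : ℂ) r ⊆ Metric.ball 0 R :=
    Metric.closedBall_subset_ball hrR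
  have hci : CircleIntegrable f 0 r :=
    (hf.mono (Metric.sphere_subset_closedBall.trans hsub)).circleIntegrable hr.le
  lift r to NNReal using hr.le
  have hr' : 0 < r := by exact_mod_cast hr
  have hA := (hasFPowerSeriesOn_cauchy_integral hci hr').differentiableOn
  have hmem : t ∈ Metric.ball (0 : ℂ) r := mem_ball_zero_iff.2 htr
  rw [Metric.eball_coe] at hA
  have hE : EqOn f (fun w => (2 * Real.pi * Complex.I : ℂ)⁻¹ •
      ∮ z in C(0, r), (z - w)⁻¹ • f z) (Metric.ball 0 r) := by
    intro w hw
    ext x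
    have hci' : CircleIntegrable (fun z => (z - w)⁻¹ • f z) 0 r := by
      refine ContinuousOn.circleIntegrable hr.le (ContinuousOn.fun_smul ?_
        (hf.mono (Metric.sphere_subset_closedBall.trans hsub)))
      refine ContinuousOn.inv₀ (by fun_prop) fun z hz h => ?_
      rw [sub_eq_zero] at h
      subst h
      exact absurd (Metric.mem_sphere.1 hz) (ne_of_lt (Metric.mem_ball.1 hw))
    have hev := (((hd x).diffContOnCl_ball hsub)).two_pi_i_inv_smul_circleIntegral_sub_inv_smul hw
    simp only [ContinuousMap.smul_apply]
    rw [← hev]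
    congr 1
    unfold circleIntegral
    have := (ContinuousMap.evalCLM ℂ x : C(X, F) →L[ℂ] F).intervalIntegral_comp_comm
      hci'.out
    simpa using this
  exact ((hA.congr hE).differentiableAt (Metric.isOpen_ball.mem_nhds hmem)).differentiableWithinAt

/-- Holomorphic dependence on `t` of the solution `y` of `y - L (Φ t) y = v`. -/
theorem differentiableOn_of_sub_apply_eq {F G : Type*} [NormedAddCommGroup F] [NormedSpace ℂ F]
    [NormedAddCommGroup G] [NormedSpace ℂ G] [CompleteSpace G] (L : F →L[ℂ] (G →L[ℂ] G))
    {Φ : ℂ → F} {s : Set ℂ} (hΦ : DifferentiableOn ℂ Φ s)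
    (hu : ∀ t ∈ s, Function.Bijective fun y => y - L (Φ t) y) {y : ℂ → G} {v : G}
    (hy : ∀ t ∈ s, y t - L (Φ t) (y t) = v) : DifferentiableOn ℂ y s := by
  have hU : ∀ t ∈ s, IsUnit (1 - L (Φ t)) := fun t ht =>
    ContinuousLinearMap.isUnit_iff_bijective.2 (hu t ht)
  have h : DifferentiableOn ℂ (fun t => Ring.inverse (1 - L (Φ t)) v) s := by
    intro t ht
    have h0 : DifferentiableWithinAt ℂ (fun t => L (Φ t)) s t :=
      L.differentiableAt.comp_differentiableWithinAt t (hΦ t ht)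
    have h1 : DifferentiableWithinAt ℂ (fun t => 1 - L (Φ t)) s t := h0.const_sub 1
    have h2 : DifferentiableWithinAt ℂ (fun t => Ring.inverse (1 - L (Φ t))) s t :=
      DifferentiableAt.comp_differentiableWithinAt (g := Ring.inverse) t
        (differentiableAt_inverse (hU t ht)) h1
    exact h2.clm_apply (differentiableWithinAt_const v)
  refine h.congr fun t ht => ?_
  obtain ⟨u, hu⟩ := hU t ht
  have hv : v = (u : G →L[ℂ] G) (y t) := by rw [hu, ← hy t ht]; rfl
  rw [← hu, Ring.inverse_unit, hv, ← mul_apply_eq_comp, u.inv_mul]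
  rfl

variable {a b : ℝ} {E : Type*} [NormedAddCommGroup E] [NormedSpace ℂ E] [CompleteSpace E]

/-- Solutions of a linear system depend holomorphically on a parameter of the system. -/
theorem differentiableOn_solution (hab : a ≤ b) {R : ℝ} {B : ℂ → ℝ → E →L[ℂ] E}
    (hB : ContinuousOn (fun p : ℂ × ℝ => B p.1 p.2) (Metric.ball 0 R ×ˢ Icc a b))
    (hd : ∀ x ∈ Icc a b, DifferentiableOn ℂ (fun t => B t x) (Metric.ball 0 R))
    {y : ℂ → ℝ → E} {y₀ : E} (hy : ∀ t ∈ Metric.ball 0 R, SolvesOn a b (B t) (y t))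
    (hy₀ : ∀ t ∈ Metric.ball 0 R, y t a = y₀) {x : ℝ} (hx : x ∈ Icc a b) :
    DifferentiableOn ℂ (fun t => y t x) (Metric.ball 0 R) := by
  have hBt : ∀ t ∈ Metric.ball (0 : ℂ) R, ContinuousOn (B t) (Icc a b) := fun t ht =>
    hB.comp (f := fun x => (t, x)) (by fun_prop) fun x hx => ⟨ht, hx⟩
  classical
  set Φ : ℂ → C(Icc a b, E →L[ℂ] E) := fun t =>
    if ht : t ∈ Metric.ball (0 : ℂ) R then restrictC (B t) (hBt t ht) else 0
  have hΦ : ∀ t ∈ Metric.ball (0 : ℂ) R, ∀ x, Φ t x = B t x := fun t ht x => by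
    simp only [Φ, dif_pos ht]; rfl
  have hΦc : ContinuousOn Φ (Metric.ball 0 R) := by
    rw [continuousOn_iff_continuous_domRestrict]
    refine ContinuousMap.continuous_of_continuous_uncurry _ ?_
    have : Continuous fun p : Metric.ball (0 : ℂ) R × Icc a b => B p.1 p.2 :=
      hB.comp_continuous (f := fun p : Metric.ball (0 : ℂ) R × Icc a b => ((p.1 : ℂ), (p.2 : ℝ)))
        (by fun_prop) fun p => ⟨p.1.2, p.2.2⟩
    refine this.congr fun p => ?_
    exact (hΦ p.1 p.1.2 p.2).symm
  have hΦd : DifferentiableOn ℂ Φ (Metric.ball 0 R) :=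
    differentiableOn_continuousMap hΦc fun x => (hd x x.2).congr fun t ht => hΦ t ht x
  set L : C(Icc a b, E →L[ℂ] E) →L[ℂ] (C(Icc a b, E) →L[ℂ] C(Icc a b, E)) :=
    (ContinuousLinearMap.compL ℂ _ _ _ (volterra hab E)).comp (pointwiseApply (Icc a b) E)
  have hL : ∀ t, L (Φ t) = systemOp hab (Φ t) := fun t => rfl
  set Y : ℂ → C(Icc a b, E) := fun t =>
    if ht : t ∈ Metric.ball (0 : ℂ) R then restrictC (y t) (hy t ht).continuousOn else 0
  have hY : ∀ t ∈ Metric.ball (0 : ℂ) R, ∀ x, Y t x = y t x := fun t ht x => by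
    simp only [Y, dif_pos ht]; rfl
  have hbij : ∀ t ∈ Metric.ball (0 : ℂ) R, Function.Bijective fun z => z - L (Φ t) z :=
    fun t _ => bijective_sub_systemOp hab (Φ t)
  have hYd : DifferentiableOn ℂ Y (Metric.ball 0 R) := by
    refine differentiableOn_of_sub_apply_eq (F := C(Icc a b, E →L[ℂ] E)) (G := C(Icc a b, E))
      (L := L) (Φ := Φ) ?_ ?_ (v := ContinuousMap.const _ y₀) fun t ht => ?_
    · exact hΦd
    · exact hbij
    rw [hL]
    ext ⟨z, hz⟩
    rw [ContinuousMap.sub_apply, systemOp_apply, hY t ht, (hy t ht).integral_eq (hBt t ht) hz,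
      hy₀ t ht, sub_eq_iff_eq_add]
    congr 1
    refine intervalIntegral.integral_congr fun s hs => ?_
    rw [uIcc_of_le hz.1] at hs
    have hsI : s ∈ Icc a b := ⟨hs.1, hs.2.trans hz.2⟩
    simp only [projIcc_of_mem hab hsI, hΦ t ht, hY t ht]
  have hfin : DifferentiableOn ℂ (fun t => Y t ⟨x, hx⟩) (Metric.ball 0 R) :=
    (ContinuousMap.evalCLM ℂ (⟨x, hx⟩ : Icc a b) :
      C(Icc a b, E) →L[ℂ] E).differentiable.comp_differentiableOn hYd
  exact hfin.congr fun t ht => (hY t ht ⟨x, hx⟩).symm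

end HolomorphicParameter

/-! ### The `L²` norm of continuous functions on an interval -/

section L2

variable {a b : ℝ}

/-- The `L²` norm on `[a, b]` with respect to the parameter. -/
def l2 (a b : ℝ) (f : ℝ → ℂ) : ℝ := Real.sqrt (∫ x in a..b, ‖f x‖ ^ 2)

theorem l2_nonneg (f : ℝ → ℂ) : 0 ≤ l2 a b f := Real.sqrt_nonneg _

theorem l2_sq (hab : a ≤ b) (f : ℝ → ℂ) : l2 a b f ^ 2 = ∫ x in a..b, ‖f x‖ ^ 2 :=
  Real.sq_sqrt (intervalIntegral.integral_nonneg hab fun _ _ => by positivity)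

theorem ContinuousOn.intervalIntegrable_Icc {F : Type*} [NormedAddCommGroup F] (hab : a ≤ b)
    {f : ℝ → F} (hf : ContinuousOn f (Icc a b)) : IntervalIntegrable f volume a b :=
  ContinuousOn.intervalIntegrable (by rwa [uIcc_of_le hab])

theorem sq_integral_mul_le (hab : a ≤ b) {u v : ℝ → ℝ} (hu : ContinuousOn u (Icc a b))
    (hv : ContinuousOn v (Icc a b)) :
    (∫ x in a..b, u x * v x) ^ 2 ≤ (∫ x in a..b, u x ^ 2) * ∫ x in a..b, v x ^ 2 := by
  have h : ∀ t : ℝ, 0 ≤ (∫ x in a..b, u x ^ 2) * (t * t) + (-2 * ∫ x in a..b, u x * v x) * t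
      + ∫ x in a..b, v x ^ 2 := fun t => by
    have h0 : 0 ≤ ∫ x in a..b, (u x * t - v x) ^ 2 :=
      intervalIntegral.integral_nonneg hab fun _ _ => by positivity
    have h1 : ∫ x in a..b, (u x * t - v x) ^ 2 =
        ∫ x in a..b, (u x ^ 2 * (t * t) + (u x * v x) * (-2 * t) + v x ^ 2) := by
      congr 1; ext x; ring
    rw [h1, intervalIntegral.integral_add, intervalIntegral.integral_add,
      intervalIntegral.integral_mul_const, intervalIntegral.integral_mul_const] at h0
    · linarith
    all_goals exact ContinuousOn.intervalIntegrable_Icc hab (by fun_prop)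
  have := discrim_le_zero h
  rw [discrim] at this
  nlinarith

theorem integral_norm_mul_norm_le (hab : a ≤ b) {f g : ℝ → ℂ} (hf : ContinuousOn f (Icc a b))
    (hg : ContinuousOn g (Icc a b)) :
    ∫ x in a..b, ‖f x‖ * ‖g x‖ ≤ l2 a b f * l2 a b g := by
  refine abs_le_of_sq_le_sq' ?_ (mul_nonneg (l2_nonneg _) (l2_nonneg _)) |>.2
  rw [mul_pow, l2_sq hab, l2_sq hab]
  exact sq_integral_mul_le hab hf.norm hg.norm

theorem norm_integral_mul_le (hab : a ≤ b) {f g : ℝ → ℂ} (hf : ContinuousOn f (Icc a b))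
    (hg : ContinuousOn g (Icc a b)) : ‖∫ x in a..b, f x * g x‖ ≤ l2 a b f * l2 a b g := by
  refine (intervalIntegral.norm_integral_le_integral_norm hab).trans ?_
  simp_rw [norm_mul]
  exact integral_norm_mul_norm_le hab hf hg

theorem l2_add_le (hab : a ≤ b) {f g : ℝ → ℂ} (hf : ContinuousOn f (Icc a b))
    (hg : ContinuousOn g (Icc a b)) : l2 a b (fun x => f x + g x) ≤ l2 a b f + l2 a b g := by
  refine abs_le_of_sq_le_sq' ?_ (add_nonneg (l2_nonneg _) (l2_nonneg _)) |>.2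
  have h1 : ∫ x in a..b, ‖f x + g x‖ ^ 2 ≤
      ∫ x in a..b, (‖f x‖ ^ 2 + ‖f x‖ * ‖g x‖ * 2 + ‖g x‖ ^ 2) := by
    refine intervalIntegral.integral_mono_on hab
      (ContinuousOn.intervalIntegrable_Icc hab (by fun_prop))
      (ContinuousOn.intervalIntegrable_Icc hab (by fun_prop)) fun x _ => ?_
    have := norm_add_le (f x) (g x)
    have h0 := norm_nonneg (f x + g x)
    nlinarith
  rw [intervalIntegral.integral_add, intervalIntegral.integral_add,
      intervalIntegral.integral_mul_const] at h1
  · have h2 := integral_norm_mul_norm_le hab hf hg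
    rw [l2_sq hab, add_sq, l2_sq hab, l2_sq hab]
    linarith
  all_goals exact ContinuousOn.intervalIntegrable_Icc hab (by fun_prop)

theorem l2_le_mul (hab : a ≤ b) {f g : ℝ → ℂ} {C : ℝ} (hC : 0 ≤ C) (hf : ContinuousOn f (Icc a b))
    (hg : ContinuousOn g (Icc a b)) (h : ∀ x ∈ Icc a b, ‖f x‖ ≤ C * ‖g x‖) :
    l2 a b f ≤ C * l2 a b g := by
  refine abs_le_of_sq_le_sq' ?_ (mul_nonneg hC (l2_nonneg _)) |>.2
  rw [mul_pow, l2_sq hab, l2_sq hab, ← intervalIntegral.integral_const_mul]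
  refine intervalIntegral.integral_mono_on hab
      (ContinuousOn.intervalIntegrable_Icc hab (by fun_prop))
      (ContinuousOn.intervalIntegrable_Icc hab (by fun_prop)) fun x hx => ?_
  rw [← mul_pow]
  exact pow_le_pow_left₀ (norm_nonneg _) (h x hx) 2

theorem l2_const_mul (c : ℂ) (f : ℝ → ℂ) :
    l2 a b (fun x => c * f x) = ‖c‖ * l2 a b f := by
  unfold l2
  simp_rw [norm_mul, mul_pow]
  rw [intervalIntegral.integral_const_mul, Real.sqrt_mul (by positivity),
    Real.sqrt_sq (norm_nonneg _)]

theorem l2_le_of_norm_le (hab : a ≤ b) {f : ℝ → ℂ} {C : ℝ} (hC : 0 ≤ C)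
    (hf : ContinuousOn f (Icc a b)) (h : ∀ x ∈ Icc a b, ‖f x‖ ≤ C) :
    l2 a b f ≤ C * Real.sqrt (b - a) := by
  have := l2_le_mul hab hC hf (g := fun _ => 1) continuousOn_const (by simpa using h)
  simpa [l2] using this

theorem exists_norm_le_Icc {F : Type*} [SeminormedAddCommGroup F] {f : ℝ → F}
    (hf : ContinuousOn f (Icc a b)) : ∃ C, 0 ≤ C ∧ ∀ x ∈ Icc a b, ‖f x‖ ≤ C := by
  obtain ⟨C, hC⟩ := isCompact_Icc.exists_bound_of_continuousOn hf
  exact ⟨max C 0, le_max_right _ _, fun x hx => (hC x hx).trans (le_max_left _ _)⟩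

theorem integral_norm_le (hab : a ≤ b) {f : ℝ → ℂ} (hf : ContinuousOn f (Icc a b)) :
    ∫ x in a..b, ‖f x‖ ≤ Real.sqrt (b - a) * l2 a b f := by
  have := integral_norm_mul_norm_le hab hf (g := fun _ => 1) continuousOn_const
  simpa [l2, mul_comm] using this

theorem eqOn_zero_of_l2_eq_zero (hab : a < b) {f : ℝ → ℂ} (hf : ContinuousOn f (Icc a b))
    (h : l2 a b f = 0) : ∀ x ∈ Icc a b, f x = 0 := by
  by_contra! hne
  obtain ⟨x, hx, hfx⟩ := hne
  have : 0 < ∫ x in a..b, ‖f x‖ ^ 2 :=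
    intervalIntegral.integral_pos hab (by fun_prop) (fun _ _ => by positivity)
      ⟨x, hx, by positivity⟩
  rw [← l2_sq hab.le, h] at this
  norm_num at this

end L2

/-! ### Calculus along the curve -/

section CurveCalculus

variable {a b : ℝ} {m : ℝ → ℝ} {α : ℝ}

/-- The speed `dz/dx = 1 + i m'(x)` of the parametrization `x ↦ x + i m(x)`. -/
def speed (m : ℝ → ℝ) (x : ℝ) : ℂ := 1 + Complex.I * ((deriv m x : ℝ) : ℂ)

theorem speed_ne_zero (m : ℝ → ℝ) (x : ℝ) : speed m x ≠ 0 := fun h => by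
  have := congrArg Complex.re h
  simp [speed] at this

theorem contDiff_speed (hm : ContDiff ℝ ∞ m) : ContDiff ℝ ∞ (speed m) := by
  have h1 : ContDiff ℝ ∞ (deriv m) := by
    have := contDiff_infty_iff_deriv.1 hm
    exact this.2
  exact contDiff_const.add (contDiff_const.mul (Complex.ofRealCLM.contDiff.comp h1))

theorem curveDeriv_eq_of_hasDerivWithinAt (hab : a < b) {f : ℝ → ℂ} {g : ℂ} {x : ℝ}
    (hx : x ∈ Icc a b) (h : HasDerivWithinAt f (speed m x * g) (Icc a b) x) :
    curveDeriv a b m f x = g := by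
  rw [curveDeriv, h.derivWithin (uniqueDiffOn_Icc hab x hx)]
  exact inv_mul_cancel_left₀ (speed_ne_zero m x) g

theorem hasDerivWithinAt_curveDeriv {f : ℝ → ℂ} {x : ℝ}
    (h : DifferentiableWithinAt ℝ f (Icc a b) x) :
    HasDerivWithinAt f (speed m x * curveDeriv a b m f x) (Icc a b) x := by
  exact h.hasDerivWithinAt.congr_deriv (mul_inv_cancel_left₀ (speed_ne_zero m x) _).symm

theorem curveDeriv_congr {f g : ℝ → ℂ} (h : EqOn f g (Icc a b)) :
    EqOn (curveDeriv a b m f) (curveDeriv a b m g) (Icc a b) := fun x hx => by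
  simp only [curveDeriv, derivWithin_congr h (h hx)]

theorem curveLaplace_congr {f g : ℝ → ℂ} (h : EqOn f g (Icc a b)) :
    EqOn (curveLaplace a b m α f) (curveLaplace a b m α g) (Icc a b) := fun x hx => by
  simp only [curveLaplace, curveDeriv_congr (curveDeriv_congr h) hx, h hx]

theorem contDiffOn_curveDeriv (hab : a < b) (hm : ContDiff ℝ ∞ m) {f : ℝ → ℂ}
    (hf : ContDiffOn ℝ ∞ f (Icc a b)) : ContDiffOn ℝ ∞ (curveDeriv a b m f) (Icc a b) :=
  (((contDiff_speed hm).contDiffOn).inv fun x _ => speed_ne_zero m x).mul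
    (hf.derivWithin (uniqueDiffOn_Icc hab) (by simp))

theorem contDiffOn_curveLaplace (hab : a < b) (hm : ContDiff ℝ ∞ m) {f : ℝ → ℂ}
    (hf : ContDiffOn ℝ ∞ f (Icc a b)) : ContDiffOn ℝ ∞ (curveLaplace a b m α f) (Icc a b) :=
  (contDiffOn_curveDeriv hab hm (contDiffOn_curveDeriv hab hm hf)).sub (contDiffOn_const.mul hf)

/-- `f₁ = ∂f` and `g = (∂² - α²) f` along the curve, with `g` continuous. -/
structure LapOn (a b : ℝ) (m : ℝ → ℝ) (α : ℝ) (f f₁ g : ℝ → ℂ) : Prop where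
  deriv_fst : ∀ x ∈ Icc a b, HasDerivWithinAt f (speed m x * f₁ x) (Icc a b) x
  deriv_snd : ∀ x ∈ Icc a b, HasDerivWithinAt f₁ (speed m x * (g x + α ^ 2 * f x)) (Icc a b) x
  cont : ContinuousOn g (Icc a b)

namespace LapOn

variable {f f₁ Lf g g₁ Lg : ℝ → ℂ}

theorem continuousOn (h : LapOn a b m α f f₁ Lf) : ContinuousOn f (Icc a b) :=
  fun x hx => (h.deriv_fst x hx).continuousWithinAt

theorem continuousOn_deriv (h : LapOn a b m α f f₁ Lf) : ContinuousOn f₁ (Icc a b) :=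
  fun x hx => (h.deriv_snd x hx).continuousWithinAt

theorem of_contDiffOn (hab : a < b) (hm : ContDiff ℝ ∞ m) (hf : ContDiffOn ℝ ∞ f (Icc a b)) :
    LapOn a b m α f (curveDeriv a b m f) (curveLaplace a b m α f) where
  deriv_fst x hx := hasDerivWithinAt_curveDeriv (hf.differentiableOn (by simp) x hx)
  deriv_snd x hx := by
    have := hasDerivWithinAt_curveDeriv (m := m)
      ((contDiffOn_curveDeriv hab hm hf).differentiableOn (by simp) x hx)
    refine this.congr_deriv ?_
    rw [curveLaplace]; ring
  cont := (contDiffOn_curveLaplace hab hm hf).continuousOn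

theorem curveDeriv_eq (hab : a < b) (h : LapOn a b m α f f₁ Lf) :
    EqOn (curveDeriv a b m f) f₁ (Icc a b) := fun x hx =>
  curveDeriv_eq_of_hasDerivWithinAt hab hx (h.deriv_fst x hx)

theorem curveLaplace_eq (hab : a < b) (h : LapOn a b m α f f₁ Lf) :
    EqOn (curveLaplace a b m α f) Lf (Icc a b) := fun x hx => by
  rw [curveLaplace, curveDeriv_congr (h.curveDeriv_eq hab) hx,
    curveDeriv_eq_of_hasDerivWithinAt hab hx (h.deriv_snd x hx)]
  ring

theorem const_mul (c : ℂ) (hf : LapOn a b m α f f₁ Lf) :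
    LapOn a b m α (fun x => c * f x) (fun x => c * f₁ x) (fun x => c * Lf x) where
  deriv_fst x hx := by
    exact ((hf.deriv_fst x hx).const_mul c).congr_deriv (by ring)
  deriv_snd x hx := by
    exact ((hf.deriv_snd x hx).const_mul c).congr_deriv (by ring)
  cont := continuousOn_const.mul hf.cont

theorem sub (hf : LapOn a b m α f f₁ Lf) (hg : LapOn a b m α g g₁ Lg) :
    LapOn a b m α (fun x => f x - g x) (fun x => f₁ x - g₁ x) (fun x => Lf x - Lg x) where
  deriv_fst x hx := by
    rw [mul_sub]; exact (hf.deriv_fst x hx).fun_sub (hg.deriv_fst x hx)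
  deriv_snd x hx := by
    have := (hf.deriv_snd x hx).fun_sub (hg.deriv_snd x hx)
    exact this.congr_deriv (by ring)
  cont := hf.cont.sub hg.cont

theorem mul (hf : LapOn a b m α f f₁ Lf) (hg : LapOn a b m α g g₁ Lg) :
    LapOn a b m α (fun x => f x * g x) (fun x => f₁ x * g x + f x * g₁ x)
      (fun x => Lf x * g x + 2 * (f₁ x * g₁ x) + f x * (Lg x + α ^ 2 * g x)) where
  deriv_fst x hx := by
    exact ((hf.deriv_fst x hx).fun_mul (hg.deriv_fst x hx)).congr_deriv (by ring)
  deriv_snd x hx := by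
    exact (((hf.deriv_snd x hx).fun_mul (hg.deriv_fst x hx)).fun_add
      ((hf.deriv_fst x hx).fun_mul (hg.deriv_snd x hx))).congr_deriv (by ring)
  cont := by
    have := hf.continuousOn; have := hg.continuousOn
    have := hf.continuousOn_deriv; have := hg.continuousOn_deriv
    have := hf.cont; have := hg.cont
    fun_prop

theorem congr_lap {Lf' : ℝ → ℂ} (h : LapOn a b m α f f₁ Lf) (h' : EqOn Lf Lf' (Icc a b)) :
    LapOn a b m α f f₁ Lf' where
  deriv_fst := h.deriv_fst
  deriv_snd x hx := by rw [← h' hx]; exact h.deriv_snd x hx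
  cont := h.cont.congr h'.symm

/-- Green's formula along the curve. -/
theorem green (hab : a ≤ b) (hm : ContDiff ℝ ∞ m) (hf : LapOn a b m α f f₁ Lf)
    (hg : LapOn a b m α g g₁ Lg) :
    graphIntegral a b m (fun x => f x * Lg x) =
      graphIntegral a b m (fun x => g x * Lf x) +
        ((f b * g₁ b - f₁ b * g b) - (f a * g₁ a - f₁ a * g a)) := by
  have hs : ContinuousOn (speed m) (Icc a b) := (contDiff_speed hm).continuous.continuousOn
  have c1 := hf.continuousOn; have c2 := hg.continuousOn
  have c3 := hf.cont; have c4 := hg.cont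
  have h := integral_eq_sub_of_hasDerivWithinAt_Icc hab
    (f := fun x => f x * g₁ x - f₁ x * g x)
    (f' := fun x => f x * Lg x * speed m x - g x * Lf x * speed m x)
    (fun x hx => by
      exact (((hf.deriv_fst x hx).fun_mul (hg.deriv_snd x hx)).fun_sub
        ((hf.deriv_snd x hx).fun_mul (hg.deriv_fst x hx))).congr_deriv (by ring)) (by fun_prop)
  rw [intervalIntegral.integral_sub] at h
  · rw [graphIntegral, graphIntegral, ← h]
    simp only [speed]; ring
  all_goals exact ContinuousOn.intervalIntegrable_Icc hab (by fun_prop)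

end LapOn

theorem graphIntegral_congr (hab : a ≤ b) {f g : ℝ → ℂ} (h : EqOn f g (Icc a b)) :
    graphIntegral a b m f = graphIntegral a b m g :=
  intervalIntegral.integral_congr fun x hx => by
    rw [uIcc_of_le hab] at hx
    simp only [h hx]

theorem graphIntegral_add (hab : a ≤ b) (hm : ContDiff ℝ ∞ m) {f g : ℝ → ℂ}
    (hf : ContinuousOn f (Icc a b)) (hg : ContinuousOn g (Icc a b)) :
    graphIntegral a b m (fun x => f x + g x) = graphIntegral a b m f + graphIntegral a b m g := by
  have hs : ContinuousOn (speed m) (Icc a b) := (contDiff_speed hm).continuous.continuousOn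
  unfold graphIntegral
  simp_rw [add_mul]
  exact intervalIntegral.integral_add (ContinuousOn.intervalIntegrable_Icc hab (hf.mul hs))
    (ContinuousOn.intervalIntegrable_Icc hab (hg.mul hs))

theorem graphIntegral_sub (hab : a ≤ b) (hm : ContDiff ℝ ∞ m) {f g : ℝ → ℂ}
    (hf : ContinuousOn f (Icc a b)) (hg : ContinuousOn g (Icc a b)) :
    graphIntegral a b m (fun x => f x - g x) = graphIntegral a b m f - graphIntegral a b m g := by
  have hs : ContinuousOn (speed m) (Icc a b) := (contDiff_speed hm).continuous.continuousOn
  unfold graphIntegral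
  simp_rw [sub_mul]
  exact intervalIntegral.integral_sub (ContinuousOn.intervalIntegrable_Icc hab (hf.mul hs))
    (ContinuousOn.intervalIntegrable_Icc hab (hg.mul hs))

theorem graphIntegral_const_mul (c : ℂ) (f : ℝ → ℂ) :
    graphIntegral a b m (fun x => c * f x) = c * graphIntegral a b m f := by
  unfold graphIntegral
  simp_rw [mul_assoc]
  exact intervalIntegral.integral_const_mul _ _

/-- Cauchy–Schwarz along the curve. -/
theorem exists_norm_graphIntegral_mul_le (hab : a ≤ b) (hm : ContDiff ℝ ∞ m) :
    ∃ C, 0 ≤ C ∧ ∀ f g : ℝ → ℂ, ContinuousOn f (Icc a b) → ContinuousOn g (Icc a b) →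
      ‖graphIntegral a b m (fun x => f x * g x)‖ ≤ C * (l2 a b f * l2 a b g) := by
  have hs : ContinuousOn (speed m) (Icc a b) := (contDiff_speed hm).continuous.continuousOn
  obtain ⟨C, hC, h⟩ := exists_norm_le_Icc hs
  refine ⟨C, hC, fun f g hf hg => ?_⟩
  have h1 := norm_integral_mul_le hab hf (hg.mul hs)
  have h2 : l2 a b (fun x => g x * speed m x) ≤ C * l2 a b g :=
    l2_le_mul hab hC (hg.mul hs) hg fun x hx => by
      rw [norm_mul, mul_comm]; exact mul_le_mul_of_nonneg_right (h x hx) (norm_nonneg _)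
  have h3 : graphIntegral a b m (fun x => f x * g x) =
      ∫ x in a..b, f x * (g x * speed m x) := by
    unfold graphIntegral; simp only [mul_assoc]; rfl
  rw [h3]
  calc _ ≤ l2 a b f * l2 a b (fun x => g x * speed m x) := h1
    _ ≤ l2 a b f * (C * l2 a b g) := mul_le_mul_of_nonneg_left h2 (l2_nonneg _)
    _ = _ := by ring

/-- A smooth function vanishing at `p` is `O(|x - p|)` on `[a, b]`. -/
theorem exists_norm_le_mul_abs_sub (hab : a < b) {f : ℝ → ℂ} (hf : ContDiffOn ℝ 1 f (Icc a b))
    {p : ℝ} (hp : p ∈ Icc a b) (h0 : f p = 0) :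
    ∃ C, 0 ≤ C ∧ ∀ x ∈ Icc a b, ‖f x‖ ≤ C * |x - p| := by
  obtain ⟨C, hC, h⟩ := exists_norm_le_Icc
    (hf.continuousOn_derivWithin (uniqueDiffOn_Icc hab) le_rfl)
  refine ⟨C, hC, fun x hx => ?_⟩
  have := (convex_Icc a b).norm_image_sub_le_of_norm_derivWithin_le
    (hf.differentiableOn (by simp)) h hp hx
  simpa [h0] using this

end CurveCalculus

/-! ### States on the deformed segment and their pairing with test functions -/

/-- A Rayleigh resonance `c₁` on the curve `x + i m(x)`, with a resonant state `ψ₀` whose pairing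
`∫ ψ₀ (∂² - α²)ψ₀ / (W - c₁) dz` does not vanish (this is what simplicity amounts to). The
field `slit` is the ellipticity of the Orr–Sommerfeld operator along the curve, uniformly as
`ε → 0`. -/
structure RayleighResonance where
  (a b α : ℝ)
  hab : a < b
  hα : 0 < α
  m : ℝ → ℝ
  hm : ContDiff ℝ ∞ m
  hma : m =ᶠ[𝓝 a] 0
  hmb : m =ᶠ[𝓝 b] 0
  W : ℝ → ℂ
  hW : ContDiffOn ℝ ∞ W (Icc a b)
  c₁ : ℂ
  slit : ∀ x ∈ Icc a b, speed m x ^ 2 * (Complex.I * α * (W x - c₁)) ∈ Complex.slitPlane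
  ψ₀ : ℝ → ℂ
  hψ₀ : ContDiffOn ℝ ∞ ψ₀ (Icc a b)
  bc : DirichletBC a b ψ₀
  eqn : ∀ x ∈ Icc a b, (W x - c₁) * curveLaplace a b m α ψ₀ x
    = curveDeriv a b m (curveDeriv a b m W) x * ψ₀ x
  ne_zero : ∃ x ∈ Icc a b, ψ₀ x ≠ 0
  pairing_ne : graphIntegral a b m (fun x => ψ₀ x * (curveLaplace a b m α ψ₀ x / (W x - c₁))) ≠ 0

namespace RayleighResonance

variable (S : RayleighResonance)

/-- The second derivative of the profile along the curve. -/
def W₂ : ℝ → ℂ := curveDeriv S.a S.b S.m (curveDeriv S.a S.b S.m S.W)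

/-- The function `1 / (W - c₁)`. -/
def v : ℝ → ℂ := fun x => (S.W x - S.c₁)⁻¹

/-- `LapOn` for the curve and the wave number of `S`. -/
abbrev Lap (f f₁ g : ℝ → ℂ) : Prop := LapOn S.a S.b S.m S.α f f₁ g

/-- Integration along the curve. -/
abbrev int (f : ℝ → ℂ) : ℂ := graphIntegral S.a S.b S.m f

/-- `∂` along the curve of `S`. -/
abbrev D (f : ℝ → ℂ) : ℝ → ℂ := curveDeriv S.a S.b S.m f

/-- `∂² - α²` along the curve of `S`. -/
abbrev L (f : ℝ → ℂ) : ℝ → ℂ := curveLaplace S.a S.b S.m S.α f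

/-- The `L²` norm in the parameter of the curve. -/
abbrev norm2 (f : ℝ → ℂ) : ℝ := l2 S.a S.b f

theorem W_sub_ne {x : ℝ} (hx : x ∈ Icc S.a S.b) : S.W x - S.c₁ ≠ 0 := fun h =>
  Complex.slitPlane_ne_zero (S.slit x hx) (by rw [h]; ring)

theorem contDiffOn_W₂ : ContDiffOn ℝ ∞ S.W₂ (Icc S.a S.b) :=
  contDiffOn_curveDeriv S.hab S.hm (contDiffOn_curveDeriv S.hab S.hm S.hW)

theorem contDiffOn_v : ContDiffOn ℝ ∞ S.v (Icc S.a S.b) :=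
  (S.hW.sub contDiffOn_const).inv fun _ hx => S.W_sub_ne hx

theorem contDiffOn_speed : ContDiffOn ℝ ∞ (speed S.m) (Icc S.a S.b) :=
  (contDiff_speed S.hm).contDiffOn

theorem lap_of_contDiffOn {f : ℝ → ℂ} (hf : ContDiffOn ℝ ∞ f (Icc S.a S.b)) :
    S.Lap f (S.D f) (S.L f) := LapOn.of_contDiffOn S.hab S.hm hf

/-- A function `ψ` with `ψ = ∂ψ = 0` at both endpoints, together with `p = ∂ψ`,
`Ω = (∂² - α²)ψ`, `ρ = ∂Ω` and `θ = (∂² - α²)Ω`. -/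
structure State where
  (ψ p Ω ρ θ : ℝ → ℂ)
  lap : S.Lap ψ p Ω
  lap' : S.Lap Ω ρ θ
  ψa : ψ S.a = 0
  ψb : ψ S.b = 0
  pa : p S.a = 0
  pb : p S.b = 0

namespace State

variable {S}

/-- The function `P_{c,ε} ψ`. -/
def op (T : S.State) (c : ℂ) (ε : ℝ) : ℝ → ℂ := fun x =>
  Complex.I * (S.α : ℂ)⁻¹ * (ε : ℂ) ^ 2 * T.θ x + (S.W x - c) * T.Ω x - S.W₂ x * T.ψ x

theorem continuousOn_op (T : S.State) (c : ℂ) (ε : ℝ) :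
    ContinuousOn (T.op c ε) (Icc S.a S.b) := by
  have := T.lap.continuousOn; have := T.lap'.cont; have := T.lap.cont
  have := S.hW.continuousOn; have := S.contDiffOn_W₂.continuousOn
  unfold op
  fun_prop

/-- The difference `T - k T'`. -/
def subSmul (T T' : S.State) (k : ℂ) : S.State where
  ψ x := T.ψ x - k * T'.ψ x
  p x := T.p x - k * T'.p x
  Ω x := T.Ω x - k * T'.Ω x
  ρ x := T.ρ x - k * T'.ρ x
  θ x := T.θ x - k * T'.θ x
  lap := T.lap.sub (T'.lap.const_mul k)
  lap' := T.lap'.sub (T'.lap'.const_mul k)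
  ψa := by simp [T.ψa, T'.ψa]
  ψb := by simp [T.ψb, T'.ψb]
  pa := by simp [T.pa, T'.pa]
  pb := by simp [T.pb, T'.pb]

/-- The multiple `k T`. -/
def smul (k : ℂ) (T : S.State) : S.State where
  ψ x := k * T.ψ x
  p x := k * T.p x
  Ω x := k * T.Ω x
  ρ x := k * T.ρ x
  θ x := k * T.θ x
  lap := T.lap.const_mul k
  lap' := T.lap'.const_mul k
  ψa := by simp [T.ψa]
  ψb := by simp [T.ψb]
  pa := by simp [T.pa]
  pb := by simp [T.pb]

theorem subSmul_op (T T' : S.State) (k c : ℂ) (ε : ℝ) (x : ℝ) :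
    (T.subSmul T' k).op c ε x = T.op c ε x - k * T'.op c ε x := by
  simp only [op, subSmul]; ring

theorem smul_op (T : S.State) (k c : ℂ) (ε : ℝ) (x : ℝ) :
    (T.smul k).op c ε x = k * T.op c ε x := by
  simp only [op, smul]; ring

theorem op_sub_op (T : S.State) (c c' : ℂ) (ε : ℝ) (x : ℝ) :
    T.op c ε x - T.op c' ε x = (c' - c) * T.Ω x := by
  simp only [op]; ring

/-- `ε (|Ω(a)| + |Ω(b)|)`. -/
def β (T : S.State) (ε : ℝ) : ℝ := ε * (‖T.Ω S.a‖ + ‖T.Ω S.b‖)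

/-- `√ε ‖Ω‖`. -/
def w (T : S.State) (ε : ℝ) : ℝ := Real.sqrt ε * S.norm2 T.Ω

/-- `ε² (|∂Ω(a)| + |∂Ω(b)|)`. -/
def γ (T : S.State) (ε : ℝ) : ℝ := ε ^ 2 * (‖T.ρ S.a‖ + ‖T.ρ S.b‖)

/-- `‖ψ‖`. -/
def n (T : S.State) : ℝ := S.norm2 T.ψ

theorem n_nonneg (T : S.State) : 0 ≤ T.n := l2_nonneg _

theorem w_nonneg (T : S.State) (ε : ℝ) : 0 ≤ T.w ε :=
  mul_nonneg (Real.sqrt_nonneg _) (l2_nonneg _)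

theorem β_nonneg (T : S.State) {ε : ℝ} (hε : 0 ≤ ε) : 0 ≤ T.β ε :=
  mul_nonneg hε (add_nonneg (norm_nonneg _) (norm_nonneg _))

theorem γ_nonneg (T : S.State) (ε : ℝ) : 0 ≤ T.γ ε :=
  mul_nonneg (sq_nonneg _) (add_nonneg (norm_nonneg _) (norm_nonneg _))

/-- Pairing of `Ω` with a function is a pairing of `ψ`, by the four boundary conditions. -/
theorem int_mul_Ω (T : S.State) {g g₁ Lg : ℝ → ℂ} (hg : S.Lap g g₁ Lg) :
    S.int (fun x => g x * T.Ω x) = S.int (fun x => T.ψ x * Lg x) := by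
  have := hg.green S.hab.le S.hm T.lap
  rw [T.ψa, T.ψb, T.pa, T.pb] at this
  simpa using this

/-- Pairing of `P_{c,ε} ψ` with a test function. -/
theorem int_mul_op (T : S.State) (c : ℂ) (ε : ℝ) {g g₁ Lg : ℝ → ℂ} (hg : S.Lap g g₁ Lg) :
    S.int (fun x => g x * T.op c ε x) =
      Complex.I * (S.α : ℂ)⁻¹ * (ε : ℂ) ^ 2 *
        ((g S.b * T.ρ S.b - g₁ S.b * T.Ω S.b) - (g S.a * T.ρ S.a - g₁ S.a * T.Ω S.a)) +
      S.int (fun x => (Complex.I * (S.α : ℂ)⁻¹ * (ε : ℂ) ^ 2 * Lg x + (S.W x - c) * g x) * T.Ω x) -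
      S.int (fun x => g x * (S.W₂ x * T.ψ x)) := by
  have c1 := T.lap.continuousOn; have c2 := T.lap'.cont; have c3 := T.lap.cont
  have c4 := S.hW.continuousOn; have c5 := S.contDiffOn_W₂.continuousOn
  have c6 := hg.continuousOn; have c7 := hg.cont
  have h := hg.green S.hab.le S.hm T.lap'
  have e1 : S.int (fun x => g x * T.op c ε x) =
      Complex.I * (S.α : ℂ)⁻¹ * (ε : ℂ) ^ 2 * S.int (fun x => g x * T.θ x) +
      S.int (fun x => g x * ((S.W x - c) * T.Ω x)) - S.int (fun x => g x * (S.W₂ x * T.ψ x)) := by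
    rw [int, int, int, int, ← graphIntegral_const_mul, ← graphIntegral_add S.hab.le S.hm,
      ← graphIntegral_sub S.hab.le S.hm]
    · congr 1; ext x; simp only [op]; ring
    all_goals fun_prop
  have e2 : S.int (fun x => (Complex.I * (S.α : ℂ)⁻¹ * (ε : ℂ) ^ 2 * Lg x + (S.W x - c) * g x)
      * T.Ω x) = Complex.I * (S.α : ℂ)⁻¹ * (ε : ℂ) ^ 2 * S.int (fun x => T.Ω x * Lg x) +
      S.int (fun x => g x * ((S.W x - c) * T.Ω x)) := by
    rw [int, int, int, ← graphIntegral_const_mul, ← graphIntegral_add S.hab.le S.hm]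
    · congr 1; ext x; ring
    all_goals fun_prop
  rw [e1, e2, int, h]
  ring

/-- Pairing of `P_{c,ε} ψ` with `g = φ / (W - c₁)`. Up to the terms containing `ε` and `c - c₁`
this is the pairing of `ψ` with the Rayleigh operator at `c₁` applied to `φ`. -/
theorem int_test (T : S.State) (c : ℂ) (ε : ℝ) {φ φ₁ Lφ g g₁ Lg : ℝ → ℂ} (hφ : S.Lap φ φ₁ Lφ)
    (hg : S.Lap g g₁ Lg) (hgφ : ∀ x ∈ Icc S.a S.b, g x = φ x * S.v x) :
    S.int (fun x => g x * T.op c ε x) =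
      Complex.I * (S.α : ℂ)⁻¹ * (ε : ℂ) ^ 2 *
        ((g S.b * T.ρ S.b - g₁ S.b * T.Ω S.b) - (g S.a * T.ρ S.a - g₁ S.a * T.Ω S.a) +
          S.int (fun x => Lg x * T.Ω x)) +
      S.int (fun x => T.ψ x * (Lφ x - S.W₂ x * S.v x * φ x)) -
      (c - S.c₁) * S.int (fun x => T.ψ x * Lg x) := by
  have c1 := T.lap.continuousOn; have c3 := T.lap.cont
  have c4 := S.hW.continuousOn; have c5 := S.contDiffOn_W₂.continuousOn
  have c6 := hg.continuousOn; have c7 := hg.cont; have c8 := hφ.continuousOn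
  have c9 := hφ.cont; have c10 := S.contDiffOn_v.continuousOn
  rw [T.int_mul_op c ε hg]
  have e1 : S.int (fun x => (Complex.I * (S.α : ℂ)⁻¹ * (ε : ℂ) ^ 2 * Lg x + (S.W x - c) * g x)
      * T.Ω x) = Complex.I * (S.α : ℂ)⁻¹ * (ε : ℂ) ^ 2 * S.int (fun x => Lg x * T.Ω x) +
      S.int (fun x => φ x * T.Ω x) - (c - S.c₁) * S.int (fun x => g x * T.Ω x) := by
    rw [int, int, int, int, ← graphIntegral_const_mul, ← graphIntegral_const_mul (c - S.c₁),
      ← graphIntegral_add S.hab.le S.hm, ← graphIntegral_sub S.hab.le S.hm]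
    · refine graphIntegral_congr S.hab.le fun x hx => ?_
      have h := S.W_sub_ne hx
      have h1 : (S.W x - S.c₁) * g x = φ x := by
        rw [hgφ x hx, v]; field_simp
      simp only [← h1]; ring
    all_goals fun_prop
  have e2 : S.int (fun x => T.ψ x * (Lφ x - S.W₂ x * S.v x * φ x)) =
      S.int (fun x => T.ψ x * Lφ x) - S.int (fun x => g x * (S.W₂ x * T.ψ x)) := by
    rw [int, int, int, ← graphIntegral_sub S.hab.le S.hm]
    · refine graphIntegral_congr S.hab.le fun x hx => ?_
      simp only [hgφ x hx]; ring
    all_goals fun_prop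
  rw [e1, e2, T.int_mul_Ω hφ, T.int_mul_Ω hg]
  ring

end State

/-! ### The energy estimate for the vorticity -/

/-- A multiplier `ζ` for which `ζ` and `ζ s² iα(W - c₁)` both have positive real part: a square root
of the inverse of `s² iα(W - c₁)`. -/
theorem exists_multiplier : ∃ (ζ ζ' : ℝ → ℂ) (k : ℝ), 0 < k ∧ ContinuousOn ζ' (Icc S.a S.b) ∧
    (∀ x ∈ Icc S.a S.b, HasDerivWithinAt ζ (ζ' x) (Icc S.a S.b) x) ∧
    ∀ x ∈ Icc S.a S.b, k ≤ (ζ x).re ∧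
      k ≤ (ζ x * (speed S.m x ^ 2 * (Complex.I * S.α * (S.W x - S.c₁)))).re := by
  set Q : ℝ → ℂ := fun x => speed S.m x ^ 2 * (Complex.I * S.α * (S.W x - S.c₁))
  have hQ : ContDiffOn ℝ ∞ Q (Icc S.a S.b) :=
    (S.contDiffOn_speed.pow 2).mul (contDiffOn_const.mul (S.hW.sub contDiffOn_const))
  -- the principal branch: `ζ` and `ζ Q = Q^{1/2}` have arguments in `(-π/2, π/2)`
  set ζ : ℝ → ℂ := fun x => Complex.exp (-(Complex.log (Q x) / 2))
  have hlog : ContDiffOn ℝ ∞ (fun x => Complex.log (Q x)) (Icc S.a S.b) := fun x hx =>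
    ContDiffAt.comp_contDiffWithinAt (g := Complex.log) x
      ((Complex.contDiffAt_log (S.slit x hx)).restrict_scalars ℝ) (hQ x hx)
  have hζ : ContDiffOn ℝ ∞ ζ (Icc S.a S.b) := (hlog.div_const 2).neg.cexp
  have hpos : ∀ x ∈ Icc S.a S.b, 0 < (ζ x).re ∧ 0 < (ζ x * Q x).re := by
    intro x hx
    have h1 := Complex.mem_slitPlane_iff_arg.1 (S.slit x hx)
    have h2 := Complex.neg_pi_lt_arg (Q x)
    have h3 := lt_of_le_of_ne (Complex.arg_le_pi (Q x)) h1.1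
    have hcos : 0 < Real.cos ((Q x).arg / 2) :=
      Real.cos_pos_of_mem_Ioo ⟨by linarith, by linarith⟩
    have him : (Complex.log (Q x) / 2).im = (Q x).arg / 2 := by
      have : (2 : ℂ) = ((2 : ℝ) : ℂ) := by norm_num
      rw [this, Complex.div_ofReal_im, Complex.log_im]
    have hz : ζ x * Q x = Complex.exp (Complex.log (Q x) / 2) := by
      have h4 : Complex.exp (Complex.log (Q x)) = Q x := Complex.exp_log h1.2
      calc ζ x * Q x = ζ x * Complex.exp (Complex.log (Q x)) := by rw [h4]
        _ = _ := by
          simp only [ζ]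
          rw [← Complex.exp_add]
          congr 1; ring
    rw [hz]
    simp only [ζ, Complex.exp_re, Complex.neg_im, him, Real.cos_neg]
    exact ⟨by positivity, by positivity⟩
  obtain ⟨x₀, hx₀, h0⟩ := isCompact_Icc.exists_isMinOn (nonempty_Icc.2 S.hab.le)
    (f := fun x => min (ζ x).re (ζ x * Q x).re)
    (continuous_min.comp_continuousOn
      ((Complex.continuous_re.comp_continuousOn hζ.continuousOn).prodMk
        (Complex.continuous_re.comp_continuousOn (hζ.continuousOn.mul hQ.continuousOn))))
  refine ⟨ζ, derivWithin ζ (Icc S.a S.b), _, lt_min (hpos x₀ hx₀).1 (hpos x₀ hx₀).2,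
    hζ.continuousOn_derivWithin (uniqueDiffOn_Icc S.hab) (by simp),
    fun x hx => (hζ.differentiableOn (by simp) x hx).hasDerivWithinAt, fun x hx => ?_⟩
  have := h0 hx
  exact ⟨this.trans (min_le_left _ _), this.trans (min_le_right _ _)⟩

end RayleighResonance

/-- The pointwise inequality behind the energy estimate. Here `z` stands for the multiplier, `s` for
the speed, `d` for the derivative of `z s`, `o` and `r` for the vorticity and its derivative, `q` for
the coefficient at `c₁`, `h` for its change with `c`, `g` for the remaining terms, and `e` for `α²`. -/
theorem energy_pointwise {ε k A B : ℝ} {z s d o r q h g e : ℂ} (hk : 0 < k)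
    (hz : k ≤ z.re) (hzq : k ≤ (z * (s ^ 2 * q)).re) (hs : 1 ≤ ‖s‖) (hd : ‖d‖ ≤ A)
    (hB : ‖z * s ^ 2‖ ≤ B) (hh : B * ‖h‖ ≤ k / 4)
    (hε : ε ^ 2 * (A ^ 2 / (4 * k) + B * ‖e‖) ≤ k / 4) :
    k / 4 * ‖o‖ ^ 2 - B ^ 2 / k * ‖g‖ ^ 2 ≤
      ((ε : ℂ) ^ 2 * (d * conj o * r) + (ε : ℂ) ^ 2 * (z * s * conj (s * r) * r) +
        z * s ^ 2 * conj o * (q * o - h * o - g) + (ε : ℂ) ^ 2 * (z * s ^ 2 * conj o * (e * o))).re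
    := by
  have hA0 : 0 ≤ A := (norm_nonneg _).trans hd
  have hB0 : 0 ≤ B := (norm_nonneg _).trans hB
  set R : ℂ := (ε : ℂ) ^ 2 * (d * conj o * r) - z * s ^ 2 * conj o * (h * o + g) +
    (ε : ℂ) ^ 2 * (z * s ^ 2 * conj o * (e * o)) with hR
  have h1 : ((ε : ℂ) ^ 2 * (d * conj o * r) + (ε : ℂ) ^ 2 * (z * s * conj (s * r) * r) +
        z * s ^ 2 * conj o * (q * o - h * o - g) +
        (ε : ℂ) ^ 2 * (z * s ^ 2 * conj o * (e * o))) =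
      ((ε ^ 2 * (‖s‖ ^ 2 * ‖r‖ ^ 2) : ℝ) : ℂ) * z + ((‖o‖ ^ 2 : ℝ) : ℂ) * (z * (s ^ 2 * q)) + R := by
    rw [hR]
    push_cast
    rw [← Complex.mul_conj', ← Complex.mul_conj', ← Complex.mul_conj', map_mul]
    ring
  rw [h1, Complex.add_re, Complex.add_re, Complex.re_ofReal_mul, Complex.re_ofReal_mul]
  have h2 : ‖R‖ ≤ ε ^ 2 * (A * ‖o‖ * ‖r‖) + B * ‖o‖ * (‖h‖ * ‖o‖ + ‖g‖) +
      ε ^ 2 * (B * ‖o‖ * (‖e‖ * ‖o‖)) := by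
    refine (norm_add_le _ _).trans (add_le_add ((norm_sub_le _ _).trans (add_le_add ?_ ?_)) ?_)
    · simp only [norm_mul, norm_pow, Complex.norm_real, RCLike.norm_conj, Real.norm_eq_abs, sq_abs]
      gcongr
    · rw [norm_mul, norm_mul, RCLike.norm_conj]
      gcongr
      exact (norm_add_le _ _).trans (by rw [norm_mul])
    · rw [norm_mul, norm_mul (z * s ^ 2 * conj o), norm_mul (z * s ^ 2), norm_mul e,
        RCLike.norm_conj, norm_pow, Complex.norm_real, Real.norm_eq_abs, sq_abs]
      gcongr
  have h3 : -‖R‖ ≤ R.re := (abs_le.1 (Complex.abs_re_le_norm R)).1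
  have h4 : ε ^ 2 * ‖r‖ ^ 2 * k ≤ ε ^ 2 * (‖s‖ ^ 2 * ‖r‖ ^ 2) * z.re := by
    have : (1 : ℝ) ≤ ‖s‖ ^ 2 := one_le_pow₀ hs
    have : ‖r‖ ^ 2 ≤ ‖s‖ ^ 2 * ‖r‖ ^ 2 := by nlinarith [sq_nonneg ‖r‖]
    gcongr
  have h5 : ‖o‖ ^ 2 * k ≤ ‖o‖ ^ 2 * (z * (s ^ 2 * q)).re := by gcongr
  have h6 : A * ‖o‖ * ‖r‖ ≤ k * ‖r‖ ^ 2 + A ^ 2 / (4 * k) * ‖o‖ ^ 2 := by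
    have : 0 ≤ (2 * k * ‖r‖ - A * ‖o‖) ^ 2 / (4 * k) := by positivity
    have e1 : (2 * k * ‖r‖ - A * ‖o‖) ^ 2 / (4 * k) =
        k * ‖r‖ ^ 2 + A ^ 2 / (4 * k) * ‖o‖ ^ 2 - A * ‖o‖ * ‖r‖ := by field_simp; ring
    linarith
  have h7 : B * ‖o‖ * ‖g‖ ≤ k / 4 * ‖o‖ ^ 2 + B ^ 2 / k * ‖g‖ ^ 2 := by
    have : 0 ≤ (k * ‖o‖ - 2 * B * ‖g‖) ^ 2 / (4 * k) := by positivity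
    have e1 : (k * ‖o‖ - 2 * B * ‖g‖) ^ 2 / (4 * k) =
        k / 4 * ‖o‖ ^ 2 + B ^ 2 / k * ‖g‖ ^ 2 - B * ‖o‖ * ‖g‖ := by field_simp; ring
    linarith
  have h8 : ε ^ 2 * (A * ‖o‖ * ‖r‖) ≤ ε ^ 2 * (k * ‖r‖ ^ 2 + A ^ 2 / (4 * k) * ‖o‖ ^ 2) := by
    gcongr
  have h9 := mul_le_mul_of_nonneg_right hε (sq_nonneg ‖o‖)
  have h10 := mul_le_mul_of_nonneg_right hh (sq_nonneg ‖o‖)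
  linarith [h2, h3, h4, h5, h7, h8, h9, h10]

theorem one_le_norm_speed (m : ℝ → ℝ) (x : ℝ) : 1 ≤ ‖speed m x‖ := by
  have := Complex.abs_re_le_norm (speed m x)
  simpa [speed] using this

namespace RayleighResonance

variable (S : RayleighResonance)

/-- The energy estimate: away from its boundary values, the vorticity is controlled by the data. -/
theorem energy_estimate : ∃ C ν ε₀, 0 ≤ C ∧ 0 < ν ∧ 0 < ε₀ ∧ ∀ (T : S.State) (c : ℂ) (ε : ℝ),
    ‖c - S.c₁‖ ≤ ν → 0 < ε → ε ≤ ε₀ →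
    T.w ε ^ 2 ≤ C * (T.β ε * T.γ ε + ε * S.norm2 (T.op c ε) ^ 2 + ε * T.n ^ 2) := by
  obtain ⟨ζ, ζ', k, hk, hζ', hζd, hζk⟩ := S.exists_multiplier
  have hζ : ContinuousOn ζ (Icc S.a S.b) := fun x hx => (hζd x hx).continuousWithinAt
  have hs := S.contDiffOn_speed
  have hs' : ContinuousOn (derivWithin (speed S.m) (Icc S.a S.b)) (Icc S.a S.b) :=
    hs.continuousOn_derivWithin (uniqueDiffOn_Icc S.hab) (by simp)
  have hsd : ∀ x ∈ Icc S.a S.b, HasDerivWithinAt (speed S.m)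
      (derivWithin (speed S.m) (Icc S.a S.b) x) (Icc S.a S.b) x := fun x hx =>
    (hs.differentiableOn (by simp) x hx).hasDerivWithinAt
  set s := speed S.m with hsdef
  set s' := derivWithin s (Icc S.a S.b)
  have hsc := hs.continuousOn
  have hW2 := S.contDiffOn_W₂.continuousOn
  obtain ⟨A, hA0, hA⟩ := exists_norm_le_Icc (f := fun x => ζ' x * s x + ζ x * s' x)
    ((hζ'.mul hsc).add (hζ.mul hs'))
  obtain ⟨B, hB0, hB⟩ := exists_norm_le_Icc (f := fun x => ζ x * s x ^ 2) (hζ.mul (hsc.pow 2))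
  obtain ⟨M, hM0, hM⟩ := exists_norm_le_Icc (f := fun x => ζ x * s x) (hζ.mul hsc)
  obtain ⟨M₂, hM₂0, hM₂⟩ := exists_norm_le_Icc hW2
  have hα := S.hα
  obtain ⟨ν, hν, hνB⟩ : ∃ ν > 0, B * (S.α * ν) ≤ k / 4 := by
    refine ⟨k / (4 * (B + 1) * S.α), by positivity, ?_⟩
    rw [mul_div_assoc', mul_div_assoc', div_le_iff₀ (by positivity)]
    nlinarith [mul_pos hk hα]
  set E := A ^ 2 / (4 * k) + B * S.α ^ 2
  have hE : 0 ≤ E := by positivity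
  obtain ⟨ε₀, hε₀, hε₀E⟩ : ∃ ε₀ > 0, ε₀ ^ 2 * E ≤ k / 4 := by
    refine ⟨Real.sqrt (k / (4 * (E + 1))), Real.sqrt_pos.2 (by positivity), ?_⟩
    rw [Real.sq_sqrt (by positivity), div_mul_eq_mul_div, div_le_div_iff₀ (by positivity)
      (by norm_num)]
    nlinarith
  set C₁ := B ^ 2 / k * (2 * S.α ^ 2 * (1 + M₂ ^ 2))
  refine ⟨4 / k * (M + C₁), ν, ε₀, by positivity, hν, hε₀, fun T c ε hc hε hεε => ?_⟩
  have c1 := T.lap.continuousOn; have c2 := T.lap'.continuousOn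
  have c3 := T.lap'.continuousOn_deriv; have c4 := T.lap'.cont
  have c5 := T.continuousOn_op c ε
  have hαc : (S.α : ℂ) ≠ 0 := by exact_mod_cast hα.ne'
  set f := T.op c ε with hf
  -- the derivative of `ε² ζ s (conj Ω) ∂Ω`
  set G : ℝ → ℂ := fun x => (ε : ℂ) ^ 2 * ((ζ' x * s x + ζ x * s' x) * conj (T.Ω x) * T.ρ x +
    ζ x * s x * (conj (s x * T.ρ x) * T.ρ x + conj (T.Ω x) *
      (s x * (T.θ x + (S.α : ℂ) ^ 2 * T.Ω x)))) with hG
  have hGc : ContinuousOn G (Icc S.a S.b) := by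
    have hconj : Continuous (conj : ℂ → ℂ) := Complex.continuous_conj
    have e1 : ContinuousOn (fun x => conj (T.Ω x)) (Icc S.a S.b) := hconj.comp_continuousOn c2
    have e2 : ContinuousOn (fun x => conj (s x * T.ρ x)) (Icc S.a S.b) :=
      hconj.comp_continuousOn (hsc.mul c3)
    fun_prop
  have hint : ∫ x in S.a..S.b, G x = (ε : ℂ) ^ 2 * (ζ S.b * s S.b * (conj (T.Ω S.b) * T.ρ S.b)) -
      (ε : ℂ) ^ 2 * (ζ S.a * s S.a * (conj (T.Ω S.a) * T.ρ S.a)) := by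
    refine integral_eq_sub_of_hasDerivWithinAt_Icc S.hab.le
      (f := fun x => (ε : ℂ) ^ 2 * (ζ x * s x * (conj (T.Ω x) * T.ρ x))) (fun x hx => ?_) hGc
    have hcj : HasDerivWithinAt (fun x => conj (T.Ω x)) (conj (s x * T.ρ x)) (Icc S.a S.b) x :=
      (Complex.conjCLE.toContinuousLinearMap.hasFDerivAt.comp_hasDerivWithinAt x
        (T.lap'.deriv_fst x hx))
    exact ((((hζd x hx).fun_mul (hsd x hx)).fun_mul
      (hcj.fun_mul (T.lap'.deriv_snd x hx))).const_mul _).congr_deriv (by simp only [hG]; ring)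
  have hpt : ∀ x ∈ Icc S.a S.b, k / 4 * ‖T.Ω x‖ ^ 2 - C₁ * (‖f x‖ ^ 2 + ‖T.ψ x‖ ^ 2) ≤
      (G x).re := by
    intro x hx
    have hGx : G x = (ε : ℂ) ^ 2 * ((ζ' x * s x + ζ x * s' x) * conj (T.Ω x) * T.ρ x) +
        (ε : ℂ) ^ 2 * (ζ x * s x * conj (s x * T.ρ x) * T.ρ x) +
        ζ x * s x ^ 2 * conj (T.Ω x) * ((Complex.I * S.α * (S.W x - S.c₁)) * T.Ω x -
          (Complex.I * S.α * (c - S.c₁)) * T.Ω x -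
          Complex.I * S.α * (f x + S.W₂ x * T.ψ x)) +
        (ε : ℂ) ^ 2 * (ζ x * s x ^ 2 * conj (T.Ω x) * ((S.α : ℂ) ^ 2 * T.Ω x)) := by
      have : (ε : ℂ) ^ 2 * T.θ x = (Complex.I * S.α * (S.W x - S.c₁)) * T.Ω x -
          (Complex.I * S.α * (c - S.c₁)) * T.Ω x -
          Complex.I * S.α * (f x + S.W₂ x * T.ψ x) := by
        rw [hf, State.op]
        have hI : Complex.I ^ 2 = -1 := Complex.I_sq
        field_simp
        linear_combination ((ε : ℂ) ^ 2 * T.θ x) * hI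
      rw [← this]; simp only [hG]; ring
    rw [hGx]
    have hp := energy_pointwise (ε := ε) (k := k) (A := A) (B := B) (z := ζ x) (s := s x)
      (d := ζ' x * s x + ζ x * s' x) (o := T.Ω x) (r := T.ρ x)
      (q := Complex.I * S.α * (S.W x - S.c₁)) (h := Complex.I * S.α * (c - S.c₁))
      (g := Complex.I * S.α * (f x + S.W₂ x * T.ψ x)) (e := (S.α : ℂ) ^ 2) hk (hζk x hx).1
      (hζk x hx).2 (one_le_norm_speed _ _) (hA x hx) (hB x hx) ?_ ?_
    · refine le_trans ?_ hp
      have : ‖Complex.I * S.α * (f x + S.W₂ x * T.ψ x)‖ ^ 2 ≤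
          2 * S.α ^ 2 * (1 + M₂ ^ 2) * (‖f x‖ ^ 2 + ‖T.ψ x‖ ^ 2) := by
        rw [norm_mul, norm_mul, Complex.norm_I, one_mul, Complex.norm_real, Real.norm_eq_abs,
          abs_of_pos hα, mul_pow, mul_assoc, mul_assoc, mul_left_comm]
        refine mul_le_mul_of_nonneg_left ?_ (by positivity)
        have h1 : ‖f x + S.W₂ x * T.ψ x‖ ≤ ‖f x‖ + M₂ * ‖T.ψ x‖ :=
          (norm_add_le _ _).trans (by rw [norm_mul]; gcongr; exact hM₂ x hx)
        calc ‖f x + S.W₂ x * T.ψ x‖ ^ 2 ≤ (‖f x‖ + M₂ * ‖T.ψ x‖) ^ 2 := by gcongr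
          _ ≤ _ := by
            nlinarith [sq_nonneg (‖f x‖ - M₂ * ‖T.ψ x‖), sq_nonneg (M₂ * ‖f x‖),
              sq_nonneg (‖T.ψ x‖)]
      have h2 : B ^ 2 / k * ‖Complex.I * S.α * (f x + S.W₂ x * T.ψ x)‖ ^ 2 ≤
          C₁ * (‖f x‖ ^ 2 + ‖T.ψ x‖ ^ 2) := by
        rw [show C₁ * (‖f x‖ ^ 2 + ‖T.ψ x‖ ^ 2) = B ^ 2 / k *
          (2 * S.α ^ 2 * (1 + M₂ ^ 2) * (‖f x‖ ^ 2 + ‖T.ψ x‖ ^ 2)) by simp only [C₁]; ring]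
        gcongr
      linarith
    · rw [norm_mul, norm_mul, Complex.norm_I, one_mul, Complex.norm_real, Real.norm_eq_abs,
          abs_of_pos hα]
      refine le_trans ?_ hνB
      gcongr
    · rw [norm_pow, Complex.norm_real, Real.norm_eq_abs, sq_abs]
      refine le_trans ?_ hε₀E
      gcongr
  have hre : (∫ x in S.a..S.b, G x).re = ∫ x in S.a..S.b, (G x).re := by
    have := Complex.reCLM.intervalIntegral_comp_comm
      (ContinuousOn.intervalIntegrable_Icc S.hab.le hGc)
    exact this.symm
  have hI1 : k / 4 * S.norm2 T.Ω ^ 2 - C₁ * (S.norm2 f ^ 2 + T.n ^ 2) ≤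
      (∫ x in S.a..S.b, G x).re := by
    rw [hre, State.n, norm2, norm2, norm2, l2_sq S.hab.le, l2_sq S.hab.le, l2_sq S.hab.le,
      ← intervalIntegral.integral_add, ← intervalIntegral.integral_const_mul,
      ← intervalIntegral.integral_const_mul, ← intervalIntegral.integral_sub]
    · refine intervalIntegral.integral_mono_on S.hab.le
        (ContinuousOn.intervalIntegrable_Icc S.hab.le (by fun_prop))
        (ContinuousOn.intervalIntegrable_Icc S.hab.le
          (Complex.continuous_re.comp_continuousOn hGc)) hpt
    all_goals exact ContinuousOn.intervalIntegrable_Icc S.hab.le (by fun_prop)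
  have hb : ∀ y ∈ Icc S.a S.b, ‖(ε : ℂ) ^ 2 * (ζ y * s y * (conj (T.Ω y) * T.ρ y))‖ ≤
      ε ^ 2 * (M * (‖T.Ω y‖ * ‖T.ρ y‖)) := fun y hy => by
    rw [norm_mul, norm_mul (ζ y * s y), norm_mul (conj _), RCLike.norm_conj, norm_pow,
      Complex.norm_real, Real.norm_eq_abs, sq_abs]
    gcongr
    exact hM y hy
  have hI2 : (∫ x in S.a..S.b, G x).re ≤ ε ^ 2 * (M * (‖T.Ω S.b‖ * ‖T.ρ S.b‖)) +
      ε ^ 2 * (M * (‖T.Ω S.a‖ * ‖T.ρ S.a‖)) := by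
    refine (Complex.re_le_norm _).trans ?_
    rw [hint]
    exact (norm_sub_le _ _).trans (add_le_add (hb _ (right_mem_Icc.2 S.hab.le))
      (hb _ (left_mem_Icc.2 S.hab.le)))
  have hI3 : ε * (k / 4 * S.norm2 T.Ω ^ 2) ≤ M * (T.β ε * T.γ ε) +
      C₁ * (ε * S.norm2 f ^ 2 + ε * T.n ^ 2) := by
    have h1 : k / 4 * S.norm2 T.Ω ^ 2 ≤ C₁ * (S.norm2 f ^ 2 + T.n ^ 2) +
      ε ^ 2 * (M * ((‖T.Ω S.a‖ + ‖T.Ω S.b‖) * (‖T.ρ S.a‖ + ‖T.ρ S.b‖))) := by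
      have : ‖T.Ω S.a‖ * ‖T.ρ S.a‖ + ‖T.Ω S.b‖ * ‖T.ρ S.b‖ ≤
          (‖T.Ω S.a‖ + ‖T.Ω S.b‖) * (‖T.ρ S.a‖ + ‖T.ρ S.b‖) := by
        nlinarith [mul_nonneg (norm_nonneg (T.Ω S.a)) (norm_nonneg (T.ρ S.b)),
          mul_nonneg (norm_nonneg (T.Ω S.b)) (norm_nonneg (T.ρ S.a))]
      have := mul_le_mul_of_nonneg_left this (show (0 : ℝ) ≤ ε ^ 2 * M by positivity)
      linarith
    have := mul_le_mul_of_nonneg_left h1 hε.le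
    simp only [State.β, State.γ]
    linarith
  have hw : T.w ε ^ 2 = ε * S.norm2 T.Ω ^ 2 := by
    rw [State.w, mul_pow, Real.sq_sqrt hε.le]
  rw [hw]
  have hbg : 0 ≤ T.β ε * T.γ ε := mul_nonneg (T.β_nonneg hε.le) (T.γ_nonneg ε)
  have hfn : 0 ≤ ε * S.norm2 f ^ 2 + ε * T.n ^ 2 := by positivity
  have hC1 : 0 ≤ C₁ := by positivity
  have h1 : ε * S.norm2 T.Ω ^ 2 ≤ 4 / k * (M * (T.β ε * T.γ ε) +
      C₁ * (ε * S.norm2 f ^ 2 + ε * T.n ^ 2)) := by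
    rw [div_mul_eq_mul_div, le_div_iff₀ hk]; linarith
  have h2 : M * (T.β ε * T.γ ε) + C₁ * (ε * S.norm2 f ^ 2 + ε * T.n ^ 2) ≤
      (M + C₁) * (T.β ε * T.γ ε + ε * S.norm2 f ^ 2 + ε * T.n ^ 2) := by
    nlinarith [mul_nonneg hC1 hbg, mul_nonneg hM0 hfn]
  have h3 : (0 : ℝ) ≤ 4 / k := by positivity
  calc _ ≤ _ := h1
    _ ≤ 4 / k * ((M + C₁) * (T.β ε * T.γ ε + ε * S.norm2 f ^ 2 + ε * T.n ^ 2)) :=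
      mul_le_mul_of_nonneg_left h2 h3
    _ = _ := by ring

end RayleighResonance

/-! ### The boundary layers -/

theorem integral_exp_neg_mul_abs_sub_le {a b k p : ℝ} (hab : a ≤ b) (hk : 0 < k)
    (hp : p = a ∨ p = b) : ∫ x in a..b, Real.exp (-(k * |x - p|)) ≤ 1 / k := by
  have key : ∀ σ : ℝ, σ ^ 2 = 1 → (∀ x ∈ Icc a b, |x - p| = σ * (x - p)) →
      ∫ x in a..b, Real.exp (-(k * |x - p|)) = σ / k *
        (Real.exp (-(k * |a - p|)) - Real.exp (-(k * |b - p|))) := by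
    intro σ hσ h
    have h1 : ∫ x in a..b, Real.exp (-(k * |x - p|)) =
        ∫ x in a..b, Real.exp (-(k * (σ * (x - p)))) :=
      intervalIntegral.integral_congr fun x hx => by
        rw [uIcc_of_le hab] at hx; simp only [h x hx]
    rw [h1, h a (left_mem_Icc.2 hab), h b (right_mem_Icc.2 hab)]
    rw [integral_eq_sub_of_hasDerivWithinAt_Icc hab
      (f := fun x => -(σ / k) * Real.exp (-(k * (σ * (x - p))))) _ (by fun_prop)]
    · ring
    · intro x _
      have : HasDerivAt (fun x : ℝ => -(k * (σ * (x - p)))) (-(k * (σ * 1))) x :=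
        ((((hasDerivAt_id x).sub_const p).const_mul σ).const_mul k).neg
      refine ((this.exp.const_mul (-(σ / k))).congr_deriv ?_).hasDerivWithinAt
      field_simp
      linear_combination hσ
  rcases hp with rfl | rfl
  · rw [key 1 (by norm_num) fun x hx => by rw [abs_of_nonneg (by linarith [hx.1]), one_mul]]
    have : 0 < Real.exp (-(k * |b - p|)) := Real.exp_pos _
    rw [sub_self, abs_zero, mul_zero, neg_zero, Real.exp_zero]
    have h0 : 0 ≤ 1 / k := by positivity
    nlinarith
  · rw [key (-1) (by norm_num) fun x hx => by rw [abs_of_nonpos (by linarith [hx.2])]; ring]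
    have : 0 < Real.exp (-(k * |a - p|)) := Real.exp_pos _
    rw [sub_self, abs_zero, mul_zero, neg_zero, Real.exp_zero]
    have h0 : 0 ≤ 1 / k := by positivity
    have : -1 / k * (Real.exp (-(k * |a - p|)) - 1) = 1 / k * (1 - Real.exp (-(k * |a - p|))) := by
      ring
    rw [this]
    nlinarith

namespace RayleighResonance

variable (S : RayleighResonance)

/-- Near each endpoint `ψ` vanishes, with a bound by the `L²` norm of the vorticity. -/
theorem exists_norm_ψ_le : ∃ C, 0 ≤ C ∧ ∀ (T : S.State) (p : ℝ), (p = S.a ∨ p = S.b) →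
    ∀ x ∈ Icc S.a S.b, ‖T.ψ x‖ ≤ C * (S.norm2 T.Ω + T.n) * |x - p| := by
  have hs := S.contDiffOn_speed.continuousOn
  obtain ⟨M, hM, hsM⟩ := exists_norm_le_Icc hs
  have hab := S.hab.le
  refine ⟨M * (M * (Real.sqrt (S.b - S.a) * (1 + S.α ^ 2))), by positivity, ?_⟩
  intro T p hp
  have c1 := T.lap.continuousOn; have c2 := T.lap.cont
  set N := S.norm2 T.Ω + T.n
  have hN : 0 ≤ N := add_nonneg (l2_nonneg _) T.n_nonneg
  have hpx : ∀ x ∈ Icc S.a S.b, ‖T.p x‖ ≤ M * (Real.sqrt (S.b - S.a) * (1 + S.α ^ 2)) * N := by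
    intro x hx
    have hsub : Icc S.a x ⊆ Icc S.a S.b := Icc_subset_Icc_right hx.2
    set u : ℝ → ℂ := fun x => T.Ω x + (S.α : ℂ) ^ 2 * T.ψ x
    have hu : ContinuousOn u (Icc S.a S.b) := by fun_prop
    have h1 := integral_eq_sub_of_hasDerivWithinAt_Icc hx.1 (f := T.p)
      (f' := fun x => speed S.m x * u x)
      (fun t ht => (T.lap.deriv_snd t (hsub ht)).mono hsub) ((hs.mul hu).mono hsub)
    rw [T.pa, sub_zero] at h1
    rw [← h1]
    have h2 : ‖∫ t in S.a..x, speed S.m t * u t‖ ≤ ∫ t in S.a..x, M * ‖u t‖ := by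
      refine intervalIntegral.norm_integral_le_of_norm_le hx.1
        (Eventually.of_forall fun t ht => ?_)
        (ContinuousOn.intervalIntegrable_Icc hx.1 ((continuousOn_const.mul hu.norm).mono hsub))
      rw [norm_mul]
      exact mul_le_mul_of_nonneg_right (hsM t ⟨ht.1.le, ht.2.trans hx.2⟩) (norm_nonneg _)
    have h3 : ∫ t in S.a..x, M * ‖u t‖ ≤ ∫ t in S.a..S.b, M * ‖u t‖ := by
      refine intervalIntegral.integral_mono_interval le_rfl hx.1 hx.2
        (Eventually.of_forall fun t => by positivity)
        (ContinuousOn.intervalIntegrable_Icc hab (by fun_prop))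
    rw [intervalIntegral.integral_const_mul (r := M) (a := S.a) (b := S.b)] at h3
    have h4 := integral_norm_le hab hu
    have h5 : l2 S.a S.b u ≤ (1 + S.α ^ 2) * N := by
      refine (l2_add_le hab c2 (g := fun x => (S.α : ℂ) ^ 2 * T.ψ x) (by fun_prop)).trans ?_
      rw [l2_const_mul]
      have e1 : ‖(S.α : ℂ) ^ 2‖ = S.α ^ 2 := by simp
      rw [e1]
      have := l2_nonneg (a := S.a) (b := S.b) T.Ω
      have h6 : l2 S.a S.b T.ψ = T.n := rfl
      have h7 := T.n_nonneg
      simp only [N, norm2, h6]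
      nlinarith [sq_nonneg S.α, mul_nonneg (sq_nonneg S.α) this]
    calc _ ≤ M * ∫ t in S.a..S.b, ‖u t‖ := h2.trans h3
      _ ≤ M * (Real.sqrt (S.b - S.a) * ((1 + S.α ^ 2) * N)) := by gcongr; exact h4.trans (by gcongr)
      _ = _ := by ring
  intro x hx
  have hpI : p ∈ Icc S.a S.b := by
    rcases hp with rfl | rfl
    exacts [left_mem_Icc.2 hab, right_mem_Icc.2 hab]
  have hp0 : T.ψ p = 0 := by
    rcases hp with rfl | rfl
    exacts [T.ψa, T.ψb]
  have := (convex_Icc S.a S.b).norm_image_sub_le_of_norm_hasDerivWithin_le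
    (C := M * (M * (Real.sqrt (S.b - S.a) * (1 + S.α ^ 2)) * N)) T.lap.deriv_fst
    (fun y hy => by
      rw [norm_mul]
      exact mul_le_mul (hsM y hy) (hpx y hy) (norm_nonneg _) hM) hpI hx
  rw [hp0, sub_zero, Real.norm_eq_abs] at this
  refine this.trans (le_of_eq ?_)
  ring

/-- A cutoff equal to one to second order at `p`, and vanishing to second order at the other
endpoint. -/
def cutoff (p : ℝ) (x : ℝ) : ℂ := ((1 - ((x - p) / (S.b - S.a)) ^ 2) ^ 2 : ℝ)

theorem contDiff_cutoff (p : ℝ) : ContDiff ℝ ∞ (S.cutoff p) :=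
  Complex.ofRealCLM.contDiff.comp ((contDiff_const.sub
    (((contDiff_id.sub contDiff_const).div_const _).pow 2)).pow 2)

theorem hasDerivAt_cutoff (p x : ℝ) : HasDerivAt (S.cutoff p)
    ((2 * (1 - ((x - p) / (S.b - S.a)) ^ 2) * -(2 * ((x - p) / (S.b - S.a)) * (1 / (S.b - S.a))) :
      ℝ) : ℂ) x := by
  have h1 : HasDerivAt (fun x : ℝ => (x - p) / (S.b - S.a)) (1 / (S.b - S.a)) x :=
    ((hasDerivAt_id x).sub_const p).div_const _
  have h2 := ((h1.fun_pow 2).const_sub 1).fun_pow 2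
  have h3 := h2.ofReal_comp
  refine h3.congr_deriv ?_
  norm_num

theorem speed_eq_one_near {p : ℝ} (hp : p = S.a ∨ p = S.b) : speed S.m =ᶠ[𝓝 p] fun _ => 1 := by
  have h : S.m =ᶠ[𝓝 p] 0 := by
    rcases hp with rfl | rfl
    exacts [S.hma, S.hmb]
  filter_upwards [h.deriv] with x hx
  simp [speed, hx]

/-- The function `x ↦ exp (κ (x - p) / ε) χ(x)` with the cutoff `χ`. -/
def layer (κ : ℂ) (p ε : ℝ) (x : ℝ) : ℂ := Complex.exp (κ * (x - p) / ε) * S.cutoff p x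

/-- The boundary layer `e` at `p` is an approximate solution of `i α⁻¹ ε² L e + (W - c) e = 0`. -/
theorem exists_layer {p : ℝ} (hp : p = S.a ∨ p = S.b) {κ : ℂ} {k : ℝ} (hk : 0 < k)
    (hκ : κ ^ 2 = Complex.I * S.α * (S.W p - S.c₁))
    (hκk : ∀ x ∈ Icc S.a S.b, (κ * (x - p)).re ≤ -(k * |x - p|)) :
    ∃ C, 0 ≤ C ∧ ∀ ε : ℝ, 0 < ε → ε ≤ 1 → ∃ g₁ Lg : ℝ → ℂ, S.Lap (S.layer κ p ε) g₁ Lg ∧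
      (∀ ρ Ω : ℝ → ℂ, ∃ τ : ℂ, ‖τ‖ = 1 ∧
        (S.layer κ p ε S.b * ρ S.b - g₁ S.b * Ω S.b) - (S.layer κ p ε S.a * ρ S.a - g₁ S.a * Ω S.a)
          = τ * (ρ p - κ / ε * Ω p)) ∧
      (∀ x ∈ Icc S.a S.b, ‖S.layer κ p ε x‖ ≤ C * Real.exp (-(k / ε * |x - p|))) ∧
      ∀ c : ℂ, ∀ x ∈ Icc S.a S.b, ‖Complex.I * (S.α : ℂ)⁻¹ * (ε : ℂ) ^ 2 * Lg x +
        (S.W x - c) * S.layer κ p ε x‖ ≤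
          C * (|x - p| + ε + ‖c - S.c₁‖) * Real.exp (-(k / ε * |x - p|)) := by
  have hab := S.hab
  have hpI : p ∈ Icc S.a S.b := by
    rcases hp with rfl | rfl
    exacts [left_mem_Icc.2 hab.le, right_mem_Icc.2 hab.le]
  have hu : UniqueDiffOn ℝ (Icc S.a S.b) := uniqueDiffOn_Icc hab
  set σ : ℝ → ℂ := fun x => (speed S.m x)⁻¹ with hσdef
  have hσ : ContDiffOn ℝ ∞ σ (Icc S.a S.b) :=
    S.contDiffOn_speed.inv fun x _ => speed_ne_zero S.m x
  set σ' := derivWithin σ (Icc S.a S.b)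
  have hσ' : ContDiffOn ℝ ∞ σ' (Icc S.a S.b) := hσ.derivWithin hu (by simp)
  have hσd : ∀ x ∈ Icc S.a S.b, HasDerivWithinAt σ (σ' x) (Icc S.a S.b) x := fun x hx =>
    (hσ.differentiableOn (by simp) x hx).hasDerivWithinAt
  have hσp : σ p = 1 := by
    simp only [hσdef, (S.speed_eq_one_near hp).self_of_nhds, inv_one]
  have hσ'p : σ' p = 0 := by
    have h1 : σ =ᶠ[𝓝[Icc S.a S.b] p] fun _ => 1 := by
      filter_upwards [(S.speed_eq_one_near hp).filter_mono nhdsWithin_le_nhds] with x hx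
      simp [hσdef, hx]
    simp only [σ']
    rw [h1.derivWithin_eq (by simpa using hσp)]
    simp
  set χ := S.cutoff p
  have hχ : ContDiffOn ℝ ∞ χ (Icc S.a S.b) := (S.contDiff_cutoff p).contDiffOn
  set χ' := derivWithin χ (Icc S.a S.b)
  have hχ' : ContDiffOn ℝ ∞ χ' (Icc S.a S.b) := hχ.derivWithin hu (by simp)
  set χ'' := derivWithin χ' (Icc S.a S.b)
  have hχ'' : ContDiffOn ℝ ∞ χ'' (Icc S.a S.b) := hχ'.derivWithin hu (by simp)
  have hχd : ∀ x ∈ Icc S.a S.b, HasDerivWithinAt χ (χ' x) (Icc S.a S.b) x := fun x hx =>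
    (hχ.differentiableOn (by simp) x hx).hasDerivWithinAt
  have hχ'd : ∀ x ∈ Icc S.a S.b, HasDerivWithinAt χ' (χ'' x) (Icc S.a S.b) x := fun x hx =>
    (hχ'.differentiableOn (by simp) x hx).hasDerivWithinAt
  have hχ'v : ∀ x ∈ Icc S.a S.b, χ' x = _ := fun x hx =>
    ((S.hasDerivAt_cutoff p x).hasDerivWithinAt (s := Icc S.a S.b)).derivWithin (hu x hx)
  have hba : S.b - S.a ≠ 0 := sub_ne_zero.2 hab.ne'
  have hχp : χ p = 1 := by simp [χ, cutoff]
  have hχ'p : χ' p = 0 := by rw [hχ'v p hpI]; simp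
  -- at the endpoint other than `p` the cutoff and its derivative vanish
  have hother : ∀ y ∈ Icc S.a S.b, ((y - p) / (S.b - S.a)) ^ 2 = 1 → χ y = 0 ∧ χ' y = 0 := by
    intro y hy h
    refine ⟨by simp [χ, cutoff, h], ?_⟩
    rw [hχ'v y hy, h]; simp
  set J : ℝ → ℂ := fun x => σ x * σ' x * χ x + 2 * σ x ^ 2 * χ' x
  have hJ : ContDiffOn ℝ ∞ J (Icc S.a S.b) :=
    ((hσ.mul hσ').mul hχ).add ((contDiffOn_const.mul (hσ.pow 2)).mul hχ')
  obtain ⟨CJ, hCJ0, hCJ⟩ := exists_norm_le_mul_abs_sub hab (hJ.of_le (by simp)) hpI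
    (by simp [J, hσ'p, hχ'p])
  set Kf : ℝ → ℂ := fun x => σ x * σ' x * χ' x + σ x ^ 2 * χ'' x - (S.α : ℂ) ^ 2 * χ x
  have hKc : ContinuousOn Kf (Icc S.a S.b) :=
    (((hσ.mul hσ').mul hχ').add ((hσ.pow 2).mul hχ'')).continuousOn.sub
      (continuousOn_const.mul hχ.continuousOn)
  obtain ⟨CK, hCK0, hCK⟩ := exists_norm_le_Icc hKc
  have hαc : (S.α : ℂ) ≠ 0 := by exact_mod_cast S.hα.ne'
  set H : ℝ → ℂ := fun x => Complex.I * (S.α : ℂ)⁻¹ * κ ^ 2 * σ x ^ 2 * χ x + (S.W x - S.c₁) * χ x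
  have hH : ContDiffOn ℝ ∞ H (Icc S.a S.b) :=
    ((contDiffOn_const.mul (hσ.pow 2)).mul hχ).add ((S.hW.sub contDiffOn_const).mul hχ)
  have hI : Complex.I ^ 2 = -1 := Complex.I_sq
  have hHp : H p = 0 := by
    simp only [H, hσp, hχp, hκ]
    field_simp
    linear_combination (S.W p - S.c₁) * hI
  obtain ⟨CH, hCH0, hCH⟩ := exists_norm_le_mul_abs_sub hab (hH.of_le (by simp)) hpI hHp
  obtain ⟨Cχ, hCχ0, hCχ⟩ := exists_norm_le_Icc hχ.continuousOn
  have hα := S.hα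
  refine ⟨CH + S.α⁻¹ * ‖κ‖ * CJ + S.α⁻¹ * CK + Cχ, by positivity, fun ε hε hε1 => ?_⟩
  have hεc : (ε : ℂ) ≠ 0 := by exact_mod_cast hε.ne'
  set E : ℝ → ℂ := fun x => Complex.exp (κ * (x - p) / ε)
  have hE : ∀ x, HasDerivWithinAt E (κ / ε * E x) (Icc S.a S.b) x := fun x => by
    have : HasDerivAt (fun x : ℝ => κ * ((x : ℂ) - p) / ε) (κ * 1 / ε) x :=
      ((((hasDerivAt_id x).ofReal_comp).sub_const (p : ℂ)).const_mul κ).div_const _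
    refine (this.cexp.congr_deriv ?_).hasDerivWithinAt
    simp only [E]; ring
  have hEc : Continuous E := by fun_prop
  have hEn : ∀ x ∈ Icc S.a S.b, ‖E x‖ ≤ Real.exp (-(k / ε * |x - p|)) := fun x hx => by
    rw [Complex.norm_exp]
    refine Real.exp_le_exp.2 ?_
    have : (κ * ((x : ℂ) - p) / ε).re = (κ * (x - p)).re / ε := Complex.div_ofReal_re _ _
    rw [this, div_le_iff₀ hε]
    have := hκk x hx
    have h2 : -(k / ε * |x - p|) * ε = -(k * |x - p|) := by field_simp
    rw [h2]; exact this
  refine ⟨fun x => σ x * (κ / ε * χ x + χ' x) * E x,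
    fun x => (κ ^ 2 / ε ^ 2 * (σ x ^ 2 * χ x) + κ / ε * J x + Kf x) * E x,
    ⟨fun x hx => ?_, fun x hx => ?_, ?_⟩, ?_, ?_, ?_⟩
  · refine ((hE x).fun_mul (hχd x hx)).congr_deriv ?_
    have : speed S.m x * σ x = 1 := mul_inv_cancel₀ (speed_ne_zero _ _)
    linear_combination (-(κ / ε * χ x + χ' x) * E x) * this
  · refine (((hσd x hx).fun_mul (((hχd x hx).const_mul (κ / ε)).fun_add (hχ'd x hx))).fun_mul
      (hE x)).congr_deriv ?_
    have : speed S.m x * σ x = 1 := mul_inv_cancel₀ (speed_ne_zero _ _)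
    simp only [J, Kf, layer]
    linear_combination (-(κ ^ 2 / ε ^ 2 * (σ x * χ x) + κ / ε * (σ' x * χ x + 2 * σ x * χ' x) +
      σ' x * χ' x + σ x * χ'' x) * E x) * this
  · have := hσ.continuousOn; have := hχ.continuousOn; have := hJ.continuousOn
    fun_prop
  · intro ρ Ω
    have hEp : E p = 1 := by simp [E]
    have hla : ∀ y, S.layer κ p ε y = E y * χ y := fun _ => rfl
    rcases hp with hp | hp
    · obtain ⟨h1, h2⟩ := hother S.b (right_mem_Icc.2 hab.le) (by rw [hp, div_self hba, one_pow])
      refine ⟨-1, by simp, ?_⟩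
      beta_reduce
      rw [← hp, hla, hla, h1, h2, hσp, hχp, hχ'p, hEp]
      ring
    · obtain ⟨h1, h2⟩ := hother S.a (left_mem_Icc.2 hab.le) (by
        rw [hp, ← neg_sub, neg_div, div_self hba]; norm_num)
      refine ⟨1, by simp, ?_⟩
      beta_reduce
      rw [← hp, hla, hla, h1, h2, hσp, hχp, hχ'p, hEp]
      ring
  · intro x hx
    have : S.layer κ p ε x = χ x * E x := mul_comm _ _
    rw [this, norm_mul]
    refine mul_le_mul ((hCχ x hx).trans ?_) (hEn x hx) (norm_nonneg _) (by positivity)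
    have : 0 ≤ CH + S.α⁻¹ * ‖κ‖ * CJ + S.α⁻¹ * CK := by positivity
    linarith
  · intro c x hx
    have e1 : Complex.I * (S.α : ℂ)⁻¹ * (ε : ℂ) ^ 2 *
        ((κ ^ 2 / ε ^ 2 * (σ x ^ 2 * χ x) + κ / ε * J x + Kf x) * E x) +
        (S.W x - c) * S.layer κ p ε x =
        (H x + Complex.I * (S.α : ℂ)⁻¹ * ε * κ * J x + Complex.I * (S.α : ℂ)⁻¹ * ε ^ 2 * Kf x -
          (c - S.c₁) * χ x) * E x := by
      have : S.layer κ p ε x = E x * χ x := rfl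
      rw [this]
      simp only [H]
      field_simp
      ring
    rw [e1, norm_mul]
    have hEn := hEn x hx
    refine mul_le_mul ?_ hEn (norm_nonneg _) (by positivity)
    have n1 : ‖Complex.I * (S.α : ℂ)⁻¹ * ε * κ * J x‖ ≤ S.α⁻¹ * ‖κ‖ * CJ * |x - p| := by
      simp only [norm_mul, Complex.norm_I, one_mul, norm_inv, Complex.norm_real, Real.norm_eq_abs,
        abs_of_pos hα, abs_of_pos hε]
      have := hCJ x hx
      have h3 : ε * ‖J x‖ ≤ 1 * (CJ * |x - p|) := by gcongr
      calc S.α⁻¹ * ε * ‖κ‖ * ‖J x‖ = S.α⁻¹ * ‖κ‖ * (ε * ‖J x‖) := by ring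
        _ ≤ S.α⁻¹ * ‖κ‖ * (1 * (CJ * |x - p|)) := by gcongr
        _ = _ := by ring
    have n2 : ‖Complex.I * (S.α : ℂ)⁻¹ * ε ^ 2 * Kf x‖ ≤ S.α⁻¹ * CK * ε := by
      simp only [norm_mul, Complex.norm_I, one_mul, norm_inv, norm_pow, Complex.norm_real,
        Real.norm_eq_abs, abs_of_pos hα, abs_of_pos hε]
      have := hCK x hx
      have h3 : ε ^ 2 ≤ ε := by nlinarith
      calc S.α⁻¹ * ε ^ 2 * ‖Kf x‖ ≤ S.α⁻¹ * ε * CK := by gcongr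
        _ = _ := by ring
    have n3 : ‖(c - S.c₁) * χ x‖ ≤ Cχ * ‖c - S.c₁‖ := by
      rw [norm_mul, mul_comm]; gcongr; exact hCχ x hx
    have n4 := hCH x hx
    have n5 : ‖H x + Complex.I * (S.α : ℂ)⁻¹ * ε * κ * J x + Complex.I * (S.α : ℂ)⁻¹ * ε ^ 2 * Kf x -
          (c - S.c₁) * χ x‖ ≤ CH * |x - p| + S.α⁻¹ * ‖κ‖ * CJ * |x - p| + S.α⁻¹ * CK * ε +
            Cχ * ‖c - S.c₁‖ :=
      (norm_sub_le _ _).trans (add_le_add ((norm_add_le _ _).trans (add_le_add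
        ((norm_add_le _ _).trans (add_le_add n4 n1)) n2)) n3)
    refine n5.trans ?_
    have p1 : 0 ≤ S.α⁻¹ * ‖κ‖ * CJ := by positivity
    have p2 : 0 ≤ S.α⁻¹ * CK := by positivity
    have p3 := abs_nonneg (x - p)
    have p4 := norm_nonneg (c - S.c₁)
    have : (CH + S.α⁻¹ * ‖κ‖ * CJ + S.α⁻¹ * CK + Cχ) * (|x - p| + ε + ‖c - S.c₁‖) -
      (CH * |x - p| + S.α⁻¹ * ‖κ‖ * CJ * |x - p| + S.α⁻¹ * CK * ε + Cχ * ‖c - S.c₁‖) =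
      (CH + S.α⁻¹ * ‖κ‖ * CJ) * (ε + ‖c - S.c₁‖) + S.α⁻¹ * CK * (|x - p| + ‖c - S.c₁‖) +
        Cχ * (|x - p| + ε) := by ring
    have : 0 ≤ (CH + S.α⁻¹ * ‖κ‖ * CJ) * (ε + ‖c - S.c₁‖) + S.α⁻¹ * CK * (|x - p| + ‖c - S.c₁‖) +
        Cχ * (|x - p| + ε) := by positivity
    linarith

/-- The Robin condition `ε ∂Ω = κ Ω` at an endpoint `p`, up to controlled errors: it is what remains
of the pairing of `P_{c,ε} ψ` with the boundary layer, which solves the leading order of the adjoint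
equation. -/
theorem robin_estimate {p : ℝ} (hp : p = S.a ∨ p = S.b) {κ : ℂ} {k : ℝ} (hk : 0 < k)
    (hκ : κ ^ 2 = Complex.I * S.α * (S.W p - S.c₁))
    (hκk : ∀ x ∈ Icc S.a S.b, (κ * (x - p)).re ≤ -(k * |x - p|)) :
    ∃ C, 0 ≤ C ∧ ∀ (T : S.State) (c : ℂ) (ε : ℝ), 0 < ε → ε ≤ 1 →
      ‖(ε : ℂ) ^ 2 * T.ρ p - κ * (ε * T.Ω p)‖ ≤
        C * (Real.sqrt ε * S.norm2 (T.op c ε) + (ε + ‖c - S.c₁‖) * T.w ε + ε * T.n) := by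
  obtain ⟨C, hC0, hC⟩ := S.exists_layer hp hk hκ hκk
  obtain ⟨A, hA0, hA⟩ := exists_norm_graphIntegral_mul_le S.hab.le S.hm
  obtain ⟨B, hB0, hB⟩ := S.exists_norm_ψ_le
  have hα := S.hα
  have hab := S.hab.le
  have hW2 := S.contDiffOn_W₂.continuousOn
  set w₂ := S.norm2 S.W₂
  have hw₂ : 0 ≤ w₂ := l2_nonneg _
  have hsk : 0 < Real.sqrt k := Real.sqrt_pos.2 hk
  set R := A * C / Real.sqrt k
  refine ⟨S.α * (R * (1 + (2 / k + 1) + B * (2 / k) * w₂)), by positivity,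
    fun T c ε hε hε1 => ?_⟩
  obtain ⟨g₁, Lg, hg, hbd, hlay, hLg⟩ := hC ε hε hε1
  obtain ⟨τ, hτ, hbd⟩ := hbd T.ρ T.Ω
  have hid := T.int_mul_op c ε hg
  rw [hbd] at hid
  have hεc : (ε : ℂ) ≠ 0 := by exact_mod_cast hε.ne'
  set g := S.layer κ p ε
  have c1 := T.lap.continuousOn; have c2 := T.lap.cont; have c3 := T.continuousOn_op c ε
  have c4 := hg.continuousOn; have c5 := hg.cont; have c6 := S.hW.continuousOn
  -- half of the decay rate of the layer is spent on absorbing factors `|x - p|`, each worth `ε`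
  set e : ℝ → ℂ := fun x => (Real.exp (-(k / (2 * ε) * |x - p|)) : ℝ)
  have hec : Continuous e := Complex.continuous_ofReal.comp (by fun_prop)
  have hen : ∀ x, ‖e x‖ = Real.exp (-(k / (2 * ε) * |x - p|)) := fun x => by
    simp only [e, Complex.norm_real, Real.norm_eq_abs, abs_of_pos (Real.exp_pos _)]
  have hel : S.norm2 e ≤ Real.sqrt ε / Real.sqrt k := by
    rw [← Real.sqrt_div hε.le]
    refine Real.sqrt_le_sqrt ?_
    have h := integral_exp_neg_mul_abs_sub_le hab (div_pos hk hε) hp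
    refine (le_of_eq ?_).trans (h.trans (le_of_eq (by rw [one_div_div])))
    congr 1; ext x
    rw [hen, ← Real.exp_nat_mul]
    congr 1; push_cast; field_simp
  have hexp1 : ∀ x, Real.exp (-(k / ε * |x - p|)) ≤ ‖e x‖ := fun x => by
    rw [hen, Real.exp_le_exp, neg_le_neg_iff]
    refine mul_le_mul_of_nonneg_right ?_ (abs_nonneg _)
    exact div_le_div_of_nonneg_left hk.le hε (by linarith)
  have hexp2 : ∀ x, |x - p| * Real.exp (-(k / ε * |x - p|)) ≤ 2 / k * ε * ‖e x‖ := fun x => by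
    have h1 : k / ε * |x - p| = k / (2 * ε) * |x - p| + k / (2 * ε) * |x - p| := by
      field_simp; ring
    rw [hen, h1, neg_add, Real.exp_add, ← mul_assoc]
    refine mul_le_mul_of_nonneg_right ?_ (Real.exp_pos _).le
    have h2 := Real.add_one_le_exp (k / (2 * ε) * |x - p|)
    rw [Real.exp_neg, ← div_eq_mul_inv, div_le_iff₀ (Real.exp_pos _)]
    have h3 : |x - p| = 2 / k * ε * (k / (2 * ε) * |x - p|) := by field_simp
    nth_rw 1 [h3]
    exact mul_le_mul_of_nonneg_left (by linarith) (by positivity)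
  have b1 : ‖S.int (fun x => g x * T.op c ε x)‖ ≤ R * (Real.sqrt ε * S.norm2 (T.op c ε)) := by
    have h1 : S.norm2 g ≤ C * S.norm2 e := l2_le_mul hab hC0 c4 hec.continuousOn fun x hx =>
      (hlay x hx).trans (mul_le_mul_of_nonneg_left (hexp1 x) hC0)
    have h0 : 0 ≤ S.norm2 (T.op c ε) := l2_nonneg _
    calc _ ≤ A * (S.norm2 g * S.norm2 (T.op c ε)) := hA _ _ c4 c3
      _ ≤ A * (C * (Real.sqrt ε / Real.sqrt k) * S.norm2 (T.op c ε)) := by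
        gcongr; exact h1.trans (by gcongr)
      _ = _ := by simp only [R]; ring
  have b2 : ‖S.int (fun x => (Complex.I * (S.α : ℂ)⁻¹ * (ε : ℂ) ^ 2 * Lg x + (S.W x - c) * g x) *
      T.Ω x)‖ ≤ R * ((2 / k + 1) * ((ε + ‖c - S.c₁‖) * T.w ε)) := by
    set u : ℝ → ℂ := fun x => Complex.I * (S.α : ℂ)⁻¹ * (ε : ℂ) ^ 2 * Lg x + (S.W x - c) * g x
    have hu : ContinuousOn u (Icc S.a S.b) := by fun_prop
    have hcn := norm_nonneg (c - S.c₁)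
    have h1 : S.norm2 u ≤ (C * ((2 / k + 1) * (ε + ‖c - S.c₁‖))) * S.norm2 e := by
      refine l2_le_mul hab (by positivity) hu hec.continuousOn fun x hx => (hLg c x hx).trans ?_
      have h3 := hexp2 x
      have h4 := mul_le_mul_of_nonneg_left (hexp1 x) (show 0 ≤ ε + ‖c - S.c₁‖ by positivity)
      have h5 : 0 ≤ 2 / k * ‖c - S.c₁‖ * ‖e x‖ := by positivity
      have h6 : (|x - p| + ε + ‖c - S.c₁‖) * Real.exp (-(k / ε * |x - p|)) ≤
          (2 / k + 1) * (ε + ‖c - S.c₁‖) * ‖e x‖ := by linarith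
      rw [mul_assoc, mul_assoc C]
      exact mul_le_mul_of_nonneg_left h6 hC0
    have h0 : 0 ≤ S.norm2 T.Ω := l2_nonneg _
    calc _ ≤ A * (S.norm2 u * S.norm2 T.Ω) := hA _ _ hu c2
      _ ≤ A * ((C * ((2 / k + 1) * (ε + ‖c - S.c₁‖))) * (Real.sqrt ε / Real.sqrt k) *
          S.norm2 T.Ω) := by
        gcongr; exact h1.trans (by gcongr)
      _ = _ := by simp only [R, State.w]; ring
  have b3 : ‖S.int (fun x => g x * (S.W₂ x * T.ψ x))‖ ≤
      R * (B * (2 / k) * w₂ * (ε * T.w ε + ε * T.n)) := by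
    have e0 : S.int (fun x => g x * (S.W₂ x * T.ψ x)) =
        S.int (fun x => (g x * T.ψ x) * S.W₂ x) := by
      congr 1; ext x; ring
    have hN : 0 ≤ S.norm2 T.Ω + T.n := add_nonneg (l2_nonneg _) T.n_nonneg
    have h1 : S.norm2 (fun x => g x * T.ψ x) ≤
        (C * (B * (S.norm2 T.Ω + T.n) * (2 / k * ε))) * S.norm2 e := by
      refine l2_le_mul hab (by positivity) (by fun_prop) hec.continuousOn fun x hx => ?_
      rw [norm_mul]
      calc ‖g x‖ * ‖T.ψ x‖ ≤ (C * Real.exp (-(k / ε * |x - p|))) *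
          (B * (S.norm2 T.Ω + T.n) * |x - p|) :=
            mul_le_mul (hlay x hx) (hB T p hp x hx) (norm_nonneg _) (by positivity)
        _ = C * (B * (S.norm2 T.Ω + T.n)) * (|x - p| * Real.exp (-(k / ε * |x - p|))) := by ring
        _ ≤ C * (B * (S.norm2 T.Ω + T.n)) * (2 / k * ε * ‖e x‖) := by
          have := hexp2 x
          gcongr
        _ = _ := by ring
    rw [e0]
    have hs1 : Real.sqrt ε ≤ 1 := Real.sqrt_le_one.2 hε1
    have hn := T.n_nonneg
    calc _ ≤ A * (S.norm2 (fun x => g x * T.ψ x) * w₂) := hA _ _ (by fun_prop) hW2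
      _ ≤ A * ((C * (B * (S.norm2 T.Ω + T.n) * (2 / k * ε))) * (Real.sqrt ε / Real.sqrt k) *
          w₂) := by
        gcongr; exact h1.trans (by gcongr)
      _ = R * (B * (2 / k) * w₂ * (ε * T.w ε + ε * (Real.sqrt ε * T.n))) := by
        simp only [R, State.w]; ring
      _ ≤ R * (B * (2 / k) * w₂ * (ε * T.w ε + ε * (1 * T.n))) := by gcongr
      _ = _ := by ring
  have hmain : ‖(ε : ℂ) ^ 2 * T.ρ p - κ * (ε * T.Ω p)‖ ≤ S.α *
      (‖S.int (fun x => g x * T.op c ε x)‖ + ‖S.int (fun x => (Complex.I * (S.α : ℂ)⁻¹ *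
        (ε : ℂ) ^ 2 * Lg x + (S.W x - c) * g x) * T.Ω x)‖ +
        ‖S.int (fun x => g x * (S.W₂ x * T.ψ x))‖) := by
    have e1 : Complex.I * (S.α : ℂ)⁻¹ * τ * ((ε : ℂ) ^ 2 * T.ρ p - κ * (ε * T.Ω p)) =
        S.int (fun x => g x * T.op c ε x) - S.int (fun x => (Complex.I * (S.α : ℂ)⁻¹ *
        (ε : ℂ) ^ 2 * Lg x + (S.W x - c) * g x) * T.Ω x) +
        S.int (fun x => g x * (S.W₂ x * T.ψ x)) := by
      rw [hid]; field_simp; ring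
    have e2 := congrArg norm e1
    rw [norm_mul, norm_mul, norm_mul, hτ, Complex.norm_I, norm_inv, Complex.norm_real,
      Real.norm_eq_abs, abs_of_pos hα, one_mul, mul_one] at e2
    have e3 : ‖(ε : ℂ) ^ 2 * T.ρ p - κ * (ε * T.Ω p)‖ = S.α * (S.α⁻¹ *
      ‖(ε : ℂ) ^ 2 * T.ρ p - κ * (ε * T.Ω p)‖) := by field_simp
    rw [e3, e2]
    refine mul_le_mul_of_nonneg_left ?_ hα.le
    exact (norm_add_le _ _).trans (add_le_add_left (norm_sub_le _ _) _)
  refine hmain.trans ?_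
  set X := Real.sqrt ε * S.norm2 (T.op c ε)
  set Y := (ε + ‖c - S.c₁‖) * T.w ε
  set Z := ε * T.n
  have hX : 0 ≤ X := mul_nonneg (Real.sqrt_nonneg _) (l2_nonneg _)
  have hw := T.w_nonneg ε
  have hY : 0 ≤ Y := by positivity
  have hZ : 0 ≤ Z := mul_nonneg hε.le T.n_nonneg
  have hYw : ε * T.w ε ≤ Y := mul_le_mul_of_nonneg_right (by linarith [norm_nonneg (c - S.c₁)]) hw
  set P := B * (2 / k) * w₂
  have hP : 0 ≤ P := by positivity
  set K := 2 / k + 1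
  have hK : 0 ≤ K := by positivity
  have : P * (ε * T.w ε + Z) ≤ P * (Y + Z) := mul_le_mul_of_nonneg_left (by linarith) hP
  have h1 : X + K * Y + P * (ε * T.w ε + Z) ≤ (1 + K + P) * (X + Y + Z) := by
    nlinarith [mul_nonneg hP hX, mul_nonneg hK hX, mul_nonneg hK hZ]
  have hR : 0 ≤ R := by positivity
  calc _ ≤ S.α * (R * X + R * (K * Y) + R * (P * (ε * T.w ε + Z))) :=
        mul_le_mul_of_nonneg_left (add_le_add (add_le_add b1 b2) b3) hα.le
    _ = S.α * (R * (X + K * Y + P * (ε * T.w ε + Z))) := by ring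
    _ ≤ S.α * (R * ((1 + K + P) * (X + Y + Z))) := by gcongr
    _ = _ := by ring

end RayleighResonance

/-! ### Variation of constants for the Rayleigh equation -/

section Rayleigh

variable {a b : ℝ} {m : ℝ → ℝ} {α : ℝ}

/-- The coefficient of the first order system of `(∂² - α²) χ = q χ` along the curve. -/
def rayleighSystem (m : ℝ → ℝ) (α : ℝ) (q : ℝ → ℂ) (x : ℝ) : (ℂ × ℂ) →L[ℂ] (ℂ × ℂ) :=
  speed m x • (ContinuousLinearMap.inl ℂ ℂ ℂ).comp (ContinuousLinearMap.snd ℂ ℂ ℂ) +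
    (speed m x * (q x + (α : ℂ) ^ 2)) •
      (ContinuousLinearMap.inr ℂ ℂ ℂ).comp (ContinuousLinearMap.fst ℂ ℂ ℂ)

theorem rayleighSystem_apply (q : ℝ → ℂ) (x : ℝ) (y : ℂ × ℂ) :
    rayleighSystem m α q x y = (speed m x * y.2, speed m x * (q x + (α : ℂ) ^ 2) * y.1) := by
  simp [rayleighSystem]

theorem contDiffOn_rayleighSystem (hm : ContDiff ℝ ∞ m) {q : ℝ → ℂ}
    (hq : ContDiffOn ℝ ∞ q (Icc a b)) : ContDiffOn ℝ ∞ (rayleighSystem m α q) (Icc a b) := by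
  have hs : ContDiffOn ℝ ∞ (speed m) (Icc a b) := (contDiff_speed hm).contDiffOn
  exact (hs.smul contDiffOn_const).add
    ((hs.mul (hq.add contDiffOn_const)).smul contDiffOn_const)

theorem LapOn.solvesOn_rayleighSystem {q f f₁ g : ℝ → ℂ} (h : LapOn a b m α f f₁ g)
    (hg : ∀ x ∈ Icc a b, g x = q x * f x) :
    SolvesOn a b (rayleighSystem m α q) fun x => (f x, f₁ x) := fun x hx => by
  rw [rayleighSystem_apply]
  refine (h.deriv_fst x hx).prodMk ((h.deriv_snd x hx).congr_deriv ?_)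
  rw [hg x hx]; ring

theorem SolvesOn.lapOn_rayleighSystem {q : ℝ → ℂ} (hq : ContinuousOn q (Icc a b))
    {y : ℝ → ℂ × ℂ} (h : SolvesOn a b (rayleighSystem m α q) y) :
    LapOn a b m α (fun x => (y x).1) (fun x => (y x).2) (fun x => q x * (y x).1) where
  deriv_fst x hx := by
    have := h x hx
    rw [rayleighSystem_apply] at this
    exact (ContinuousLinearMap.fst ℝ ℂ ℂ).hasFDerivAt.comp_hasDerivWithinAt x this
  deriv_snd x hx := by
    have := h x hx
    rw [rayleighSystem_apply] at this
    refine ((ContinuousLinearMap.snd ℝ ℂ ℂ).hasFDerivAt.comp_hasDerivWithinAt x this).congr_deriv ?_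
    simp only [ContinuousLinearMap.coe_snd']; ring
  cont := hq.mul (continuous_fst.comp_continuousOn h.continuousOn)

theorem LapOn.eqOn_zero_of_rayleigh (hab : a < b) (hm : ContDiff ℝ ∞ m) {q f f₁ g : ℝ → ℂ}
    (hq : ContDiffOn ℝ ∞ q (Icc a b)) (h : LapOn a b m α f f₁ g)
    (hg : ∀ x ∈ Icc a b, g x = q x * f x) (h0 : f a = 0) (h1 : f₁ a = 0) :
    ∀ x ∈ Icc a b, f x = 0 := by
  have hz : SolvesOn a b (rayleighSystem m α q) fun _ => (0 : ℂ × ℂ) := fun x _ => by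
    rw [map_zero]; exact hasDerivWithinAt_const _ _ _
  intro x hx
  have := SolvesOn.eqOn hab.le (contDiffOn_rayleighSystem hm hq).continuousOn
    (h.solvesOn_rayleighSystem hg) hz (by simp [h0, h1]) hx
  exact (Prod.mk.inj this).1

/-- A second solution of the Rayleigh equation, with Wronskian one. -/
theorem exists_second_solution (hab : a < b) (hm : ContDiff ℝ ∞ m) {q ψ : ℝ → ℂ}
    (hq : ContDiffOn ℝ ∞ q (Icc a b)) (hψ : ContDiffOn ℝ ∞ ψ (Icc a b))
    (heq : ∀ x ∈ Icc a b, curveLaplace a b m α ψ x = q x * ψ x) (h0 : ψ a = 0)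
    (hne : ∃ x ∈ Icc a b, ψ x ≠ 0) :
    ∃ χ : ℝ → ℂ, ContDiffOn ℝ ∞ χ (Icc a b) ∧
      (∀ x ∈ Icc a b, curveLaplace a b m α χ x = q x * χ x) ∧
      ∀ x ∈ Icc a b, ψ x * curveDeriv a b m χ x - curveDeriv a b m ψ x * χ x = 1 := by
  have hB := contDiffOn_rayleighSystem (α := α) hm hq
  have hL := LapOn.of_contDiffOn (α := α) hab hm hψ
  have hd : curveDeriv a b m ψ a ≠ 0 := fun hd => by
    obtain ⟨x, hx, hne⟩ := hne
    exact hne (hL.eqOn_zero_of_rayleigh hab hm hq heq h0 hd x hx)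
  obtain ⟨y, hya, hy⟩ := exists_solvesOn hab.le hB.continuousOn
    ((-(curveDeriv a b m ψ a)⁻¹, 0) : ℂ × ℂ)
  have hχ := hy.lapOn_rayleighSystem hq.continuousOn
  refine ⟨fun x => (y x).1, (hy.contDiffOn hab hB).fst, hχ.curveLaplace_eq hab, fun x hx => ?_⟩
  have hW : ∀ x ∈ Icc a b, HasDerivWithinAt (fun x => ψ x * (y x).2 - curveDeriv a b m ψ x * (y x).1)
      0 (Icc a b) x := fun x hx =>
    (((hL.deriv_fst x hx).fun_mul (hχ.deriv_snd x hx)).fun_sub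
      ((hL.deriv_snd x hx).fun_mul (hχ.deriv_fst x hx))).congr_deriv (by
        rw [heq x hx]; ring)
  have := (convex_Icc a b).is_const_of_fderivWithin_eq_zero (𝕜 := ℝ)
    (fun x hx => (hW x hx).differentiableWithinAt) (fun x hx => by
      have h := (hW x hx).hasFDerivWithinAt.fderivWithin (uniqueDiffOn_Icc hab x hx)
      rw [h]; ext; simp) hx (left_mem_Icc.2 hab.le)
  rw [hχ.curveDeriv_eq hab hx]
  refine this.trans ?_
  rw [hya, h0]
  field_simp
  ring

/-- The solution of `(∂² - α²) φ = q φ + k` with vanishing Cauchy data at `a`. -/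
def variationOfConstants (a : ℝ) (m : ℝ → ℝ) (ψ χ k : ℝ → ℂ) (x : ℝ) : ℂ :=
  χ x * (∫ t in a..x, ψ t * k t * speed m t) - ψ x * ∫ t in a..x, χ t * k t * speed m t

theorem lapOn_variationOfConstants (hab : a < b) (hm : ContDiff ℝ ∞ m) {q ψ χ k : ℝ → ℂ}
    (hψ : ContDiffOn ℝ ∞ ψ (Icc a b)) (hχ : ContDiffOn ℝ ∞ χ (Icc a b))
    (hk : ContinuousOn k (Icc a b)) (hq : ContinuousOn q (Icc a b))
    (heψ : ∀ x ∈ Icc a b, curveLaplace a b m α ψ x = q x * ψ x)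
    (heχ : ∀ x ∈ Icc a b, curveLaplace a b m α χ x = q x * χ x)
    (hw : ∀ x ∈ Icc a b, ψ x * curveDeriv a b m χ x - curveDeriv a b m ψ x * χ x = 1) :
    LapOn a b m α (variationOfConstants a m ψ χ k)
      (fun x => curveDeriv a b m χ x * (∫ t in a..x, ψ t * k t * speed m t) -
        curveDeriv a b m ψ x * ∫ t in a..x, χ t * k t * speed m t)
      (fun x => q x * variationOfConstants a m ψ χ k x + k x) := by
  have hs : ContinuousOn (speed m) (Icc a b) := (contDiff_speed hm).continuous.continuousOn
  have c1 := hψ.continuousOn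
  have c2 := hχ.continuousOn
  have i1 : ∀ x ∈ Icc a b, HasDerivWithinAt (fun x => ∫ t in a..x, ψ t * k t * speed m t)
      (ψ x * k x * speed m x) (Icc a b) x := fun x hx =>
    hasDerivWithinAt_integral_Icc hab.le (by fun_prop) hx
  have i2 : ∀ x ∈ Icc a b, HasDerivWithinAt (fun x => ∫ t in a..x, χ t * k t * speed m t)
      (χ x * k x * speed m x) (Icc a b) x := fun x hx =>
    hasDerivWithinAt_integral_Icc hab.le (by fun_prop) hx
  have d1 := LapOn.of_contDiffOn (α := α) hab hm hψ
  have d2 := LapOn.of_contDiffOn (α := α) hab hm hχ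
  have hd : ∀ x ∈ Icc a b, HasDerivWithinAt (variationOfConstants a m ψ χ k)
      (speed m x * (curveDeriv a b m χ x * (∫ t in a..x, ψ t * k t * speed m t) -
        curveDeriv a b m ψ x * ∫ t in a..x, χ t * k t * speed m t)) (Icc a b) x := fun x hx =>
    (((d2.deriv_fst x hx).fun_mul (i1 x hx)).fun_sub
        ((d1.deriv_fst x hx).fun_mul (i2 x hx))).congr_deriv (by ring)
  refine ⟨hd, fun x hx => ?_, ?_⟩
  · refine (((d2.deriv_snd x hx).fun_mul (i1 x hx)).fun_sub
        ((d1.deriv_snd x hx).fun_mul (i2 x hx))).congr_deriv ?_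
    rw [heψ x hx, heχ x hx]
    have := hw x hx
    rw [variationOfConstants]
    linear_combination (k x * speed m x) * this
  · have : ContinuousOn (variationOfConstants a m ψ χ k) (Icc a b) := fun x hx =>
      (hd x hx).continuousWithinAt
    fun_prop

theorem contDiffOn_integral (hab : a < b) {f : ℝ → ℂ} (hf : ContDiffOn ℝ ∞ f (Icc a b)) :
    ContDiffOn ℝ ∞ (fun x => ∫ t in a..x, f t) (Icc a b) := by
  have hu := uniqueDiffOn_Icc hab
  have hd : ∀ x ∈ Icc a b, HasDerivWithinAt (fun x => ∫ t in a..x, f t) (f x) (Icc a b) x :=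
    fun x hx => hasDerivWithinAt_integral_Icc hab.le hf.continuousOn hx
  rw [contDiffOn_infty_iff_derivWithin hu]
  exact ⟨fun x hx => (hd x hx).differentiableWithinAt,
    hf.congr fun x hx => (hd x hx).derivWithin (hu x hx)⟩

theorem contDiffOn_variationOfConstants (hab : a < b) (hm : ContDiff ℝ ∞ m) {ψ χ k : ℝ → ℂ}
    (hψ : ContDiffOn ℝ ∞ ψ (Icc a b)) (hχ : ContDiffOn ℝ ∞ χ (Icc a b))
    (hk : ContDiffOn ℝ ∞ k (Icc a b)) :
    ContDiffOn ℝ ∞ (variationOfConstants a m ψ χ k) (Icc a b) := by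
  have hs : ContDiffOn ℝ ∞ (speed m) (Icc a b) := (contDiff_speed hm).contDiffOn
  exact (hχ.mul (contDiffOn_integral hab ((hψ.mul hk).mul hs))).sub
    (hψ.mul (contDiffOn_integral hab ((hχ.mul hk).mul hs)))

theorem variationOfConstants_right {ψ χ k : ℝ → ℂ} (hψ : ψ b = 0)
    (h : graphIntegral a b m (fun x => ψ x * k x) = 0) : variationOfConstants a m ψ χ k b = 0 := by
  have : ∫ t in a..b, ψ t * k t * speed m t = 0 := h
  rw [variationOfConstants, this, hψ]; ring

theorem variationOfConstants_left (ψ χ k : ℝ → ℂ) : variationOfConstants a m ψ χ k a = 0 := by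
  simp [variationOfConstants]

/-- The `L²` norm of the inhomogeneity controls the solution and its derivative pointwise. -/
theorem exists_bound_integral_mul (hab : a ≤ b) (hm : ContDiff ℝ ∞ m) {ψ : ℝ → ℂ}
    (hψ : ContinuousOn ψ (Icc a b)) : ∃ C, 0 ≤ C ∧ ∀ k : ℝ → ℂ, ContinuousOn k (Icc a b) →
      ∀ x ∈ Icc a b, ‖∫ t in a..x, ψ t * k t * speed m t‖ ≤ C * l2 a b k := by
  have hs : ContinuousOn (speed m) (Icc a b) := (contDiff_speed hm).continuous.continuousOn
  refine ⟨l2 a b (fun t => ψ t * speed m t), l2_nonneg _, fun k hk x hx => ?_⟩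
  have hsub : Icc a x ⊆ Icc a b := Icc_subset_Icc_right hx.2
  have h1 : ‖∫ t in a..x, ψ t * k t * speed m t‖ ≤ ∫ t in a..x, ‖ψ t * speed m t‖ * ‖k t‖ := by
    refine intervalIntegral.norm_integral_le_of_norm_le hx.1
      (Eventually.of_forall fun t _ => ?_)
      (ContinuousOn.intervalIntegrable_Icc hx.1 (ContinuousOn.mono (by fun_prop) hsub))
    rw [← norm_mul]
    exact le_of_eq (congrArg _ (by ring))
  refine h1.trans (le_trans ?_ (integral_norm_mul_norm_le hab (hψ.mul hs) hk))
  exact intervalIntegral.integral_mono_interval le_rfl hx.1 hx.2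
    (Eventually.of_forall fun t => by positivity)
    (ContinuousOn.intervalIntegrable_Icc hab (by fun_prop))

end Rayleigh

/-! ### The a priori estimate -/

namespace RayleighResonance

variable (S : RayleighResonance)

/-- The coefficient `W'' / (W - c₁)` of the Rayleigh equation. -/
def q : ℝ → ℂ := fun x => S.W₂ x * S.v x

theorem contDiffOn_q : ContDiffOn ℝ ∞ S.q (Icc S.a S.b) := S.contDiffOn_W₂.mul S.contDiffOn_v

theorem L_ψ₀_eq : ∀ x ∈ Icc S.a S.b, S.L S.ψ₀ x = S.q x * S.ψ₀ x := fun x hx => by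
  have h := S.eqn x hx
  have hne := S.W_sub_ne hx
  rw [q, v, mul_right_comm, ← div_eq_mul_inv, eq_div_iff hne, mul_comm]
  exact h

theorem lap_ψ₀ : S.Lap S.ψ₀ (S.D S.ψ₀) (S.L S.ψ₀) := S.lap_of_contDiffOn S.hψ₀

theorem lap_v : S.Lap S.v (S.D S.v) (S.L S.v) := S.lap_of_contDiffOn S.contDiffOn_v

theorem endpoint_mem {p : ℝ} (hp : p = S.a ∨ p = S.b) : p ∈ Icc S.a S.b := by
  rcases hp with rfl | rfl
  exacts [left_mem_Icc.2 S.hab.le, right_mem_Icc.2 S.hab.le]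

/-- The size of `f` as a right-hand side: its `L²` norm, allowed to grow like `1 / √ε`, and its
pairings with twice differentiable test functions. -/
structure ForcingBound (ε F : ℝ) (f : ℝ → ℂ) : Prop where
  nonneg : 0 ≤ F
  l2_le : Real.sqrt ε * S.norm2 f ≤ F
  weak : ∀ g g₁ Lg : ℝ → ℂ, S.Lap g g₁ Lg → ‖S.int (fun x => g x * f x)‖ ≤
    F * (S.norm2 g + S.norm2 Lg)

/-- The error term `F + ε β + ε w + |c - c₁| n`. -/
def err (T : S.State) (c : ℂ) (ε F : ℝ) : ℝ :=
  F + ε * T.β ε + ε * T.w ε + ‖c - S.c₁‖ * T.n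

theorem err_nonneg (T : S.State) (c : ℂ) {ε F : ℝ} (hε : 0 ≤ ε) (hF : 0 ≤ F) :
    0 ≤ S.err T c ε F := by
  have := T.β_nonneg hε; have := T.w_nonneg ε; have := T.n_nonneg
  unfold err; positivity

/-- The Rayleigh operator at `c₁` applied to `ψ`, paired with a test function `φ = (W - c₁) g`. -/
theorem test_estimate : ∃ C, 0 ≤ C ∧ ∀ (T : S.State) (c : ℂ) (ε F K : ℝ) (φ φ₁ Lφ g g₁ Lg : ℝ → ℂ),
    0 < ε → ε ≤ 1 → S.ForcingBound ε F (T.op c ε) → S.Lap φ φ₁ Lφ → S.Lap g g₁ Lg →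
    (∀ x ∈ Icc S.a S.b, g x = φ x * S.v x) → S.norm2 g ≤ K → S.norm2 Lg ≤ K →
    ‖g₁ S.a‖ ≤ K → ‖g₁ S.b‖ ≤ K →
    ‖S.int (fun x => T.ψ x * (Lφ x - S.q x * φ x)) + Complex.I * (S.α : ℂ)⁻¹ * (ε : ℂ) ^ 2 *
      (g S.b * T.ρ S.b - g S.a * T.ρ S.a)‖ ≤ C * K * S.err T c ε F := by
  obtain ⟨A, hA0, hA⟩ := exists_norm_graphIntegral_mul_le S.hab.le S.hm
  have hα := S.hα
  refine ⟨2 + S.α⁻¹ * (1 + A) + A, by positivity, ?_⟩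
  intro T c ε F K φ φ₁ Lφ g g₁ Lg hε hε1 hF hφ hg hgφ k1 k2 k3 k4
  have hK : 0 ≤ K := (norm_nonneg _).trans k3
  have h := T.int_test c ε hφ hg hgφ
  have c1 := T.lap.continuousOn; have c2 := T.lap.cont; have c3 := hg.cont
  have hn := T.n_nonneg; have hw := T.w_nonneg ε; have hβ := T.β_nonneg hε.le
  have hF0 := hF.nonneg
  have e1 : S.int (fun x => T.ψ x * (Lφ x - S.q x * φ x)) + Complex.I * (S.α : ℂ)⁻¹ * (ε : ℂ) ^ 2 *
      (g S.b * T.ρ S.b - g S.a * T.ρ S.a) = S.int (fun x => g x * T.op c ε x) -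
      (Complex.I * (S.α : ℂ)⁻¹ * (ε : ℂ) ^ 2 * (g₁ S.a * T.Ω S.a - g₁ S.b * T.Ω S.b) +
        Complex.I * (S.α : ℂ)⁻¹ * (ε : ℂ) ^ 2 * S.int (fun x => Lg x * T.Ω x)) +
        (c - S.c₁) * S.int (fun x => T.ψ x * Lg x) := by
    rw [h]; simp only [q]; ring
  have nI : ‖Complex.I * (S.α : ℂ)⁻¹ * (ε : ℂ) ^ 2‖ = S.α⁻¹ * ε ^ 2 := by
    simp [abs_of_pos hα]
  have b1 : ‖S.int (fun x => g x * T.op c ε x)‖ ≤ 2 * K * F := by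
    refine (hF.weak _ _ _ hg).trans ?_
    calc F * (S.norm2 g + S.norm2 Lg) ≤ F * (K + K) := by gcongr
      _ = _ := by ring
  have b2 : ‖Complex.I * (S.α : ℂ)⁻¹ * (ε : ℂ) ^ 2 * (g₁ S.a * T.Ω S.a - g₁ S.b * T.Ω S.b)‖ ≤
      S.α⁻¹ * K * (ε * T.β ε) := by
    rw [norm_mul, nI]
    have : ‖g₁ S.a * T.Ω S.a - g₁ S.b * T.Ω S.b‖ ≤ K * ‖T.Ω S.a‖ + K * ‖T.Ω S.b‖ := by
      refine (norm_sub_le _ _).trans ?_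
      rw [norm_mul, norm_mul]
      gcongr
    calc _ ≤ S.α⁻¹ * ε ^ 2 * (K * ‖T.Ω S.a‖ + K * ‖T.Ω S.b‖) := by gcongr
      _ = _ := by simp only [State.β]; ring
  have b3 : ‖Complex.I * (S.α : ℂ)⁻¹ * (ε : ℂ) ^ 2 * S.int (fun x => Lg x * T.Ω x)‖ ≤
      S.α⁻¹ * A * K * (ε * T.w ε) := by
    rw [norm_mul, nI]
    have h0 : 0 ≤ S.norm2 T.Ω := l2_nonneg _
    have hε2 : ε ^ 2 ≤ ε * Real.sqrt ε := by
      rw [sq]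
      refine mul_le_mul_of_nonneg_left ?_ hε.le
      exact Real.le_sqrt_of_sq_le (by nlinarith)
    calc _ ≤ S.α⁻¹ * (ε * Real.sqrt ε) * (A * (K * S.norm2 T.Ω)) := by
          gcongr
          exact (hA _ _ c3 c2).trans (by gcongr)
      _ = _ := by simp only [State.w]; ring
  have b4 : ‖(c - S.c₁) * S.int (fun x => T.ψ x * Lg x)‖ ≤ A * K * (‖c - S.c₁‖ * T.n) := by
    rw [norm_mul]
    calc _ ≤ ‖c - S.c₁‖ * (A * (T.n * K)) := by
          gcongr
          refine (hA _ _ c1 c3).trans ?_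
          have : l2 S.a S.b T.ψ = T.n := rfl
          rw [this]
          gcongr
      _ = _ := by ring
  rw [e1]
  have hfin := (norm_add_le _ _).trans (add_le_add ((norm_sub_le _ _).trans
    (add_le_add b1 ((norm_add_le _ _).trans (add_le_add b2 b3)))) b4)
  refine hfin.trans ?_
  have p0 : 0 ≤ S.α⁻¹ := by positivity
  have p1 : 0 ≤ ε * T.β ε := by positivity
  have p2 : 0 ≤ ε * T.w ε := by positivity
  have p3 : 0 ≤ ‖c - S.c₁‖ * T.n := by positivity
  unfold err
  have : (2 + S.α⁻¹ * (1 + A) + A) * K * (F + ε * T.β ε + ε * T.w ε + ‖c - S.c₁‖ * T.n) -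
    (2 * K * F + (S.α⁻¹ * K * (ε * T.β ε) + S.α⁻¹ * A * K * (ε * T.w ε)) +
      A * K * (‖c - S.c₁‖ * T.n)) =
    K * ((S.α⁻¹ * (1 + A) + A) * F + (2 + S.α⁻¹ * A + A) * (ε * T.β ε) +
      (2 + S.α⁻¹ + A) * (ε * T.w ε) + (2 + S.α⁻¹ * (1 + A)) * (‖c - S.c₁‖ * T.n)) := by ring
  have : 0 ≤ K * ((S.α⁻¹ * (1 + A) + A) * F + (2 + S.α⁻¹ * A + A) * (ε * T.β ε) +
      (2 + S.α⁻¹ + A) * (ε * T.w ε) + (2 + S.α⁻¹ * (1 + A)) * (‖c - S.c₁‖ * T.n)) := by positivity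
  linarith

/-- `ε² ∂Ω(p)` is determined by `ψ` up to small errors, as the pairing of `ψ` with a function `r` that
does not depend on `ε`. The value of that pairing at `ψ₀` is the slip `∂ψ₀(p)`. -/
theorem slow_estimate {p : ℝ} (hp : p = S.a ∨ p = S.b) : ∃ r : ℝ → ℂ,
    ContinuousOn r (Icc S.a S.b) ∧ S.int (fun x => S.ψ₀ x * r x) = S.D S.ψ₀ p ∧
    ∃ C, 0 ≤ C ∧ ∀ (T : S.State) (c : ℂ) (ε F : ℝ), 0 < ε → ε ≤ 1 →
      S.ForcingBound ε F (T.op c ε) →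
      ‖Complex.I * (S.α : ℂ)⁻¹ * (ε : ℂ) ^ 2 * (S.v p * T.ρ p) - S.int (fun x => T.ψ x * r x)‖ ≤
        C * S.err T c ε F := by
  obtain ⟨C, hC0, hC⟩ := S.test_estimate
  have hba : ((S.b : ℂ) - S.a) ≠ 0 := by
    rw [← Complex.ofReal_sub]; exact_mod_cast sub_ne_zero.2 S.hab.ne'
  -- an affine function that is one at `p` and zero at the other endpoint, with the sign of the
  -- outer normal
  obtain ⟨φ, τ, hφ, hτ, hval⟩ : ∃ (φ : ℝ → ℂ) (τ : ℂ), ContDiff ℝ ∞ φ ∧ ‖τ‖ = 1 ∧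
      ∀ h : ℝ → ℂ, φ S.b * h S.b - φ S.a * h S.a = τ * h p := by
    rcases hp with rfl | rfl
    · refine ⟨fun x => ((S.b : ℂ) - x) / (S.b - S.a), -1, ?_, by simp, fun h => ?_⟩
      · exact ((contDiff_const (c := (S.b : ℂ))).sub Complex.ofRealCLM.contDiff).div_const _
      · beta_reduce
        rw [sub_self, div_self hba]; ring
    · refine ⟨fun x => ((x : ℂ) - S.a) / (S.b - S.a), 1, ?_, by simp, fun h => ?_⟩
      · exact (Complex.ofRealCLM.contDiff.sub (contDiff_const (c := (S.a : ℂ)))).div_const _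
      · beta_reduce
        rw [sub_self, div_self hba]; ring
  have hlφ := S.lap_of_contDiffOn hφ.contDiffOn
  have hg : ContDiffOn ℝ ∞ (fun x => φ x * S.v x) (Icc S.a S.b) :=
    hφ.contDiffOn.mul S.contDiffOn_v
  have hlg := S.lap_of_contDiffOn hg
  have hq := S.contDiffOn_q.continuousOn
  have hψ := S.hψ₀.continuousOn
  have c1 := hlφ.cont; have c2 := hφ.continuous.continuousOn (s := Icc S.a S.b)
  have hττ : τ ≠ 0 := fun h => by rw [h, norm_zero] at hτ; norm_num at hτ
  set R : ℝ → ℂ := fun x => S.L φ x - S.q x * φ x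
  have hR : ContinuousOn R (Icc S.a S.b) := by fun_prop
  refine ⟨fun x => -τ⁻¹ * R x, by fun_prop, ?_, C * (S.norm2 (fun x => φ x * S.v x) +
    S.norm2 (S.L fun x => φ x * S.v x) + ‖S.D (fun x => φ x * S.v x) S.a‖ +
    ‖S.D (fun x => φ x * S.v x) S.b‖), ?_, fun T c ε F hε hε1 hF => ?_⟩
  · have h1 : S.int (fun x => S.ψ₀ x * (-τ⁻¹ * R x)) = -τ⁻¹ * S.int (fun x => S.ψ₀ x * R x) := by
      rw [int, int, ← graphIntegral_const_mul]; congr 1; ext x; ring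
    have h2 := S.lap_ψ₀.green S.hab.le S.hm hlφ
    have h3 : S.int (fun x => S.ψ₀ x * R x) = S.int (fun x => S.ψ₀ x * S.L φ x) -
        S.int (fun x => φ x * S.L S.ψ₀ x) := by
      have c3 := S.lap_ψ₀.cont
      rw [int, int, int, ← graphIntegral_sub S.hab.le S.hm]
      · refine graphIntegral_congr S.hab.le fun x hx => ?_
        simp only [R, S.L_ψ₀_eq x hx]; ring
      all_goals fun_prop
    rw [h1, h3, int, h2, S.bc.1, S.bc.2]
    have := hval (S.D S.ψ₀)
    field_simp
    linear_combination this
  · have := l2_nonneg (a := S.a) (b := S.b) (fun x => φ x * S.v x)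
    have := l2_nonneg (a := S.a) (b := S.b) (S.L fun x => φ x * S.v x)
    positivity
  · have h0 := l2_nonneg (a := S.a) (b := S.b) (fun x => φ x * S.v x)
    have h0' := l2_nonneg (a := S.a) (b := S.b) (S.L fun x => φ x * S.v x)
    have h0'' := norm_nonneg (S.D (fun x => φ x * S.v x) S.a)
    have h0''' := norm_nonneg (S.D (fun x => φ x * S.v x) S.b)
    have h := hC T c ε F (S.norm2 (fun x => φ x * S.v x) +
        S.norm2 (S.L fun x => φ x * S.v x) + ‖S.D (fun x => φ x * S.v x) S.a‖ +
        ‖S.D (fun x => φ x * S.v x) S.b‖) φ _ _ _ _ _ hε hε1 hF hlφ hlg (fun x _ => rfl)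
      (by linarith) (by linarith) (by linarith) (by linarith)
    refine le_trans (le_of_eq ?_) h
    have h1 : S.int (fun x => T.ψ x * (-τ⁻¹ * R x)) = -τ⁻¹ * S.int (fun x => T.ψ x * R x) := by
      rw [int, int, ← graphIntegral_const_mul]; congr 1; ext x; ring
    have h2 := hval (fun x => S.v x * T.ρ x)
    have h3 : S.int (fun x => T.ψ x * (S.L φ x - S.q x * φ x)) + Complex.I * (S.α : ℂ)⁻¹ *
        (ε : ℂ) ^ 2 * (φ S.b * S.v S.b * T.ρ S.b - φ S.a * S.v S.a * T.ρ S.a) =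
        τ * (Complex.I * (S.α : ℂ)⁻¹ * (ε : ℂ) ^ 2 * (S.v p * T.ρ p) -
          S.int (fun x => T.ψ x * (-τ⁻¹ * R x))) := by
      have e := mul_inv_cancel₀ hττ
      rw [h1]
      linear_combination (Complex.I * (S.α : ℂ)⁻¹ * (ε : ℂ) ^ 2) * h2 -
        S.int (fun x => T.ψ x * R x) * e
    rw [h3, norm_mul, hτ, one_mul]

/-- The coefficient of `f` along `ψ₀`. -/
def coord (f : ℝ → ℂ) : ℂ := (∫ x in S.a..S.b, conj (S.ψ₀ x) * f x) / (S.norm2 S.ψ₀ ^ 2 : ℝ)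

theorem norm2_ψ₀_pos : 0 < S.norm2 S.ψ₀ := by
  refine lt_of_le_of_ne (l2_nonneg _) fun h => ?_
  obtain ⟨x, hx, hne⟩ := S.ne_zero
  exact hne (eqOn_zero_of_l2_eq_zero S.hab S.hψ₀.continuousOn h.symm x hx)

theorem integral_conj_mul_self (f : ℝ → ℂ) :
    ∫ x in S.a..S.b, conj (f x) * f x = ((S.norm2 f ^ 2 : ℝ) : ℂ) := by
  rw [norm2, l2_sq S.hab.le, ← intervalIntegral.integral_ofReal]
  congr 1; ext x
  rw [Complex.conj_mul']; push_cast; rfl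

/-- The component of `ψ` transversal to `ψ₀` is small: duality with the solutions of the Rayleigh
equation with right-hand side orthogonal to `ψ₀`. -/
theorem dual_estimate : ∃ C, 0 ≤ C ∧ ∀ (T : S.State) (c : ℂ) (ε F : ℝ), 0 < ε → ε ≤ 1 →
    S.ForcingBound ε F (T.op c ε) →
    S.norm2 (fun x => T.ψ x - S.coord T.ψ * S.ψ₀ x) ≤ C * S.err T c ε F := by
  obtain ⟨C, hC0, hC⟩ := S.test_estimate
  obtain ⟨χ, hχ, heχ, hw⟩ := exists_second_solution S.hab S.hm S.contDiffOn_q S.hψ₀ S.L_ψ₀_eq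
    S.bc.1 S.ne_zero
  have hab := S.hab.le
  have cs := S.contDiffOn_speed.continuousOn
  have cψ := S.hψ₀.continuousOn
  have cχ := hχ.continuousOn
  have cq := S.contDiffOn_q.continuousOn
  have lχ := S.lap_of_contDiffOn hχ
  have cDψ := S.lap_ψ₀.continuousOn_deriv
  have cDχ := lχ.continuousOn_deriv
  have cv := S.contDiffOn_v.continuousOn
  have cDv := S.lap_v.continuousOn_deriv
  have cLv := S.lap_v.cont
  obtain ⟨A, hA0, hA⟩ := exists_bound_integral_mul hab S.hm cψ
  obtain ⟨B, hB0, hB⟩ := exists_bound_integral_mul hab S.hm cχ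
  obtain ⟨M₁, hM₁, m₁⟩ := exists_norm_le_Icc cψ
  obtain ⟨M₂, hM₂, m₂⟩ := exists_norm_le_Icc cχ
  obtain ⟨M₃, hM₃, m₃⟩ := exists_norm_le_Icc cDψ
  obtain ⟨M₄, hM₄, m₄⟩ := exists_norm_le_Icc cDχ
  obtain ⟨N₁, hN₁, n₁⟩ := exists_norm_le_Icc cv
  obtain ⟨N₂, hN₂, n₂⟩ := exists_norm_le_Icc cDv
  obtain ⟨N₃, hN₃, n₃⟩ := exists_norm_le_Icc (f := fun x => S.q x * S.v x + S.L S.v x +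
    (S.α : ℂ) ^ 2 * S.v x) (by fun_prop)
  set P := M₂ * A + M₁ * B
  set P₁ := M₄ * A + M₃ * B
  have hP : 0 ≤ P := by positivity
  have hP₁ : 0 ≤ P₁ := by positivity
  set sq := Real.sqrt (S.b - S.a)
  have hsq : 0 ≤ sq := Real.sqrt_nonneg _
  set K₀ := P * N₁ * sq + (P₁ * N₁ + P * N₂) + (N₁ + (P * N₃ + 2 * (P₁ * N₂)) * sq)
  refine ⟨C * K₀, by positivity, fun T c ε F hε hε1 hF => ?_⟩
  have c1 := T.lap.continuousOn
  set u : ℝ → ℂ := fun x => T.ψ x - S.coord T.ψ * S.ψ₀ x with hu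
  have cu : ContinuousOn u (Icc S.a S.b) := by fun_prop
  have ccu : ContinuousOn (fun x => conj (u x)) (Icc S.a S.b) :=
    Complex.continuous_conj.comp_continuousOn cu
  have ccψ : ContinuousOn (fun x => conj (S.ψ₀ x)) (Icc S.a S.b) :=
    Complex.continuous_conj.comp_continuousOn cψ
  -- with the factor `s⁻¹` the integral `∫ f k dz` is the `L²` pairing of `f` with `u`
  set k : ℝ → ℂ := fun x => (speed S.m x)⁻¹ * conj (u x)
  have ck : ContinuousOn k (Icc S.a S.b) :=
    (cs.inv₀ fun x _ => speed_ne_zero S.m x).mul ccu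
  have hn : 0 ≤ S.norm2 u := l2_nonneg _
  have hkn : S.norm2 k ≤ S.norm2 u := by
    have := l2_le_mul hab zero_le_one ck cu fun x _ => by
      simp only [k]
      rw [norm_mul, RCLike.norm_conj, norm_inv]
      exact mul_le_mul_of_nonneg_right (inv_le_one_of_one_le₀ (one_le_norm_speed _ _))
        (norm_nonneg _)
    simpa using this
  -- orthogonality of `u` to `ψ₀`
  have horth : ∫ x in S.a..S.b, conj (S.ψ₀ x) * u x = 0 := by
    have h1 : ∫ x in S.a..S.b, conj (S.ψ₀ x) * u x = (∫ x in S.a..S.b, conj (S.ψ₀ x) * T.ψ x) -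
        S.coord T.ψ * ∫ x in S.a..S.b, conj (S.ψ₀ x) * S.ψ₀ x := by
      rw [← intervalIntegral.integral_const_mul, ← intervalIntegral.integral_sub]
      · congr 1; ext x; simp only [hu]; ring
      all_goals exact ContinuousOn.intervalIntegrable_Icc hab (by fun_prop)
    rw [h1, S.integral_conj_mul_self, coord, div_mul_cancel₀, sub_self]
    exact_mod_cast (pow_pos S.norm2_ψ₀_pos 2).ne'
  have horth' : ∫ x in S.a..S.b, S.ψ₀ x * conj (u x) = 0 := by
    have h1 := congrArg conj horth
    rw [map_zero, intervalIntegral.integral_of_le hab, ← integral_conj] at h1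
    rw [← h1, intervalIntegral.integral_of_le hab]; congr 1; ext x; simp
  have hgi : ∀ f : ℝ → ℂ, S.int (fun x => f x * k x) = ∫ x in S.a..S.b, f x * conj (u x) := by
    intro f
    unfold int graphIntegral
    congr 1; ext x
    have := speed_ne_zero S.m x
    have e : (1 + Complex.I * ((deriv S.m x : ℝ) : ℂ)) = speed S.m x := rfl
    simp only [k, e]
    field_simp
  have hk0 : S.int (fun x => S.ψ₀ x * k x) = 0 := by rw [hgi, horth']
  -- `φ` solves the Dirichlet problem for the Rayleigh equation with right-hand side `k`, so that the
  -- pairing of `ψ` in `test_estimate` becomes `∫ ψ k dz = ‖u‖²`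
  set φ := variationOfConstants S.a S.m S.ψ₀ χ k
  have lφ := lapOn_variationOfConstants S.hab S.hm S.hψ₀ hχ ck cq S.L_ψ₀_eq heχ hw
  set φ₁ : ℝ → ℂ := fun x => S.D χ x * (∫ t in S.a..x, S.ψ₀ t * k t * speed S.m t) -
        S.D S.ψ₀ x * ∫ t in S.a..x, χ t * k t * speed S.m t
  have hφ0 : φ S.a = 0 := variationOfConstants_left _ _ _
  have hφb : φ S.b = 0 := variationOfConstants_right S.bc.2 hk0
  have bφ : ∀ x ∈ Icc S.a S.b, ‖φ x‖ ≤ P * S.norm2 u := fun x hx => by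
    refine (norm_sub_le _ _).trans ?_
    rw [norm_mul, norm_mul]
    calc _ ≤ M₂ * (A * S.norm2 u) + M₁ * (B * S.norm2 u) :=
        add_le_add (mul_le_mul (m₂ x hx) ((hA k ck x hx).trans (by gcongr)) (norm_nonneg _) hM₂)
          (mul_le_mul (m₁ x hx) ((hB k ck x hx).trans (by gcongr)) (norm_nonneg _) hM₁)
      _ = _ := by simp only [P]; ring
  have bφ₁ : ∀ x ∈ Icc S.a S.b, ‖φ₁ x‖ ≤ P₁ * S.norm2 u := fun x hx => by
    refine (norm_sub_le _ _).trans ?_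
    rw [norm_mul, norm_mul]
    calc _ ≤ M₄ * (A * S.norm2 u) + M₃ * (B * S.norm2 u) :=
        add_le_add (mul_le_mul (m₄ x hx) ((hA k ck x hx).trans (by gcongr)) (norm_nonneg _) hM₄)
          (mul_le_mul (m₃ x hx) ((hB k ck x hx).trans (by gcongr)) (norm_nonneg _) hM₃)
      _ = _ := by simp only [P₁]; ring
  have lg := lφ.mul S.lap_v
  have cφ := lφ.continuousOn
  have cφ₁ := lφ.continuousOn_deriv
  have bg : S.norm2 (fun x => φ x * S.v x) ≤ P * N₁ * sq * S.norm2 u := by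
    have := l2_le_of_norm_le hab (C := P * S.norm2 u * N₁) (by positivity)
      (f := fun x => φ x * S.v x) (by fun_prop) fun x hx => by
        rw [norm_mul]
        exact mul_le_mul (bφ x hx) (n₁ x hx) (norm_nonneg _) (by positivity)
    exact this.trans (le_of_eq (by ring))
  have bg₁ : ∀ x ∈ Icc S.a S.b, ‖φ₁ x * S.v x + φ x * S.D S.v x‖ ≤
      (P₁ * N₁ + P * N₂) * S.norm2 u := fun x hx => by
    refine (norm_add_le _ _).trans ?_
    rw [norm_mul, norm_mul]
    calc _ ≤ P₁ * S.norm2 u * N₁ + P * S.norm2 u * N₂ :=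
        add_le_add (mul_le_mul (bφ₁ x hx) (n₁ x hx) (norm_nonneg _) (by positivity))
          (mul_le_mul (bφ x hx) (n₂ x hx) (norm_nonneg _) (by positivity))
      _ = _ := by ring
  have bLg : S.norm2 (fun x => (S.q x * φ x + k x) * S.v x + 2 * (φ₁ x * S.D S.v x) +
      φ x * (S.L S.v x + (S.α : ℂ) ^ 2 * S.v x)) ≤
      (N₁ + (P * N₃ + 2 * (P₁ * N₂)) * sq) * S.norm2 u := by
    have h1 : S.norm2 (fun x => k x * S.v x) ≤ N₁ * S.norm2 k :=
      l2_le_mul hab hN₁ (by fun_prop) ck fun x hx => by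
        rw [norm_mul, mul_comm]; gcongr; exact n₁ x hx
    have h2 : S.norm2 (fun x => φ x * (S.q x * S.v x + S.L S.v x + (S.α : ℂ) ^ 2 * S.v x) +
        2 * (φ₁ x * S.D S.v x)) ≤ ((P * N₃ + 2 * (P₁ * N₂)) * S.norm2 u) * sq :=
      l2_le_of_norm_le hab (by positivity) (by fun_prop) fun x hx => by
        refine (norm_add_le _ _).trans ?_
        rw [norm_mul, norm_mul 2, norm_mul (φ₁ x), Complex.norm_two]
        calc _ ≤ P * S.norm2 u * N₃ + 2 * (P₁ * S.norm2 u * N₂) :=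
            add_le_add (mul_le_mul (bφ x hx) (n₃ x hx) (norm_nonneg _) (by positivity))
              (mul_le_mul_of_nonneg_left
                (mul_le_mul (bφ₁ x hx) (n₂ x hx) (norm_nonneg _) (by positivity)) (by norm_num))
          _ = _ := by ring
    have h3 := l2_add_le hab (f := fun x => k x * S.v x)
      (g := fun x => φ x * (S.q x * S.v x + S.L S.v x + (S.α : ℂ) ^ 2 * S.v x) +
        2 * (φ₁ x * S.D S.v x)) (by fun_prop) (by fun_prop)
    have h4 : (fun x => (S.q x * φ x + k x) * S.v x + 2 * (φ₁ x * S.D S.v x) +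
      φ x * (S.L S.v x + (S.α : ℂ) ^ 2 * S.v x)) = fun x => k x * S.v x +
        (φ x * (S.q x * S.v x + S.L S.v x + (S.α : ℂ) ^ 2 * S.v x) +
        2 * (φ₁ x * S.D S.v x)) := by ext x; ring
    rw [h4]
    calc _ ≤ _ := h3
      _ ≤ N₁ * S.norm2 u + ((P * N₃ + 2 * (P₁ * N₂)) * S.norm2 u) * sq :=
        add_le_add (h1.trans (by gcongr)) h2
      _ = _ := by ring
  have q1 : 0 ≤ P * N₁ * sq := by positivity
  have q2 : 0 ≤ P₁ * N₁ + P * N₂ := by positivity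
  have q3 : 0 ≤ N₁ + (P * N₃ + 2 * (P₁ * N₂)) * sq := by positivity
  have r1 : P * N₁ * sq * S.norm2 u ≤ K₀ * S.norm2 u :=
    mul_le_mul_of_nonneg_right (by simp only [K₀]; linarith) hn
  have r2 : (P₁ * N₁ + P * N₂) * S.norm2 u ≤ K₀ * S.norm2 u :=
    mul_le_mul_of_nonneg_right (by simp only [K₀]; linarith) hn
  have r3 : (N₁ + (P * N₃ + 2 * (P₁ * N₂)) * sq) * S.norm2 u ≤ K₀ * S.norm2 u :=
    mul_le_mul_of_nonneg_right (by simp only [K₀]; linarith) hn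
  have h := hC T c ε F (K₀ * S.norm2 u) φ _ _ _ _ _ hε hε1 hF lφ lg (fun x _ => rfl)
    (bg.trans r1) (bLg.trans r3) ((bg₁ _ (left_mem_Icc.2 hab)).trans r2)
    ((bg₁ _ (right_mem_Icc.2 hab)).trans r2)
  change ‖S.int (fun x => T.ψ x * (S.q x * φ x + k x - S.q x * φ x)) + Complex.I *
    (S.α : ℂ)⁻¹ * (ε : ℂ) ^ 2 * (φ S.b * S.v S.b * T.ρ S.b - φ S.a * S.v S.a * T.ρ S.a)‖ ≤ _ at h
  rw [hφ0, hφb] at h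
  simp only [zero_mul, sub_self, mul_zero, add_zero] at h
  have h5 : S.int (fun x => T.ψ x * (S.q x * φ x + k x - S.q x * φ x)) =
      ((S.norm2 u ^ 2 : ℝ) : ℂ) := by
    have e1 : S.int (fun x => T.ψ x * (S.q x * φ x + k x - S.q x * φ x)) =
        S.int (fun x => T.ψ x * k x) := by congr 1; ext x; ring
    rw [e1, hgi, ← S.integral_conj_mul_self]
    have e2 : ∫ x in S.a..S.b, T.ψ x * conj (u x) = (∫ x in S.a..S.b, conj (u x) * u x) +
        S.coord T.ψ * ∫ x in S.a..S.b, S.ψ₀ x * conj (u x) := by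
      rw [← intervalIntegral.integral_const_mul, ← intervalIntegral.integral_add]
      · congr 1; ext x; simp only [hu]; ring
      all_goals exact ContinuousOn.intervalIntegrable_Icc hab (by fun_prop)
    rw [e2, horth', mul_zero, add_zero]
  rw [h5, Complex.norm_real, Real.norm_eq_abs, abs_of_nonneg (by positivity)] at h
  rcases hn.eq_or_lt with h0 | h0
  · rw [← h0]
    exact mul_nonneg (by positivity) (S.err_nonneg T c hε.le hF.nonneg)
  · refine le_of_mul_le_mul_left ?_ h0
    calc S.norm2 u * S.norm2 u = S.norm2 u ^ 2 := by ring
      _ ≤ _ := h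
      _ = _ := by ring

end RayleighResonance

/-- Absorption of the small terms in the coupled estimates for the boundary and interior norms of
the vorticity. -/
theorem absorb_coupled {C μ X β γ w : ℝ} (hC : 1 ≤ C) (hμ : 0 ≤ μ) (hμC : 10 * C ^ 2 * μ ≤ 1)
    (hX : 0 ≤ X) (hγ : 0 ≤ γ) (hw : 0 ≤ w) (h1 : β ≤ C * (γ + μ * w + X))
    (h2 : γ ≤ C * (μ * β + μ * w + X)) (h3 : w ^ 2 ≤ C * (β * γ + X ^ 2)) :
    β + γ + w ≤ 40 * C ^ 2 * X := by
  have hC0 : 0 ≤ C := by linarith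
  have hCC : C ≤ C ^ 2 := by nlinarith
  have hCμ : C * μ ≤ 1 / 10 := by nlinarith
  have hC2μ : C ^ 2 * μ ≤ 1 / 10 := by linarith
  have a1 : γ ≤ 2 * C * (μ * w) + 2 * C * X := by
    have e1 : C * (μ * β) ≤ (C ^ 2 * μ) * (γ + μ * w + X) := by
      calc C * (μ * β) = (C * μ) * β := by ring
        _ ≤ (C * μ) * (C * (γ + μ * w + X)) := by gcongr
        _ = _ := by ring
    have e2 : (C ^ 2 * μ) * (γ + μ * w + X) ≤ 1 / 10 * (γ + μ * w + X) := by gcongr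
    have e3 : 0 ≤ μ * w := by positivity
    nlinarith
  have a2 : β ≤ 3 * C ^ 2 * (μ * w) + 3 * C ^ 2 * X := by
    have e1 : C * γ ≤ C * (2 * C * (μ * w) + 2 * C * X) := by gcongr
    have e3 : 0 ≤ μ * w := by positivity
    nlinarith
  have b1 : β * γ ≤ (3 * C ^ 2 * (μ * w) + 3 * C ^ 2 * X) * (2 * C * (μ * w) + 2 * C * X) := by
    have e3 : 0 ≤ μ * w := by positivity
    gcongr
  have b2 : w ^ 2 ≤ 12 * (C ^ 2 * μ) ^ 2 * w ^ 2 + 13 * (C ^ 2) ^ 2 * X ^ 2 := by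
    have e1 : C * (β * γ) ≤ 6 * (C ^ 2) ^ 2 * (μ * w + X) ^ 2 := by
      calc _ ≤ C * ((3 * C ^ 2 * (μ * w) + 3 * C ^ 2 * X) * (2 * C * (μ * w) + 2 * C * X)) := by
            gcongr
        _ = _ := by ring
    have e2 : (μ * w + X) ^ 2 ≤ 2 * (μ * w) ^ 2 + 2 * X ^ 2 := by nlinarith [sq_nonneg (μ * w - X)]
    have e3 : 6 * (C ^ 2) ^ 2 * (μ * w + X) ^ 2 ≤ 6 * (C ^ 2) ^ 2 * (2 * (μ * w) ^ 2 + 2 * X ^ 2) := by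
      gcongr
    have e4 : C * X ^ 2 ≤ (C ^ 2) ^ 2 * X ^ 2 := by
      gcongr
      nlinarith
    nlinarith
  have b3 : (C ^ 2 * μ) ^ 2 ≤ 1 / 100 := by
    have : 0 ≤ C ^ 2 * μ := by positivity
    nlinarith
  have b4 : w ^ 2 ≤ (10 * C ^ 2 * X) ^ 2 := by
    have : 12 * (C ^ 2 * μ) ^ 2 * w ^ 2 ≤ 12 * (1 / 100) * w ^ 2 := by gcongr
    have : 0 ≤ (C ^ 2) ^ 2 * X ^ 2 := by positivity
    nlinarith
  have b5 : w ≤ 10 * C ^ 2 * X := (abs_le_of_sq_le_sq' b4 (by positivity)).2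
  have d1 : 2 * C * (μ * w) ≤ w := by
    have : C * μ * w ≤ 1 / 10 * w := by gcongr
    linarith
  have d2 : 3 * C ^ 2 * (μ * w) ≤ w := by
    have : C ^ 2 * μ * w ≤ 1 / 10 * w := by gcongr
    linarith
  have d3 : C * X ≤ C ^ 2 * X := by gcongr
  have : 0 ≤ C ^ 2 * X := by positivity
  linarith

namespace RayleighResonance

variable (S : RayleighResonance)

/-- The exponent `κ` of a boundary layer `exp (κ (x - p) / ε)` decaying into the segment. -/
def IsLayerExponent (p : ℝ) (κ : ℂ) : Prop :=
  κ ^ 2 = Complex.I * S.α * (S.W p - S.c₁) ∧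
    ∃ k : ℝ, 0 < k ∧ ∀ x ∈ Icc S.a S.b, (κ * (x - p)).re ≤ -(k * |x - p|)

variable {S} in
theorem IsLayerExponent.ne_zero {p : ℝ} {κ : ℂ} (hp : p ∈ Icc S.a S.b)
    (h : S.IsLayerExponent p κ) : κ ≠ 0 := by
  rintro rfl
  have h1 := h.1
  have h2 : (S.α : ℂ) ≠ 0 := Complex.ofReal_ne_zero.2 S.hα.ne'
  have := mul_ne_zero (mul_ne_zero Complex.I_ne_zero h2) (S.W_sub_ne hp)
  rw [← h1] at this
  simp at this

theorem isLayerExponent_left {κ : ℂ} (h : κ ^ 2 = Complex.I * S.α * (S.W S.a - S.c₁))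
    (hre : κ.re < 0) : S.IsLayerExponent S.a κ := by
  refine ⟨h, -κ.re, by linarith, fun x hx => le_of_eq ?_⟩
  rw [← Complex.ofReal_sub, Complex.re_mul_ofReal, abs_of_nonneg (sub_nonneg.2 hx.1)]
  ring

theorem isLayerExponent_right {κ : ℂ} (h : κ ^ 2 = Complex.I * S.α * (S.W S.b - S.c₁))
    (hre : 0 < κ.re) : S.IsLayerExponent S.b κ := by
  refine ⟨h, κ.re, hre, fun x hx => le_of_eq ?_⟩
  rw [← Complex.ofReal_sub, Complex.re_mul_ofReal, abs_of_nonpos (sub_nonpos.2 hx.2)]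
  ring

theorem exists_sqrt_re_pos {z : ℂ} (hz : z ∈ Complex.slitPlane) : ∃ κ : ℂ, κ ^ 2 = z ∧ 0 < κ.re := by
  have h1 := Complex.mem_slitPlane_iff_arg.1 hz
  have h2 := Complex.neg_pi_lt_arg z
  have h3 := lt_of_le_of_ne (Complex.arg_le_pi z) h1.1
  have hcos : 0 < Real.cos (z.arg / 2) := Real.cos_pos_of_mem_Ioo ⟨by linarith, by linarith⟩
  have him : (Complex.log z / 2).im = z.arg / 2 := by
    have : (2 : ℂ) = ((2 : ℝ) : ℂ) := by norm_num
    rw [this, Complex.div_ofReal_im, Complex.log_im]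
  refine ⟨Complex.exp (Complex.log z / 2), ?_, ?_⟩
  · rw [← Complex.exp_nat_mul]
    push_cast
    rw [mul_div_cancel₀ _ two_ne_zero, Complex.exp_log h1.2]
  · rw [Complex.exp_re, him]; positivity

theorem exists_layer_exponents : ∃ κa κb : ℂ,
    κa ^ 2 = Complex.I * S.α * (S.W S.a - S.c₁) ∧ κa.re < 0 ∧
    κb ^ 2 = Complex.I * S.α * (S.W S.b - S.c₁) ∧ 0 < κb.re := by
  have h : ∀ p, p = S.a ∨ p = S.b → Complex.I * S.α * (S.W p - S.c₁) ∈ Complex.slitPlane := by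
    intro p hp
    have h1 := S.slit p (S.endpoint_mem hp)
    rwa [(S.speed_eq_one_near hp).eq_of_nhds, one_pow, one_mul] at h1
  obtain ⟨κa, h1, h2⟩ := exists_sqrt_re_pos (h S.a (Or.inl rfl))
  obtain ⟨κb, h3, h4⟩ := exists_sqrt_re_pos (h S.b (Or.inr rfl))
  exact ⟨-κa, κb, by rw [neg_sq, h1], by simpa using h2, h3, h4⟩

/-- The norm in which states are controlled uniformly in `ε`. -/
def State.N {S : RayleighResonance} (T : S.State) (ε : ℝ) : ℝ := T.n + T.β ε + T.w ε + T.γ ε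

theorem State.N_nonneg {S : RayleighResonance} (T : S.State) {ε : ℝ} (hε : 0 ≤ ε) : 0 ≤ T.N ε :=
  add_nonneg (add_nonneg (add_nonneg T.n_nonneg (T.β_nonneg hε)) (T.w_nonneg ε)) (T.γ_nonneg ε)

variable {S} in
/-- The value `ε Ω(p)` is controlled by `ε² ∂Ω(p)`. -/
theorem exists_β_le_at {p : ℝ} (hp : p = S.a ∨ p = S.b) {κ : ℂ} (hκ : S.IsLayerExponent p κ) :
    ∃ C, 0 ≤ C ∧ ∀ (T : S.State) (c : ℂ) (ε F : ℝ), 0 < ε → ε ≤ 1 →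
      S.ForcingBound ε F (T.op c ε) →
      ε * ‖T.Ω p‖ ≤ C * (ε ^ 2 * ‖T.ρ p‖ + (ε + ‖c - S.c₁‖) * T.w ε + (T.n + F)) := by
  obtain ⟨hκ2, k, hk, hκk⟩ := id hκ
  obtain ⟨C, hC0, hC⟩ := S.robin_estimate hp hk hκ2 hκk
  have hκ0 := norm_pos_iff.2 (hκ.ne_zero (S.endpoint_mem hp))
  refine ⟨‖κ‖⁻¹ * (1 + C), by positivity, fun T c ε F hε hε1 hF => ?_⟩
  have h := hC T c ε hε hε1
  have hn := T.n_nonneg; have hw := T.w_nonneg ε; have hF0 := hF.nonneg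
  have h1 : ‖κ * (ε * T.Ω p)‖ ≤ ‖(ε : ℂ) ^ 2 * T.ρ p‖ +
      ‖(ε : ℂ) ^ 2 * T.ρ p - κ * (ε * T.Ω p)‖ := norm_le_norm_add_norm_sub _ _
  rw [norm_mul, norm_mul, norm_mul, norm_pow, Complex.norm_real, Real.norm_eq_abs,
    abs_of_pos hε] at h1
  have h2 : C * (√ε * S.norm2 (T.op c ε) + (ε + ‖c - S.c₁‖) * T.w ε + ε * T.n) ≤
      C * (ε ^ 2 * ‖T.ρ p‖ + (ε + ‖c - S.c₁‖) * T.w ε + (T.n + F)) := by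
    have := hF.l2_le
    have : ε * T.n ≤ 1 * T.n := by gcongr
    have : 0 ≤ ε ^ 2 * ‖T.ρ p‖ := by positivity
    gcongr ?_ * ?_
    linarith
  have h3 : 0 ≤ (ε + ‖c - S.c₁‖) * T.w ε + (T.n + F) := by positivity
  have h4 : ‖κ‖ * (ε * ‖T.Ω p‖) ≤
      (1 + C) * (ε ^ 2 * ‖T.ρ p‖ + (ε + ‖c - S.c₁‖) * T.w ε + (T.n + F)) := by linarith
  calc ε * ‖T.Ω p‖ = ‖κ‖⁻¹ * (‖κ‖ * (ε * ‖T.Ω p‖)) := by field_simp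
    _ ≤ ‖κ‖⁻¹ * ((1 + C) * (ε ^ 2 * ‖T.ρ p‖ + (ε + ‖c - S.c₁‖) * T.w ε + (T.n + F))) := by gcongr
    _ = _ := by ring

/-- The value `ε² ∂Ω(p)` is controlled by `ψ`. -/
theorem exists_γ_le_at {p : ℝ} (hp : p = S.a ∨ p = S.b) :
    ∃ C, 0 ≤ C ∧ ∀ (T : S.State) (c : ℂ) (ε F : ℝ), 0 < ε → ε ≤ 1 →
      S.ForcingBound ε F (T.op c ε) → ε ^ 2 * ‖T.ρ p‖ ≤ C * (T.n + S.err T c ε F) := by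
  obtain ⟨r, cr, -, C, hC0, hC⟩ := S.slow_estimate hp
  obtain ⟨A, hA0, hA⟩ := exists_norm_graphIntegral_mul_le S.hab.le S.hm
  have hv : S.v p ≠ 0 := inv_ne_zero (S.W_sub_ne (S.endpoint_mem hp))
  have hv0 := norm_pos_iff.2 hv
  have hα := S.hα
  have hr : 0 ≤ S.norm2 r := l2_nonneg _
  refine ⟨S.α * ‖S.v p‖⁻¹ * (A * S.norm2 r + C), by positivity, fun T c ε F hε hε1 hF => ?_⟩
  have h := hC T c ε F hε hε1 hF
  have hn := T.n_nonneg
  have he := S.err_nonneg T c hε.le hF.nonneg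
  have h1 := norm_le_norm_add_norm_sub (S.int (fun x => T.ψ x * r x))
    (Complex.I * (S.α : ℂ)⁻¹ * (ε : ℂ) ^ 2 * (S.v p * T.ρ p))
  rw [norm_sub_rev] at h1
  have h2 := hA _ _ T.lap.continuousOn cr
  have h3 : ‖Complex.I * (S.α : ℂ)⁻¹ * (ε : ℂ) ^ 2 * (S.v p * T.ρ p)‖ =
      S.α⁻¹ * ‖S.v p‖ * (ε ^ 2 * ‖T.ρ p‖) := by
    simp [abs_of_pos hα]; ring
  have h4 : S.α⁻¹ * ‖S.v p‖ * (ε ^ 2 * ‖T.ρ p‖) ≤ (A * S.norm2 r + C) * (T.n + S.err T c ε F) := by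
    rw [← h3]
    have e2 : ‖S.int (fun x => T.ψ x * r x)‖ ≤ A * (T.n * S.norm2 r) := h2
    have e3 : 0 ≤ C * T.n := by positivity
    have e4 : 0 ≤ A * S.norm2 r * S.err T c ε F := by positivity
    linarith
  calc ε ^ 2 * ‖T.ρ p‖ = S.α * ‖S.v p‖⁻¹ * (S.α⁻¹ * ‖S.v p‖ * (ε ^ 2 * ‖T.ρ p‖)) := by field_simp
    _ ≤ S.α * ‖S.v p‖⁻¹ * ((A * S.norm2 r + C) * (T.n + S.err T c ε F)) := by gcongr
    _ = _ := by ring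

set_option maxHeartbeats 800000 in
/-- The a priori estimate: states are controlled by their coefficient along `ψ₀` and by the size
of `P_{c,ε} ψ`, uniformly for `c` near `c₁` and `ε` near zero. -/
theorem apriori_estimate : ∃ C μ₀, 0 ≤ C ∧ 0 < μ₀ ∧ μ₀ ≤ 1 ∧ ∀ (T : S.State) (c : ℂ) (ε F : ℝ),
    ‖c - S.c₁‖ ≤ μ₀ → 0 < ε → ε ≤ μ₀ → S.ForcingBound ε F (T.op c ε) →
    T.N ε ≤ C * (‖S.coord T.ψ‖ + F) := by
  obtain ⟨κa, κb, ha, ha', hb, hb'⟩ := S.exists_layer_exponents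
  obtain ⟨Ca, hCa0, hCa⟩ := exists_β_le_at (Or.inl rfl) (S.isLayerExponent_left ha ha')
  obtain ⟨Cb, hCb0, hCb⟩ := exists_β_le_at (Or.inr rfl) (S.isLayerExponent_right hb hb')
  obtain ⟨Ga, hGa0, hGa⟩ := S.exists_γ_le_at (Or.inl rfl)
  obtain ⟨Gb, hGb0, hGb⟩ := S.exists_γ_le_at (Or.inr rfl)
  obtain ⟨E, ν, ε₀, hE0, hν, hε₀, hE⟩ := S.energy_estimate
  obtain ⟨Dd, hD0, hD⟩ := S.dual_estimate
  set C := 1 + 2 * (Ca + Cb) + 2 * (Ga + Gb) + E with hCdef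
  have hC1 : 1 ≤ C := by linarith
  have hC0 : 0 ≤ C := by linarith
  set n₀ := S.norm2 S.ψ₀
  have hn₀ : 0 ≤ n₀ := l2_nonneg _
  set K := 40 * C ^ 2 with hK
  have hK0 : 0 ≤ K := by positivity
  obtain ⟨μ₀, hμ₀, hμν, hμε, hμ1, hμC, hμD⟩ : ∃ μ₀ : ℝ, 0 < μ₀ ∧ μ₀ ≤ ν ∧ μ₀ ≤ ε₀ ∧ μ₀ ≤ 1 ∧
      10 * C ^ 2 * (2 * μ₀) ≤ 1 ∧ Dd * (K + 1) * (2 * μ₀) ≤ 1 / 2 := by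
    refine ⟨min (min ν ε₀) (min 1 (min (1 / (20 * C ^ 2)) (1 / (4 * (Dd * (K + 1) + 1))))),
      by positivity, (min_le_left _ _).trans (min_le_left _ _),
      (min_le_left _ _).trans (min_le_right _ _), (min_le_right _ _).trans (min_le_left _ _),
      ?_, ?_⟩
    · have : min (min ν ε₀) (min 1 (min (1 / (20 * C ^ 2)) (1 / (4 * (Dd * (K + 1) + 1))))) ≤
        1 / (20 * C ^ 2) :=
        (min_le_right _ _).trans ((min_le_right _ _).trans (min_le_left _ _))
      rw [le_div_iff₀ (by positivity)] at this
      linarith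
    · have h0 : min (min ν ε₀) (min 1 (min (1 / (20 * C ^ 2)) (1 / (4 * (Dd * (K + 1) + 1))))) ≤
        1 / (4 * (Dd * (K + 1) + 1)) :=
        (min_le_right _ _).trans ((min_le_right _ _).trans (min_le_right _ _))
      rw [le_div_iff₀ (by positivity)] at h0
      have : 0 < min (min ν ε₀) (min 1 (min (1 / (20 * C ^ 2)) (1 / (4 * (Dd * (K + 1) + 1))))) := by
        positivity
      linarith
  refine ⟨(1 + K) * (2 * (Dd + n₀ + 1) + 2), μ₀, by positivity, hμ₀, hμ1,
    fun T c ε F hc hε hεμ hF => ?_⟩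
  have hε1 : ε ≤ 1 := hεμ.trans hμ1
  have hn := T.n_nonneg; have hw := T.w_nonneg ε; have hβ := T.β_nonneg hε.le
  have hγ := T.γ_nonneg ε; have hF0 := hF.nonneg
  have hcn := norm_nonneg (c - S.c₁)
  set μ := ε + ‖c - S.c₁‖ with hμ
  have hμ0 : 0 ≤ μ := by positivity
  have hμ2 : μ ≤ 2 * μ₀ := by linarith
  have hεμ' : ε ≤ μ := by linarith
  set X := T.n + F
  have hX : 0 ≤ X := by positivity
  have b1 : T.β ε ≤ C * (T.γ ε + μ * T.w ε + X) := by
    have h1 := hCa T c ε F hε hε1 hF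
    have h2 := hCb T c ε F hε hε1 hF
    have e1 : ε ^ 2 * ‖T.ρ S.a‖ ≤ T.γ ε := by
      unfold State.γ; gcongr; linarith [norm_nonneg (T.ρ S.b)]
    have e2 : ε ^ 2 * ‖T.ρ S.b‖ ≤ T.γ ε := by
      unfold State.γ; gcongr; linarith [norm_nonneg (T.ρ S.a)]
    have e3 : T.β ε = ε * ‖T.Ω S.a‖ + ε * ‖T.Ω S.b‖ := by unfold State.β; ring
    have e4 : 0 ≤ T.γ ε + μ * T.w ε + X := by positivity
    calc T.β ε ≤ Ca * (T.γ ε + μ * T.w ε + X) + Cb * (T.γ ε + μ * T.w ε + X) := by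
          rw [e3]
          exact add_le_add (h1.trans (by gcongr)) (h2.trans (by gcongr))
      _ = (Ca + Cb) * (T.γ ε + μ * T.w ε + X) := by ring
      _ ≤ _ := mul_le_mul_of_nonneg_right (by linarith) e4
  have herr : T.n + S.err T c ε F ≤ μ * T.β ε + μ * T.w ε + 2 * X := by
    have e1 : ε * T.β ε ≤ μ * T.β ε := by gcongr
    have e2 : ε * T.w ε ≤ μ * T.w ε := by gcongr
    have e3 : ‖c - S.c₁‖ * T.n ≤ 1 * T.n := by gcongr; linarith
    unfold err; simp only [X]; linarith
  have b2 : T.γ ε ≤ C * (μ * T.β ε + μ * T.w ε + X) := by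
    have h1 := hGa T c ε F hε hε1 hF
    have h2 := hGb T c ε F hε hε1 hF
    have e3 : T.γ ε = ε ^ 2 * ‖T.ρ S.a‖ + ε ^ 2 * ‖T.ρ S.b‖ := by unfold State.γ; ring
    have e4 : 0 ≤ μ * T.β ε + μ * T.w ε := by positivity
    calc T.γ ε ≤ Ga * (μ * T.β ε + μ * T.w ε + 2 * X) + Gb * (μ * T.β ε + μ * T.w ε + 2 * X) := by
          rw [e3]
          exact add_le_add (h1.trans (by gcongr)) (h2.trans (by gcongr))
      _ = (Ga + Gb) * (μ * T.β ε + μ * T.w ε + 2 * X) := by ring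
      _ ≤ (Ga + Gb) * (2 * (μ * T.β ε + μ * T.w ε + X)) := by gcongr; linarith
      _ = (2 * (Ga + Gb)) * (μ * T.β ε + μ * T.w ε + X) := by ring
      _ ≤ _ := mul_le_mul_of_nonneg_right (by linarith) (by positivity)
  have b3 : T.w ε ^ 2 ≤ C * (T.β ε * T.γ ε + X ^ 2) := by
    have h1 := hE T c ε (hc.trans hμν) hε (hεμ.trans hμε)
    have h2 : ε * S.norm2 (T.op c ε) ^ 2 ≤ F ^ 2 := by
      have h3 := hF.l2_le
      have h4 : 0 ≤ √ε * S.norm2 (T.op c ε) := mul_nonneg (Real.sqrt_nonneg _) (l2_nonneg _)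
      calc _ = (√ε * S.norm2 (T.op c ε)) ^ 2 := by rw [mul_pow, Real.sq_sqrt hε.le]
        _ ≤ _ := by gcongr
    have h3 : ε * T.n ^ 2 ≤ 1 * T.n ^ 2 := by gcongr
    have h4 : F ^ 2 + T.n ^ 2 ≤ X ^ 2 := by
      have e : X ^ 2 = F ^ 2 + T.n ^ 2 + 2 * (T.n * F) := by simp only [X]; ring
      linarith only [e, mul_nonneg hn hF0]
    calc _ ≤ _ := h1
      _ ≤ E * (T.β ε * T.γ ε + X ^ 2) :=
        mul_le_mul_of_nonneg_left (by linarith only [h2, h3, h4]) hE0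
      _ ≤ _ := mul_le_mul_of_nonneg_right (by linarith only [hCdef, hCa0, hCb0, hGa0, hGb0])
        (by positivity)
  have hμC' : 10 * C ^ 2 * μ ≤ 1 := (mul_le_mul_of_nonneg_left hμ2 (by positivity)).trans hμC
  have key := absorb_coupled hC1 hμ0 hμC' hX hγ hw b1 b2 b3
  have hdual := hD T c ε F hε hε1 hF
  have c1 := T.lap.continuousOn
  have hn1 : T.n ≤ S.norm2 (fun x => T.ψ x - S.coord T.ψ * S.ψ₀ x) + ‖S.coord T.ψ‖ * n₀ := by
    have h1 := l2_add_le S.hab.le (f := fun x => T.ψ x - S.coord T.ψ * S.ψ₀ x)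
      (g := fun x => S.coord T.ψ * S.ψ₀ x)
      (by have := S.hψ₀.continuousOn; fun_prop) (by have := S.hψ₀.continuousOn; fun_prop)
    rw [l2_const_mul] at h1
    simpa [State.n] using h1
  have herr2 : S.err T c ε F ≤ F + μ * ((K + 1) * X) := by
    have e1 : ε * T.β ε + ε * T.w ε ≤ μ * (K * X) := by
      rw [← mul_add]; gcongr; linarith
    have e2 : ‖c - S.c₁‖ * T.n ≤ μ * X := by
      gcongr
      · linarith
      · simp only [X]; linarith
    unfold err; linarith
  have hsmall : Dd * (μ * ((K + 1) * X)) ≤ 1 / 2 * X := by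
    have : Dd * (K + 1) * μ ≤ 1 / 2 :=
      (mul_le_mul_of_nonneg_left hμ2 (show 0 ≤ Dd * (K + 1) by positivity)).trans hμD
    calc _ = Dd * (K + 1) * μ * X := by ring
      _ ≤ _ := by gcongr
  have hℓ := norm_nonneg (S.coord T.ψ)
  have hn2 : X ≤ (2 * (Dd + n₀ + 1)) * (‖S.coord T.ψ‖ + F) := by
    have e1 : Dd * S.err T c ε F ≤ Dd * (F + μ * ((K + 1) * X)) := by gcongr
    have e2 : 0 ≤ Dd * ‖S.coord T.ψ‖ := by positivity
    have e3 : 0 ≤ n₀ * F := by positivity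
    have e4 : X = T.n + F := rfl
    linarith only [e1, e2, e3, e4, hn1, hdual, hsmall, hℓ]
  have hXK : T.N ε ≤ (1 + K) * X := by
    have : T.n ≤ X := by simp only [X]; linarith
    unfold State.N
    linarith only [this, key]
  calc _ ≤ _ := hXK
    _ ≤ (1 + K) * ((2 * (Dd + n₀ + 1)) * (‖S.coord T.ψ‖ + F)) := by gcongr
    _ ≤ _ := by
      have : 0 ≤ (1 + K) * (2 * (‖S.coord T.ψ‖ + F)) := by positivity
      linarith only [this]

end RayleighResonance

/-! ### The reduced equation for the eigenvalue -/

namespace RayleighResonance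

variable (S : RayleighResonance)

/-- The adjoint resonant state `ψ₀ / (W - c₁)`. -/
def g₀ : ℝ → ℂ := fun x => S.ψ₀ x * S.v x

theorem contDiffOn_g₀ : ContDiffOn ℝ ∞ S.g₀ (Icc S.a S.b) := S.hψ₀.mul S.contDiffOn_v

theorem lap_g₀ : S.Lap S.g₀ (S.D S.g₀) (S.L S.g₀) := S.lap_of_contDiffOn S.contDiffOn_g₀

theorem contDiffOn_L_g₀ : ContDiffOn ℝ ∞ (S.L S.g₀) (Icc S.a S.b) :=
  contDiffOn_curveLaplace S.hab S.hm S.contDiffOn_g₀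

theorem g₀_endpoint {p : ℝ} (hp : p = S.a ∨ p = S.b) : S.g₀ p = 0 := by
  rcases hp with rfl | rfl
  · simp [g₀, S.bc.1]
  · simp [g₀, S.bc.2]

theorem D_g₀_endpoint {p : ℝ} (hp : p = S.a ∨ p = S.b) : S.D S.g₀ p = S.D S.ψ₀ p * S.v p := by
  have h := (S.lap_ψ₀.mul S.lap_v).curveDeriv_eq S.hab (S.endpoint_mem hp)
  have h0 : S.ψ₀ p = 0 := by
    rcases hp with rfl | rfl
    exacts [S.bc.1, S.bc.2]
  rw [h0, zero_mul, add_zero] at h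
  exact h

/-- The pairing `∫ ψ₀ (∂² - α²)ψ₀ / (W - c₁) dz`, the slope of the reduced equation. -/
def pairing : ℂ := graphIntegral S.a S.b S.m
  (fun x => S.ψ₀ x * (curveLaplace S.a S.b S.m S.α S.ψ₀ x / (S.W x - S.c₁)))

theorem int_ψ₀_mul_L_g₀ : S.int (fun x => S.ψ₀ x * S.L S.g₀ x) = S.pairing := by
  have h := S.lap_ψ₀.green S.hab.le S.hm S.lap_g₀
  rw [S.g₀_endpoint (Or.inl rfl), S.g₀_endpoint (Or.inr rfl), S.bc.1, S.bc.2] at h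
  rw [int, h, pairing]
  simp only [zero_mul, mul_zero, sub_zero, add_zero]
  refine graphIntegral_congr S.hab.le fun x _ => ?_
  simp only [g₀, v]; ring

theorem exists_pairing_eq_one : ∃ h : ℝ → ℂ, ContinuousOn h (Icc S.a S.b) ∧
    S.int (fun x => S.g₀ x * h x) = 1 := by
  have c1 := S.contDiffOn_g₀.continuousOn
  have c2 := S.contDiffOn_speed.continuousOn
  have hpos : S.norm2 S.g₀ ≠ 0 := fun h => by
    obtain ⟨x, hx, hne⟩ := S.ne_zero
    have := eqOn_zero_of_l2_eq_zero S.hab c1 h x hx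
    exact (mul_ne_zero hne (inv_ne_zero (S.W_sub_ne hx))) this
  have hpos' : ((S.norm2 S.g₀ ^ 2 : ℝ) : ℂ) ≠ 0 := by exact_mod_cast pow_ne_zero 2 hpos
  refine ⟨fun x => ((S.norm2 S.g₀ ^ 2 : ℝ) : ℂ)⁻¹ * ((speed S.m x)⁻¹ * conj (S.g₀ x)),
    continuousOn_const.mul ((c2.inv₀ fun x _ => speed_ne_zero S.m x).mul
      (Complex.continuous_conj.comp_continuousOn c1)), ?_⟩
  have h1 := S.integral_conj_mul_self S.g₀
  refine Eq.trans ?_ (inv_mul_cancel₀ hpos')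
  conv_rhs => rw [← h1, ← intervalIntegral.integral_const_mul, h1]
  unfold int graphIntegral
  congr 1; ext x
  have := speed_ne_zero S.m x
  have e : (1 + Complex.I * ((deriv S.m x : ℝ) : ℂ)) = speed S.m x := rfl
  rw [e]
  field_simp

/-- Pairing `P_{c,ε} ψ` with `ψ₀ / (W - c₁)`. -/
theorem pairing_identity (T : S.State) (c : ℂ) (ε : ℝ) :
    S.int (fun x => S.g₀ x * T.op c ε x) =
      Complex.I * (S.α : ℂ)⁻¹ * (ε : ℂ) ^ 2 * (S.D S.ψ₀ S.a * S.v S.a * T.Ω S.a -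
        S.D S.ψ₀ S.b * S.v S.b * T.Ω S.b + S.int (fun x => T.ψ x * S.L (S.L S.g₀) x)) -
      (c - S.c₁) * S.int (fun x => T.ψ x * S.L S.g₀ x) := by
  have h := T.int_test c ε S.lap_ψ₀ S.lap_g₀ (fun x _ => rfl)
  have h1 : S.int (fun x => T.ψ x * (S.L S.ψ₀ x - S.W₂ x * S.v x * S.ψ₀ x)) = 0 := by
    rw [int, graphIntegral_congr S.hab.le (g := fun _ => 0) fun x hx => ?_]
    · simp [graphIntegral]
    · simp only [S.L_ψ₀_eq x hx, q]; ring
  rw [h, h1, T.int_mul_Ω (S.lap_of_contDiffOn S.contDiffOn_L_g₀), S.g₀_endpoint (Or.inl rfl),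
    S.g₀_endpoint (Or.inr rfl), S.D_g₀_endpoint (Or.inl rfl), S.D_g₀_endpoint (Or.inr rfl)]
  ring

theorem int_g₀_Ω (T : S.State) : S.int (fun x => S.g₀ x * T.Ω x) =
    S.int (fun x => T.ψ x * S.L S.g₀ x) := T.int_mul_Ω S.lap_g₀

theorem exists_norm_int_mul_le {r : ℝ → ℂ} (hr : ContinuousOn r (Icc S.a S.b)) :
    ∃ C, 0 ≤ C ∧ ∀ f : ℝ → ℂ, ContinuousOn f (Icc S.a S.b) →
      ‖S.int (fun x => f x * r x)‖ ≤ C * S.norm2 f := by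
  obtain ⟨A, hA0, hA⟩ := exists_norm_graphIntegral_mul_le S.hab.le S.hm
  have : 0 ≤ S.norm2 r := l2_nonneg _
  exact ⟨A * S.norm2 r, by positivity, fun f hf => (hA f r hf hr).trans (le_of_eq (by ring))⟩

theorem State.n_le_N {S : RayleighResonance} (T : S.State) {ε : ℝ} (hε : 0 ≤ ε) : T.n ≤ T.N ε := by
  have := T.β_nonneg hε; have := T.w_nonneg ε; have := T.γ_nonneg ε
  unfold State.N; linarith

theorem State.β_le_N {S : RayleighResonance} (T : S.State) {ε : ℝ} : T.β ε ≤ T.N ε := by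
  have := T.n_nonneg; have := T.w_nonneg ε; have := T.γ_nonneg ε
  unfold State.N; linarith

theorem State.w_le_N {S : RayleighResonance} (T : S.State) {ε : ℝ} (hε : 0 ≤ ε) : T.w ε ≤ T.N ε := by
  have := T.n_nonneg; have := T.β_nonneg hε; have := T.γ_nonneg ε
  unfold State.N; linarith

theorem err_le (T : S.State) (c : ℂ) {ε F : ℝ} (hε : 0 ≤ ε) :
    S.err T c ε F ≤ F + (ε + ‖c - S.c₁‖) * T.N ε := by
  have h1 := T.γ_nonneg ε
  have h2 : ‖c - S.c₁‖ * T.n ≤ ‖c - S.c₁‖ * T.N ε :=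
    mul_le_mul_of_nonneg_left (T.n_le_N hε) (norm_nonneg _)
  have h3 : ε * (T.β ε + T.w ε) ≤ ε * T.N ε := by
    have := T.n_nonneg
    refine mul_le_mul_of_nonneg_left ?_ hε
    unfold State.N; linarith
  unfold err; linarith

/-- Multiples of a fixed function and of the vorticity of another state are admissible as
right-hand sides. -/
theorem exists_forcingBound {h : ℝ → ℂ} (hh : ContinuousOn h (Icc S.a S.b)) :
    ∃ C, 0 ≤ C ∧ ∀ (T' : S.State) (θ k : ℂ) (ε : ℝ) (f : ℝ → ℂ), 0 < ε → ε ≤ 1 →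
      (∀ x ∈ Icc S.a S.b, f x = θ * h x + k * T'.Ω x) →
      S.ForcingBound ε (C * (‖θ‖ + ‖k‖ * T'.N ε)) f := by
  obtain ⟨A, hA0, hA⟩ := exists_norm_graphIntegral_mul_le S.hab.le S.hm
  have hh0 : 0 ≤ S.norm2 h := l2_nonneg _
  refine ⟨(1 + A) * (1 + S.norm2 h), by positivity, fun T' θ k ε f hε hε1 hf => ?_⟩
  have c1 := T'.lap.cont
  have hN := T'.N_nonneg hε.le
  have hC : 0 ≤ (1 + A) * (1 + S.norm2 h) * (‖θ‖ + ‖k‖ * T'.N ε) := by positivity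
  refine ⟨hC, ?_, fun g g₁ Lg hg => ?_⟩
  · have e1 : S.norm2 f = S.norm2 (fun x => θ * h x + k * T'.Ω x) := by
      unfold norm2 l2
      congr 1
      refine intervalIntegral.integral_congr fun x hx => ?_
      rw [uIcc_of_le S.hab.le] at hx
      simp only [hf x hx]
    have e2 := l2_add_le S.hab.le (f := fun x => θ * h x) (g := fun x => k * T'.Ω x)
      (by fun_prop) (by fun_prop)
    rw [l2_const_mul, l2_const_mul] at e2
    have e3 : √ε ≤ 1 := Real.sqrt_le_one.2 hε1
    have e4 := T'.w_le_N hε.le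
    calc √ε * S.norm2 f ≤ √ε * (‖θ‖ * S.norm2 h + ‖k‖ * S.norm2 T'.Ω) := by
          rw [e1]; gcongr
      _ = √ε * (‖θ‖ * S.norm2 h) + ‖k‖ * T'.w ε := by unfold State.w; ring
      _ ≤ 1 * (‖θ‖ * S.norm2 h) + ‖k‖ * T'.N ε := by gcongr
      _ ≤ (1 + A) * (1 + S.norm2 h) * (‖θ‖ + ‖k‖ * T'.N ε) := by
        have p1 : 0 ≤ (1 + A * (1 + S.norm2 h)) * ‖θ‖ := by positivity
        have p2 : 0 ≤ (A + S.norm2 h + A * S.norm2 h) * (‖k‖ * T'.N ε) := by positivity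
        linarith
  · have c2 := hg.continuousOn
    have e1 : S.int (fun x => g x * f x) = θ * S.int (fun x => g x * h x) +
        k * S.int (fun x => T'.ψ x * Lg x) := by
      rw [← T'.int_mul_Ω hg, int, int, int, ← graphIntegral_const_mul, ← graphIntegral_const_mul,
        ← graphIntegral_add S.hab.le S.hm]
      · refine graphIntegral_congr S.hab.le fun x hx => ?_
        simp only [hf x hx]; ring
      all_goals fun_prop
    have e2 := hA g h c2 hh
    have e3 := hA T'.ψ Lg T'.lap.continuousOn hg.cont
    have e4 : l2 S.a S.b T'.ψ ≤ T'.N ε := T'.n_le_N hε.le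
    have hg0 : 0 ≤ S.norm2 g := l2_nonneg _
    have hLg0 : 0 ≤ S.norm2 Lg := l2_nonneg _
    rw [e1]
    calc _ ≤ ‖θ‖ * (A * (S.norm2 g * S.norm2 h)) + ‖k‖ * (A * (T'.N ε * S.norm2 Lg)) := by
          refine (norm_add_le _ _).trans ?_
          rw [norm_mul, norm_mul]
          refine add_le_add (by gcongr) (mul_le_mul_of_nonneg_left (e3.trans ?_) (norm_nonneg _))
          gcongr
      _ ≤ _ := by
        have p1 : 0 ≤ ‖θ‖ * S.norm2 g * (1 + A + S.norm2 h) := by positivity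
        have p2 : 0 ≤ ‖θ‖ * S.norm2 Lg * ((1 + A) * (1 + S.norm2 h)) := by positivity
        have p3 : 0 ≤ ‖k‖ * T'.N ε * S.norm2 Lg * (1 + S.norm2 h + A * S.norm2 h) := by positivity
        have p4 : 0 ≤ ‖k‖ * T'.N ε * S.norm2 g * ((1 + A) * (1 + S.norm2 h)) := by positivity
        linarith

/-- The right-hand side of the equation for `ψ` is almost orthogonal to `ψ₀ / (W - c₁)`, which the
adjoint of the Rayleigh operator at `c₁` annihilates. -/
theorem exists_pairing_le : ∃ C, 0 ≤ C ∧ ∀ (T : S.State) (c : ℂ) (ε : ℝ), 0 < ε → ε ≤ 1 →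
    ‖S.int (fun x => S.g₀ x * T.op c ε x)‖ ≤ C * ((ε + ‖c - S.c₁‖) * T.N ε) := by
  obtain ⟨A, hA0, hA⟩ := S.exists_norm_int_mul_le
    (contDiffOn_curveLaplace (α := S.α) S.hab S.hm S.contDiffOn_L_g₀).continuousOn
  obtain ⟨B, hB0, hB⟩ := S.exists_norm_int_mul_le S.contDiffOn_L_g₀.continuousOn
  have hα := S.hα
  set M := ‖S.D S.ψ₀ S.a * S.v S.a‖ + ‖S.D S.ψ₀ S.b * S.v S.b‖
  have hM : 0 ≤ M := by positivity
  refine ⟨S.α⁻¹ * (M + A) + B, by positivity, fun T c ε hε hε1 => ?_⟩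
  have hN := T.N_nonneg hε.le
  have h1 : ‖S.int (fun x => T.ψ x * S.L (S.L S.g₀) x)‖ ≤ A * T.N ε :=
    (hA _ T.lap.continuousOn).trans (mul_le_mul_of_nonneg_left (T.n_le_N hε.le) hA0)
  have h2 : ‖S.int (fun x => T.ψ x * S.L S.g₀ x)‖ ≤ B * T.N ε :=
    (hB _ T.lap.continuousOn).trans (mul_le_mul_of_nonneg_left (T.n_le_N hε.le) hB0)
  have h3 : ‖S.D S.ψ₀ S.a * S.v S.a * T.Ω S.a - S.D S.ψ₀ S.b * S.v S.b * T.Ω S.b‖ ≤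
      M * (‖T.Ω S.a‖ + ‖T.Ω S.b‖) := by
    refine (norm_sub_le _ _).trans ?_
    rw [norm_mul _ (T.Ω S.a), norm_mul _ (T.Ω S.b)]
    have p1 : 0 ≤ ‖S.D S.ψ₀ S.a * S.v S.a‖ * ‖T.Ω S.b‖ := by positivity
    have p2 : 0 ≤ ‖S.D S.ψ₀ S.b * S.v S.b‖ * ‖T.Ω S.a‖ := by positivity
    simp only [M]; linarith
  have nI : ‖Complex.I * (S.α : ℂ)⁻¹ * (ε : ℂ) ^ 2‖ = S.α⁻¹ * ε ^ 2 := by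
    simp [abs_of_pos hα]
  rw [S.pairing_identity]
  have hβ := T.β_le_N (ε := ε)
  calc _ ≤ S.α⁻¹ * ε ^ 2 * (M * (‖T.Ω S.a‖ + ‖T.Ω S.b‖) + A * T.N ε) +
        ‖c - S.c₁‖ * (B * T.N ε) := by
        refine (norm_sub_le _ _).trans ?_
        rw [norm_mul, norm_mul (c - S.c₁), nI]
        gcongr
        exact (norm_add_le _ _).trans (add_le_add h3 h1)
    _ = S.α⁻¹ * M * ε * T.β ε + S.α⁻¹ * A * ε ^ 2 * T.N ε + B * ‖c - S.c₁‖ * T.N ε := by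
        unfold State.β; ring
    _ ≤ S.α⁻¹ * M * ε * T.N ε + S.α⁻¹ * A * ε * T.N ε + B * ‖c - S.c₁‖ * T.N ε := by
        have : ε ^ 2 ≤ ε := by nlinarith
        gcongr
    _ ≤ _ := by
        have p1 : 0 ≤ S.α⁻¹ * (M + A) * ‖c - S.c₁‖ * T.N ε := by positivity
        have p2 : 0 ≤ B * ε * T.N ε := by positivity
        linarith

/-- Solutions of `P_{c,ε} ψ = θ h + k Ω'` are controlled by their coefficient along `ψ₀` and
`k Ω'`, and `θ` is determined by `k Ω'` up to small errors. -/
theorem forced_estimate {h : ℝ → ℂ} (hh : ContinuousOn h (Icc S.a S.b))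
    (hgh : S.int (fun x => S.g₀ x * h x) = 1) :
    ∃ C μ₀, 1 ≤ C ∧ 0 < μ₀ ∧ μ₀ ≤ 1 ∧ ∀ (T T' : S.State) (θ k c : ℂ) (ε : ℝ),
      ‖c - S.c₁‖ ≤ μ₀ → 0 < ε → ε ≤ μ₀ →
      (∀ x ∈ Icc S.a S.b, T.op c ε x = θ * h x + k * T'.Ω x) →
      T.N ε ≤ C * (‖S.coord T.ψ‖ + ‖k‖ * T'.N ε) ∧
      ‖θ + k * S.int (fun x => S.g₀ x * T'.Ω x)‖ ≤
        C * (ε + ‖c - S.c₁‖) * (‖S.coord T.ψ‖ + ‖k‖ * T'.N ε) ∧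
      S.norm2 (fun x => T.ψ x - S.coord T.ψ * S.ψ₀ x) ≤
        C * (ε + ‖c - S.c₁‖) * ‖S.coord T.ψ‖ + C * (‖k‖ * T'.N ε) := by
  obtain ⟨C₁, hC₁, h₁⟩ := S.exists_forcingBound hh
  obtain ⟨C₂, μ₁, hC₂, hμ₁, hμ₁1, h₂⟩ := S.apriori_estimate
  obtain ⟨C₃, hC₃, h₃⟩ := S.exists_pairing_le
  obtain ⟨C₄, hC₄, h₄⟩ := S.exists_norm_int_mul_le S.contDiffOn_L_g₀.continuousOn
  obtain ⟨C₅, hC₅, h₅⟩ := S.dual_estimate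
  set B := C₂ * (1 + C₁ * (C₄ + 1)) with hB
  have hB0 : 0 ≤ B := by positivity
  obtain ⟨μ₀, hμ₀, hμ01, hμ0⟩ : ∃ μ₀ : ℝ, 0 < μ₀ ∧ μ₀ ≤ μ₁ ∧ C₂ * C₁ * C₃ * (2 * μ₀) ≤ 1 / 2 := by
    refine ⟨min μ₁ (1 / (4 * (C₂ * C₁ * C₃ + 1))), by positivity, min_le_left _ _, ?_⟩
    have h0 : min μ₁ (1 / (4 * (C₂ * C₁ * C₃ + 1))) ≤ 1 / (4 * (C₂ * C₁ * C₃ + 1)) := min_le_right _ _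
    rw [le_div_iff₀ (by positivity)] at h0
    have : 0 < min μ₁ (1 / (4 * (C₂ * C₁ * C₃ + 1))) := by positivity
    linarith
  set C := 1 + 2 * B + C₃ * (2 * B) + C₅ * (C₁ * (C₃ * (2 * B * 2) + (C₄ + 1)) + 2 * B * 2) with hC
  have hq1 : 0 ≤ C₃ * (2 * B) := by positivity
  have hq2 : 0 ≤ C₅ * (C₁ * (C₃ * (2 * B * 2) + (C₄ + 1)) + 2 * B * 2) := by positivity
  refine ⟨C, μ₀, by linarith, hμ₀, hμ01.trans hμ₁1, fun T T' θ k c ε hc hε hεμ hop => ?_⟩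
  have hε1 : ε ≤ 1 := hεμ.trans (hμ01.trans hμ₁1)
  have hN := T.N_nonneg hε.le
  have hN' := T'.N_nonneg hε.le
  have hcn := norm_nonneg (c - S.c₁)
  set μ := ε + ‖c - S.c₁‖ with hμ
  have hμp : 0 ≤ μ := by positivity
  have hμ2 : μ ≤ 2 * μ₀ := by linarith
  have hμ2' : μ ≤ 2 := by linarith
  set J := S.int (fun x => S.g₀ x * T'.Ω x) with hJ
  set ℓ := ‖S.coord T.ψ‖
  have hℓ : 0 ≤ ℓ := norm_nonneg _
  set Y := ‖k‖ * T'.N ε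
  have hY : 0 ≤ Y := by positivity
  have hF := h₁ T' θ k ε _ hε hε1 hop
  have a1 := h₂ T c ε _ (hc.trans hμ01) hε (hεμ.trans hμ01) hF
  have a2 : ‖θ + k * J‖ ≤ C₃ * (μ * T.N ε) := by
    have e := h₃ T c ε hε hε1
    have e1 : S.int (fun x => S.g₀ x * T.op c ε x) = θ + k * J := by
      have c1 := S.contDiffOn_g₀.continuousOn
      have c2 := T'.lap.cont
      rw [hJ, ← mul_one θ, ← hgh, int, int, int, ← graphIntegral_const_mul,
        ← graphIntegral_const_mul, ← graphIntegral_add S.hab.le S.hm]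
      · refine graphIntegral_congr S.hab.le fun x hx => ?_
        simp only [hop x hx]; ring
      all_goals fun_prop
    rwa [e1] at e
  have a3 : ‖k * J‖ ≤ C₄ * Y := by
    rw [norm_mul, hJ, S.int_g₀_Ω]
    calc _ ≤ ‖k‖ * (C₄ * T'.N ε) := by
          gcongr
          exact (h₄ _ T'.lap.continuousOn).trans
            (mul_le_mul_of_nonneg_left (T'.n_le_N hε.le) hC₄)
      _ = _ := by simp only [Y]; ring
  have a4 : ‖θ‖ ≤ C₃ * (μ * T.N ε) + C₄ * Y := by
    calc ‖θ‖ = ‖(θ + k * J) - k * J‖ := by ring_nf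
      _ ≤ _ := (norm_sub_le _ _).trans (add_le_add a2 a3)
  have a5 : T.N ε ≤ 2 * B * (ℓ + Y) := by
    have e1 : C₂ * C₁ * C₃ * μ * T.N ε ≤ 1 / 2 * T.N ε := by
      refine mul_le_mul_of_nonneg_right ?_ hN
      exact (mul_le_mul_of_nonneg_left hμ2 (by positivity)).trans hμ0
    have e2 : C₂ * (ℓ + C₁ * (‖θ‖ + Y)) ≤ C₂ * (ℓ + C₁ * (C₃ * (μ * T.N ε) + C₄ * Y + Y)) := by
      gcongr
    have e3 : 0 ≤ C₂ * (C₁ * (C₄ + 1)) * ℓ := by positivity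
    have e4 : 0 ≤ C₂ * Y := by positivity
    simp only [B]
    linarith only [a1, e1, e2, e3, e4]
  refine ⟨a5.trans ?_, a2.trans ?_, ?_⟩
  · exact mul_le_mul_of_nonneg_right (by linarith only [hC, hq1, hq2]) (by positivity)
  · calc _ ≤ C₃ * (μ * (2 * B * (ℓ + Y))) := by gcongr
      _ = C₃ * (2 * B) * μ * (ℓ + Y) := by ring
      _ ≤ _ := by
        gcongr
        linarith only [hC, hB0, hq2]
  · have e1 := h₅ T c ε _ hε hε1 hF
    have e2 := S.err_le T c (F := C₁ * (‖θ‖ + Y)) hε.le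
    have e3 : C₁ * (‖θ‖ + Y) + μ * T.N ε ≤
        C₁ * (C₃ * (μ * (2 * B * (ℓ + Y))) + C₄ * Y + Y) + μ * (2 * B * (ℓ + Y)) := by
      have : C₃ * (μ * T.N ε) ≤ C₃ * (μ * (2 * B * (ℓ + Y))) := by gcongr
      gcongr
      linarith only [a4, this]
    have e4 : μ * Y ≤ 2 * Y := by gcongr
    have e5 : C₁ * (C₃ * (μ * (2 * B * (ℓ + Y))) + C₄ * Y + Y) + μ * (2 * B * (ℓ + Y)) ≤
        (C₁ * (C₃ * (2 * B * 2) + (C₄ + 1)) + 2 * B * 2) * (μ * ℓ + Y) := by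
      have p1 : C₁ * C₃ * (2 * B) * (μ * Y) ≤ C₁ * C₃ * (2 * B) * (2 * Y) := by gcongr
      have p2 : (2 * B) * (μ * Y) ≤ (2 * B) * (2 * Y) := by gcongr
      have p3 : 0 ≤ (C₁ * C₃ * (2 * B) + C₁ * (C₄ + 1) + 2 * B) * (μ * ℓ) := by positivity
      linarith only [p1, p2, p3]
    calc _ ≤ _ := e1
      _ ≤ C₅ * ((C₁ * (C₃ * (2 * B * 2) + (C₄ + 1)) + 2 * B * 2) * (μ * ℓ + Y)) :=
        mul_le_mul_of_nonneg_left (e2.trans (e3.trans e5)) hC₅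
      _ = (C₅ * (C₁ * (C₃ * (2 * B * 2) + (C₄ + 1)) + 2 * B * 2)) * (μ * ℓ + Y) := by ring
      _ ≤ C * (μ * ℓ + Y) :=
        mul_le_mul_of_nonneg_right (by linarith only [hC, hB0, hq1]) (by positivity)
      _ = _ := by ring

end RayleighResonance

/-! ### The first order system of the Orr–Sommerfeld equation -/

section LinearSystems

variable {a b : ℝ} {E : Type*} [NormedAddCommGroup E] [NormedSpace ℂ E] [CompleteSpace E]

/-- The solutions of a linear system, as a linear function of the initial value. -/
theorem exists_solutionMap (hab : a ≤ b) {B : ℝ → E →L[ℂ] E} (hB : ContinuousOn B (Icc a b)) :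
    ∃ Φ : E →ₗ[ℂ] (ℝ → E), ∀ y₀, Φ y₀ a = y₀ ∧ SolvesOn a b B (Φ y₀) := by
  choose y h1 h2 using fun y₀ : E => exists_solvesOn hab hB y₀
  have hp : ∀ x ∈ Icc a b, (projIcc a b hab x : ℝ) = x := fun x hx => by
    rw [projIcc_of_mem hab hx]
  refine ⟨{ toFun := fun y₀ x => y y₀ (projIcc a b hab x)
            map_add' := fun y₀ z₀ => ?_
            map_smul' := fun k y₀ => ?_ }, fun y₀ => ⟨?_, fun x hx => ?_⟩⟩
  · ext x
    refine SolvesOn.eqOn hab hB (h2 (y₀ + z₀)) (z := fun x => y y₀ x + y z₀ x)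
      (fun x hx => ?_) (by simp [h1]) (projIcc a b hab x).2
    rw [map_add]
    exact (h2 y₀ x hx).add (h2 z₀ x hx)
  · ext x
    refine SolvesOn.eqOn hab hB (h2 (k • y₀)) (z := fun x => k • y y₀ x)
      (fun x hx => ?_) (by simp [h1]) (projIcc a b hab x).2
    rw [map_smul]
    exact (h2 y₀ x hx).const_smul k
  · change y y₀ (projIcc a b hab a) = y₀
    rw [hp a ⟨le_rfl, hab⟩, h1]
  · change HasDerivWithinAt (fun x => y y₀ (projIcc a b hab x)) (B x (y y₀ (projIcc a b hab x))) _ _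
    rw [hp x hx]
    exact (h2 y₀ x hx).congr_of_mem (fun z hz => by rw [hp z hz]) hx

theorem exists_solvesOn_forced (hab : a ≤ b) {B : ℝ → E →L[ℂ] E} (hB : ContinuousOn B (Icc a b))
    {g : ℝ → E} (hg : ContinuousOn g (Icc a b)) : ∃ y : ℝ → E, y a = 0 ∧
      ∀ x ∈ Icc a b, HasDerivWithinAt y (B x (y x) + g x) (Icc a b) x := by
  have hG : ContinuousOn (fun x => ∫ t in a..x, g t) (Icc a b) := fun x hx =>
    (hasDerivWithinAt_integral_Icc hab hg hx).continuousWithinAt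
  obtain ⟨y, hy, h⟩ := exists_integral_eq hab hB hG
  refine ⟨y, by simpa using h a ⟨le_rfl, hab⟩, fun x hx => ?_⟩
  rw [add_comm]
  exact ((hasDerivWithinAt_integral_Icc hab hg hx).add
    (hasDerivWithinAt_integral_Icc hab (hB.clm_apply hy) hx)).congr_of_mem h hx

end LinearSystems

/-- The phase space of the Orr–Sommerfeld system: `((ψ, ∂ψ), (Ω, ∂Ω))` with `Ω = (∂² - α²)ψ`. -/
abbrev OSPhase : Type := (ℂ × ℂ) × (ℂ × ℂ)

/-- The part of the Orr–Sommerfeld system that does not depend on the profile. -/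
def osFree (α : ℝ) : OSPhase →L[ℂ] OSPhase := LinearMap.toContinuousLinearMap
  { toFun := fun y => ((y.1.2, y.2.1 + (α : ℂ) ^ 2 * y.1.1), (y.2.2, (α : ℂ) ^ 2 * y.2.1))
    map_add' := fun y z => by ext <;> simp <;> ring
    map_smul' := fun k y => by ext <;> simp <;> ring }

/-- The matrix unit that adds `ψ` to the equation for `∂Ω`. -/
def osStream : OSPhase →L[ℂ] OSPhase := LinearMap.toContinuousLinearMap
  { toFun := fun y => ((0, 0), (0, y.1.1))
    map_add' := fun y z => by ext <;> simp
    map_smul' := fun k y => by ext <;> simp }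

/-- The matrix unit that adds `Ω` to the equation for `∂Ω`. -/
def osVorticity : OSPhase →L[ℂ] OSPhase := LinearMap.toContinuousLinearMap
  { toFun := fun y => ((0, 0), (0, y.2.1))
    map_add' := fun y z => by ext <;> simp
    map_smul' := fun k y => by ext <;> simp }

/-- The coefficient of the Orr–Sommerfeld system, where `s` is the speed of the curve, `κ` is the
inverse of `iα⁻¹ε²`, and `w`, `w₂` are the values of `W - c` and `W''`. -/
def osSystem (α : ℝ) (κ s w w₂ : ℂ) : OSPhase →L[ℂ] OSPhase :=
  s • (osFree α + (κ * w₂) • osStream - (κ * w) • osVorticity)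

theorem osSystem_apply (α : ℝ) (κ s w w₂ : ℂ) (y : OSPhase) : osSystem α κ s w w₂ y =
    ((s * y.1.2, s * (y.2.1 + (α : ℂ) ^ 2 * y.1.1)),
      (s * y.2.2, s * ((α : ℂ) ^ 2 * y.2.1 + κ * (w₂ * y.1.1 - w * y.2.1)))) := by
  ext <;> simp [osSystem, osFree, osStream, osVorticity, -mul_eq_mul_left_iff]; ring

/-- `iα⁻¹ε²`. -/
def viscosity (α ε : ℝ) : ℂ := Complex.I * (α : ℂ)⁻¹ * (ε : ℂ) ^ 2

theorem viscosity_ne_zero {α ε : ℝ} (hα : 0 < α) (hε : 0 < ε) : viscosity α ε ≠ 0 := by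
  have h1 : (α : ℂ) ≠ 0 := Complex.ofReal_ne_zero.2 hα.ne'
  have h2 : (ε : ℂ) ≠ 0 := Complex.ofReal_ne_zero.2 hε.ne'
  exact mul_ne_zero (mul_ne_zero Complex.I_ne_zero (inv_ne_zero h1)) (pow_ne_zero 2 h2)

theorem HasDerivWithinAt.osPhase {y : ℝ → OSPhase} {y' : OSPhase} {s : Set ℝ} {x : ℝ}
    (h : HasDerivWithinAt y y' s x) :
    HasDerivWithinAt (fun x => (y x).1.1) y'.1.1 s x ∧
    HasDerivWithinAt (fun x => (y x).1.2) y'.1.2 s x ∧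
    HasDerivWithinAt (fun x => (y x).2.1) y'.2.1 s x ∧
    HasDerivWithinAt (fun x => (y x).2.2) y'.2.2 s x := by
  have h1 := (ContinuousLinearMap.fst ℝ (ℂ × ℂ) (ℂ × ℂ)).hasFDerivAt.comp_hasDerivWithinAt x h
  have h2 := (ContinuousLinearMap.snd ℝ (ℂ × ℂ) (ℂ × ℂ)).hasFDerivAt.comp_hasDerivWithinAt x h
  exact ⟨(ContinuousLinearMap.fst ℝ ℂ ℂ).hasFDerivAt.comp_hasDerivWithinAt x h1,
    (ContinuousLinearMap.snd ℝ ℂ ℂ).hasFDerivAt.comp_hasDerivWithinAt x h1,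
    (ContinuousLinearMap.fst ℝ ℂ ℂ).hasFDerivAt.comp_hasDerivWithinAt x h2,
    (ContinuousLinearMap.snd ℝ ℂ ℂ).hasFDerivAt.comp_hasDerivWithinAt x h2⟩

section OS

variable {a b : ℝ} {m : ℝ → ℝ} {α ε : ℝ}

/-- A solution of the forced Orr–Sommerfeld system consists of a function, `∂`, `∂² - α²`, …. -/
theorem lapOn_of_osSystem {w w₂ f : ℝ → ℂ} {y : ℝ → OSPhase} (hw : ContinuousOn w (Icc a b))
    (hw₂ : ContinuousOn w₂ (Icc a b)) (hf : ContinuousOn f (Icc a b)) {κ : ℂ}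
    (hy : ∀ x ∈ Icc a b, HasDerivWithinAt y (osSystem α κ (speed m x) (w x) (w₂ x) (y x) +
      ((0, 0), (0, speed m x * (κ * f x)))) (Icc a b) x) :
    LapOn a b m α (fun x => (y x).1.1) (fun x => (y x).1.2) (fun x => (y x).2.1) ∧
    LapOn a b m α (fun x => (y x).2.1) (fun x => (y x).2.2)
      (fun x => κ * (f x + w₂ x * (y x).1.1 - w x * (y x).2.1)) := by
  have hc : ContinuousOn y (Icc a b) := fun x hx => (hy x hx).continuousWithinAt
  refine ⟨⟨fun x hx => ?_, fun x hx => ?_, by fun_prop⟩,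
    ⟨fun x hx => ?_, fun x hx => ?_, by fun_prop⟩⟩
  · refine (hy x hx).osPhase.1.congr_deriv ?_
    simp [osSystem_apply]
  · refine (hy x hx).osPhase.2.1.congr_deriv ?_
    simp [osSystem_apply]
  · refine (hy x hx).osPhase.2.2.1.congr_deriv ?_
    simp [osSystem_apply]
  · refine (hy x hx).osPhase.2.2.2.congr_deriv ?_
    simp [osSystem_apply]; ring

theorem solvesOn_osSystem_of_lapOn {w w₂ f ψ p Ω ρ θ : ℝ → ℂ} {κ : ℂ}
    (h1 : LapOn a b m α ψ p Ω) (h2 : LapOn a b m α Ω ρ θ)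
    (hθ : ∀ x ∈ Icc a b, θ x = κ * (f x + w₂ x * ψ x - w x * Ω x)) :
    ∀ x ∈ Icc a b, HasDerivWithinAt (fun x => ((ψ x, p x), (Ω x, ρ x)))
      (osSystem α κ (speed m x) (w x) (w₂ x) ((ψ x, p x), (Ω x, ρ x)) +
      ((0, 0), (0, speed m x * (κ * f x)))) (Icc a b) x := by
  intro x hx
  refine (((h1.deriv_fst x hx).prodMk (h1.deriv_snd x hx)).prodMk
    ((h2.deriv_fst x hx).prodMk (h2.deriv_snd x hx))).congr_deriv ?_
  rw [osSystem_apply, hθ x hx]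
  ext <;> simp
  ring

end OS

theorem continuousOn_osSystem {X : Type*} [TopologicalSpace X] {α : ℝ} {κ : ℂ} {s w w₂ : X → ℂ}
    {A : Set X} (hs : ContinuousOn s A) (hw : ContinuousOn w A) (hw₂ : ContinuousOn w₂ A) :
    ContinuousOn (fun x => osSystem α κ (s x) (w x) (w₂ x)) A := by
  unfold osSystem
  fun_prop

/-! ### The bordered problem -/

namespace RayleighResonance

variable (S : RayleighResonance)

theorem coord_sub_mul {f g : ℝ → ℂ} (hf : ContinuousOn f (Icc S.a S.b))
    (hg : ContinuousOn g (Icc S.a S.b)) (k : ℂ) :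
    S.coord (fun x => f x - k * g x) = S.coord f - k * S.coord g := by
  have c1 : ContinuousOn (fun x => conj (S.ψ₀ x)) (Icc S.a S.b) :=
    Complex.continuous_conj.comp_continuousOn S.hψ₀.continuousOn
  have : ∫ x in S.a..S.b, conj (S.ψ₀ x) * (f x - k * g x) =
      (∫ x in S.a..S.b, conj (S.ψ₀ x) * f x) - k * ∫ x in S.a..S.b, conj (S.ψ₀ x) * g x := by
    rw [← intervalIntegral.integral_const_mul, ← intervalIntegral.integral_sub]
    · congr 1; ext x; ring
    all_goals exact ContinuousOn.intervalIntegrable_Icc S.hab.le (by fun_prop)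
  rw [coord, this, coord, coord]; ring

theorem coord_subSmul (T T' : S.State) (k : ℂ) :
    S.coord (T.subSmul T' k).ψ = S.coord T.ψ - k * S.coord T'.ψ :=
  S.coord_sub_mul T.lap.continuousOn T'.lap.continuousOn k

theorem State.eq_zero_of_N {S : RayleighResonance} (T : S.State) {ε : ℝ} (hε : 0 < ε)
    (h : T.N ε ≤ 0) : (∀ x ∈ Icc S.a S.b, T.ψ x = 0) ∧ T.Ω S.a = 0 ∧ T.ρ S.a = 0 := by
  have h1 := T.n_nonneg; have h2 := T.β_nonneg hε.le; have h3 := T.w_nonneg ε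
  have h4 := T.γ_nonneg ε
  unfold State.N at h
  refine ⟨eqOn_zero_of_l2_eq_zero S.hab T.lap.continuousOn (le_antisymm (by
    change T.n ≤ 0; linarith) h1), ?_, ?_⟩
  · have h5 : ε * (‖T.Ω S.a‖ + ‖T.Ω S.b‖) = 0 := le_antisymm (by change T.β ε ≤ 0; linarith) h2
    have h6 := (mul_eq_zero.1 h5).resolve_left hε.ne'
    exact norm_eq_zero.1 (by linarith [norm_nonneg (T.Ω S.a), norm_nonneg (T.Ω S.b)])
  · have h5 : ε ^ 2 * (‖T.ρ S.a‖ + ‖T.ρ S.b‖) = 0 :=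
      le_antisymm (by change T.γ ε ≤ 0; linarith) h4
    have h6 := (mul_eq_zero.1 h5).resolve_left (by positivity)
    exact norm_eq_zero.1 (by linarith [norm_nonneg (T.ρ S.a), norm_nonneg (T.ρ S.b)])

/-- The bordered problem `P_{c,ε} ψ = η h`, `coord ψ = 1` is solvable if it has at most one
solution. -/
theorem exists_bordered_solution {h : ℝ → ℂ} (hh : ContinuousOn h (Icc S.a S.b)) {c : ℂ} {ε : ℝ}
    (hε : 0 < ε) (hinj : ∀ (T : S.State) (η : ℂ), (∀ x ∈ Icc S.a S.b, T.op c ε x = η * h x) →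
      S.coord T.ψ = 0 → η = 0 ∧ T.Ω S.a = 0 ∧ T.ρ S.a = 0) :
    ∃ (T : S.State) (η : ℂ), (∀ x ∈ Icc S.a S.b, T.op c ε x = η * h x) ∧ S.coord T.ψ = 1 := by
  have hab := S.hab.le
  have cs := S.contDiffOn_speed.continuousOn
  have cw : ContinuousOn (fun x => S.W x - c) (Icc S.a S.b) :=
    S.hW.continuousOn.sub continuousOn_const
  have cw₂ := S.contDiffOn_W₂.continuousOn
  have hκ := viscosity_ne_zero S.hα hε
  set κ := (viscosity S.α ε)⁻¹
  have hB := continuousOn_osSystem (α := S.α) (κ := κ) cs cw cw₂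
  obtain ⟨Φ, hΦ⟩ := exists_solutionMap hab hB
  obtain ⟨y, hya, hy⟩ := exists_solvesOn_forced hab hB
    (g := fun x => (((0, 0), (0, speed S.m x * (κ * h x))) : OSPhase)) (by fun_prop)
  -- three parameters: the free initial values `Ω(a)`, `∂Ω(a)`, and `η`; and as many conditions:
  -- `ψ(b) = 0`, `∂ψ(b) = 0`, and `coord ψ = 1`
  set z : (ℂ × ℂ) × ℂ → ℝ → OSPhase := fun v x => Φ ((0, 0), v.1) x + v.2 • y x with hz
  have hzd : ∀ v, ∀ x ∈ Icc S.a S.b, HasDerivWithinAt (z v)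
      (osSystem S.α κ (speed S.m x) (S.W x - c) (S.W₂ x) (z v x) +
        ((0, 0), (0, speed S.m x * (κ * (v.2 * h x))))) (Icc S.a S.b) x := fun v x hx => by
    refine (((hΦ ((0, 0), v.1)).2 x hx).add ((hy x hx).const_smul v.2)).congr_deriv ?_
    simp only [hz, map_add, map_smul, smul_add]
    rw [add_assoc]
    congr 2
    ext <;> simp
    ring
  have hza : ∀ v, z v S.a = ((0, 0), v.1) := fun v => by simp [hz, hΦ, hya]
  have hzc : ∀ v, ContinuousOn (z v) (Icc S.a S.b) := fun v x hx =>
    (hzd v x hx).continuousWithinAt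
  have hadd : ∀ u v x, z (u + v) x = z u x + z v x := fun u v x => by
    have : (((0, 0), (u + v).1) : OSPhase) = ((0, 0), u.1) + ((0, 0), v.1) := by simp
    simp only [hz, this, map_add, Pi.add_apply, Prod.snd_add, add_smul]
    abel
  have hsmul : ∀ (k : ℂ) v x, z (k • v) x = k • z v x := fun k v x => by
    have : (((0, 0), (k • v).1) : OSPhase) = k • ((0, 0), v.1) := by simp
    simp only [hz, this, map_smul, Pi.smul_apply, smul_add, smul_smul]
    rfl
  have hcoord : ∀ (k : ℂ) u v, S.coord (fun x => (z u x).1.1 - k * (z v x).1.1) =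
      S.coord (fun x => (z u x).1.1) - k * S.coord (fun x => (z v x).1.1) := fun k u v =>
    S.coord_sub_mul (by have := hzc u; fun_prop) (by have := hzc v; fun_prop) k
  let A : ((ℂ × ℂ) × ℂ) →ₗ[ℂ] ((ℂ × ℂ) × ℂ) :=
    { toFun := fun v => ((z v S.b).1, S.coord fun x => (z v x).1.1)
      map_add' := fun u v => by
        have := hcoord (-1) u v
        simp only [neg_mul, one_mul, sub_neg_eq_add] at this
        simp only [hadd, Prod.fst_add, this]
        rfl
      map_smul' := fun k v => by
        have := hcoord (-k) 0 v
        have h0 : ∀ x, z 0 x = 0 := fun x => by simpa using hsmul 0 0 x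
        simp only [neg_mul, sub_neg_eq_add, h0, Prod.fst_zero, zero_add] at this
        have e : S.coord (fun _ => (0 : ℂ)) = 0 := by simp [coord]
        rw [e, zero_add] at this
        simp only [hsmul, Prod.smul_fst, smul_eq_mul, this, RingHom.id_apply]
        rfl }
  have mk : ∀ v, (A v).1 = 0 → ∃ T : S.State,
      (∀ x ∈ Icc S.a S.b, T.op c ε x = v.2 * h x) ∧ S.coord T.ψ = (A v).2 ∧
        (T.Ω S.a, T.ρ S.a) = v.1 := by
    intro v hv
    obtain ⟨l1, l2⟩ := lapOn_of_osSystem (f := fun x => v.2 * h x) cw cw₂ (by fun_prop) (hzd v)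
    have hb : (z v S.b).1 = 0 := hv
    refine ⟨⟨_, _, _, _, _, l1, l2, by simp [hza], by simp [hb], by simp [hza], by simp [hb]⟩,
      fun x hx => ?_, rfl, by simp [hza]⟩
    have : viscosity S.α ε * κ = 1 := mul_inv_cancel₀ hκ
    simp only [State.op]
    change viscosity S.α ε * _ + _ - _ = _
    linear_combination (v.2 * h x + S.W₂ x * (z v x).1.1 - (S.W x - c) * (z v x).2.1) * this
  have hAinj : Function.Injective A := by
    rw [injective_iff_map_eq_zero]
    intro v hv
    obtain ⟨T, h1, h2, h3⟩ := mk v (by rw [hv]; rfl)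
    obtain ⟨h4, h5, h6⟩ := hinj T v.2 h1 (by rw [h2, hv]; rfl)
    rw [h5, h6] at h3
    exact Prod.ext h3.symm h4
  obtain ⟨v, hv⟩ := (LinearMap.injective_iff_surjective.1 hAinj) (0, 1)
  obtain ⟨T, h1, h2, -⟩ := mk v (by rw [hv])
  exact ⟨T, v.2, h1, by rw [h2, hv]⟩

end RayleighResonance

/-! ### The eigenvalue branch on the deformed segment -/

namespace RayleighResonance

variable (S : RayleighResonance)

/-- `T` and `η` solve the bordered problem with right-hand side `h`. -/
def IsBordered (h : ℝ → ℂ) (ε : ℝ) (c : ℂ) (T : S.State) (η : ℂ) : Prop :=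
  (∀ x ∈ Icc S.a S.b, T.op c ε x = η * h x) ∧ S.coord T.ψ = 1

/-- The bordered problem is uniquely solvable; its solution is a small perturbation of `ψ₀`, and
`η` is a small perturbation of an affine function of `c`. -/
theorem bordered_estimate {h : ℝ → ℂ} (hh : ContinuousOn h (Icc S.a S.b))
    (hgh : S.int (fun x => S.g₀ x * h x) = 1) :
    ∃ C μ₀, 1 ≤ C ∧ 0 < μ₀ ∧ μ₀ ≤ 1 ∧ ∀ (ε : ℝ), 0 < ε → ε ≤ μ₀ → ∀ c, ‖c - S.c₁‖ ≤ μ₀ →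
      (∃ T η, S.IsBordered h ε c T η) ∧
      (∀ T : S.State, (∀ x ∈ Icc S.a S.b, T.op c ε x = 0) → S.coord T.ψ = 0 →
        ∀ x ∈ Icc S.a S.b, T.ψ x = 0) ∧
      ∀ T η, S.IsBordered h ε c T η →
        T.N ε ≤ C ∧ ‖η‖ ≤ C * (ε + ‖c - S.c₁‖) ∧
        S.norm2 (fun x => T.ψ x - S.ψ₀ x) ≤ C * (ε + ‖c - S.c₁‖) ∧
        (∀ c' T' η', ‖c' - S.c₁‖ ≤ μ₀ → S.IsBordered h ε c' T' η' →
          ‖(η - η') + (c - c') * S.pairing‖ ≤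
            C * (ε + ‖c - S.c₁‖ + ‖c' - S.c₁‖) * ‖c - c'‖) ∧
        (η = 0 → ∀ (T' : S.State) (k : ℂ), (∀ x ∈ Icc S.a S.b, T'.op c ε x = k * T.Ω x) →
          ‖k * S.pairing‖ ≤ C * (ε + ‖c - S.c₁‖) * ‖k‖) := by
  obtain ⟨C, μ₀, hC1, hμ₀, hμ1, hE⟩ := S.forced_estimate hh hgh
  obtain ⟨B, hB0, hB⟩ := S.exists_norm_int_mul_le S.contDiffOn_L_g₀.continuousOn
  have hC0 : 0 ≤ C := by linarith
  -- the estimates for the difference of a state and its part along another one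
  have hforced : ∀ ε, 0 < ε → ε ≤ μ₀ → ∀ c, ‖c - S.c₁‖ ≤ μ₀ → ∀ T η,
      S.IsBordered h ε c T η → T.N ε ≤ C ∧ ‖η‖ ≤ C * (ε + ‖c - S.c₁‖) ∧
        S.norm2 (fun x => T.ψ x - S.ψ₀ x) ≤ C * (ε + ‖c - S.c₁‖) ∧
        ‖S.int (fun x => S.g₀ x * T.Ω x) - S.pairing‖ ≤ B * C * (ε + ‖c - S.c₁‖) := by
    intro ε hε hεμ c hc T η hT
    obtain ⟨h1, h2, h3⟩ := hE T T η 0 c ε hc hε hεμ fun x hx => by rw [hT.1 x hx]; ring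
    rw [hT.2] at h1 h2 h3
    simp only [norm_one, norm_zero, zero_mul, add_zero, mul_one, mul_zero, one_mul] at h1 h2 h3
    refine ⟨h1, h2, h3, ?_⟩
    have c1 := T.lap.continuousOn
    have c2 := S.hψ₀.continuousOn
    have c3 := S.contDiffOn_L_g₀.continuousOn
    rw [S.int_g₀_Ω, ← S.int_ψ₀_mul_L_g₀, int, int, ← graphIntegral_sub S.hab.le S.hm (by fun_prop)
      (by fun_prop)]
    have h4 := hB (fun x => T.ψ x - S.ψ₀ x) (by fun_prop)
    have h5 : S.int (fun x => (T.ψ x - S.ψ₀ x) * S.L S.g₀ x) =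
        S.int (fun x => T.ψ x * S.L S.g₀ x - S.ψ₀ x * S.L S.g₀ x) := by
      congr 1; ext x; ring
    rw [h5] at h4
    calc _ ≤ _ := h4
      _ ≤ B * (C * (ε + ‖c - S.c₁‖)) := by gcongr
      _ = _ := by ring
  refine ⟨C * C + B * C + C, μ₀, ?_, hμ₀, hμ1, fun ε hε hεμ c hc => ⟨?_, ?_, ?_⟩⟩
  · nlinarith [mul_nonneg hB0 hC0, mul_nonneg hC0 hC0]
  · refine S.exists_bordered_solution hh hε fun T η hT h0 => ?_
    obtain ⟨h1, h2, -⟩ := hE T T η 0 c ε hc hε hεμ fun x hx => by rw [hT x hx]; ring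
    rw [h0] at h1 h2
    simp only [norm_zero, zero_mul, add_zero, mul_zero] at h1 h2
    exact ⟨norm_le_zero_iff.1 h2, (T.eq_zero_of_N hε h1).2⟩
  · intro T hT h0
    obtain ⟨h1, -, -⟩ := hE T T 0 0 c ε hc hε hεμ fun x hx => by rw [hT x hx]; ring
    rw [h0] at h1
    simp only [norm_zero, zero_mul, add_zero, mul_zero] at h1
    exact (T.eq_zero_of_N hε h1).1
  intro T η hT
  obtain ⟨h1, h2, h3, h4⟩ := hforced ε hε hεμ c hc T η hT
  have hcn := norm_nonneg (c - S.c₁)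
  have hBC : 0 ≤ B * C := by positivity
  have hCC : 0 ≤ C * C := by positivity
  have hCle : C ≤ C * C + B * C + C := by linarith
  refine ⟨h1.trans hCle, h2.trans (by gcongr), h3.trans (by gcongr), ?_, ?_⟩
  · intro c' T' η' hc' hT'
    obtain ⟨h1', h2', h3', h4'⟩ := hforced ε hε hεμ c' hc' T' η' hT'
    have hop : ∀ x ∈ Icc S.a S.b, (T.subSmul T' 1).op c ε x = (η - η') * h x + (c - c') * T'.Ω x := by
      intro x hx
      have e := T'.op_sub_op c c' ε x
      rw [T.subSmul_op, hT.1 x hx]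
      have e' := hT'.1 x hx
      linear_combination -e - e'
    obtain ⟨-, h5, -⟩ := hE _ T' _ _ c ε hc hε hεμ hop
    rw [S.coord_subSmul, hT.2, hT'.2] at h5
    simp only [mul_one, sub_self, norm_zero, zero_add] at h5
    have hcn' := norm_nonneg (c' - S.c₁)
    have hd := norm_nonneg (c - c')
    set J := S.int (fun x => S.g₀ x * T'.Ω x)
    have e1 : (η - η') + (c - c') * S.pairing = ((η - η') + (c - c') * J) -
        (c - c') * (J - S.pairing) := by ring
    rw [e1]
    calc _ ≤ C * (ε + ‖c - S.c₁‖) * (‖c - c'‖ * C) + ‖c - c'‖ * (B * C * (ε + ‖c' - S.c₁‖)) := by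
          refine (norm_sub_le _ _).trans ?_
          rw [norm_mul (c - c')]
          gcongr
          exact h5.trans (by gcongr)
      _ ≤ _ := by
          have p1 : 0 ≤ C * C * ‖c' - S.c₁‖ * ‖c - c'‖ := by positivity
          have p2 : 0 ≤ B * C * ‖c - S.c₁‖ * ‖c - c'‖ := by positivity
          have p3 : 0 ≤ C * (ε + ‖c - S.c₁‖ + ‖c' - S.c₁‖) * ‖c - c'‖ := by positivity
          linarith
  · intro hη T' k hT'
    have hop : ∀ x ∈ Icc S.a S.b, (T'.subSmul T (S.coord T'.ψ)).op c ε x =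
        0 * h x + k * T.Ω x := by
      intro x hx
      rw [T'.subSmul_op, hT.1 x hx, hT' x hx, hη]; ring
    obtain ⟨-, h5, -⟩ := hE _ T _ _ c ε hc hε hεμ hop
    rw [S.coord_subSmul, hT.2] at h5
    simp only [mul_one, sub_self, norm_zero, zero_add] at h5
    have hk := norm_nonneg k
    set J := S.int (fun x => S.g₀ x * T.Ω x)
    have e1 : k * S.pairing = k * J - k * (J - S.pairing) := by ring
    rw [e1]
    calc _ ≤ C * (ε + ‖c - S.c₁‖) * (‖k‖ * C) + ‖k‖ * (B * C * (ε + ‖c - S.c₁‖)) := by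
          refine (norm_sub_le _ _).trans ?_
          rw [norm_mul k (J - _)]
          gcongr
          exact h5.trans (by gcongr)
      _ ≤ _ := by
          have p3 : 0 ≤ C * (ε + ‖c - S.c₁‖) * ‖k‖ := by positivity
          linarith

/-- The leading order of the boundary values of the vorticity of a normalized eigenfunction: in the
boundary layer the vorticity compensates the slip of `ψ₀`. -/
theorem boundary_vorticity {h : ℝ → ℂ} (hh : ContinuousOn h (Icc S.a S.b))
    (hgh : S.int (fun x => S.g₀ x * h x) = 1) {p : ℝ} (hp : p = S.a ∨ p = S.b) {κ : ℂ}
    (hκ : S.IsLayerExponent p κ) :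
    ∃ C μ₀, 0 ≤ C ∧ 0 < μ₀ ∧ ∀ (T : S.State) (c : ℂ) (ε : ℝ), 0 < ε → ε ≤ μ₀ →
      ‖c - S.c₁‖ ≤ μ₀ → (∀ x ∈ Icc S.a S.b, T.op c ε x = 0) → S.coord T.ψ = 1 →
      ‖Complex.I * (S.α : ℂ)⁻¹ * ε * (S.v p * T.Ω p) - κ⁻¹ * S.D S.ψ₀ p‖ ≤
        C * (ε + ‖c - S.c₁‖) := by
  obtain ⟨C₁, μ₀, hC1, hμ₀, hμ1, hE⟩ := S.bordered_estimate hh hgh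
  obtain ⟨C₂, hC₂, hF⟩ := S.exists_forcingBound hh
  obtain ⟨r, cr, hr, C₃, hC₃, hS⟩ := S.slow_estimate hp
  have hκ0 := hκ.ne_zero (S.endpoint_mem hp)
  obtain ⟨hκ2, k, hk, hκk⟩ := hκ
  obtain ⟨C₄, hC₄, hR⟩ := S.robin_estimate hp hk hκ2 hκk
  obtain ⟨B, hB0, hB⟩ := S.exists_norm_int_mul_le cr
  have hC0 : 0 ≤ C₁ := by linarith
  have hα := S.hα
  refine ⟨‖κ‖⁻¹ * (C₃ * C₁ + B * C₁ + S.α⁻¹ * ‖S.v p‖ * (C₄ * (2 * C₁))), μ₀, by positivity, hμ₀,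
    fun T c ε hε hεμ hc hop hcoord => ?_⟩
  have hε1 := hεμ.trans hμ1
  have hb : S.IsBordered h ε c T 0 := ⟨fun x hx => by rw [hop x hx, zero_mul], hcoord⟩
  obtain ⟨-, -, hest⟩ := hE ε hε hεμ c hc
  obtain ⟨h1, -, h3, -, -⟩ := hest T 0 hb
  have hcn := norm_nonneg (c - S.c₁)
  set μ := ε + ‖c - S.c₁‖ with hμ
  have hμ0 : 0 ≤ μ := by positivity
  have f0 := hF T 0 0 ε (T.op c ε) hε hε1 fun x hx => by rw [hop x hx]; ring
  simp only [norm_zero, zero_mul, add_zero, mul_zero] at f0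
  have c1 := T.lap.continuousOn
  have c2 := S.hψ₀.continuousOn
  have a1 : ‖Complex.I * (S.α : ℂ)⁻¹ * (ε : ℂ) ^ 2 * (S.v p * T.ρ p) -
      S.int (fun x => T.ψ x * r x)‖ ≤ C₃ * (μ * C₁) := by
    refine (hS T c ε 0 hε hε1 f0).trans ?_
    have := S.err_le T c (F := 0) hε.le
    rw [zero_add] at this
    gcongr
    exact this.trans (by gcongr)
  have a2 : ‖S.int (fun x => T.ψ x * r x) - S.D S.ψ₀ p‖ ≤ B * (C₁ * μ) := by
    rw [← hr, int, int, ← graphIntegral_sub S.hab.le S.hm (by fun_prop) (by fun_prop)]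
    have h4 := hB (fun x => T.ψ x - S.ψ₀ x) (by fun_prop)
    have h5 : S.int (fun x => (T.ψ x - S.ψ₀ x) * r x) =
        S.int (fun x => T.ψ x * r x - S.ψ₀ x * r x) := by
      congr 1; ext x; ring
    rw [h5] at h4
    exact h4.trans (by gcongr)
  have a3 : ‖(ε : ℂ) ^ 2 * T.ρ p - κ * (ε * T.Ω p)‖ ≤ C₄ * (2 * C₁ * μ) := by
    refine (hR T c ε hε hε1).trans ?_
    have h0 : √ε * S.norm2 (T.op c ε) ≤ 0 := f0.l2_le
    have hw := T.w_le_N hε.le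
    have hn := T.n_le_N hε.le
    have e1 : μ * T.w ε ≤ μ * C₁ := by gcongr; linarith
    have e2 : ε * T.n ≤ μ * C₁ := by
      have : ε ≤ μ := by linarith
      have := T.n_nonneg
      gcongr
      linarith
    gcongr
    linarith
  have e : Complex.I * (S.α : ℂ)⁻¹ * ε * (S.v p * T.Ω p) - κ⁻¹ * S.D S.ψ₀ p = κ⁻¹ *
      ((Complex.I * (S.α : ℂ)⁻¹ * (ε : ℂ) ^ 2 * (S.v p * T.ρ p) - S.int (fun x => T.ψ x * r x)) +
      (S.int (fun x => T.ψ x * r x) - S.D S.ψ₀ p) -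
      Complex.I * (S.α : ℂ)⁻¹ * S.v p * ((ε : ℂ) ^ 2 * T.ρ p - κ * (ε * T.Ω p))) := by
    field_simp
    ring
  have nI : ‖Complex.I * (S.α : ℂ)⁻¹ * S.v p‖ = S.α⁻¹ * ‖S.v p‖ := by
    simp [abs_of_pos hα]
  rw [e, norm_mul, norm_inv]
  calc _ ≤ ‖κ‖⁻¹ * (C₃ * (μ * C₁) + B * (C₁ * μ) + S.α⁻¹ * ‖S.v p‖ * (C₄ * (2 * C₁ * μ))) := by
        gcongr
        refine (norm_sub_le _ _).trans (add_le_add ((norm_add_le _ _).trans (add_le_add a1 a2)) ?_)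
        rw [norm_mul, nI]
        gcongr
    _ = _ := by ring

/-- The value of `dc/dε` at `ε = 0`. -/
def slope (κa κb : ℂ) : ℂ :=
  (κa⁻¹ * (S.D S.ψ₀ S.a) ^ 2 - κb⁻¹ * (S.D S.ψ₀ S.b) ^ 2) / S.pairing

/-- First order expansion of an eigenvalue that is `O(ε)`-close to `c₁`. -/
theorem eigenvalue_expansion {h : ℝ → ℂ} (hh : ContinuousOn h (Icc S.a S.b))
    (hgh : S.int (fun x => S.g₀ x * h x) = 1) {κa κb : ℂ} (ha : S.IsLayerExponent S.a κa)
    (hb : S.IsLayerExponent S.b κb) (M : ℝ) (hM : 0 ≤ M) :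
    ∃ C μ₀, 0 ≤ C ∧ 0 < μ₀ ∧ ∀ (T : S.State) (c : ℂ) (ε : ℝ), 0 < ε → ε ≤ μ₀ →
      ‖c - S.c₁‖ ≤ μ₀ → ‖c - S.c₁‖ ≤ M * ε → (∀ x ∈ Icc S.a S.b, T.op c ε x = 0) →
      S.coord T.ψ = 1 → ‖c - (S.c₁ + S.slope κa κb * ε)‖ ≤ C * ε ^ 2 := by
  obtain ⟨C₁, μ₁, hC1, hμ₁, hμ1, hE⟩ := S.bordered_estimate hh hgh
  obtain ⟨Ca, μa, hCa, hμa, hVa⟩ := S.boundary_vorticity hh hgh (Or.inl rfl) ha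
  obtain ⟨Cb, μb, hCb, hμb, hVb⟩ := S.boundary_vorticity hh hgh (Or.inr rfl) hb
  obtain ⟨A, hA0, hA⟩ := S.exists_norm_int_mul_le
    (contDiffOn_curveLaplace (α := S.α) S.hab S.hm S.contDiffOn_L_g₀).continuousOn
  obtain ⟨B, hB0, hB⟩ := S.exists_norm_int_mul_le S.contDiffOn_L_g₀.continuousOn
  have hα := S.hα
  have hI : S.pairing ≠ 0 := S.pairing_ne
  have hC0 : 0 ≤ C₁ := by linarith
  set K := 1 + M
  have hK : 0 ≤ K := by positivity
  refine ⟨‖S.pairing‖⁻¹ * (M * (B * (C₁ * K)) + ‖S.D S.ψ₀ S.a‖ * (Ca * K) +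
    ‖S.D S.ψ₀ S.b‖ * (Cb * K) + S.α⁻¹ * (A * C₁)), min μ₁ (min μa μb), by positivity,
    by positivity, fun T c ε hε hεμ hc hcM hop hcoord => ?_⟩
  have hmin : min μ₁ (min μa μb) ≤ μ₁ ∧ min μ₁ (min μa μb) ≤ μa ∧ min μ₁ (min μa μb) ≤ μb :=
    ⟨min_le_left _ _, (min_le_right _ _).trans (min_le_left _ _),
      (min_le_right _ _).trans (min_le_right _ _)⟩
  have hbd : S.IsBordered h ε c T 0 := ⟨fun x hx => by rw [hop x hx, zero_mul], hcoord⟩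
  obtain ⟨-, -, hest⟩ := hE ε hε (hεμ.trans hmin.1) c (hc.trans hmin.1)
  obtain ⟨h1, -, h3, -, -⟩ := hest T 0 hbd
  have va := hVa T c ε hε (hεμ.trans hmin.2.1) (hc.trans hmin.2.1) hop hcoord
  have vb := hVb T c ε hε (hεμ.trans hmin.2.2) (hc.trans hmin.2.2) hop hcoord
  have hμK : ε + ‖c - S.c₁‖ ≤ K * ε := by simp only [K]; linarith
  have c1 := T.lap.continuousOn
  have c2 := S.hψ₀.continuousOn
  have c3 := S.contDiffOn_L_g₀.continuousOn
  have hid := S.pairing_identity T c ε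
  have h0 : S.int (fun x => S.g₀ x * T.op c ε x) = 0 := by
    rw [int, graphIntegral_congr S.hab.le (g := fun _ => 0) fun x hx => ?_]
    · simp [graphIntegral]
    · simp only [hop x hx, mul_zero]
  rw [h0] at hid
  set J := S.int (fun x => T.ψ x * S.L S.g₀ x)
  set Q := S.int (fun x => T.ψ x * S.L (S.L S.g₀) x)
  have a1 : ‖J - S.pairing‖ ≤ B * (C₁ * (K * ε)) := by
    rw [← S.int_ψ₀_mul_L_g₀, int, ← graphIntegral_sub S.hab.le S.hm (by fun_prop) (by fun_prop)]
    have h4 := hB (fun x => T.ψ x - S.ψ₀ x) (by fun_prop)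
    have h5 : S.int (fun x => (T.ψ x - S.ψ₀ x) * S.L S.g₀ x) =
        S.int (fun x => T.ψ x * S.L S.g₀ x - S.ψ₀ x * S.L S.g₀ x) := by
      congr 1; ext x; ring
    rw [h5] at h4
    refine h4.trans ?_
    gcongr
    exact h3.trans (by gcongr)
  have a2 : ‖Q‖ ≤ A * C₁ := (hA _ c1).trans (by gcongr; exact (T.n_le_N hε.le).trans h1)
  have e : c - (S.c₁ + S.slope κa κb * ε) = S.pairing⁻¹ *
      (-((c - S.c₁) * (J - S.pairing)) +
      ε * (S.D S.ψ₀ S.a * (Complex.I * (S.α : ℂ)⁻¹ * ε * (S.v S.a * T.Ω S.a) - κa⁻¹ * S.D S.ψ₀ S.a))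
      - ε * (S.D S.ψ₀ S.b * (Complex.I * (S.α : ℂ)⁻¹ * ε * (S.v S.b * T.Ω S.b) -
        κb⁻¹ * S.D S.ψ₀ S.b)) + Complex.I * (S.α : ℂ)⁻¹ * (ε : ℂ) ^ 2 * Q) := by
    have e1 : S.pairing * S.slope κa κb =
        κa⁻¹ * (S.D S.ψ₀ S.a) ^ 2 - κb⁻¹ * (S.D S.ψ₀ S.b) ^ 2 := mul_div_cancel₀ _ hI
    have e2 : S.pairing⁻¹ * S.pairing = 1 := inv_mul_cancel₀ hI
    linear_combination (-(c - S.c₁) + S.slope κa κb * ε) * e2 + S.pairing⁻¹ * hid -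
      S.pairing⁻¹ * ε * e1
  have nI : ‖Complex.I * (S.α : ℂ)⁻¹ * (ε : ℂ) ^ 2‖ = S.α⁻¹ * ε ^ 2 := by
    simp [abs_of_pos hα]
  rw [e, norm_mul, norm_inv]
  have nε : ‖(ε : ℂ)‖ = ε := by rw [Complex.norm_real, Real.norm_of_nonneg hε.le]
  calc _ ≤ ‖S.pairing‖⁻¹ * ((M * ε) * (B * (C₁ * (K * ε))) +
        ε * (‖S.D S.ψ₀ S.a‖ * (Ca * (K * ε))) + ε * (‖S.D S.ψ₀ S.b‖ * (Cb * (K * ε))) +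
        S.α⁻¹ * ε ^ 2 * (A * C₁)) := by
        gcongr
        refine (norm_add_le _ _).trans (add_le_add ((norm_sub_le _ _).trans (add_le_add
          ((norm_add_le _ _).trans (add_le_add ?_ ?_)) ?_)) ?_)
        · rw [norm_neg, norm_mul]; gcongr
        · rw [norm_mul, norm_mul (S.D _ _), nε]; gcongr; exact va.trans (by gcongr)
        · rw [norm_mul, norm_mul (S.D _ _), nε]; gcongr; exact vb.trans (by gcongr)
        · rw [norm_mul, nI]; gcongr
    _ = _ := by ring

/-- Near a resonance with non-vanishing pairing there is, for small `ε`, exactly one eigenvalue of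
the Orr–Sommerfeld operator on the deformed segment; it is simple and differentiable in `ε` at
`ε = 0`. -/
theorem exists_eigenvalue_branch : ∃ (c : ℝ → ℂ) (ν ε₀ : ℝ), 0 < ν ∧ 0 < ε₀ ∧
    (∀ ε ∈ Ioo 0 ε₀, c ε ∈ Metric.ball S.c₁ ν ∧
      (∀ c' ∈ Metric.ball S.c₁ ν, ∀ T : S.State, (∀ x ∈ Icc S.a S.b, T.op c' ε x = 0) →
        (∃ x ∈ Icc S.a S.b, T.ψ x ≠ 0) → c' = c ε) ∧
      ∃ T₀ : S.State, (∀ x ∈ Icc S.a S.b, T₀.op (c ε) ε x = 0) ∧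
        (∃ x ∈ Icc S.a S.b, T₀.ψ x ≠ 0) ∧
        (∀ T : S.State, (∀ x ∈ Icc S.a S.b, T.op (c ε) ε x = 0) →
          ∃ k, ∀ x ∈ Icc S.a S.b, T.ψ x = k * T₀.ψ x) ∧
        ∀ (T : S.State) (k : ℂ), (∀ x ∈ Icc S.a S.b, T.op (c ε) ε x = k * T₀.Ω x) → k = 0) ∧
    ∀ κa κb, S.IsLayerExponent S.a κa → S.IsLayerExponent S.b κb →
      (fun ε : ℝ => c ε - (S.c₁ + S.slope κa κb * ε)) =O[𝓝[>] (0 : ℝ)] fun ε : ℝ => ε ^ 2 := by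
  obtain ⟨h, hh, hgh⟩ := S.exists_pairing_eq_one
  obtain ⟨C, μ₀, hC1, hμ₀, hμ1, hE⟩ := S.bordered_estimate hh hgh
  have hC0 : 0 < C := by linarith
  have hI : S.pairing ≠ 0 := S.pairing_ne
  set ι := ‖S.pairing‖ with hι
  have hι0 : 0 < ι := norm_pos_iff.2 hI
  obtain ⟨ν, hν, hνμ, hνC⟩ : ∃ ν : ℝ, 0 < ν ∧ ν ≤ μ₀ ∧ C * (4 * ν) ≤ ι / 2 := by
    refine ⟨min μ₀ (ι / (8 * C)), by positivity, min_le_left _ _, ?_⟩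
    have : min μ₀ (ι / (8 * C)) ≤ ι / (8 * C) := min_le_right _ _
    rw [le_div_iff₀ (by positivity)] at this
    linarith
  obtain ⟨ε₀, hε₀, hεν, hεC⟩ : ∃ ε₀ : ℝ, 0 < ε₀ ∧ ε₀ ≤ ν ∧ C * ε₀ ≤ ι * ν / 4 := by
    refine ⟨min ν (ι * ν / (4 * C)), by positivity, min_le_left _ _, ?_⟩
    have : min ν (ι * ν / (4 * C)) ≤ ι * ν / (4 * C) := min_le_right _ _
    rw [le_div_iff₀ (by positivity)] at this
    linarith
  have hη : ∀ (ε : ℝ) (c : ℂ), ∃ η, 0 < ε → ε ≤ ε₀ → ‖c - S.c₁‖ ≤ ν → ∃ T, S.IsBordered h ε c T η := by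
    intro ε c
    by_cases hcond : 0 < ε ∧ ε ≤ ε₀ ∧ ‖c - S.c₁‖ ≤ ν
    · obtain ⟨⟨T, η, hT⟩, -⟩ := hE ε hcond.1 (hcond.2.1.trans (hεν.trans hνμ)) c
        (hcond.2.2.trans hνμ)
      exact ⟨η, fun _ _ _ => ⟨T, hT⟩⟩
    · exact ⟨0, fun h1 h2 h3 => absurd ⟨h1, h2, h3⟩ hcond⟩
  choose η hη using hη
  -- `η ε` is uniformly close to an affine function, so Newton's map is a contraction
  set Ψ : ℝ → ℂ → ℂ := fun ε c => c + η ε c / S.pairing with hΨ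
  have hlip : ∀ ε, 0 < ε → ε ≤ ε₀ → ∀ c c', ‖c - S.c₁‖ ≤ ν → ‖c' - S.c₁‖ ≤ ν →
      ‖Ψ ε c - Ψ ε c'‖ ≤ 1 / 2 * ‖c - c'‖ := by
    intro ε h1 h2 c c' h3 h4
    obtain ⟨T, hT⟩ := hη ε c h1 h2 h3
    obtain ⟨T', hT'⟩ := hη ε c' h1 h2 h4
    obtain ⟨-, -, hest⟩ := hE ε h1 (h2.trans (hεν.trans hνμ)) c (h3.trans hνμ)
    have h5 := (hest T _ hT).2.2.2.1 c' T' _ (h4.trans hνμ) hT'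
    have e : Ψ ε c - Ψ ε c' = S.pairing⁻¹ * ((η ε c - η ε c') + (c - c') * S.pairing) := by
      simp only [hΨ]; field_simp; ring
    rw [e, norm_mul, norm_inv]
    calc _ ≤ ι⁻¹ * (C * (4 * ν) * ‖c - c'‖) := by
          gcongr
          refine h5.trans ?_
          gcongr
          linarith
      _ ≤ ι⁻¹ * (ι / 2 * ‖c - c'‖) := by gcongr
      _ = _ := by field_simp
  have hstart : ∀ ε, 0 < ε → ε ≤ ε₀ → ‖Ψ ε S.c₁ - S.c₁‖ ≤ C / ι * ε := by
    intro ε h1 h2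
    have h3 : ‖S.c₁ - S.c₁‖ ≤ ν := by simpa using hν.le
    obtain ⟨T, hT⟩ := hη ε S.c₁ h1 h2 h3
    obtain ⟨-, -, hest⟩ := hE ε h1 (h2.trans (hεν.trans hνμ)) S.c₁ (h3.trans hνμ)
    have h5 := (hest T _ hT).2.1
    rw [sub_self, norm_zero, add_zero] at h5
    simp only [hΨ, add_sub_cancel_left, norm_div]
    rw [div_mul_eq_mul_div]
    gcongr
  have hfix : ∀ ε : ℝ, ∃ c, 0 < ε → ε ≤ ε₀ → ‖c - S.c₁‖ ≤ ν ∧ η ε c = 0 := by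
    intro ε
    by_cases hcond : 0 < ε ∧ ε ≤ ε₀
    swap
    · exact ⟨0, fun h1 h2 => absurd ⟨h1, h2⟩ hcond⟩
    obtain ⟨h1, h2⟩ := hcond
    have hmaps : MapsTo (Ψ ε) (Metric.closedBall S.c₁ ν) (Metric.closedBall S.c₁ ν) := by
      intro c hc
      rw [mem_closedBall_iff_norm] at hc ⊢
      have h3 := hlip ε h1 h2 c S.c₁ hc (by simpa using hν.le)
      have h4 := hstart ε h1 h2
      have h5 : C / ι * ε ≤ ν / 4 := by
        rw [div_mul_eq_mul_div, div_le_iff₀ hι0]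
        calc C * ε ≤ C * ε₀ := by gcongr
          _ ≤ _ := hεC
          _ = _ := by ring
      have h6 := norm_sub_le_norm_sub_add_norm_sub (Ψ ε c) (Ψ ε S.c₁) S.c₁
      linarith
    have hcontr : ContractingWith (1 / 2) (hmaps.restrict (Ψ ε) _ _) := by
      refine ⟨by norm_num, LipschitzWith.of_dist_le_mul fun x y => ?_⟩
      rw [Subtype.dist_eq, Subtype.dist_eq, dist_eq_norm, dist_eq_norm]
      have := hlip ε h1 h2 x y (mem_closedBall_iff_norm.1 x.2) (mem_closedBall_iff_norm.1 y.2)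
      simpa using this
    obtain ⟨y, hy, hfy, -⟩ := hcontr.exists_fixedPoint' Metric.isClosed_closedBall.isComplete hmaps
      (Metric.mem_closedBall_self hν.le) (edist_ne_top _ _)
    refine ⟨y, fun _ _ => ⟨mem_closedBall_iff_norm.1 hy, ?_⟩⟩
    have : y + η ε y / S.pairing = y := hfy
    simpa [hI] using this
  choose c hc using hfix
  have hclose : ∀ ε, 0 < ε → ε ≤ ε₀ → ‖c ε - S.c₁‖ ≤ 2 * (C / ι) * ε := by
    intro ε h1 h2
    obtain ⟨h3, h4⟩ := hc ε h1 h2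
    have h5 := hlip ε h1 h2 (c ε) S.c₁ h3 (by simpa using hν.le)
    have h6 := hstart ε h1 h2
    have h7 := norm_sub_le_norm_sub_add_norm_sub (Ψ ε (c ε)) (Ψ ε S.c₁) S.c₁
    have h8 : Ψ ε (c ε) = c ε := by simp [hΨ, h4]
    rw [h8] at h5 h7
    linarith
  have hball : ∀ ε ∈ Ioo 0 ε₀, ‖c ε - S.c₁‖ < ν := by
    intro ε hε
    refine (hclose ε hε.1 hε.2.le).trans_lt ?_
    calc 2 * (C / ι) * ε < 2 * (C / ι) * ε₀ := by have := hε.2; gcongr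
      _ = 2 * (C * ε₀) / ι := by ring
      _ ≤ 2 * (ι * ν / 4) / ι := by gcongr
      _ = ν / 2 := by field_simp; ring
      _ < ν := by linarith
  refine ⟨c, ν, ε₀, hν, hε₀, fun ε hε => ⟨mem_ball_iff_norm.2 (hball ε hε), ?_, ?_⟩, ?_⟩
  · intro c' hc' T hT hne
    have hc'' : ‖c' - S.c₁‖ ≤ ν := (mem_ball_iff_norm.1 hc').le
    obtain ⟨T', hT'⟩ := hη ε c' hε.1 hε.2.le hc''
    obtain ⟨-, hker, hest⟩ := hE ε hε.1 (hε.2.le.trans (hεν.trans hνμ)) c' (hc''.trans hνμ)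
    have hcoord : S.coord T.ψ ≠ 0 := fun h0 => by
      obtain ⟨x, hx, hne⟩ := hne
      exact hne (hker T hT h0 x hx)
    have hb : S.IsBordered h ε c' (T.smul (S.coord T.ψ)⁻¹) 0 := by
      refine ⟨fun x hx => by rw [T.smul_op, hT x hx]; ring, ?_⟩
      have := S.coord_sub_mul (f := fun _ => 0) continuousOn_const T.lap.continuousOn
        (-(S.coord T.ψ)⁻¹)
      simp only [neg_mul, sub_neg_eq_add, zero_add] at this
      change S.coord (fun x => (S.coord T.ψ)⁻¹ * T.ψ x) = 1
      rw [this, inv_mul_cancel₀ hcoord]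
      simp [coord]
    have h5 := (hest _ _ hb).2.2.2.1 c' T' _ (hc''.trans hνμ) hT'
    -- both `0` and `η ε c'` solve the bordered problem at `c'`
    simp only [sub_self, norm_zero, mul_zero, zero_mul, add_zero, zero_sub, norm_neg] at h5
    have h6 : η ε c' = 0 := norm_le_zero_iff.1 h5
    obtain ⟨h7, h8⟩ := hc ε hε.1 hε.2.le
    have h9 := hlip ε hε.1 hε.2.le c' (c ε) hc'' h7
    simp only [hΨ, h6, h8, zero_div, add_zero] at h9
    exact sub_eq_zero.1 (norm_le_zero_iff.1 (by linarith [norm_nonneg (c' - c ε)]))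
  · obtain ⟨h7, h8⟩ := hc ε hε.1 hε.2.le
    obtain ⟨T₀, hT₀⟩ := hη ε (c ε) hε.1 hε.2.le h7
    rw [h8] at hT₀
    obtain ⟨-, hker, hest⟩ := hE ε hε.1 (hε.2.le.trans (hεν.trans hνμ)) (c ε) (h7.trans hνμ)
    refine ⟨T₀, fun x hx => by rw [hT₀.1 x hx, zero_mul], ?_, fun T hT => ?_, fun T k hT => ?_⟩
    · by_contra! hcon
      have h1 := hT₀.2
      have h2 : S.coord T₀.ψ = 0 := by
        rw [coord, intervalIntegral.integral_congr (g := fun _ => 0) fun x hx => ?_]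
        · simp
        · rw [uIcc_of_le S.hab.le] at hx
          simp only [hcon x hx, mul_zero]
      rw [h2] at h1
      exact zero_ne_one h1
    · refine ⟨S.coord T.ψ, fun x hx => sub_eq_zero.1
        (hker (T.subSmul T₀ (S.coord T.ψ)) (fun x hx => ?_) ?_ x hx)⟩
      · rw [T.subSmul_op, hT x hx, hT₀.1 x hx]; ring
      · rw [S.coord_subSmul, hT₀.2]; ring
    · have h5 := (hest T₀ 0 hT₀).2.2.2.2 rfl T k hT
      by_contra hk
      have hk0 : 0 < ‖k‖ := norm_pos_iff.2 hk
      rw [norm_mul, ← hι] at h5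
      have h6 : C * (ε + ‖c ε - S.c₁‖) ≤ C * (4 * ν) := by
        gcongr
        have := hε.2.le
        linarith
      nlinarith
  -- the fixed point is `O(ε)`-close to `c₁`, as the expansion requires
  · intro κa κb ha hb
    obtain ⟨K, μ₁, hK, hμ₁, hexp⟩ := S.eigenvalue_expansion hh hgh ha hb (2 * (C / ι)) (by positivity)
    refine IsBigO.of_bound K ?_
    have hμ2 : 0 < min ε₀ (min μ₁ (μ₁ / (2 * (C / ι)))) := by positivity
    filter_upwards [Ioo_mem_nhdsGT hμ2] with ε hε
    have h1 : ε ≤ ε₀ := hε.2.le.trans (min_le_left _ _)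
    have h2 : ε ≤ μ₁ := hε.2.le.trans ((min_le_right _ _).trans (min_le_left _ _))
    have h3 : ε ≤ μ₁ / (2 * (C / ι)) := hε.2.le.trans ((min_le_right _ _).trans (min_le_right _ _))
    obtain ⟨h7, h8⟩ := hc ε hε.1 h1
    obtain ⟨T₀, hT₀⟩ := hη ε (c ε) hε.1 h1 h7
    rw [h8] at hT₀
    have h4 := hclose ε hε.1 h1
    have := hexp T₀ (c ε) ε hε.1 h2 (h4.trans ?_) h4
      (fun x hx => by rw [hT₀.1 x hx, zero_mul]) hT₀.2
    · rwa [norm_pow, Real.norm_of_nonneg hε.1.le]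
    · rw [le_div_iff₀ (by positivity)] at h3
      linarith

end RayleighResonance

/-! ### Absolutely continuous functions with complex values -/

section AC

variable {a b : ℝ}

theorem AbsolutelyContinuousOnInterval.of_dist_le {X Y : Type*} [PseudoMetricSpace X]
    [PseudoMetricSpace Y] {f : ℝ → X} {g : ℝ → Y} (hf : AbsolutelyContinuousOnInterval f a b)
    (h : ∀ x ∈ uIcc a b, ∀ y ∈ uIcc a b, dist (g x) (g y) ≤ dist (f x) (f y)) :
    AbsolutelyContinuousOnInterval g a b := by
  rw [absolutelyContinuousOnInterval_iff] at hf ⊢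
  intro ε hε
  obtain ⟨δ, hδ, hf⟩ := hf ε hε
  refine ⟨δ, hδ, fun E hE hE' => (Finset.sum_le_sum fun i hi => ?_).trans_lt (hf E hE hE')⟩
  exact h _ (hE.1 i hi).1 _ (hE.1 i hi).2

theorem AbsolutelyContinuousOnInterval.congr {X : Type*} [PseudoMetricSpace X] {f g : ℝ → X}
    (hf : AbsolutelyContinuousOnInterval f a b) (h : EqOn g f (uIcc a b)) :
    AbsolutelyContinuousOnInterval g a b :=
  hf.of_dist_le fun x hx y hy => by rw [h hx, h hy]

theorem absolutelyContinuousOnInterval_integral {g : ℝ → ℂ}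
    (hg : IntervalIntegrable g volume a b) :
    AbsolutelyContinuousOnInterval (fun x => ∫ t in a..x, g t) a b := by
  have hre : IntervalIntegrable (fun t => (g t).re) volume a b := ⟨hg.1.re, hg.2.re⟩
  have him : IntervalIntegrable (fun t => (g t).im) volume a b := ⟨hg.1.im, hg.2.im⟩
  have h1 := (hre.absolutelyContinuousOnInterval_intervalIntegral (c := a) left_mem_uIcc).of_dist_le
    (g := fun x => ((∫ t in a..x, (g t).re : ℝ) : ℂ)) fun x _ y _ => by
      rw [dist_eq_norm, dist_eq_norm, ← Complex.ofReal_sub, Complex.norm_real]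
  have h2 := (him.absolutelyContinuousOnInterval_intervalIntegral (c := a) left_mem_uIcc).of_dist_le
    (g := fun x => ((∫ t in a..x, (g t).im : ℝ) : ℂ)) fun x _ y _ => by
      rw [dist_eq_norm, dist_eq_norm, ← Complex.ofReal_sub, Complex.norm_real]
  refine (h1.add (h2.const_smul Complex.I)).congr fun x hx => ?_
  have hgx : IntervalIntegrable g volume a x := hg.mono_set (uIcc_subset_uIcc_left hx)
  have e1 : IntervalIntegrable (fun t => ((g t).re : ℂ)) volume a x :=
    ⟨hgx.1.re.ofReal, hgx.2.re.ofReal⟩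
  have e2 : IntervalIntegrable (fun t => ((g t).im : ℂ)) volume a x :=
    ⟨hgx.1.im.ofReal, hgx.2.im.ofReal⟩
  simp only [Pi.add_apply, smul_eq_mul]
  rw [← intervalIntegral.integral_ofReal, ← intervalIntegral.integral_ofReal,
    ← intervalIntegral.integral_const_mul, ← intervalIntegral.integral_add e1 (e2.const_mul _)]
  congr 1; ext t
  rw [mul_comm]; exact (Complex.re_add_im _).symm

/-- The fundamental theorem of calculus for absolutely continuous functions with complex values. -/
theorem AbsolutelyContinuousOnInterval.eq_add_integral (hab : a ≤ b) {F g : ℝ → ℂ}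
    (hF : AbsolutelyContinuousOnInterval F a b)
    (hg : derivWithin F (Icc a b) =ᵐ[volume.restrict (Icc a b)] g) :
    IntervalIntegrable g volume a b ∧ ∀ x ∈ Icc a b, F x = F a + ∫ t in a..x, g t := by
  have hre : AbsolutelyContinuousOnInterval (fun x => (F x).re) a b :=
    hF.of_dist_le fun x _ y _ => by
      rw [Real.dist_eq, dist_eq_norm, ← Complex.sub_re]; exact Complex.abs_re_le_norm _
  have him : AbsolutelyContinuousOnInterval (fun x => (F x).im) a b :=
    hF.of_dist_le fun x _ y _ => by
      rw [Real.dist_eq, dist_eq_norm, ← Complex.sub_im]; exact Complex.abs_im_le_norm _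
  have hg' : ∀ᵐ x, x ∈ uIoc a b → ((deriv (fun x => (F x).re) x : ℝ) : ℂ) +
      Complex.I * ((deriv (fun x => (F x).im) x : ℝ) : ℂ) = g x := by
    rw [Filter.EventuallyEq, ae_restrict_iff' measurableSet_Icc] at hg
    have hb : ∀ᵐ x : ℝ, x ≠ b := by simp [ae_iff, measure_singleton]
    filter_upwards [hg, hre.ae_differentiableAt, him.ae_differentiableAt, hb] with x h1 h2 h3 h4 h5
    rw [uIoc_of_le hab] at h5
    rw [uIcc_of_le hab] at h2 h3
    have hx : x ∈ Icc a b := Ioc_subset_Icc_self h5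
    have hn : Icc a b ∈ 𝓝 x := Icc_mem_nhds h5.1 (lt_of_le_of_ne h5.2 h4)
    rw [← h1 hx, derivWithin_of_mem_nhds hn]
    have h6 := (h2 hx).hasDerivAt.ofReal_comp.add ((h3 hx).hasDerivAt.ofReal_comp.const_mul Complex.I)
    refine (h6.congr_of_eventuallyEq (Eventually.of_forall fun t => ?_)).deriv.symm
    simp only [Pi.add_apply]
    rw [mul_comm]; exact (Complex.re_add_im _).symm
  have i1 := hre.intervalIntegrable_deriv
  have i2 := him.intervalIntegrable_deriv
  have i3 : IntervalIntegrable (fun x => ((deriv (fun x => (F x).re) x : ℝ) : ℂ)) volume a b :=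
    ⟨i1.1.ofReal, i1.2.ofReal⟩
  have i4 : IntervalIntegrable (fun x => ((deriv (fun x => (F x).im) x : ℝ) : ℂ)) volume a b :=
    ⟨i2.1.ofReal, i2.2.ofReal⟩
  have i5 := i3.add (i4.const_mul Complex.I)
  have hg'' := (ae_restrict_iff' measurableSet_uIoc).2 hg'
  refine ⟨i5.congr_ae hg'', fun x hx => ?_⟩
  have hsub : uIcc a x ⊆ uIcc a b := uIcc_subset_uIcc_left (by rwa [uIcc_of_le hab])
  have e1 := (hre.mono hsub).integral_deriv_eq_sub
  have e2 := (him.mono hsub).integral_deriv_eq_sub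
  have e3 : ∫ t in a..x, g t = ∫ t in a..x, (((deriv (fun x => (F x).re) t : ℝ) : ℂ) +
      Complex.I * ((deriv (fun x => (F x).im) t : ℝ) : ℂ)) := by
    refine intervalIntegral.integral_congr_ae ?_
    filter_upwards [hg'] with t ht htx
    refine (ht ?_).symm
    rw [uIoc_of_le hx.1] at htx
    rw [uIoc_of_le hab]
    exact ⟨htx.1, htx.2.trans hx.2⟩
  rw [e3, intervalIntegral.integral_add (i3.mono_set hsub) ((i4.mono_set hsub).const_mul _),
    intervalIntegral.integral_const_mul, intervalIntegral.integral_ofReal,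
    intervalIntegral.integral_ofReal, e1, e2]
  refine Complex.ext ?_ ?_ <;> simp

theorem ae_derivWithin_eq_of_eq_add_integral (hab : a ≤ b) {F g : ℝ → ℂ}
    (hg : IntervalIntegrable g volume a b)
    (h : ∀ x ∈ Icc a b, F x = F a + ∫ t in a..x, g t) :
    derivWithin F (Icc a b) =ᵐ[volume.restrict (Icc a b)] g := by
  rw [Filter.EventuallyEq, ae_restrict_iff' measurableSet_Icc]
  have hb : ∀ᵐ x : ℝ, x ≠ b := by simp [ae_iff, measure_singleton]
  have ha : ∀ᵐ x : ℝ, x ≠ a := by simp [ae_iff, measure_singleton]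
  filter_upwards [hg.ae_hasDerivAt_integral, hb, ha] with x h1 h2 h3 hx
  have hn : Icc a b ∈ 𝓝 x :=
    Icc_mem_nhds (lt_of_le_of_ne hx.1 h3.symm) (lt_of_le_of_ne hx.2 h2)
  rw [derivWithin_of_mem_nhds hn]
  refine (((h1 (by rwa [uIcc_of_le hab]) a left_mem_uIcc).const_add (F a)).congr_of_eventuallyEq
    ?_).deriv
  filter_upwards [hn] with t ht using h t ht

theorem absolutelyContinuousOnInterval_of_eq_add_integral (hab : a ≤ b) {F g : ℝ → ℂ}
    (hg : IntervalIntegrable g volume a b)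
    (h : ∀ x ∈ Icc a b, F x = F a + ∫ t in a..x, g t) :
    AbsolutelyContinuousOnInterval F a b :=
  (absolutelyContinuousOnInterval_integral hg).of_dist_le fun x hx y hy => by
    rw [uIcc_of_le hab] at hx hy
    rw [h x hx, h y hy, dist_add_left]

theorem absolutelyContinuousOnInterval_of_hasDerivWithinAt (hab : a ≤ b) {F g : ℝ → ℂ}
    (hg : ContinuousOn g (Icc a b)) (h : ∀ x ∈ Icc a b, HasDerivWithinAt F (g x) (Icc a b) x) :
    AbsolutelyContinuousOnInterval F a b := by
  refine absolutelyContinuousOnInterval_of_eq_add_integral hab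
    (ContinuousOn.intervalIntegrable_Icc hab hg) fun x hx => ?_
  have hs : Icc a x ⊆ Icc a b := Icc_subset_Icc le_rfl hx.2
  rw [integral_eq_sub_of_hasDerivWithinAt_Icc hx.1 (fun t ht => (h t (hs ht)).mono hs)
    (hg.mono hs)]
  ring

end AC

/-! ### Invertibility of the Orr–Sommerfeld operator on the real segment -/

section RealSegment

variable {a b : ℝ} {α ε : ℝ} {W : ℝ → ℂ} {c : ℂ}

theorem curveDeriv_zero (f : ℝ → ℂ) : curveDeriv a b 0 f = derivWithin f (Icc a b) := by
  ext x
  simp [curveDeriv, Pi.zero_def]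

theorem speed_zero (x : ℝ) : speed 0 x = 1 := by simp [speed, Pi.zero_def]

/-- `u` solves the Orr–Sommerfeld equation with right-hand side `f` in the sense of `H⁴`, where
`p`, `Ω`, `ρ` are `u'`, `u'' - α² u` and `Ω'`. -/
structure IsWeakOSSolution (a b α : ℝ) (κ : ℂ) (w w₂ f u p Ω ρ : ℝ → ℂ) : Prop where
  lap : LapOn a b 0 α u p Ω
  deriv : ∀ x ∈ Icc a b, HasDerivWithinAt Ω (ρ x) (Icc a b) x
  cont : ContinuousOn ρ (Icc a b)
  integrable : IntervalIntegrable
    (fun t => (α : ℂ) ^ 2 * Ω t + κ * (f t + w₂ t * u t - w t * Ω t)) volume a b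
  eqn : ∀ x ∈ Icc a b, ρ x = ρ a +
    ∫ t in a..x, ((α : ℂ) ^ 2 * Ω t + κ * (f t + w₂ t * u t - w t * Ω t))

theorem hasDerivWithinAt_of_ac (hab : a ≤ b) {F : ℝ → ℂ}
    (hF : AbsolutelyContinuousOnInterval F a b)
    (hg : AbsolutelyContinuousOnInterval (derivWithin F (Icc a b)) a b) {x : ℝ}
    (hx : x ∈ Icc a b) :
    HasDerivWithinAt F (derivWithin F (Icc a b) x) (Icc a b) x := by
  have h := (hF.eq_add_integral hab (EventuallyEq.refl _ _)).2
  have hc : ContinuousOn (derivWithin F (Icc a b)) (Icc a b) := by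
    simpa [uIcc_of_le hab] using hg.continuousOn
  exact ((hasDerivWithinAt_integral_Icc hab hc hx).const_add (F a)).congr_of_mem h hx

theorem orrSommerfeldOp_eq {u p Ω ρ : ℝ → ℂ} (hab : a < b) (h : LapOn a b 0 α u p Ω)
    (hρ : ∀ x ∈ Icc a b, HasDerivWithinAt Ω (ρ x) (Icc a b) x) {x : ℝ} (hx : x ∈ Icc a b) :
    orrSommerfeldOp a b 0 α W c ε u x =
      viscosity α ε * (derivWithin ρ (Icc a b) x - (α : ℂ) ^ 2 * Ω x) + (W x - c) * Ω x -
        curveDeriv a b 0 (curveDeriv a b 0 W) x * u x := by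
  have h1 : EqOn (curveLaplace a b 0 α u) Ω (Icc a b) := fun x hx => h.curveLaplace_eq hab hx
  have h2 : EqOn (curveDeriv a b 0 Ω) ρ (Icc a b) := fun x hx => by
    rw [curveDeriv_zero]
    exact (hρ x hx).derivWithin (uniqueDiffOn_Icc hab x hx)
  have h3 : curveDeriv a b 0 (curveDeriv a b 0 Ω) x = derivWithin ρ (Icc a b) x := by
    rw [curveDeriv_congr h2 hx, curveDeriv_zero]
  rw [orrSommerfeldOp, h1 hx, curveLaplace_congr h1 hx, curveLaplace, h3]
  rfl

/-- Regularity: elements of the domain of the Orr–Sommerfeld operator are solutions. -/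
theorem isWeakOSSolution_of_memCurveSobolev (hab : a < b) (hα : 0 < α) (hε : 0 < ε)
    {f u : ℝ → ℂ} (hu : MemCurveSobolev a b 0 4 u)
    (hP : orrSommerfeldOp a b 0 α W c ε u =ᵐ[volume.restrict (Icc a b)] f) :
    ∃ Ω ρ, IsWeakOSSolution a b α (viscosity α ε)⁻¹ (fun x => W x - c)
      (curveDeriv a b 0 (curveDeriv a b 0 W)) f u (curveDeriv a b 0 u) Ω ρ := by
  have h0 := hu.1 0 (by norm_num)
  have h1 := hu.1 1 (by norm_num)
  have h2 := hu.1 2 (by norm_num)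
  have h3 := hu.1 3 (by norm_num)
  simp only [Function.iterate_succ, Function.iterate_zero, Function.comp, id, curveDeriv_zero]
    at h0 h1 h2 h3
  rw [curveDeriv_zero u]
  set u₁ := derivWithin u (Icc a b)
  set u₂ := derivWithin u₁ (Icc a b)
  set u₃ := derivWithin u₂ (Icc a b)
  have d0 := fun x hx => hasDerivWithinAt_of_ac (x := x) hab.le h0 h1 hx
  have d1 := fun x hx => hasDerivWithinAt_of_ac (x := x) hab.le h1 h2 hx
  have d2 := fun x hx => hasDerivWithinAt_of_ac (x := x) hab.le h2 h3 hx
  have c0 : ContinuousOn u (Icc a b) := by simpa [uIcc_of_le hab.le] using h0.continuousOn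
  have c1 : ContinuousOn u₁ (Icc a b) := by simpa [uIcc_of_le hab.le] using h1.continuousOn
  have c2 : ContinuousOn u₂ (Icc a b) := by simpa [uIcc_of_le hab.le] using h2.continuousOn
  have c3 : ContinuousOn u₃ (Icc a b) := by simpa [uIcc_of_le hab.le] using h3.continuousOn
  have hlap : LapOn a b 0 α u u₁ (fun x => u₂ x - (α : ℂ) ^ 2 * u x) :=
    ⟨fun x hx => (d0 x hx).congr_deriv (by rw [speed_zero, one_mul]),
      fun x hx => (d1 x hx).congr_deriv (by rw [speed_zero]; ring), by fun_prop⟩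
  have hρ : ∀ x ∈ Icc a b, HasDerivWithinAt (fun x => u₂ x - (α : ℂ) ^ 2 * u x)
      (u₃ x - (α : ℂ) ^ 2 * u₁ x) (Icc a b) x := fun x hx =>
    (d2 x hx).sub ((d0 x hx).const_mul _)
  have hac : AbsolutelyContinuousOnInterval (fun x => u₃ x - (α : ℂ) ^ 2 * u₁ x) a b :=
    h3.sub (h1.const_smul ((α : ℂ) ^ 2))
  have hκ := viscosity_ne_zero hα hε
  have hder : derivWithin (fun x => u₃ x - (α : ℂ) ^ 2 * u₁ x) (Icc a b)
      =ᵐ[volume.restrict (Icc a b)] fun t => (α : ℂ) ^ 2 * (u₂ t - (α : ℂ) ^ 2 * u t) +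
        (viscosity α ε)⁻¹ * (f t + curveDeriv a b 0 (curveDeriv a b 0 W) t * u t -
          (W t - c) * (u₂ t - (α : ℂ) ^ 2 * u t)) := by
    filter_upwards [hP, ae_restrict_mem measurableSet_Icc] with x h4 h5
    rw [orrSommerfeldOp_eq hab hlap hρ h5] at h4
    rw [← h4]
    field_simp
    ring
  obtain ⟨h6, h7⟩ := hac.eq_add_integral hab.le hder
  exact ⟨_, _, hlap, hρ, by fun_prop, h6, h7⟩

/-- Solutions belong to the domain of the Orr–Sommerfeld operator. -/
theorem IsWeakOSSolution.memCurveSobolev (hab : a < b) (hα : 0 < α) (hε : 0 < ε)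
    (hW : ContDiffOn ℝ ∞ W (Icc a b)) {f u p Ω ρ : ℝ → ℂ}
    (hf : MemLp f 2 (volume.restrict (Icc a b)))
    (h : IsWeakOSSolution a b α (viscosity α ε)⁻¹ (fun x => W x - c)
      (curveDeriv a b 0 (curveDeriv a b 0 W)) f u p Ω ρ) :
    MemCurveSobolev a b 0 4 u ∧
      orrSommerfeldOp a b 0 α W c ε u =ᵐ[volume.restrict (Icc a b)] f := by
  have hU := uniqueDiffOn_Icc hab
  have cu := h.lap.continuousOn
  have cp := h.lap.continuousOn_deriv
  have cΩ := h.lap.cont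
  have cρ := h.cont
  have cW := hW.continuousOn
  have cW₂ : ContinuousOn (curveDeriv a b 0 (curveDeriv a b 0 W)) (Icc a b) :=
    (contDiffOn_curveDeriv hab contDiff_const (contDiffOn_curveDeriv hab contDiff_const hW)
      ).continuousOn
  have d0 : ∀ x ∈ Icc a b, HasDerivWithinAt u (p x) (Icc a b) x := fun x hx =>
    (h.lap.deriv_fst x hx).congr_deriv (by rw [speed_zero, one_mul])
  have d1 : ∀ x ∈ Icc a b, HasDerivWithinAt p (Ω x + (α : ℂ) ^ 2 * u x) (Icc a b) x := fun x hx =>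
    (h.lap.deriv_snd x hx).congr_deriv (by rw [speed_zero, one_mul])
  have d2 : ∀ x ∈ Icc a b, HasDerivWithinAt (fun x => Ω x + (α : ℂ) ^ 2 * u x)
      (ρ x + (α : ℂ) ^ 2 * p x) (Icc a b) x := fun x hx =>
    (h.deriv x hx).add ((d0 x hx).const_mul _)
  have hρac := absolutelyContinuousOnInterval_of_eq_add_integral hab.le h.integrable h.eqn
  have hρd := ae_derivWithin_eq_of_eq_add_integral hab.le h.integrable h.eqn
  have e1 : EqOn (derivWithin u (Icc a b)) p (Icc a b) := fun x hx => (d0 x hx).derivWithin (hU x hx)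
  have e2 : EqOn (derivWithin (derivWithin u (Icc a b)) (Icc a b))
      (fun x => Ω x + (α : ℂ) ^ 2 * u x) (Icc a b) := fun x hx => by
    rw [derivWithin_congr e1 (e1 hx)]; exact (d1 x hx).derivWithin (hU x hx)
  have e3 : EqOn (derivWithin (derivWithin (derivWithin u (Icc a b)) (Icc a b)) (Icc a b))
      (fun x => ρ x + (α : ℂ) ^ 2 * p x) (Icc a b) := fun x hx => by
    rw [derivWithin_congr e2 (e2 hx)]; exact (d2 x hx).derivWithin (hU x hx)
  have hκ := viscosity_ne_zero hα hε
  have a0 := absolutelyContinuousOnInterval_of_hasDerivWithinAt hab.le cp d0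
  have a1 := absolutelyContinuousOnInterval_of_hasDerivWithinAt hab.le (by fun_prop) d1
  have a2 := absolutelyContinuousOnInterval_of_hasDerivWithinAt hab.le (by fun_prop) d2
  have hder : derivWithin (fun x => ρ x + (α : ℂ) ^ 2 * p x) (Icc a b)
      =ᵐ[volume.restrict (Icc a b)] fun t => (viscosity α ε)⁻¹ * f t + ((α : ℂ) ^ 2 * Ω t +
        (viscosity α ε)⁻¹ * (curveDeriv a b 0 (curveDeriv a b 0 W) t * u t - (W t - c) * Ω t) +
        (α : ℂ) ^ 2 * (Ω t + (α : ℂ) ^ 2 * u t)) := by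
    have hi : IntervalIntegrable (fun t => ((α : ℂ) ^ 2 * Ω t + (viscosity α ε)⁻¹ * (f t +
        curveDeriv a b 0 (curveDeriv a b 0 W) t * u t - (W t - c) * Ω t)) +
        (α : ℂ) ^ 2 * (Ω t + (α : ℂ) ^ 2 * u t)) volume a b :=
      h.integrable.add (ContinuousOn.intervalIntegrable_Icc hab.le (by fun_prop))
    refine (ae_derivWithin_eq_of_eq_add_integral hab.le hi fun x hx => ?_).trans
      (Eventually.of_forall fun t => by beta_reduce; ring)
    have hs : Icc a x ⊆ Icc a b := Icc_subset_Icc le_rfl hx.2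
    have hpx := integral_eq_sub_of_hasDerivWithinAt_Icc hx.1
      (fun t ht => (d1 t (hs ht)).mono hs) (ContinuousOn.mono (by fun_prop) hs)
    rw [intervalIntegral.integral_add
      (h.integrable.mono_set (uIcc_subset_uIcc_left (by rwa [uIcc_of_le hab.le])))
      (ContinuousOn.intervalIntegrable_Icc hx.1 (ContinuousOn.mono (by fun_prop) hs)),
      intervalIntegral.integral_const_mul, hpx, h.eqn x hx]
    ring
  refine ⟨⟨fun j hj => ?_, ?_⟩, ?_⟩
  · have he : ∀ {F G : ℝ → ℂ}, AbsolutelyContinuousOnInterval G a b → EqOn F G (Icc a b) →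
        AbsolutelyContinuousOnInterval F a b := fun hG hFG =>
      hG.congr (by rwa [uIcc_of_le hab.le])
    interval_cases j
    · exact a0
    · simp only [Function.iterate_succ, Function.iterate_zero, Function.comp, id, curveDeriv_zero]
      exact he a1 e1
    · simp only [Function.iterate_succ, Function.iterate_zero, Function.comp, id, curveDeriv_zero]
      exact he a2 e2
    · simp only [Function.iterate_succ, Function.iterate_zero, Function.comp, id, curveDeriv_zero]
      exact he (hρac.add (a1.const_smul ((α : ℂ) ^ 2))) e3
  · have hcont : ∀ {g : ℝ → ℂ}, ContinuousOn g (Icc a b) →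
        MemLp g 2 (volume.restrict (Icc a b)) := fun {g} hg => by
      obtain ⟨M, hM0, hM⟩ := exists_norm_le_Icc hg
      exact MemLp.of_bound (hg.aestronglyMeasurable measurableSet_Icc) M
        ((ae_restrict_iff' measurableSet_Icc).2 (Eventually.of_forall hM))
    refine MemLp.ae_eq ?_ ((hf.const_mul (viscosity α ε)⁻¹).add (hcont (g := fun t =>
      ((α : ℂ) ^ 2 * Ω t + (viscosity α ε)⁻¹ * (curveDeriv a b 0 (curveDeriv a b 0 W) t * u t -
        (W t - c) * Ω t) + (α : ℂ) ^ 2 * (Ω t + (α : ℂ) ^ 2 * u t))) (by fun_prop)))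
    change _ =ᵐ[_] curveDeriv a b 0 (curveDeriv a b 0 (curveDeriv a b 0 (curveDeriv a b 0 u)))
    rw [curveDeriv_zero u, curveDeriv_zero (derivWithin u _), curveDeriv_zero (derivWithin _ _),
      curveDeriv_zero (derivWithin _ _)]
    refine hder.symm.trans ?_
    filter_upwards [ae_restrict_mem measurableSet_Icc] with x hx
    exact (derivWithin_congr e3 (e3 hx)).symm
  · filter_upwards [hρd, ae_restrict_mem measurableSet_Icc] with x h4 h5
    rw [orrSommerfeldOp_eq hab h.lap h.deriv h5, h4]
    field_simp
    ring

/-- The homogeneous Orr–Sommerfeld system with all four boundary conditions has only the zero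
solution. -/
def HasTrivialKernel (a b α : ℝ) (W : ℝ → ℂ) (ε : ℝ) (c : ℂ) : Prop :=
  ∀ y : ℝ → OSPhase, SolvesOn a b (fun x => osSystem α (viscosity α ε)⁻¹ (speed 0 x) (W x - c)
    (curveDeriv a b 0 (curveDeriv a b 0 W) x)) y → (y a).1 = 0 → (y b).1 = 0 →
      ∀ x ∈ Icc a b, y x = 0

theorem SolvesOn.isWeakOSSolution (hab : a < b) (hW : ContDiffOn ℝ ∞ W (Icc a b)) {κ : ℂ}
    {y : ℝ → OSPhase} {f : ℝ → ℂ} (hf : IntervalIntegrable f volume a b)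
    (hy : ∀ x ∈ Icc a b, HasDerivWithinAt y (osSystem α κ (speed 0 x) (W x - c)
      (curveDeriv a b 0 (curveDeriv a b 0 W) x) (y x) + ((0, 0), (∫ t in a..x, κ * f t, 0)))
      (Icc a b) x) :
    IsWeakOSSolution a b α κ (fun x => W x - c) (curveDeriv a b 0 (curveDeriv a b 0 W)) f
      (fun x => (y x).1.1) (fun x => (y x).1.2) (fun x => (y x).2.1)
      (fun x => (y x).2.2 + ∫ t in a..x, κ * f t) := by
  have hc : ContinuousOn y (Icc a b) := fun x hx => (hy x hx).continuousWithinAt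
  have cW := hW.continuousOn
  have cW₂ : ContinuousOn (curveDeriv a b 0 (curveDeriv a b 0 W)) (Icc a b) :=
    (contDiffOn_curveDeriv hab contDiff_const (contDiffOn_curveDeriv hab contDiff_const hW)
      ).continuousOn
  have ci : ContinuousOn (fun x => ∫ t in a..x, κ * f t) (Icc a b) := by
    have := intervalIntegral.continuousOn_primitive_interval' (hf.const_mul κ) left_mem_uIcc
    rwa [uIcc_of_le hab.le] at this
  have cg : ContinuousOn (fun t => (α : ℂ) ^ 2 * (y t).2.1 + κ *
    (curveDeriv a b 0 (curveDeriv a b 0 W) t * (y t).1.1 - (W t - c) * (y t).2.1)) (Icc a b) := by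
    fun_prop
  have d3 : ∀ x ∈ Icc a b, HasDerivWithinAt (fun x => (y x).2.2) ((α : ℂ) ^ 2 * (y x).2.1 + κ *
      (curveDeriv a b 0 (curveDeriv a b 0 W) x * (y x).1.1 - (W x - c) * (y x).2.1))
      (Icc a b) x := fun x hx => by
    refine (hy x hx).osPhase.2.2.2.congr_deriv ?_
    simp [osSystem_apply, speed_zero]
  have hg : (fun t => (α : ℂ) ^ 2 * (y t).2.1 + κ * (f t + curveDeriv a b 0
      (curveDeriv a b 0 W) t * (y t).1.1 - (W t - c) * (y t).2.1)) = fun t =>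
      ((α : ℂ) ^ 2 * (y t).2.1 + κ * (curveDeriv a b 0 (curveDeriv a b 0 W) t * (y t).1.1 -
        (W t - c) * (y t).2.1)) + κ * f t := by
    ext t; ring
  refine ⟨⟨fun x hx => ?_, fun x hx => ?_, by fun_prop⟩, fun x hx => ?_, by fun_prop, ?_,
    fun x hx => ?_⟩
  · refine (hy x hx).osPhase.1.congr_deriv ?_
    simp [osSystem_apply]
  · refine (hy x hx).osPhase.2.1.congr_deriv ?_
    simp [osSystem_apply]
  · refine (hy x hx).osPhase.2.2.1.congr_deriv ?_
    simp [osSystem_apply, speed_zero]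
  · rw [hg]
    exact (ContinuousOn.intervalIntegrable_Icc hab.le cg).add (hf.const_mul κ)
  · have hs : Icc a x ⊆ Icc a b := Icc_subset_Icc le_rfl hx.2
    have h1 := integral_eq_sub_of_hasDerivWithinAt_Icc hx.1
      (fun t ht => (d3 t (hs ht)).mono hs) (cg.mono hs)
    have hfx : IntervalIntegrable f volume a x :=
      hf.mono_set (uIcc_subset_uIcc_left (by rwa [uIcc_of_le hab.le]))
    rw [hg, intervalIntegral.integral_add
      (ContinuousOn.intervalIntegrable_Icc hx.1 (cg.mono hs)) (hfx.const_mul κ), h1]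
    simp only [intervalIntegral.integral_same, add_zero]
    ring

/-- The difference of two solutions is a classical solution of the homogeneous system. -/
theorem IsWeakOSSolution.solvesOn_sub (hab : a < b) (hW : ContDiffOn ℝ ∞ W (Icc a b)) {κ : ℂ}
    {f u p Ω ρ u' p' Ω' ρ' : ℝ → ℂ}
    (h : IsWeakOSSolution a b α κ (fun x => W x - c) (curveDeriv a b 0 (curveDeriv a b 0 W))
      f u p Ω ρ)
    (h' : IsWeakOSSolution a b α κ (fun x => W x - c) (curveDeriv a b 0 (curveDeriv a b 0 W))
      f u' p' Ω' ρ') :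
    SolvesOn a b (fun x => osSystem α κ (speed 0 x) (W x - c)
      (curveDeriv a b 0 (curveDeriv a b 0 W) x))
      fun x => ((u x - u' x, p x - p' x), (Ω x - Ω' x, ρ x - ρ' x)) := by
  have cW := hW.continuousOn
  have cW₂ : ContinuousOn (curveDeriv a b 0 (curveDeriv a b 0 W)) (Icc a b) :=
    (contDiffOn_curveDeriv hab contDiff_const (contDiffOn_curveDeriv hab contDiff_const hW)
      ).continuousOn
  have c1 := h.lap.continuousOn; have c2 := h'.lap.continuousOn
  have c3 := h.lap.cont; have c4 := h'.lap.cont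
  have cg : ContinuousOn (fun t => (α : ℂ) ^ 2 * (Ω t - Ω' t) + κ *
    (curveDeriv a b 0 (curveDeriv a b 0 W) t * (u t - u' t) - (W t - c) * (Ω t - Ω' t)))
    (Icc a b) := by
    fun_prop
  have hρ : ∀ x ∈ Icc a b, ρ x - ρ' x = (ρ a - ρ' a) + ∫ t in a..x,
      ((α : ℂ) ^ 2 * (Ω t - Ω' t) + κ * (curveDeriv a b 0 (curveDeriv a b 0 W) t * (u t - u' t) -
        (W t - c) * (Ω t - Ω' t))) := fun x hx => by
    have hsub : uIcc a x ⊆ uIcc a b := uIcc_subset_uIcc_left (by rwa [uIcc_of_le hab.le])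
    rw [h.eqn x hx, h'.eqn x hx, add_sub_add_comm, ← intervalIntegral.integral_sub
      (h.integrable.mono_set hsub) (h'.integrable.mono_set hsub)]
    congr 2; ext t; ring
  have l1 := h.lap.sub h'.lap
  intro x hx
  refine (((l1.deriv_fst x hx).prodMk (l1.deriv_snd x hx)).prodMk
    (((h.deriv x hx).sub (h'.deriv x hx)).prodMk
      (((hasDerivWithinAt_integral_Icc hab.le cg hx).const_add _).congr_of_mem hρ hx))).congr_deriv ?_
  rw [osSystem_apply, speed_zero]
  simp

/-- Invertibility onto `L²` is the absence of non-trivial classical solutions. -/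
theorem isInvertibleOntoL2_iff (hab : a < b) (hα : 0 < α) (hε : 0 < ε)
    (hW : ContDiffOn ℝ ∞ W (Icc a b)) :
    IsInvertibleOntoL2 a b (fun ψ => MemCurveSobolev a b 0 4 ψ ∧ DirichletNeumannBC a b 0 ψ)
      (orrSommerfeldOp a b 0 α W c ε) ↔ HasTrivialKernel a b α W ε c := by
  have cW₂ : ContinuousOn (curveDeriv a b 0 (curveDeriv a b 0 W)) (Icc a b) :=
    (contDiffOn_curveDeriv hab contDiff_const (contDiffOn_curveDeriv hab contDiff_const hW)
      ).continuousOn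
  set κ := (viscosity α ε)⁻¹
  have hB := continuousOn_osSystem (α := α) (κ := κ) (s := speed 0)
    (w := fun x => W x - c) (contDiff_speed contDiff_const).continuous.continuousOn
    (hW.continuousOn.sub continuousOn_const) cW₂
  have ha : a ∈ Icc a b := left_mem_Icc.2 hab.le
  have hb : b ∈ Icc a b := right_mem_Icc.2 hab.le
  constructor
  · intro h y hy hya hyb
    have hw := SolvesOn.isWeakOSSolution hab hW (κ := κ) (f := fun _ => 0) (y := y) (c := c) (α := α)
      intervalIntegrable_const fun x hx => by
        refine (hy x hx).congr_deriv ?_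
        have : (((0, 0), (∫ t in a..x, κ * (0 : ℂ), 0)) : OSPhase) = 0 := by simp
        rw [this, add_zero]
    have h0 : MemLp (fun _ : ℝ => (0 : ℂ)) 2 (volume.restrict (Icc a b)) := MemLp.zero'
    obtain ⟨hm, hP⟩ := hw.memCurveSobolev hab hα hε hW h0
    obtain ⟨ψ, -, -, huniq⟩ := h _ h0
    have hz : ∀ z : ℝ → ℂ, EqOn z (fun _ => 0) (Icc a b) →
        EqOn (curveDeriv a b 0 z) (fun _ => 0) (Icc a b) := fun z hz x hx => by
      rw [curveDeriv_congr hz hx, curveDeriv_zero]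
      simp
    have hzero : IsWeakOSSolution a b α κ (fun x => W x - c)
        (curveDeriv a b 0 (curveDeriv a b 0 W)) (fun _ => 0) (fun _ => 0) (fun _ => 0)
        (fun _ => 0) (fun _ => 0) :=
      ⟨⟨fun x _ => by simpa using hasDerivWithinAt_const x _ (0 : ℂ),
        fun x _ => by simpa using hasDerivWithinAt_const x _ (0 : ℂ), continuousOn_const⟩,
        fun x _ => by simpa using hasDerivWithinAt_const x _ (0 : ℂ), continuousOn_const,
        by simp, by simp⟩
    obtain ⟨hm0, hP0⟩ := hzero.memCurveSobolev hab hα hε hW h0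
    have hz0 := hz _ fun _ _ => rfl
    have e0 := huniq _ ⟨hm0, ⟨rfl, rfl⟩, hz0 ha, hz0 hb⟩ hP0
    have hD := fun x hx => hw.lap.curveDeriv_eq hab (x := x) hx
    have e1 := huniq _ ⟨hm, ⟨congrArg Prod.fst hya, congrArg Prod.fst hyb⟩,
      (hD a ha).trans (congrArg Prod.snd hya), (hD b hb).trans (congrArg Prod.snd hyb)⟩ hP
    have z0 : EqOn (fun x => (y x).1.1) (fun _ => 0) (Icc a b) := e1.trans e0.symm
    have z1 : EqOn (fun x => (y x).1.2) (fun _ => 0) (Icc a b) := fun x hx => by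
      rw [← hD x hx]; exact hz _ z0 hx
    have z2 : EqOn (fun x => (y x).2.1) (fun _ => 0) (Icc a b) := fun x hx => by
      rw [← hw.lap.curveLaplace_eq hab hx, curveLaplace, curveDeriv_congr (hz _ z0) hx,
        hz0 hx]
      have := z0 hx
      beta_reduce at this ⊢
      rw [this]; ring
    have z3 : EqOn (fun x => (y x).2.2) (fun _ => 0) (Icc a b) := fun x hx => by
      have h4 := hw.deriv x hx
      have h5 := h4.derivWithin (uniqueDiffOn_Icc hab x hx)
      have h6 := hz _ z2 hx
      rw [curveDeriv_zero, h5] at h6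
      simpa using h6
    intro x hx
    exact Prod.ext (Prod.ext (z0 hx) (z1 hx)) (Prod.ext (z2 hx) (z3 hx))
  · intro h f hf
    have hfi : IntervalIntegrable f volume a b := by
      rw [intervalIntegrable_iff_integrableOn_Icc_of_le hab.le]
      exact hf.integrable (by norm_num)
    obtain ⟨Φ, hΦ⟩ := exists_solutionMap hab.le hB
    have ci : ContinuousOn (fun x => ∫ t in a..x, κ * f t) (Icc a b) := by
      have := intervalIntegral.continuousOn_primitive_interval' (hfi.const_mul κ) left_mem_uIcc
      rwa [uIcc_of_le hab.le] at this
    -- `f` is only square integrable, so the system is written for `∂Ω - ∫ κ f`, which is `C¹`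
    obtain ⟨y₁, hy₁a, hy₁⟩ := exists_solvesOn_forced hab.le hB
      (g := fun x => (((0, 0), (∫ t in a..x, κ * f t, 0)) : OSPhase)) (by fun_prop)
    -- the map from `(Ω(a), ∂Ω(a))` to `(ψ(b), ∂ψ(b))`
    let A : (ℂ × ℂ) →ₗ[ℂ] (ℂ × ℂ) :=
      LinearMap.fst ℂ _ _ ∘ₗ LinearMap.proj b ∘ₗ Φ ∘ₗ LinearMap.inr ℂ (ℂ × ℂ) (ℂ × ℂ)
    have hA : ∀ v, A v = (Φ (0, v) b).1 := fun v => rfl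
    have hAinj : Function.Injective A := by
      rw [injective_iff_map_eq_zero]
      intro v hv
      have := h (Φ (0, v)) (hΦ _).2 (by rw [(hΦ _).1]) (by rw [← hA, hv]) a ha
      rw [(hΦ _).1] at this
      exact (Prod.mk.inj this).2
    obtain ⟨v, hv⟩ := (LinearMap.injective_iff_surjective.1 hAinj) (-(y₁ b).1)
    rw [hA] at hv
    set y : ℝ → OSPhase := fun x => Φ (0, v) x + y₁ x with hy
    have hyd : ∀ x ∈ Icc a b, HasDerivWithinAt y (osSystem α κ (speed 0 x) (W x - c)
      (curveDeriv a b 0 (curveDeriv a b 0 W) x) (y x) + ((0, 0), (∫ t in a..x, κ * f t, 0)))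
      (Icc a b) x := fun x hx => by
      refine (((hΦ (0, v)).2 x hx).add (hy₁ x hx)).congr_deriv ?_
      simp only [hy, map_add]
      rw [add_assoc]
    have hw := SolvesOn.isWeakOSSolution hab hW hfi hyd
    have hya : (y a).1 = 0 := by simp [hy, hΦ, hy₁a]
    have hyb : (y b).1 = 0 := by simp [hy, hv]
    obtain ⟨hm, hP⟩ := hw.memCurveSobolev hab hα hε hW hf
    have hD := fun x hx => hw.lap.curveDeriv_eq hab (x := x) hx
    refine ⟨_, ⟨hm, ⟨congrArg Prod.fst hya, congrArg Prod.fst hyb⟩,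
      (hD a ha).trans (congrArg Prod.snd hya), (hD b hb).trans (congrArg Prod.snd hyb)⟩, hP, fun φ hφ hPφ x hx => ?_⟩
    obtain ⟨Ω, ρ, hwφ⟩ := isWeakOSSolution_of_memCurveSobolev hab hα hε hφ.1 hPφ
    have h1 := h _ (hwφ.solvesOn_sub hab hW hw)
      (by simp [hφ.2.1.1, hφ.2.2.1, hya]) (by simp [hφ.2.1.2, hφ.2.2.2, hyb]) x hx
    exact sub_eq_zero.1 (Prod.mk.inj (Prod.mk.inj h1).1).1

end RealSegment

/-! ### Eigenfunctions and Jordan chains as solutions of a linear system -/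

/-- The coefficient of the system for pairs `(ψ, ψ₁)` with `P ψ = 0` and `P ψ₁ = (∂² - α²)ψ`. -/
def pairSystem (α : ℝ) (κ s w w₂ : ℂ) : (OSPhase × OSPhase) →L[ℂ] (OSPhase × OSPhase) :=
  (ContinuousLinearMap.inl ℂ OSPhase OSPhase).comp
      ((osSystem α κ s w w₂).comp (ContinuousLinearMap.fst ℂ OSPhase OSPhase)) +
    (ContinuousLinearMap.inr ℂ OSPhase OSPhase).comp
      ((osSystem α κ s w w₂).comp (ContinuousLinearMap.snd ℂ OSPhase OSPhase) +
        (s * κ) • osVorticity.comp (ContinuousLinearMap.fst ℂ OSPhase OSPhase))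

theorem pairSystem_apply (α : ℝ) (κ s w w₂ : ℂ) (Y : OSPhase × OSPhase) :
    pairSystem α κ s w w₂ Y = (osSystem α κ s w w₂ Y.1,
      osSystem α κ s w w₂ Y.2 + ((0, 0), (0, s * (κ * Y.1.2.1)))) := by
  have : (s * κ) • osVorticity Y.1 = ((0, 0), (0, s * (κ * Y.1.2.1))) := by
    ext <;> simp [osVorticity, mul_assoc]
  simp [pairSystem, this]

theorem continuousOn_pairSystem {X : Type*} [TopologicalSpace X] {α : ℝ} {κ : ℂ} {s w w₂ : X → ℂ}
    {A : Set X} (hs : ContinuousOn s A) (hw : ContinuousOn w A) (hw₂ : ContinuousOn w₂ A) :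
    ContinuousOn (fun x => pairSystem α κ (s x) (w x) (w₂ x)) A := by
  have := continuousOn_osSystem (α := α) (κ := κ) hs hw hw₂
  unfold pairSystem
  fun_prop

section Pair

variable {a b : ℝ} {α : ℝ} {κ : ℂ} {s w w₂ : ℝ → ℂ}

theorem solvesOn_pairSystem {y z : ℝ → OSPhase}
    (hy : SolvesOn a b (fun x => osSystem α κ (s x) (w x) (w₂ x)) y)
    (hz : ∀ x ∈ Icc a b, HasDerivWithinAt z (osSystem α κ (s x) (w x) (w₂ x) (z x) +
      ((0, 0), (0, s x * (κ * (y x).2.1)))) (Icc a b) x) :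
    SolvesOn a b (fun x => pairSystem α κ (s x) (w x) (w₂ x)) fun x => (y x, z x) := fun x hx => by
  rw [pairSystem_apply]
  exact (hy x hx).prodMk (hz x hx)

theorem SolvesOn.of_pairSystem {Y : ℝ → OSPhase × OSPhase}
    (h : SolvesOn a b (fun x => pairSystem α κ (s x) (w x) (w₂ x)) Y) :
    SolvesOn a b (fun x => osSystem α κ (s x) (w x) (w₂ x)) (fun x => (Y x).1) ∧
    ∀ x ∈ Icc a b, HasDerivWithinAt (fun x => (Y x).2) (osSystem α κ (s x) (w x) (w₂ x) (Y x).2 +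
      ((0, 0), (0, s x * (κ * (Y x).1.2.1)))) (Icc a b) x := by
  have h' := fun x hx => by
    have := h x hx
    rw [pairSystem_apply] at this
    exact this
  exact ⟨fun x hx => (ContinuousLinearMap.fst ℝ OSPhase OSPhase).hasFDerivAt.comp_hasDerivWithinAt x
      (h' x hx),
    fun x hx => (ContinuousLinearMap.snd ℝ OSPhase OSPhase).hasFDerivAt.comp_hasDerivWithinAt x
      (h' x hx)⟩

end Pair

theorem curveDeriv_const_mul {a b : ℝ} {m : ℝ → ℝ} (k : ℂ) (f : ℝ → ℂ) :
    curveDeriv a b m (fun x => k * f x) = fun x => k * curveDeriv a b m f x := by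
  ext x
  have : derivWithin (fun x => k * f x) (Icc a b) x = k * derivWithin f (Icc a b) x :=
    derivWithin_const_mul_field k
  simp only [curveDeriv, this]
  ring

theorem curveLaplace_const_mul {a b : ℝ} {m : ℝ → ℝ} {α : ℝ} (k : ℂ) (f : ℝ → ℂ) :
    curveLaplace a b m α (fun x => k * f x) = fun x => k * curveLaplace a b m α f x := by
  ext x
  simp only [curveLaplace]
  rw [curveDeriv_const_mul, curveDeriv_const_mul]
  ring

theorem curveDeriv_eqOn_zero {a b : ℝ} {m : ℝ → ℝ} {f : ℝ → ℂ} (h : ∀ x ∈ Icc a b, f x = 0) :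
    ∀ x ∈ Icc a b, curveDeriv a b m f x = 0 := fun x hx => by
  rw [curveDeriv_congr (g := fun _ => 0) h hx]
  simp [curveDeriv]

namespace RayleighResonance

variable (S : RayleighResonance)

/-- Solutions of the system for pairs on the deformed segment are states. -/
theorem exists_states {ε : ℝ} (hε : 0 < ε) {c : ℂ} {Y : ℝ → OSPhase × OSPhase}
    (hY : SolvesOn S.a S.b (fun x => pairSystem S.α (viscosity S.α ε)⁻¹ (speed S.m x)
      (S.W x - c) (S.W₂ x)) Y)
    (h1 : (Y S.a).1.1 = 0) (h2 : (Y S.a).2.1 = 0) (h3 : (Y S.b).1.1 = 0) (h4 : (Y S.b).2.1 = 0) :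
    ∃ T T₁ : S.State, (∀ x ∈ Icc S.a S.b, T.op c ε x = 0) ∧
      (∀ x ∈ Icc S.a S.b, T₁.op c ε x = T.Ω x) ∧ (T.Ω S.a, T.ρ S.a) = (Y S.a).1.2 ∧
        (T₁.Ω S.a, T₁.ρ S.a) = (Y S.a).2.2 := by
  obtain ⟨hy, hz⟩ := hY.of_pairSystem
  have cY := hY.continuousOn
  have cw : ContinuousOn (fun x => S.W x - c) (Icc S.a S.b) :=
    S.hW.continuousOn.sub continuousOn_const
  have cw₂ := S.contDiffOn_W₂.continuousOn
  have hκ := mul_inv_cancel₀ (viscosity_ne_zero S.hα hε)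
  set κ := (viscosity S.α ε)⁻¹
  have hy' : ∀ x ∈ Icc S.a S.b, HasDerivWithinAt (fun x => (Y x).1)
      (osSystem S.α κ (speed S.m x) (S.W x - c) (S.W₂ x) (Y x).1 +
        ((0, 0), (0, speed S.m x * (κ * 0)))) (Icc S.a S.b) x := fun x hx => by
    refine (hy x hx).congr_deriv ?_
    ext <;> simp
  obtain ⟨l1, l2⟩ := lapOn_of_osSystem (f := fun _ => 0) cw cw₂ continuousOn_const hy'
  obtain ⟨l3, l4⟩ := lapOn_of_osSystem (f := fun x => (Y x).1.2.1) cw cw₂ (by fun_prop) hz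
  refine ⟨⟨_, _, _, _, _, l1, l2, by simp [h1], by simp [h3], by simp [h1], by simp [h3]⟩,
    ⟨_, _, _, _, _, l3, l4, by simp [h2], by simp [h4], by simp [h2], by simp [h4]⟩,
    fun x hx => ?_, fun x hx => ?_, rfl, rfl⟩
  · simp only [State.op]
    change viscosity S.α ε * _ + _ - _ = _
    linear_combination (S.W₂ x * (Y x).1.1.1 - (S.W x - c) * (Y x).1.2.1) * hκ
  · simp only [State.op]
    change viscosity S.α ε * _ + _ - _ = _
    linear_combination ((Y x).1.2.1 + S.W₂ x * (Y x).2.1.1 - (S.W x - c) * (Y x).2.2.1) * hκ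

variable {S} in
/-- States with `P ψ = 0` are solutions of the Orr–Sommerfeld system. -/
theorem State.solvesOn (T : S.State) {ε : ℝ} (hε : 0 < ε) {c : ℂ}
    (h : ∀ x ∈ Icc S.a S.b, T.op c ε x = 0) :
    SolvesOn S.a S.b (fun x => osSystem S.α (viscosity S.α ε)⁻¹ (speed S.m x)
      (S.W x - c) (S.W₂ x)) fun x => ((T.ψ x, T.p x), (T.Ω x, T.ρ x)) := by
  have hκ := viscosity_ne_zero S.hα hε
  intro x hx
  refine (solvesOn_osSystem_of_lapOn (w := fun x => S.W x - c) (w₂ := S.W₂) (f := fun _ => 0)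
    (κ := (viscosity S.α ε)⁻¹) T.lap T.lap' (fun x hx => ?_) x hx).congr_deriv ?_
  · have h1 := h x hx
    simp only [State.op] at h1
    change viscosity S.α ε * _ + _ - _ = _ at h1
    rw [eq_inv_mul_iff_mul_eq₀ hκ]
    linear_combination h1
  · simp only [mul_zero]
    exact add_zero _

variable {S} in
theorem State.eq_zero_of_ψ (T : S.State) (h : ∀ x ∈ Icc S.a S.b, T.ψ x = 0) :
    (∀ x ∈ Icc S.a S.b, T.Ω x = 0) ∧ ∀ x ∈ Icc S.a S.b, T.ρ x = 0 := by
  have hΩ : ∀ x ∈ Icc S.a S.b, T.Ω x = 0 := fun x hx => by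
    rw [← T.lap.curveLaplace_eq S.hab hx, curveLaplace, h x hx, mul_zero, sub_zero]
    exact curveDeriv_eqOn_zero (curveDeriv_eqOn_zero h) x hx
  refine ⟨hΩ, fun x hx => ?_⟩
  rw [← T.lap'.curveDeriv_eq S.hab hx]
  exact curveDeriv_eqOn_zero hΩ x hx

end RayleighResonance

/-! ### The multiplicity on the real segment -/

section Multiplicity

variable {a b : ℝ} {α ε : ℝ} {W : ℝ → ℂ} {c : ℂ}

theorem contDiffOn_osSystem {κ : ℂ} {s w w₂ : ℝ → ℂ} (hs : ContDiffOn ℝ ∞ s (Icc a b))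
    (hw : ContDiffOn ℝ ∞ w (Icc a b)) (hw₂ : ContDiffOn ℝ ∞ w₂ (Icc a b)) :
    ContDiffOn ℝ ∞ (fun x => osSystem α κ (s x) (w x) (w₂ x)) (Icc a b) := by
  unfold osSystem
  exact hs.smul ((contDiffOn_const.add ((contDiffOn_const.mul hw₂).smul contDiffOn_const)).sub
    ((contDiffOn_const.mul hw).smul contDiffOn_const))

theorem contDiffOn_curveDeriv_curveDeriv (hab : a < b) (hW : ContDiffOn ℝ ∞ W (Icc a b)) :
    ContDiffOn ℝ ∞ (curveDeriv a b 0 (curveDeriv a b 0 W)) (Icc a b) :=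
  contDiffOn_curveDeriv hab contDiff_const (contDiffOn_curveDeriv hab contDiff_const hW)

/-- Smooth functions are solutions of the Orr–Sommerfeld system, with a right-hand side. -/
theorem hasDerivWithinAt_of_contDiffOn (hab : a < b) (hα : 0 < α) (hε : 0 < ε) {ψ f : ℝ → ℂ}
    (hψ : ContDiffOn ℝ ∞ ψ (Icc a b))
    (h : ∀ x ∈ Icc a b, orrSommerfeldOp a b 0 α W c ε ψ x = f x) :
    ∀ x ∈ Icc a b, HasDerivWithinAt (fun x => (((ψ x, curveDeriv a b 0 ψ x),
      (curveLaplace a b 0 α ψ x, curveDeriv a b 0 (curveLaplace a b 0 α ψ) x)) : OSPhase))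
      (osSystem α (viscosity α ε)⁻¹ (speed 0 x) (W x - c)
        (curveDeriv a b 0 (curveDeriv a b 0 W) x) ((ψ x, curveDeriv a b 0 ψ x),
      (curveLaplace a b 0 α ψ x, curveDeriv a b 0 (curveLaplace a b 0 α ψ) x)) +
      ((0, 0), (0, speed 0 x * ((viscosity α ε)⁻¹ * f x)))) (Icc a b) x := by
  have hκ := viscosity_ne_zero hα hε
  have l1 := LapOn.of_contDiffOn (α := α) hab (m := 0) contDiff_const hψ
  have l2 := LapOn.of_contDiffOn (α := α) hab (m := 0) contDiff_const
    (contDiffOn_curveLaplace (α := α) hab (m := 0) contDiff_const hψ)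
  refine solvesOn_osSystem_of_lapOn (w := fun x => W x - c) l1 l2 fun x hx => ?_
  rw [eq_inv_mul_iff_mul_eq₀ hκ, ← h x hx, orrSommerfeldOp, viscosity]
  ring

/-- Solutions of the Orr–Sommerfeld system are smooth functions with `P ψ = 0`. -/
theorem SolvesOn.smooth_solution (hab : a < b) (hα : 0 < α) (hε : 0 < ε)
    (hW : ContDiffOn ℝ ∞ W (Icc a b)) {y : ℝ → OSPhase}
    (hy : SolvesOn a b (fun x => osSystem α (viscosity α ε)⁻¹ (speed 0 x) (W x - c)
      (curveDeriv a b 0 (curveDeriv a b 0 W) x)) y) :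
    ContDiffOn ℝ ∞ (fun x => (y x).1.1) (Icc a b) ∧
    (∀ x ∈ Icc a b, curveDeriv a b 0 (fun x => (y x).1.1) x = (y x).1.2) ∧
    (∀ x ∈ Icc a b, curveLaplace a b 0 α (fun x => (y x).1.1) x = (y x).2.1) ∧
    (∀ x ∈ Icc a b, curveDeriv a b 0 (curveLaplace a b 0 α fun x => (y x).1.1) x = (y x).2.2) ∧
    ∀ x ∈ Icc a b, orrSommerfeldOp a b 0 α W c ε (fun x => (y x).1.1) x = 0 := by
  have hκ := mul_inv_cancel₀ (viscosity_ne_zero hα hε)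
  have cW₂ := contDiffOn_curveDeriv_curveDeriv hab hW
  have hs : ContDiffOn ℝ ∞ (speed 0) (Icc a b) := (contDiff_speed contDiff_const).contDiffOn
  have hsm := hy.contDiffOn hab (contDiffOn_osSystem hs (hW.sub contDiffOn_const) cW₂)
  obtain ⟨l1, l2⟩ := lapOn_of_osSystem (w := fun x => W x - c) (f := fun _ => 0)
    (hW.continuousOn.sub (continuousOn_const (c := c))) cW₂.continuousOn continuousOn_const
    fun x hx => (hy x hx).congr_deriv (by
      simp only [mul_zero]
      exact (add_zero _).symm)
  have hL : EqOn (curveLaplace a b 0 α fun x => (y x).1.1) (fun x => (y x).2.1) (Icc a b) :=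
    fun x hx => l1.curveLaplace_eq hab hx
  refine ⟨hsm.fst.fst, fun x hx => l1.curveDeriv_eq hab hx, hL, fun x hx => ?_, fun x hx => ?_⟩
  · rw [curveDeriv_congr hL hx, l2.curveDeriv_eq hab hx]
  rw [orrSommerfeldOp, hL hx, curveLaplace_congr hL hx, l2.curveLaplace_eq hab hx]
  change viscosity α ε * _ + _ - _ = _
  simp only [zero_add]
  linear_combination (curveDeriv a b 0 (curveDeriv a b 0 W) x * (y x).1.1 -
    (W x - c) * (y x).2.1) * hκ

theorem domRestrict_eq_smul {X : Set ℝ} {f g : ℝ → ℂ} {k : ℂ} :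
    X.domRestrict f = k • X.domRestrict g ↔ ∀ x ∈ X, f x = k * g x := by
  constructor
  · intro h x hx
    exact congrFun h ⟨x, hx⟩
  · intro h
    ext ⟨x, hx⟩
    exact h x hx

/-- A generalized eigenspace without Jordan chains over a simple eigenfunction is a line. -/
theorem generalizedEigenspace_eq_span {m : ℝ → ℝ} {bc : (ℝ → ℂ) → Prop}
    {P : (ℝ → ℂ) → ℝ → ℂ}
    {ψ₀ : ℝ → ℂ} (hψ₀ : ContDiffOn ℝ ∞ ψ₀ (Icc a b)) (hbc : bc ψ₀)
    (hP : ∀ x ∈ Icc a b, P ψ₀ x = 0)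
    (h : ∀ (ψ : ℝ → ℂ) (k : ℂ), ContDiffOn ℝ ∞ ψ (Icc a b) → bc ψ →
      (∀ x ∈ Icc a b, P ψ x = k * curveLaplace a b m α ψ₀ x) →
      ∃ k', ∀ x ∈ Icc a b, ψ x = k' * ψ₀ x) :
    generalizedEigenspace a b m α bc P = Submodule.span ℂ {(Icc a b).domRestrict ψ₀} := by
  refine le_antisymm (sInf_le fun ψ φ hψ hφ hb hφS hPψ => ?_) (le_sInf fun X hX => ?_)
  · obtain ⟨k, hk⟩ := Submodule.mem_span_singleton.1 hφS
    have hk' := domRestrict_eq_smul.1 hk.symm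
    obtain ⟨k', hk'⟩ := h ψ k hψ hb fun x hx => by
      rw [hPψ hx, curveLaplace_congr (g := fun x => k * ψ₀ x) hk' hx]
      rw [curveLaplace_const_mul]
    exact Submodule.mem_span_singleton.2 ⟨k', (domRestrict_eq_smul.2 hk').symm⟩
  · rw [Submodule.span_singleton_le_iff_mem]
    refine hX ψ₀ (fun _ => 0) hψ₀ contDiffOn_const hbc ?_ fun x hx => ?_
    · exact X.zero_mem
    · rw [hP x hx, curveLaplace, curveDeriv_eqOn_zero (curveDeriv_eqOn_zero fun _ _ => rfl) x hx]
      simp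

end Multiplicity

namespace RayleighResonance

variable (S : RayleighResonance)

/-- Simplicity of the eigenvalue carries over to the real segment, if the systems for pairs have the
same monodromy. -/
theorem transfer {ε : ℝ} (hε : 0 < ε) {c : ℂ} {U : ℝ → ℂ} (hU : ContDiffOn ℝ ∞ U (Icc S.a S.b))
    (htr : ∀ Y Y₀ : ℝ → OSPhase × OSPhase,
      SolvesOn S.a S.b (fun x => pairSystem S.α (viscosity S.α ε)⁻¹ (speed S.m x)
        (S.W x - c) (S.W₂ x)) Y →
      SolvesOn S.a S.b (fun x => pairSystem S.α (viscosity S.α ε)⁻¹ (speed 0 x)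
        (U x - c) (curveDeriv S.a S.b 0 (curveDeriv S.a S.b 0 U) x)) Y₀ →
      Y S.a = Y₀ S.a → Y S.b = Y₀ S.b) :
    ((∀ T : S.State, (∀ x ∈ Icc S.a S.b, T.op c ε x = 0) → ∀ x ∈ Icc S.a S.b, T.ψ x = 0) →
      HasTrivialKernel S.a S.b S.α U ε c) ∧
    ((∃ T₀ : S.State, (∀ x ∈ Icc S.a S.b, T₀.op c ε x = 0) ∧
        (∃ x ∈ Icc S.a S.b, T₀.ψ x ≠ 0) ∧
        (∀ T : S.State, (∀ x ∈ Icc S.a S.b, T.op c ε x = 0) →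
          ∃ k, ∀ x ∈ Icc S.a S.b, T.ψ x = k * T₀.ψ x) ∧
        ∀ (T : S.State) (k : ℂ), (∀ x ∈ Icc S.a S.b, T.op c ε x = k * T₀.Ω x) → k = 0) →
      ¬ HasTrivialKernel S.a S.b S.α U ε c ∧
      Module.finrank ℂ (generalizedEigenspace S.a S.b 0 S.α (DirichletNeumannBC S.a S.b 0)
        (orrSommerfeldOp S.a S.b 0 S.α U c ε)) = 1) := by
  have hab := S.hab.le
  have ha : S.a ∈ Icc S.a S.b := left_mem_Icc.2 hab
  have hb : S.b ∈ Icc S.a S.b := right_mem_Icc.2 hab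
  have cw : ContinuousOn (fun x => S.W x - c) (Icc S.a S.b) :=
    S.hW.continuousOn.sub continuousOn_const
  have cU : ContinuousOn (fun x => U x - c) (Icc S.a S.b) :=
    hU.continuousOn.sub continuousOn_const
  have cU₂ := (contDiffOn_curveDeriv_curveDeriv S.hab hU).continuousOn
  have cs0 : ContinuousOn (speed 0) (Icc S.a S.b) :=
    (contDiff_speed contDiff_const).continuous.continuousOn
  set κ := (viscosity S.α ε)⁻¹
  have hBM := continuousOn_pairSystem (α := S.α) (κ := κ) S.contDiffOn_speed.continuousOn cw
    S.contDiffOn_W₂.continuousOn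
  have hBR := continuousOn_pairSystem (α := S.α) (κ := κ) cs0 cU cU₂
  have hBR' := continuousOn_osSystem (α := S.α) (κ := κ) cs0 cU cU₂
  -- pairs on the real segment with all boundary conditions give pairs of states
  have hstates : ∀ Y₀ : ℝ → OSPhase × OSPhase, SolvesOn S.a S.b (fun x => pairSystem S.α κ
      (speed 0 x) (U x - c) (curveDeriv S.a S.b 0 (curveDeriv S.a S.b 0 U) x)) Y₀ →
      (Y₀ S.a).1.1 = 0 → (Y₀ S.a).2.1 = 0 → (Y₀ S.b).1.1 = 0 → (Y₀ S.b).2.1 = 0 →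
      ∃ T T₁ : S.State, (∀ x ∈ Icc S.a S.b, T.op c ε x = 0) ∧
        (∀ x ∈ Icc S.a S.b, T₁.op c ε x = T.Ω x) ∧ (T.Ω S.a, T.ρ S.a) = (Y₀ S.a).1.2 ∧
        (T₁.Ω S.a, T₁.ρ S.a) = (Y₀ S.a).2.2 := by
    intro Y₀ hY₀ h1 h2 h3 h4
    obtain ⟨Y, hYa, hY⟩ := exists_solvesOn hab hBM (Y₀ S.a)
    have hYb := htr Y Y₀ hY hY₀ hYa
    rw [← hYa]
    exact S.exists_states hε hY (by rw [hYa, h1]) (by rw [hYa, h2]) (by rw [hYb, h3])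
      (by rw [hYb, h4])
  have hBM' := continuousOn_osSystem (α := S.α) (κ := κ) S.contDiffOn_speed.continuousOn cw
    S.contDiffOn_W₂.continuousOn
  have hzeroSol : ∀ B : ℝ → OSPhase →L[ℂ] OSPhase, SolvesOn S.a S.b B fun _ => 0 :=
    fun B x _ => by rw [map_zero]; exact hasDerivWithinAt_const _ _ _
  have hzero : ∀ T : S.State, (∀ x ∈ Icc S.a S.b, T.op c ε x = 0) → (T.Ω S.a, T.ρ S.a) = 0 →
      ∀ x ∈ Icc S.a S.b, T.ψ x = 0 ∧ T.Ω x = 0 := fun T hT d x hx => by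
    have := SolvesOn.eqOn hab hBM' (T.solvesOn hε hT) (hzeroSol _)
      (Prod.ext (Prod.ext T.ψa T.pa) d) hx
    exact ⟨congrArg (fun y : OSPhase => y.1.1) this, congrArg (fun y : OSPhase => y.2.1) this⟩
  -- the same for single solutions
  have hstate : ∀ y : ℝ → OSPhase, SolvesOn S.a S.b (fun x => osSystem S.α κ
      (speed 0 x) (U x - c) (curveDeriv S.a S.b 0 (curveDeriv S.a S.b 0 U) x)) y →
      (y S.a).1 = 0 → (y S.b).1 = 0 →
      ∃ T : S.State, (∀ x ∈ Icc S.a S.b, T.op c ε x = 0) ∧ (T.Ω S.a, T.ρ S.a) = (y S.a).2 := by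
    intro y hy h1 h2
    obtain ⟨T, T₁, hT, hT₁, d, d₁⟩ := hstates _ (solvesOn_pairSystem (y := fun _ => 0) (z := y)
      (hzeroSol _) fun x hx => (hy x hx).congr_deriv (by simp)) rfl h1 rfl h2
    exact ⟨T₁, fun x hx => by rw [hT₁ x hx, (hzero T hT d x hx).2], d₁⟩
  constructor
  · intro hker y hy h1 h2
    obtain ⟨T, hT, d⟩ := hstate y hy h1 h2
    obtain ⟨e1, e2⟩ := T.eq_zero_of_ψ (hker T hT)
    rw [e1 _ ha, e2 _ ha] at d
    exact SolvesOn.eqOn hab hBR' hy (hzeroSol _) (Prod.ext h1 d.symm)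
  · rintro ⟨T₀, hT₀, ⟨x₀, hx₀, hne⟩, hsimple, hchain⟩
    obtain ⟨y₀, hya, hy⟩ := exists_solvesOn hab hBR' (((0, 0), (T₀.Ω S.a, T₀.ρ S.a)) : OSPhase)
    have hyb : (y₀ S.b).1 = 0 := by
      have := htr _ _ (solvesOn_pairSystem (y := fun _ => 0) (hzeroSol _)
          fun x hx => (T₀.solvesOn hε hT₀ x hx).congr_deriv (by
            simp only [Prod.snd_zero, Prod.fst_zero, mul_zero]; exact (add_zero _).symm))
        (solvesOn_pairSystem (y := fun _ => 0) (z := y₀) (hzeroSol _)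
          fun x hx => (hy x hx).congr_deriv (by simp)) (by rw [hya, T₀.ψa, T₀.pa])
      have h1 := congrArg (fun Y : OSPhase × OSPhase => Y.2.1) this
      rw [← show _ = (y₀ S.b).1 from h1]
      simp [T₀.ψb, T₀.pb]
    have hv : (T₀.Ω S.a, T₀.ρ S.a) ≠ 0 := fun h => hne (hzero T₀ hT₀ h x₀ hx₀).1
    obtain ⟨r1, r2, r3, r4, r5⟩ := hy.smooth_solution S.hab S.hα hε hU
    refine ⟨fun htriv => hv ?_, ?_⟩
    · have := htriv y₀ hy (by rw [hya]; rfl) hyb S.a ha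
      rw [hya] at this
      exact congrArg Prod.snd this
    rw [generalizedEigenspace_eq_span r1
      ⟨⟨congrArg (fun y : OSPhase => y.1.1) hya, congrArg Prod.fst hyb⟩, by rw [r2 _ ha, hya],
        by rw [r2 _ hb]; exact congrArg Prod.snd hyb⟩ r5]
    · refine finrank_span_singleton fun h => hv ?_
      have hψ : ∀ x ∈ Icc S.a S.b, (y₀ x).1.1 = 0 := fun x hx => congrFun h ⟨x, hx⟩
      have hL : ∀ x ∈ Icc S.a S.b, curveLaplace S.a S.b 0 S.α (fun x => (y₀ x).1.1) x = 0 :=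
        fun x hx => by
          rw [curveLaplace, curveDeriv_eqOn_zero (curveDeriv_eqOn_zero hψ) x hx, hψ x hx]
          simp
      have e1 := hL _ ha
      have e2 := curveDeriv_eqOn_zero (m := 0) hL _ ha
      rw [r3 _ ha, hya] at e1
      rw [r4 _ ha, hya] at e2
      exact Prod.ext e1 e2
    -- a chain `P ψ = k (∂² - α²)ψ₀` gives one on the deformed segment, so `k = 0`
    · intro ψ k hψ ⟨⟨b1, b2⟩, b3, b4⟩ hPψ
      have hz := hasDerivWithinAt_of_contDiffOn (f := fun x => k * (y₀ x).2.1) S.hab S.hα hε hψ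
        fun x hx => by rw [hPψ x hx, r3 x hx]
      have hky : SolvesOn S.a S.b (fun x => osSystem S.α κ (speed 0 x) (U x - c)
          (curveDeriv S.a S.b 0 (curveDeriv S.a S.b 0 U) x)) fun x => k • y₀ x := fun x hx => by
        rw [map_smul]
        exact (hy x hx).const_smul k
      obtain ⟨T, T₁, hT, hT₁, d, d₁⟩ := hstates _ (solvesOn_pairSystem hky hz)
        (by simp [hya]) (Prod.ext b1 b3) (by simp [hyb]) (Prod.ext b2 b4)
      have hTk : ∀ x ∈ Icc S.a S.b, T.Ω x = k * T₀.Ω x := fun x hx => by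
        refine sub_eq_zero.1 (hzero (T.subSmul T₀ k) (fun x hx => ?_) ?_ x hx).2
        · rw [State.subSmul_op, hT x hx, hT₀ x hx]; ring
        · simp only [hya] at d
          have e1 := congrArg Prod.fst d
          have e2 := congrArg Prod.snd d
          exact Prod.ext (sub_eq_zero.2 e1) (sub_eq_zero.2 e2)
      have hk : k = 0 := hchain T₁ k fun x hx => by rw [hT₁ x hx, hTk x hx]
      have hT₁' : ∀ x ∈ Icc S.a S.b, T₁.op c ε x = 0 := fun x hx => by
        rw [hT₁ x hx, hTk x hx, hk, zero_mul]
      obtain ⟨k', hk'⟩ := hsimple T₁ hT₁'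
      obtain ⟨e1, e2⟩ := (T₁.subSmul T₀ k').eq_zero_of_ψ fun x hx => sub_eq_zero.2 (hk' x hx)
      have e1 := sub_eq_zero.1 (e1 _ ha)
      have e2 := sub_eq_zero.1 (e2 _ ha)
      refine ⟨k', fun x hx => ?_⟩
      have := SolvesOn.eqOn hab hBR' (fun x hx => (hz x hx).congr_deriv (by simp [hk, κ]))
        (z := fun x => k' • y₀ x) (fun x hx => by
          rw [map_smul]
          exact (hy x hx).const_smul k') ?_ hx
      · exact congrArg (fun y : OSPhase => y.1.1) this
      · rw [hya]
        refine Prod.ext ?_ (d₁.symm.trans ?_)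
        · exact Prod.ext (by simpa using b1) (by simpa using b3)
        · exact Prod.ext e1 e2

end RayleighResonance

/-! ### Deformation of the segment -/

/-- The curves `x ↦ x + t m₀(x)`, for complex `t` with `|t| < R`, are deformations of `[a, b]` that
move points only inside the open set `Ω ⊆ ℂ`; for real `t` they are reparametrizations of `[a, b]`. -/
structure IsDeformation (a b : ℝ) (m₀ : ℝ → ℝ) (R : ℝ) (Ω : Set ℂ) : Prop where
  isOpen : IsOpen Ω
  smooth : ContDiff ℝ ∞ m₀
  mem_of_tsupport : ∀ x ∈ tsupport m₀, ∀ t ∈ Metric.ball (0 : ℂ) R, (x : ℂ) + t * m₀ x ∈ Ω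
  mem_Icc : ∀ x ∈ Icc a b, ∀ t : ℝ, |t| < R → x + t * m₀ x ∈ Icc a b
  left : m₀ a = 0
  right : m₀ b = 0

/-- `V` extends `f : [a, b] → ℂ` and is holomorphic in `Ω`. -/
structure IsExtension (a b : ℝ) (Ω : Set ℂ) (f : ℝ → ℂ) (V : ℂ → ℂ) : Prop where
  eq : ∀ x ∈ Icc a b, V x = f x
  holo : DifferentiableOn ℂ V Ω

theorem differentiableOn_pairSystem {α : ℝ} {κ s : ℂ} {w w₂ : ℂ → ℂ} {A : Set ℂ}
    (hw : DifferentiableOn ℂ w A) (hw₂ : DifferentiableOn ℂ w₂ A) :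
    DifferentiableOn ℂ (fun t => pairSystem α κ s (w t) (w₂ t)) A := by
  have hos : DifferentiableOn ℂ (fun t => osSystem α κ s (w t) (w₂ t)) A := by
    unfold osSystem
    exact (((differentiableOn_const _).add ((hw₂.const_mul κ).smul_const _)).sub
      ((hw.const_mul κ).smul_const _)).const_smul s
  unfold pairSystem
  exact ((differentiableOn_const _).clm_comp (hos.clm_comp (differentiableOn_const _))).add
    ((differentiableOn_const _).clm_comp ((hos.clm_comp (differentiableOn_const _)).add
      (differentiableOn_const _)))

theorem pairSystem_eq_smul (α : ℝ) (κ s w w₂ : ℂ) :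
    pairSystem α κ s w w₂ = s • pairSystem α κ 1 w w₂ := by
  simp only [pairSystem, osSystem, one_smul, one_mul, smul_add, ContinuousLinearMap.smul_comp,
    ContinuousLinearMap.comp_smul, mul_smul, ContinuousLinearMap.comp_add]

section Deformation

variable {a b R : ℝ} {m₀ : ℝ → ℝ} {Ω : Set ℂ} {f : ℝ → ℂ} {V : ℂ → ℂ}

/-- The derivative of `f` has an extension, namely the derivative of the extension. -/
theorem IsExtension.exists_deriv (hab : a < b) (hΩ : IsOpen Ω) (h : IsExtension a b Ω f V) :
    ∃ V₁, IsExtension a b Ω (curveDeriv a b 0 f) V₁ ∧ ∀ z ∈ Ω, V₁ z = deriv V z := by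
  classical
  have hV : ∀ z ∈ Ω, (if z ∈ Ω then deriv V z else curveDeriv a b 0 f z.re) = deriv V z :=
    fun z hz => if_pos hz
  -- outside `Ω` nothing is known about `V`; there the values on the segment are prescribed
  refine ⟨fun z => if z ∈ Ω then deriv V z else curveDeriv a b 0 f z.re, ⟨fun x hx => ?_,
    (h.holo.deriv hΩ).congr hV⟩, hV⟩
  by_cases hz : (x : ℂ) ∈ Ω
  · rw [hV _ hz]
    refine (curveDeriv_eq_of_hasDerivWithinAt hab hx ?_).symm
    rw [speed_zero, one_mul]
    exact (h.holo.differentiableAt (hΩ.mem_nhds hz)).hasDerivAt.comp_ofReal.hasDerivWithinAt.congr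
      (fun y hy => (h.eq y hy).symm) (h.eq x hx).symm
  · simp only [if_neg hz, Complex.ofReal_re]

namespace IsDeformation

variable (d : IsDeformation a b m₀ R Ω)

include d in
theorem continuousOn (h : IsExtension a b Ω f V) (hf : ContinuousOn f (Icc a b)) :
    ContinuousOn (fun p : ℂ × ℝ => V (p.2 + p.1 * m₀ p.2)) (Metric.ball 0 R ×ˢ Icc a b) := by
  intro p hp
  by_cases hx : p.2 ∈ tsupport m₀
  · have hz := d.mem_of_tsupport _ hx _ hp.1
    have hV := (h.holo.differentiableAt (d.isOpen.mem_nhds hz)).continuousAt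
    have hm := d.smooth.continuous
    have hc : Continuous fun p : ℂ × ℝ => (p.2 : ℂ) + p.1 * m₀ p.2 := by fun_prop
    exact (hV.comp_of_eq (g := V) (f := fun p : ℂ × ℝ => (p.2 : ℂ) + p.1 * m₀ p.2)
      hc.continuousAt rfl).continuousWithinAt
  · have he : ∀ᶠ q : ℂ × ℝ in 𝓝 p, m₀ q.2 = 0 :=
      continuousAt_snd.eventually (notMem_tsupport_iff_eventuallyEq.1 hx)
    have hc : ContinuousWithinAt (fun p : ℂ × ℝ => f p.2) (Metric.ball 0 R ×ˢ Icc a b) p :=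
      (hf p.2 hp.2).comp continuousWithinAt_snd fun q hq => hq.2
    refine hc.congr_of_eventuallyEq ?_ ?_
    · filter_upwards [nhdsWithin_le_nhds he, self_mem_nhdsWithin] with q hq hq'
      rw [hq, ← h.eq _ hq'.2]
      simp
    · rw [he.self_of_nhds, ← h.eq _ hp.2]
      simp

include d in
theorem differentiableOn (h : IsExtension a b Ω f V) (x : ℝ) :
    DifferentiableOn ℂ (fun t : ℂ => V (x + t * m₀ x)) (Metric.ball 0 R) := by
  by_cases hx : x ∈ tsupport m₀
  · exact h.holo.comp (by fun_prop) fun t ht => d.mem_of_tsupport x hx t ht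
  · simp only [image_eq_zero_of_notMem_tsupport hx, Complex.ofReal_zero, mul_zero, add_zero]
    exact differentiableOn_const _

include d in
theorem eq_of_real (h : IsExtension a b Ω f V) {x : ℝ} (hx : x ∈ Icc a b) {t : ℝ} (ht : |t| < R) :
    V (x + (t : ℂ) * m₀ x) = f (x + t * m₀ x) := by
  rw [← h.eq _ (d.mem_Icc x hx t ht)]
  push_cast
  rfl

include d in
theorem contDiffOn (h : IsExtension a b Ω f V) (hf : ContDiffOn ℝ ∞ f (Icc a b)) {t : ℂ}
    (ht : t ∈ Metric.ball (0 : ℂ) R) :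
    ContDiffOn ℝ ∞ (fun x : ℝ => V (x + t * m₀ x)) (Icc a b) := by
  intro x hx
  by_cases hx' : x ∈ tsupport m₀
  · have hz := d.mem_of_tsupport x hx' t ht
    have hV : ContDiffAt ℝ ∞ V (x + t * m₀ x) :=
      ((h.holo.contDiffOn d.isOpen).contDiffAt (d.isOpen.mem_nhds hz)).restrict_scalars ℝ
    have hm : ContDiff ℝ ∞ fun x : ℝ => (m₀ x : ℂ) := Complex.ofRealCLM.contDiff.comp d.smooth
    have hc : ContDiff ℝ ∞ fun x : ℝ => (x : ℂ) + t * m₀ x :=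
      Complex.ofRealCLM.contDiff.add (contDiff_const.mul hm)
    exact (hV.comp x hc.contDiffAt).contDiffWithinAt
  · have he : ∀ᶠ y in 𝓝 x, m₀ y = 0 := notMem_tsupport_iff_eventuallyEq.1 hx'
    refine (hf x hx).congr_of_eventuallyEq ?_ ?_
    · filter_upwards [nhdsWithin_le_nhds he, self_mem_nhdsWithin] with q hq hq'
      rw [hq, ← h.eq _ hq']
      simp
    · rw [he.self_of_nhds, ← h.eq _ hx]
      simp

include d in
theorem curveDeriv_eq (hab : a < b) {V₁ : ℂ → ℂ} (h : IsExtension a b Ω f V)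
    (hf : DifferentiableOn ℝ f (Icc a b))
    (h₁ : IsExtension a b Ω (curveDeriv a b 0 f) V₁) (hV₁ : ∀ z ∈ Ω, V₁ z = deriv V z) {τ : ℝ}
    (hτ : Complex.I * τ ∈ Metric.ball (0 : ℂ) R) :
    EqOn (curveDeriv a b (fun x => τ * m₀ x) fun x => V (x + (Complex.I * τ) * m₀ x))
      (fun x => V₁ (x + (Complex.I * τ) * m₀ x)) (Icc a b) := by
  intro x hx
  refine curveDeriv_eq_of_hasDerivWithinAt hab hx ?_
  have hm : HasDerivAt m₀ (deriv m₀ x) x :=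
    (d.smooth.differentiable (by simp) x).hasDerivAt
  have hs : speed (fun x => τ * m₀ x) x = 1 + Complex.I * τ * (deriv m₀ x : ℝ) := by
    rw [speed, (hm.const_mul τ).deriv]
    push_cast
    ring
  by_cases hx' : x ∈ tsupport m₀
  · have hz := d.mem_of_tsupport x hx' _ hτ
    have hV := (h.holo.differentiableAt (d.isOpen.mem_nhds hz)).hasDerivAt
    have hc : HasDerivAt (fun x : ℝ => (x : ℂ) + Complex.I * τ * m₀ x)
        (1 + Complex.I * τ * (deriv m₀ x : ℝ)) x :=
      (Complex.ofRealCLM.hasDerivAt (x := x)).add (hm.ofReal_comp.const_mul _)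
    refine (hV.comp x hc).hasDerivWithinAt.congr_deriv ?_
    rw [hs, ← hV₁ _ hz, mul_comm]
  · have he : m₀ =ᶠ[𝓝 x] fun _ => 0 := notMem_tsupport_iff_eventuallyEq.1 hx'
    have hm0 : deriv m₀ x = 0 := by rw [he.deriv_eq, deriv_const]
    have e0 : m₀ x = 0 := he.self_of_nhds
    have := hasDerivWithinAt_curveDeriv (m := 0) (hf x hx)
    rw [speed_zero, one_mul, ← h₁.eq x hx] at this
    refine (this.congr_of_eventuallyEq ?_ ?_).congr_deriv ?_
    · filter_upwards [nhdsWithin_le_nhds he, self_mem_nhdsWithin] with q hq hq'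
      rw [hq, ← h.eq _ hq']
      simp
    · rw [e0, ← h.eq _ hx]
      simp
    · change _ = _ * V₁ _
      rw [hs, hm0, e0]
      simp

end IsDeformation

/-- Linear systems `dy/dz = A(z) y` on the curves `x ↦ x + t m₀(x)` have the same monodromy: for
real `t` because of the change of variables, and hence for all `t` by analytic continuation. -/
theorem monodromy_eq {E : Type*} [NormedAddCommGroup E] [NormedSpace ℂ E] [CompleteSpace E]
    (hab : a ≤ b) (d : IsDeformation a b m₀ R Ω) {A : ℂ → ℝ → E →L[ℂ] E}
    (hA : ContinuousOn (fun p : ℂ × ℝ => A p.1 p.2) (Metric.ball 0 R ×ˢ Icc a b))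
    (hd : ∀ x ∈ Icc a b, DifferentiableOn ℂ (fun t => A t x) (Metric.ball 0 R))
    (hr : ∀ x ∈ Icc a b, ∀ t : ℝ, |t| < R → A t x = A 0 (x + t * m₀ x))
    {t : ℂ} (ht : t ∈ Metric.ball (0 : ℂ) R) {y y₀ : ℝ → E}
    (hy : SolvesOn a b (fun x => (1 + t * (deriv m₀ x : ℝ)) • A t x) y)
    (hy₀ : SolvesOn a b (A 0) y₀) (h : y a = y₀ a) : y b = y₀ b := by
  have hR : 0 < R := lt_of_le_of_lt dist_nonneg ht
  have h0 : (0 : ℂ) ∈ Metric.ball (0 : ℂ) R := Metric.mem_ball_self hR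
  have ha : a ∈ Icc a b := left_mem_Icc.2 hab
  have hb : b ∈ Icc a b := right_mem_Icc.2 hab
  have cm : Continuous (deriv m₀) := d.smooth.continuous_deriv (by simp)
  set B : ℂ → ℝ → E →L[ℂ] E := fun t x => (1 + t * (deriv m₀ x : ℝ)) • A t x with hB
  have hBc : ContinuousOn (fun p : ℂ × ℝ => B p.1 p.2) (Metric.ball 0 R ×ˢ Icc a b) := by
    have : Continuous fun p : ℂ × ℝ => 1 + p.1 * (deriv m₀ p.2 : ℝ) := by fun_prop
    exact this.continuousOn.smul hA
  have hBd : ∀ x ∈ Icc a b, DifferentiableOn ℂ (fun t => B t x) (Metric.ball 0 R) := fun x hx => by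
    have : Differentiable ℂ fun t : ℂ => 1 + t * (deriv m₀ x : ℝ) := by fun_prop
    exact this.differentiableOn.smul (hd x hx)
  have hBt : ∀ t ∈ Metric.ball (0 : ℂ) R, ContinuousOn (B t) (Icc a b) := fun t ht =>
    hBc.comp (f := fun x => (t, x)) (by fun_prop) fun x hx => ⟨ht, hx⟩
  have hex : ∀ t : ℂ, ∃ z : ℝ → E, t ∈ Metric.ball (0 : ℂ) R → z a = y₀ a ∧ SolvesOn a b (B t) z :=
    fun t => by
      by_cases ht : t ∈ Metric.ball (0 : ℂ) R
      · obtain ⟨z, h1, h2⟩ := exists_solvesOn hab (hBt t ht) (y₀ a)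
        exact ⟨z, fun _ => ⟨h1, h2⟩⟩
      · exact ⟨0, fun h => (ht h).elim⟩
  choose Z hZ using hex
  have hhol := differentiableOn_solution hab hBc hBd (fun t ht => (hZ t ht).2)
    (fun t ht => (hZ t ht).1) hb
  -- for real `t` the solution is `y₀` in the new variable
  have hreal : ∀ t : ℝ, |t| < R → Z t b = y₀ b := by
    intro t ht
    have ht' : (t : ℂ) ∈ Metric.ball (0 : ℂ) R := by simpa using ht
    have hs : SolvesOn a b (B t) fun x => y₀ (x + t * m₀ x) := fun x hx => by
      have hm : HasDerivAt m₀ (deriv m₀ x) x := (d.smooth.differentiable (by simp) x).hasDerivAt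
      have hc : HasDerivWithinAt (fun x => x + t * m₀ x) (1 + t * deriv m₀ x) (Icc a b) x :=
        ((hasDerivAt_id x).add (hm.const_mul t)).hasDerivWithinAt
      have := (hy₀ _ (d.mem_Icc x hx t ht)).scomp x hc fun x hx => d.mem_Icc x hx t ht
      refine this.congr_deriv ?_
      change _ = ((1 + (t : ℂ) * (deriv m₀ x : ℝ)) • A t x) (y₀ (x + t * m₀ x))
      rw [hr x hx t ht, smul_apply, ← Complex.coe_smul]
      push_cast
      rfl
    have := SolvesOn.eqOn hab (hBt t ht') (hZ t ht').2 hs (by rw [(hZ t ht').1, d.left]; simp) hb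
    simp only [d.right, mul_zero, add_zero] at this
    exact this
  have hZt : y b = Z t b := SolvesOn.eqOn hab (hBt t ht) hy (hZ t ht).2 (by rw [h, (hZ t ht).1]) hb
  have han : AnalyticOnNhd ℂ (fun t => Z t b - y₀ b) (Metric.ball 0 R) :=
    (hhol.sub (differentiableOn_const _)).analyticOnNhd Metric.isOpen_ball
  have hfr : ∃ᶠ t in 𝓝[≠] (0 : ℂ), Z t b - y₀ b = 0 := by
    have hto : Tendsto (fun t : ℝ => (t : ℂ)) (𝓝[≠] 0) (𝓝[≠] 0) := by
      refine tendsto_nhdsWithin_of_tendsto_nhds_of_eventually_within _ ?_ ?_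
      · exact (Complex.continuous_ofReal.tendsto' 0 0 rfl).mono_left nhdsWithin_le_nhds
      · filter_upwards [self_mem_nhdsWithin] with t ht
        exact Complex.ofReal_ne_zero.2 ht
    refine hto.frequently (Eventually.frequently ?_)
    have : ∀ᶠ t : ℝ in 𝓝 0, |t| < R := by
      have := Metric.ball_mem_nhds (0 : ℝ) hR
      filter_upwards [this] with t ht
      simpa using ht
    filter_upwards [nhdsWithin_le_nhds this] with t ht
    rw [hreal t ht, sub_self]
  have := han.eqOn_zero_of_preconnected_of_frequently_eq_zero
    (convex_ball 0 R).isPreconnected h0 hfr ht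
  rw [hZt]
  exact sub_eq_zero.1 this

/-- The systems for Orr–Sommerfeld pairs on the deformed and on the real segment have the same
monodromy. -/
theorem IsDeformation.pairSystem_monodromy (hab : a < b) (d : IsDeformation a b m₀ R Ω)
    (h : IsExtension a b Ω f V) (hf : ContDiffOn ℝ ∞ f (Icc a b)) {τ : ℝ}
    (hτ : Complex.I * τ ∈ Metric.ball (0 : ℂ) R) {W : ℝ → ℂ}
    (hW : ∀ x ∈ Icc a b, W x = V (x + Complex.I * τ * m₀ x)) (α : ℝ) (κ c : ℂ)
    {Y Y₀ : ℝ → OSPhase × OSPhase}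
    (hY : SolvesOn a b (fun x => pairSystem α κ (speed (fun x => τ * m₀ x) x) (W x - c)
      (curveDeriv a b (fun x => τ * m₀ x) (curveDeriv a b (fun x => τ * m₀ x) W) x)) Y)
    (hY₀ : SolvesOn a b (fun x => pairSystem α κ (speed 0 x) (f x - c)
      (curveDeriv a b 0 (curveDeriv a b 0 f) x)) Y₀) (ha : Y a = Y₀ a) : Y b = Y₀ b := by
  have hf₁ : ContDiffOn ℝ ∞ (curveDeriv a b 0 f) (Icc a b) :=
    contDiffOn_curveDeriv hab contDiff_const hf
  have hf₂ := contDiffOn_curveDeriv_curveDeriv hab hf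
  obtain ⟨V₁, h₁, e₁⟩ := h.exists_deriv hab d.isOpen
  obtain ⟨V₂, h₂, e₂⟩ := h₁.exists_deriv hab d.isOpen
  have hR : 0 < R := lt_of_le_of_lt dist_nonneg hτ
  have hW₁ : EqOn (curveDeriv a b (fun x => τ * m₀ x) W)
      (fun x => V₁ (x + (Complex.I * τ) * m₀ x)) (Icc a b) := fun x hx => by
    rw [curveDeriv_congr hW hx]
    exact d.curveDeriv_eq hab h (hf.differentiableOn (by simp)) h₁ e₁ hτ hx
  have hW₂ : EqOn (curveDeriv a b (fun x => τ * m₀ x) (curveDeriv a b (fun x => τ * m₀ x) W))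
      (fun x => V₂ (x + (Complex.I * τ) * m₀ x)) (Icc a b) := fun x hx => by
    rw [curveDeriv_congr hW₁ hx]
    exact d.curveDeriv_eq hab h₁ (hf₁.differentiableOn (by simp)) h₂ e₂ hτ hx
  have h00 : ∀ x ∈ Icc a b, pairSystem α κ 1 (V (x + (0 : ℂ) * m₀ x) - c)
      (V₂ (x + (0 : ℂ) * m₀ x)) = pairSystem α κ 1 (f x - c)
        (curveDeriv a b 0 (curveDeriv a b 0 f) x) := fun x hx => by
    rw [zero_mul, add_zero, h.eq x hx, h₂.eq x hx]
  refine monodromy_eq hab.le d (A := fun t x => pairSystem α κ 1 (V (x + t * m₀ x) - c)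
    (V₂ (x + t * m₀ x))) ?_ (fun x hx => ?_) (fun x hx t ht => ?_) hτ (fun x hx => ?_)
    (fun x hx => ?_) ha
  · exact continuousOn_pairSystem (s := fun _ => 1)
      (w := fun p : ℂ × ℝ => V (p.2 + p.1 * m₀ p.2) - c)
      (w₂ := fun p : ℂ × ℝ => V₂ (p.2 + p.1 * m₀ p.2)) continuousOn_const
      ((d.continuousOn h hf.continuousOn).sub continuousOn_const)
      (d.continuousOn h₂ hf₂.continuousOn)
  · have g1 := d.differentiableOn h x
    have g2 := d.differentiableOn h₂ x
    exact differentiableOn_pairSystem (g1.sub_const c) g2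
  · refine Eq.trans ?_ (h00 _ (d.mem_Icc x hx t ht)).symm
    rw [d.eq_of_real h hx ht, d.eq_of_real h₂ hx ht]
  · refine (hY x hx).congr_deriv ?_
    have hm : HasDerivAt m₀ (deriv m₀ x) x :=
      (d.smooth.differentiable (by simp) x).hasDerivAt
    have hs : speed (fun x => τ * m₀ x) x = 1 + Complex.I * τ * (deriv m₀ x : ℝ) := by
      rw [speed, (hm.const_mul τ).deriv]
      push_cast
      ring
    simp only []
    rw [hW₂ hx, hW x hx, pairSystem_eq_smul, hs]
  · refine (hY₀ x hx).congr_deriv ?_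
    simp only []
    rw [h00 x hx, speed_zero]

end Deformation

/-! ### Ellipticity along the deformed segment -/

/-- If a point of the deformed segment is elliptic with margin `η`, either because `U - c₀` is not
small or because `Im W` is negative to first order in `τ`, then it is elliptic for all `c` in the
half-strip. -/
theorem mem_slitPlane_of_margin {α τ q k u g η δ B c₀ : ℝ} {w c : ℂ} (hα : 0 < α)
    (hq : |q| ≤ k) (hk : k ≤ 1 / 2) (hη : 0 < η) (hkB : 4 * k * (B + η + 1) ≤ η / 4)
    (hτ : 0 < τ) (hτ' : τ ≤ 1) (hδ : 0 < δ) (hδη : δ ≤ η * τ / 4)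
    (hw : ‖w - u - Complex.I * τ * g‖ ≤ η * τ / 4) (hg : |g| ≤ B) (hor : η ≤ |u - c₀| ∨ g ≤ -η)
    (hc : c ∈ halfStrip c₀ δ) :
    (1 + Complex.I * q) ^ 2 * (Complex.I * α * (w - c)) ∈ Complex.slitPlane := by
  obtain ⟨hc1, hc2⟩ := hc
  have hre : |w.re - u| ≤ η * τ / 4 := by
    have := (Complex.abs_re_le_norm _).trans hw
    simpa using this
  have him : |w.im - τ * g| ≤ η * τ / 4 := by
    have := (Complex.abs_im_le_norm _).trans hw
    simpa using this
  obtain ⟨q1, q2⟩ := abs_le.1 hq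
  obtain ⟨g1, g2⟩ := abs_le.1 hg
  obtain ⟨i1, i2⟩ := abs_le.1 him
  have hk0 : 0 ≤ k := (abs_nonneg q).trans hq
  have hB0 : 0 ≤ B := (abs_nonneg g).trans hg
  have hqq : q ^ 2 ≤ 1 / 4 := by
    have := abs_le_of_sq_le_sq' (a := q) (b := 1 / 2)
    nlinarith only [q1, q2, hk, hk0]
  by_contra hslit
  rw [Complex.mem_slitPlane_iff, not_or, not_lt, not_not] at hslit
  obtain ⟨e1, e2⟩ := hslit
  set x := w.re - c.re with hx
  set y := w.im - c.im with hy
  have f1 : ((1 + Complex.I * q) ^ 2 * (Complex.I * α * (w - c))).re =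
      -α * (x * (2 * q) + y * (1 - q ^ 2)) := by
    simp [pow_two, hx, hy]; ring
  have f2 : ((1 + Complex.I * q) ^ 2 * (Complex.I * α * (w - c))).im =
      α * (x * (1 - q ^ 2) - y * (2 * q)) := by
    simp [pow_two, hx, hy]; ring
  rw [f1] at e1
  rw [f2] at e2
  have h1 : x * (1 - q ^ 2) = y * (2 * q) :=
    sub_eq_zero.1 ((mul_eq_zero.1 e2).resolve_left hα.ne')
  have h2 : 0 ≤ x * (2 * q) + y * (1 - q ^ 2) := by
    by_contra hneg
    have := mul_pos hα (neg_pos.2 (not_le.1 hneg))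
    linarith
  -- the condition on the argument gives `Im (w - c) ≥ 0`
  have hy0 : 0 ≤ y := by
    have h3 : 0 ≤ y * ((2 * q) ^ 2 + (1 - q ^ 2) ^ 2) := by
      have := mul_nonneg h2 (show 0 ≤ 1 - q ^ 2 by linarith)
      linear_combination this + (2 * q) * h1
    exact nonneg_of_mul_nonneg_left h3 (by nlinarith only [hqq, sq_nonneg q])
  have hyle : y ≤ τ * g + η * τ / 4 + δ := by
    rw [hy]; linarith
  -- if `U - c₀` is not small, `Re (w - c)` is too large compared with `q y`; otherwise `y < 0`
  rcases hor with hor | hor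
  · have hxy : |x| ≤ 4 * k * y := by
      have h4 : |x| * (1 - q ^ 2) ≤ 2 * k * y := by
        have : |x * (1 - q ^ 2)| = |y * (2 * q)| := by rw [h1]
        rw [abs_mul, abs_mul, abs_mul, abs_of_nonneg (show 0 ≤ 1 - q ^ 2 by linarith),
          abs_of_nonneg hy0, abs_two] at this
        rw [this]
        nlinarith only [hq, hy0]
      nlinarith only [h4, abs_nonneg x, hqq, mul_nonneg hk0 hy0]
    have hyB : y ≤ B + η + 1 := by
      have : τ * g ≤ B := by nlinarith only [g2, hτ, hτ', hB0]
      have : η * τ ≤ η := by nlinarith only [hη, hτ']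
      linarith
    have h5 : |x| ≤ η / 4 := hxy.trans
      ((mul_le_mul_of_nonneg_left hyB (by positivity)).trans hkB)
    have h6 : |u - c₀| ≤ |w.re - u| + |x| + |c.re - c₀| := by
      have : u - c₀ = -(w.re - u) + x + (c.re - c₀) := by rw [hx]; ring
      rw [this]
      refine (abs_add_le _ _).trans (add_le_add_left ((abs_add_le _ _).trans ?_) _)
      rw [abs_neg]
    have : η * τ ≤ η := by nlinarith only [hη, hτ']
    linarith
  · have : τ * g ≤ -(η * τ) := by nlinarith only [hτ, hor]
    have : 0 < η * τ := mul_pos hη hτ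
    linarith

section Margin

variable {a b R : ℝ} {m₀ : ℝ → ℝ} {Ω : Set ℂ} {f : ℝ → ℂ} {V : ℂ → ℂ}

/-- The profile on the deformed segment to first order in `t`. -/
theorem IsDeformation.eventually_taylor (hab : a < b) (d : IsDeformation a b m₀ R Ω) (hR : 0 < R)
    (h : IsExtension a b Ω f V) (hf : ContDiffOn ℝ ∞ f (Icc a b)) {η : ℝ} (hη : 0 < η) :
    ∀ᶠ t : ℂ in 𝓝 0, ∀ x ∈ Icc a b,
      ‖V (x + t * m₀ x) - f x - t * (m₀ x * curveDeriv a b 0 f x)‖ ≤ η * ‖t‖ := by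
  have hf₁ : ContDiffOn ℝ ∞ (curveDeriv a b 0 f) (Icc a b) :=
    contDiffOn_curveDeriv hab contDiff_const hf
  obtain ⟨V₁, h₁, e₁⟩ := h.exists_deriv hab d.isOpen
  have hcont : ContinuousOn (fun p : ℂ × ℝ => m₀ p.2 * V₁ (p.2 + p.1 * m₀ p.2) -
      m₀ p.2 * curveDeriv a b 0 f p.2) (Metric.ball 0 R ×ˢ Icc a b) := by
    have c1 := d.continuousOn h₁ hf₁.continuousOn
    have c2 : ContinuousOn (fun p : ℂ × ℝ => curveDeriv a b 0 f p.2)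
        (Metric.ball 0 R ×ˢ Icc a b) := hf₁.continuousOn.comp continuousOn_snd fun p hp => hp.2
    have c3 : Continuous fun p : ℂ × ℝ => (m₀ p.2 : ℂ) :=
      Complex.continuous_ofReal.comp (d.smooth.continuous.comp continuous_snd)
    exact (c3.continuousOn.mul c1).sub (c3.continuousOn.mul c2)
  have hev : ∀ᶠ t : ℂ in 𝓝 0, ∀ x ∈ Icc a b,
      ‖m₀ x * V₁ (x + t * m₀ x) - m₀ x * curveDeriv a b 0 f x‖ ≤ η := by
    refine isCompact_Icc.eventually_forall_of_forall_eventually (P := fun (t : ℂ) (x : ℝ) =>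
      x ∈ Icc a b → ‖m₀ x * V₁ (x + t * m₀ x) - m₀ x * curveDeriv a b 0 f x‖ ≤ η)
      (fun x hx => ?_) |>.mono fun t ht x hx => ht x hx hx
    have h0 : (0 : ℂ) ∈ Metric.ball (0 : ℂ) R := Metric.mem_ball_self hR
    have := (hcont (0, x) ⟨h0, hx⟩).norm.eventually_le_const (u := η) (by
      simp only [zero_mul, add_zero]
      rw [h₁.eq x hx, sub_self, norm_zero]
      exact hη)
    rw [nhdsWithin_prod_eq, Metric.isOpen_ball.nhdsWithin_eq h0] at this
    have h2 := eventually_nhdsWithin_iff.1 (show ∀ᶠ z : ℂ × ℝ in 𝓝[univ ×ˢ Icc a b] (0, x),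
      ‖m₀ z.2 * V₁ (z.2 + z.1 * m₀ z.2) - m₀ z.2 * curveDeriv a b 0 f z.2‖ ≤ η by
        rw [nhdsWithin_prod_eq, nhdsWithin_univ]
        exact this)
    filter_upwards [h2] with z hz hz'
    exact hz ⟨mem_univ _, hz'⟩
  obtain ⟨ρ, hρ, hball⟩ := Metric.eventually_nhds_iff_ball.1 hev
  filter_upwards [Metric.ball_mem_nhds (0 : ℂ) (lt_min hρ hR)] with t ht x hx
  have hsub : Metric.ball (0 : ℂ) (min ρ R) ⊆ Metric.ball 0 R :=
    Metric.ball_subset_ball (min_le_right _ _)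
  have hd : ∀ t ∈ Metric.ball (0 : ℂ) (min ρ R), HasDerivWithinAt
      (fun t : ℂ => V (x + t * m₀ x) - t * (m₀ x * curveDeriv a b 0 f x))
      (m₀ x * V₁ (x + t * m₀ x) - m₀ x * curveDeriv a b 0 f x)
      (Metric.ball (0 : ℂ) (min ρ R)) t := by
    intro t ht
    have hl : HasDerivAt (fun t : ℂ => t * (m₀ x * curveDeriv a b 0 f x))
        (m₀ x * curveDeriv a b 0 f x) t := by
      simpa using (hasDerivAt_id t).mul_const (m₀ x * curveDeriv a b 0 f x)
    have hV : HasDerivAt (fun t : ℂ => V (x + t * m₀ x)) (m₀ x * V₁ (x + t * m₀ x)) t := by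
      by_cases hx' : x ∈ tsupport m₀
      · have hz := d.mem_of_tsupport x hx' t (hsub ht)
        have hi : HasDerivAt (fun t : ℂ => (x : ℂ) + t * m₀ x) (m₀ x) t := by
          simpa using ((hasDerivAt_id t).mul_const (m₀ x : ℂ)).const_add (x : ℂ)
        refine ((h.holo.differentiableAt (d.isOpen.mem_nhds hz)).hasDerivAt.comp t hi).congr_deriv ?_
        rw [e₁ _ hz, mul_comm]
      · simp only [image_eq_zero_of_notMem_tsupport hx', Complex.ofReal_zero, mul_zero, zero_mul]
        exact hasDerivAt_const _ _
    exact (hV.sub hl).hasDerivWithinAt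
  have := Convex.norm_image_sub_le_of_norm_hasDerivWithin_le hd (fun t ht =>
    hball t (Metric.ball_subset_ball (min_le_left _ _) ht) x hx) (convex_ball _ _)
    (Metric.mem_ball_self (lt_min hρ hR)) ht
  simp only [zero_mul, add_zero, sub_zero, h.eq x hx] at this
  rwa [sub_right_comm]

end Margin

namespace DeformationData

variable {a b : ℝ} {U : ℝ → ℝ} {c₀ : ℝ} (D : DeformationData a b U c₀)

/-- The complex neighbourhood of `K` in which `V` is holomorphic. -/
def domain : Set ℂ := Metric.thickening D.r ((fun x : ℝ => (x : ℂ)) '' D.K)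

include D in
theorem exists_isDeformation : ∃ R, 0 < R ∧ IsDeformation a b D.m₀ R D.domain := by
  have hsupp : HasCompactSupport D.m₀ := D.isCompact_K.of_isClosed_subset (isClosed_tsupport _)
    fun x hx => (D.m₀_support hx).1
  obtain ⟨C, hC⟩ := hsupp.exists_bound_of_continuous D.m₀_smooth.continuous
  have hC0 : 0 ≤ C := (norm_nonneg _).trans (hC 0)
  have hend : ∀ x, (x = a ∨ x = b) → D.m₀ x = 0 := fun x hx =>
    image_eq_zero_of_notMem_tsupport fun h => by
      have h1 := D.K_inside x (D.m₀_support h).1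
      have h2 := D.r_pos
      rcases hx with rfl | rfl <;> linarith
  have hlt : ∀ t : ℝ, 0 ≤ t → t < D.r / (C + 1) → ∀ x, t * |D.m₀ x| < D.r := fun t h0 ht x => by
    rw [lt_div_iff₀ (by linarith)] at ht
    have : |D.m₀ x| ≤ C := hC x
    have := mul_le_mul_of_nonneg_left this h0
    linarith
  refine ⟨D.r / (C + 1), div_pos D.r_pos (by linarith), Metric.isOpen_thickening, D.m₀_smooth,
    fun x hx t ht => ?_, fun x hx t ht => ?_, hend a (Or.inl rfl), hend b (Or.inr rfl)⟩
  · refine Metric.mem_thickening_iff.2 ⟨x, ⟨x, (D.m₀_support hx).1, rfl⟩, ?_⟩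
    rw [dist_eq_norm, add_sub_cancel_left, norm_mul, Complex.norm_real]
    exact hlt _ (norm_nonneg t) (by simpa using ht) x
  · by_cases h : x ∈ tsupport D.m₀
    · have h1 := D.K_inside x (D.m₀_support h).1
      have h2 := hlt _ (abs_nonneg t) ht x
      rw [← abs_mul] at h2
      obtain ⟨h3, h4⟩ := abs_lt.1 h2
      constructor <;> linarith
    · rw [image_eq_zero_of_notMem_tsupport h]
      simpa using hx

include D in
theorem isExtension : IsExtension a b D.domain (fun x => (U x : ℂ)) D.V := ⟨D.V_eq, D.V_holo⟩

theorem profile_eq (τ : ℝ) (x : ℝ) : D.profile τ x = D.V (x + Complex.I * τ * D.m₀ x) := by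
  simp only [profile, height]
  push_cast
  rw [mul_assoc]

include D in
theorem m₀_eventuallyEq_zero {x : ℝ} (hx : x = a ∨ x = b) : D.m₀ =ᶠ[𝓝 x] 0 :=
  notMem_tsupport_iff_eventuallyEq.1 fun h => by
    have h1 := D.K_inside x (D.m₀_support h).1
    have h2 := D.r_pos
    rcases hx with rfl | rfl <;> linarith

include D in
/-- Points of the segment are elliptic with a margin: `U - c₀` is not small or `m₀ U'` is
negative. -/
theorem exists_margin (hab : a < b) (hU : ContDiffOn ℝ ∞ U (Icc a b)) :
    ∃ η, 0 < η ∧ ∀ x ∈ Icc a b, η ≤ |U x - c₀| ∨ D.m₀ x * derivWithin U (Icc a b) x ≤ -η := by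
  have cU := hU.continuousOn
  have cU' : ContinuousOn (derivWithin U (Icc a b)) (Icc a b) :=
    hU.continuousOn_derivWithin (uniqueDiffOn_Icc hab) (by simp)
  have cm := D.m₀_smooth.continuous
  obtain ⟨x₀, hx₀, hmin⟩ := isCompact_Icc.exists_isMinOn (nonempty_Icc.2 hab.le)
    (f := fun x => max |U x - c₀| (-(D.m₀ x * derivWithin U (Icc a b) x))) (by fun_prop)
  refine ⟨_, ?_, fun x hx => (le_max_iff.1 (hmin hx)).imp id fun h => by linarith⟩
  by_cases hc : U x₀ = c₀
  · have hK := D.K_inside x₀ (D.level_subset x₀ hx₀ hc)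
    have hr := D.r_pos
    have := D.m₀_sign_level x₀ hx₀ hc
    rw [← derivWithin_of_mem_nhds (Icc_mem_nhds (by linarith) (by linarith) : Icc a b ∈ 𝓝 x₀)] at this
    exact lt_max_of_lt_right (neg_pos.2 this)
  · exact lt_max_of_lt_left (abs_pos.2 (sub_ne_zero.2 hc))

include D in
/-- For small `τ`, the deformed segment is elliptic for all `c` in a half-strip. -/
theorem eventually_elliptic (hab : a < b) (hU : ContDiffOn ℝ ∞ U (Icc a b))
    (hc₀ : ProfileHypothesis a b U c₀) {α : ℝ} (hα : 0 < α) {R : ℝ} (hR : 0 < R)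
    (d : IsDeformation a b D.m₀ R D.domain) :
    ∀ᶠ τ : ℝ in 𝓝[>] 0, Complex.I * τ ∈ Metric.ball (0 : ℂ) R ∧ ∃ δ > 0,
      U a ∉ Ioo (c₀ - δ) (c₀ + δ) ∧ U b ∉ Ioo (c₀ - δ) (c₀ + δ) ∧
      ∀ c ∈ halfStrip c₀ δ, ∀ x ∈ Icc a b,
        speed (D.height τ) x ^ 2 * (Complex.I * α * (D.profile τ x - c)) ∈ Complex.slitPlane := by
  obtain ⟨η, hη, hor⟩ := D.exists_margin hab hU
  have hUc : ContDiffOn ℝ ∞ (fun x => (U x : ℂ)) (Icc a b) :=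
    Complex.ofRealCLM.contDiff.comp_contDiffOn hU
  have cU' : ContinuousOn (derivWithin U (Icc a b)) (Icc a b) :=
    hU.continuousOn_derivWithin (uniqueDiffOn_Icc hab) (by simp)
  have cm := D.m₀_smooth.continuous
  obtain ⟨B, hB0, hB⟩ := exists_norm_le_Icc (a := a) (b := b)
    (f := fun x => D.m₀ x * derivWithin U (Icc a b) x) (by fun_prop)
  obtain ⟨M, hM0, hM⟩ := exists_norm_le_Icc (a := a) (b := b) (f := deriv D.m₀)
    (D.m₀_smooth.continuous_deriv (by simp)).continuousOn
  have hI : Tendsto (fun τ : ℝ => Complex.I * (τ : ℂ)) (𝓝[>] 0) (𝓝 0) := by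
    have : Continuous fun τ : ℝ => Complex.I * (τ : ℂ) := by fun_prop
    exact (this.tendsto' 0 0 (by simp)).mono_left nhdsWithin_le_nhds
  have hsmall : ∀ p q : ℝ, 0 < q → ∀ᶠ τ : ℝ in 𝓝[>] 0, τ * p ≤ q := fun p q hq => by
    have : Continuous fun τ : ℝ => τ * p := by fun_prop
    exact ((this.tendsto' 0 0 (by simp)).mono_left nhdsWithin_le_nhds).eventually_le_const hq
  filter_upwards [hI.eventually (d.eventually_taylor hab hR D.isExtension hUc
    (η := η / 4) (by positivity)), hI.eventually (Metric.ball_mem_nhds (0 : ℂ) hR),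
    hsmall 1 1 one_pos, hsmall M (1 / 2) (by norm_num),
    hsmall (4 * M * (B + η + 1)) (η / 4) (by positivity), self_mem_nhdsWithin]
    with τ h1 h2 h3 h4 h5 h6
  have hτ : 0 < τ := h6
  have ha := abs_pos.2 (sub_ne_zero.2 hc₀.ne_left)
  have hb := abs_pos.2 (sub_ne_zero.2 hc₀.ne_right)
  refine ⟨h2, min (η * τ / 4) (min |U a - c₀| |U b - c₀|), by positivity, ?_, ?_,
    fun c hc x hx => ?_⟩
  · rintro ⟨k1, k2⟩
    have : |U a - c₀| < min (η * τ / 4) (min |U a - c₀| |U b - c₀|) :=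
      abs_lt.2 ⟨by linarith, by linarith⟩
    exact (lt_irrefl _ (this.trans_le ((min_le_right _ _).trans (min_le_left _ _))))
  · rintro ⟨k1, k2⟩
    have : |U b - c₀| < min (η * τ / 4) (min |U a - c₀| |U b - c₀|) :=
      abs_lt.2 ⟨by linarith, by linarith⟩
    exact (lt_irrefl _ (this.trans_le ((min_le_right _ _).trans (min_le_right _ _))))
  · have hm : HasDerivAt D.m₀ (deriv D.m₀ x) x :=
      (D.m₀_smooth.differentiable (by simp) x).hasDerivAt
    have hs : speed (D.height τ) x = 1 + Complex.I * ((τ * deriv D.m₀ x : ℝ) : ℂ) := by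
      rw [speed, show deriv (D.height τ) x = _ from (hm.const_mul τ).deriv]
    rw [hs]
    refine mem_slitPlane_of_margin (u := U x) (g := D.m₀ x * derivWithin U (Icc a b) x) (B := B)
      (k := τ * M) hα ?_ h4 hη (by linarith) hτ (by linarith) (by positivity)
      (min_le_left _ _)
      ?_ (hB x hx) (hor x hx) hc
    · rw [abs_mul, abs_of_pos hτ]
      exact mul_le_mul_of_nonneg_left (hM x hx) hτ.le
    · have h7 : curveDeriv a b 0 (fun x => (U x : ℂ)) x = (derivWithin U (Icc a b) x : ℝ) := by
        refine curveDeriv_eq_of_hasDerivWithinAt hab hx ?_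
        rw [speed_zero, one_mul]
        exact (hU.differentiableOn (by simp) x hx).hasDerivWithinAt.ofReal_comp
      have h8 := h1 x hx
      rw [h7] at h8
      rw [D.profile_eq]
      push_cast
      refine h8.trans (le_of_eq ?_)
      rw [norm_mul, Complex.norm_I, one_mul, Complex.norm_real, Real.norm_of_nonneg hτ.le]
      ring

end DeformationData

/-! ### Simple resonances -/

section Simple

variable {a b : ℝ} {m : ℝ → ℝ} {α : ℝ}

/-- The Dirichlet problem for `∂² - α²` on a curve from `a` to `b` has only the zero solution. -/
theorem eqOn_zero_of_curveLaplace_eq_zero (hab : a < b) (hα : 0 < α) (hm : ContDiff ℝ ∞ m)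
    (hma : m a = 0) (hmb : m b = 0) {ψ : ℝ → ℂ} (hψ : ContDiffOn ℝ ∞ ψ (Icc a b))
    (hbc : DirichletBC a b ψ) (h : ∀ x ∈ Icc a b, curveLaplace a b m α ψ x = 0) :
    ∀ x ∈ Icc a b, ψ x = 0 := by
  -- the solution `sinh(α(z - b))` is the test function
  have hz : ∀ x, HasDerivAt (fun x : ℝ => (α : ℂ) * (x + Complex.I * m x - b))
      (α * speed m x) x := fun x => by
    have h1 : HasDerivAt m (deriv m x) x := (hm.differentiable (by simp) x).hasDerivAt
    exact (((Complex.ofRealCLM.hasDerivAt (x := x)).add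
      (h1.ofReal_comp.const_mul Complex.I)).sub_const _).const_mul _
  have hs : LapOn a b m α (fun x => Complex.sinh (α * (x + Complex.I * m x - b)))
      (fun x => α * Complex.cosh (α * (x + Complex.I * m x - b))) fun _ => 0 :=
    ⟨fun x _ => ((Complex.hasDerivAt_sinh _).comp x (hz x)).hasDerivWithinAt.congr_deriv (by ring),
      fun x _ => (((Complex.hasDerivAt_cosh _).comp x (hz x)).const_mul
        (α : ℂ)).hasDerivWithinAt.congr_deriv (by ring), continuousOn_const⟩
  have hL := LapOn.of_contDiffOn (α := α) hab hm hψ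
  have hg := (hL.congr_lap (Lf' := fun _ => 0) h).green hab.le hm hs
  have h0 : curveDeriv a b m ψ a * Complex.sinh (α * (a + Complex.I * m a - b)) = 0 := by
    rw [hbc.1, hbc.2, hma, hmb] at hg
    simp only [mul_zero, Complex.ofReal_zero, add_zero, sub_self, Complex.sinh_zero, zero_mul,
      zero_sub] at hg
    rw [hma]
    simpa using hg
  have hsinh : Complex.sinh (α * (a + Complex.I * m a - b)) ≠ 0 := by
    rw [hma, Complex.ofReal_zero, mul_zero, add_zero, ← Complex.ofReal_sub, ← Complex.ofReal_mul,
      ← Complex.ofReal_sinh]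
    refine Complex.ofReal_ne_zero.2 fun h => ?_
    rw [Real.sinh_eq_zero] at h
    exact (mul_neg_of_pos_of_neg hα (sub_neg.2 hab)).ne h
  exact hL.eqOn_zero_of_rayleigh hab hm (q := fun _ => 0) contDiffOn_const
    (fun x hx => by rw [h x hx, zero_mul]) hbc.1 ((mul_eq_zero.1 h0).resolve_right hsinh)

theorem orrSommerfeldOp_zero (W : ℝ → ℂ) (c : ℂ) (f : ℝ → ℂ) (x : ℝ) :
    orrSommerfeldOp a b m α W c 0 f x =
      (W x - c) * curveLaplace a b m α f x - curveDeriv a b m (curveDeriv a b m W) x * f x := by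
  simp [orrSommerfeldOp]

/-- The space of generalized eigenvectors of the Rayleigh problem is a line only if it is spanned by
an eigenfunction `ψ₀` with non-vanishing pairing: otherwise a solution `ψ₁` of `P ψ₁ = (∂² - α²)ψ₀`,
found by variation of constants, is a second generalized eigenvector. -/
theorem exists_state_of_finrank_eq_one (hab : a < b) (hα : 0 < α) (hm : ContDiff ℝ ∞ m)
    (hma : m a = 0) (hmb : m b = 0) {W : ℝ → ℂ} (hW : ContDiffOn ℝ ∞ W (Icc a b)) {c : ℂ}
    (hne : ∀ x ∈ Icc a b, W x - c ≠ 0)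
    (hfin : Module.finrank ℂ (generalizedEigenspace a b m α (DirichletBC a b)
      (orrSommerfeldOp a b m α W c 0)) = 1) :
    ∃ ψ₀ : ℝ → ℂ, ContDiffOn ℝ ∞ ψ₀ (Icc a b) ∧ DirichletBC a b ψ₀ ∧
      (∀ x ∈ Icc a b, (W x - c) * curveLaplace a b m α ψ₀ x =
        curveDeriv a b m (curveDeriv a b m W) x * ψ₀ x) ∧
      (∃ x ∈ Icc a b, ψ₀ x ≠ 0) ∧
      graphIntegral a b m (fun x => ψ₀ x * (curveLaplace a b m α ψ₀ x / (W x - c))) ≠ 0 ∧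
      ∀ ψ : ℝ → ℂ, (Icc a b).domRestrict ψ ∈ generalizedEigenspace a b m α (DirichletBC a b)
        (orrSommerfeldOp a b m α W c 0) → ∃ k : ℂ, ∀ x ∈ Icc a b, ψ x = k * ψ₀ x := by
  set P := orrSommerfeldOp a b m α W c 0 with hP
  have hzero : ∀ x ∈ Icc a b, curveLaplace a b m α (fun _ => 0) x = 0 := fun x hx => by
    rw [curveLaplace, curveDeriv_eqOn_zero (curveDeriv_eqOn_zero fun _ _ => rfl) x hx]
    simp
  obtain ⟨ψ₀, hψ₀, hbc, hPψ₀, hnz⟩ : ∃ ψ₀ : ℝ → ℂ, ContDiffOn ℝ ∞ ψ₀ (Icc a b) ∧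
      DirichletBC a b ψ₀ ∧ (∀ x ∈ Icc a b, P ψ₀ x = 0) ∧ ∃ x ∈ Icc a b, ψ₀ x ≠ 0 := by
    by_contra! hno
    have : generalizedEigenspace a b m α (DirichletBC a b) P = ⊥ := by
      refine le_bot_iff.1 (sInf_le fun ψ φ hψ _ hb hφS hPψ => ?_)
      have hφ : ∀ x ∈ Icc a b, φ x = 0 := fun x hx =>
        congrFun ((Submodule.mem_bot ℂ).1 hφS) ⟨x, hx⟩
      have := hno ψ hψ hb fun x hx => by
        rw [hPψ hx, curveLaplace_congr (g := fun _ => 0) hφ hx, hzero x hx]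
      refine (Submodule.mem_bot ℂ).2 ?_
      ext ⟨x, hx⟩
      exact this x hx
    rw [this, finrank_bot] at hfin
    exact zero_ne_one hfin
  have hmem : ∀ X ∈ {S : Submodule ℂ (Icc a b → ℂ) | ∀ ψ φ : ℝ → ℂ, ContDiffOn ℝ ∞ ψ (Icc a b) →
      ContDiffOn ℝ ∞ φ (Icc a b) → DirichletBC a b ψ → (Icc a b).domRestrict φ ∈ S →
      EqOn (P ψ) (curveLaplace a b m α φ) (Icc a b) → (Icc a b).domRestrict ψ ∈ S},
      (Icc a b).domRestrict ψ₀ ∈ X := fun X hX =>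
    hX ψ₀ (fun _ => 0) hψ₀ contDiffOn_const hbc X.zero_mem fun x hx => by
      rw [hPψ₀ x hx, hzero x hx]
  have hspan : ∀ ψ : ℝ → ℂ, (Icc a b).domRestrict ψ ∈ generalizedEigenspace a b m α
      (DirichletBC a b) P → ∃ k : ℂ, ∀ x ∈ Icc a b, ψ x = k * ψ₀ x := by
    intro ψ hψ
    set v : generalizedEigenspace a b m α (DirichletBC a b) P :=
      ⟨(Icc a b).domRestrict ψ₀, Submodule.mem_sInf.2 hmem⟩ with hv
    have hv0 : v ≠ 0 := fun h => by
      obtain ⟨x, hx, hx0⟩ := hnz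
      exact hx0 (congrFun (congrArg Subtype.val h) ⟨x, hx⟩)
    obtain ⟨k, hk⟩ := (finrank_eq_one_iff_of_nonzero' v hv0).1 hfin ⟨_, hψ⟩
    exact ⟨k, domRestrict_eq_smul.1 (congrArg Subtype.val hk).symm⟩
  have heqn : ∀ x ∈ Icc a b, (W x - c) * curveLaplace a b m α ψ₀ x =
      curveDeriv a b m (curveDeriv a b m W) x * ψ₀ x := fun x hx => by
    have := hPψ₀ x hx
    rw [hP, orrSommerfeldOp_zero] at this
    exact sub_eq_zero.1 this
  refine ⟨ψ₀, hψ₀, hbc, heqn, hnz, fun hI => ?_, hspan⟩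
  have hW₂ : ContDiffOn ℝ ∞ (curveDeriv a b m (curveDeriv a b m W)) (Icc a b) :=
    contDiffOn_curveDeriv hab hm (contDiffOn_curveDeriv hab hm hW)
  have hWc : ContDiffOn ℝ ∞ (fun x => W x - c) (Icc a b) := hW.sub contDiffOn_const
  set q : ℝ → ℂ := fun x => curveDeriv a b m (curveDeriv a b m W) x / (W x - c) with hq
  have cq : ContDiffOn ℝ ∞ q (Icc a b) := by
    simpa only [hq, div_eq_mul_inv, Pi.inv_apply] using hW₂.mul (hWc.inv hne)
  have ck : ContDiffOn ℝ ∞ (fun x => curveLaplace a b m α ψ₀ x / (W x - c)) (Icc a b) :=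
    by simpa only [div_eq_mul_inv, Pi.inv_apply] using (contDiffOn_curveLaplace hab hm hψ₀).mul (hWc.inv hne)
  have hLψ : ∀ x ∈ Icc a b, curveLaplace a b m α ψ₀ x = q x * ψ₀ x := fun x hx => by
    rw [hq, div_mul_eq_mul_div, eq_div_iff (hne x hx), ← heqn x hx, mul_comm]
  obtain ⟨χ, hχ, hLχ, hwr⟩ := exists_second_solution hab hm cq hψ₀ hLψ hbc.1 hnz
  have hl := lapOn_variationOfConstants hab hm hψ₀ hχ ck.continuousOn cq.continuousOn hLψ hLχ hwr
  set ψ₁ := variationOfConstants a m ψ₀ χ fun x => curveLaplace a b m α ψ₀ x / (W x - c)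
  have hψ₁ : ContDiffOn ℝ ∞ ψ₁ (Icc a b) := contDiffOn_variationOfConstants hab hm hψ₀ hχ ck
  have hPψ₁ : ∀ x ∈ Icc a b, P ψ₁ x = curveLaplace a b m α ψ₀ x := fun x hx => by
    rw [hP, orrSommerfeldOp_zero, hl.curveLaplace_eq hab hx, hq]
    have := hne x hx
    field_simp
    ring
  obtain ⟨k, hk⟩ := hspan ψ₁ (Submodule.mem_sInf.2 fun X hX => hX ψ₁ ψ₀ hψ₁ hψ₀
    ⟨variationOfConstants_left _ _ _, variationOfConstants_right hbc.2 hI⟩ (hmem X hX) hPψ₁)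
  obtain ⟨x, hx, hx0⟩ := hnz
  refine hx0 (eqOn_zero_of_curveLaplace_eq_zero hab hα hm hma hmb hψ₀ hbc (fun x hx => ?_) x hx)
  rw [← hPψ₁ x hx, hP, orrSommerfeldOp_zero, curveLaplace_congr (g := fun x => k * ψ₀ x) hk hx,
    curveLaplace_const_mul, hk x hx]
  linear_combination k * heqn x hx

end Simple

/-! ### The eigenvalue branch near a simple resonance -/

namespace RayleighResonance

variable (S : RayleighResonance)

/-- The slope does not depend on the normalization of the resonant state. -/
theorem slope_of_eq_smul {κa κb k : ℂ} (hk : k ≠ 0) {ψ : ℝ → ℂ}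
    (h : ∀ x ∈ Icc S.a S.b, ψ x = k * S.ψ₀ x) :
    graphIntegral S.a S.b S.m (fun x => ψ x * (S.L ψ x / (S.W x - S.c₁))) ≠ 0 ∧
    (κa⁻¹ * S.D ψ S.a ^ 2 - κb⁻¹ * S.D ψ S.b ^ 2) /
      graphIntegral S.a S.b S.m (fun x => ψ x * (S.L ψ x / (S.W x - S.c₁))) = S.slope κa κb := by
  have hab := S.hab.le
  have hI : graphIntegral S.a S.b S.m (fun x => ψ x * (S.L ψ x / (S.W x - S.c₁))) =
      k ^ 2 * S.pairing := by
    rw [pairing, ← graphIntegral_const_mul]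
    refine graphIntegral_congr hab fun x hx => ?_
    simp only [L]
    rw [curveLaplace_congr (g := fun x => k * S.ψ₀ x) h hx, curveLaplace_const_mul, h x hx]
    ring
  have hD : ∀ x ∈ Icc S.a S.b, S.D ψ x = k * S.D S.ψ₀ x := fun x hx => by
    rw [D, curveDeriv_congr (g := fun x => k * S.ψ₀ x) h hx, curveDeriv_const_mul]
  have hp : S.pairing ≠ 0 := S.pairing_ne
  rw [hI, hD _ (left_mem_Icc.2 hab), hD _ (right_mem_Icc.2 hab), slope]
  refine ⟨mul_ne_zero (pow_ne_zero 2 hk) hp, ?_⟩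
  rw [← mul_div_mul_left _ S.pairing (pow_ne_zero 2 hk)]
  ring_nf

/-- The spectrum of the Orr–Sommerfeld operator on the real segment near a resonance. -/
theorem exists_orrSommerfeld_eigenvalue {U : ℝ → ℝ} (hU : ContDiffOn ℝ ∞ U (Icc S.a S.b))
    (htr : ∀ (ε : ℝ) (c : ℂ) (Y Y₀ : ℝ → OSPhase × OSPhase),
      SolvesOn S.a S.b (fun x => pairSystem S.α (viscosity S.α ε)⁻¹ (speed S.m x)
        (S.W x - c) (S.W₂ x)) Y →
      SolvesOn S.a S.b (fun x => pairSystem S.α (viscosity S.α ε)⁻¹ (speed 0 x)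
        (U x - c) (curveDeriv S.a S.b 0 (curveDeriv S.a S.b 0 fun x => (U x : ℂ)) x)) Y₀ →
      Y S.a = Y₀ S.a → Y S.b = Y₀ S.b) :
    ∃ (c : ℝ → ℂ) (ν ε₀ : ℝ), 0 < ν ∧ 0 < ε₀ ∧
      (∀ ε ∈ Ioo 0 ε₀,
        orrSommerfeldSpectrum S.a S.b U S.α ε ∩ Metric.ball S.c₁ ν = {c ε} ∧
        Module.finrank ℂ (orrSommerfeldEigenspace S.a S.b U S.α ε (c ε)) = 1) ∧
      ∀ κa κb, S.IsLayerExponent S.a κa → S.IsLayerExponent S.b κb →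
        (fun ε : ℝ => c ε - (S.c₁ + S.slope κa κb * ε)) =O[𝓝[>] (0 : ℝ)] fun ε : ℝ => ε ^ 2 := by
  have hUc : ContDiffOn ℝ ∞ (fun x => (U x : ℂ)) (Icc S.a S.b) :=
    Complex.ofRealCLM.contDiff.comp_contDiffOn hU
  obtain ⟨c, ν, ε₀, hν, hε₀, hc, hexp⟩ := S.exists_eigenvalue_branch
  refine ⟨c, ν, ε₀, hν, hε₀, fun ε hε => ?_, hexp⟩
  obtain ⟨hmem, huniq, hT⟩ := hc ε hε
  have hspec : ∀ c', c' ∈ orrSommerfeldSpectrum S.a S.b U S.α ε ↔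
      ¬ HasTrivialKernel S.a S.b S.α (fun x => (U x : ℂ)) ε c' := fun c' =>
    not_congr (isInvertibleOntoL2_iff S.hab S.hα hε.1 hUc)
  obtain ⟨hker, hdim⟩ := (S.transfer hε.1 hUc (htr ε (c ε))).2 hT
  refine ⟨Subset.antisymm ?_ ?_, hdim⟩
  · rintro c' ⟨h1, h2⟩
    by_contra hne
    refine (hspec c').1 h1 ((S.transfer hε.1 hUc (htr ε c')).1 fun T hTop x hx => ?_)
    by_contra hx0
    exact hne (huniq c' h2 T hTop ⟨x, hx, hx0⟩)
  · rintro _ rfl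
    exact ⟨(hspec _).2 hker, hmem⟩

end RayleighResonance

theorem proposition4p6 (a b : ℝ) (hab : a < b) (α : ℝ) (hα : 0 < α)
    (U : ℝ → ℝ) (hU : ContDiffOn ℝ ∞ U (Icc a b)) (c₀ : ℝ) (hc₀ : ProfileHypothesis a b U c₀)
    (D : DeformationData a b U c₀) :
    ∃ τ₀ > 0, ∀ τ ∈ Ioo 0 τ₀, ∃ δ > 0,
      (∀ c ∈ halfStrip c₀ δ, ∀ x ∈ Icc a b, D.profile τ x ≠ c) ∧
      U a ∉ Ioo (c₀ - δ) (c₀ + δ) ∧ U b ∉ Ioo (c₀ - δ) (c₀ + δ) ∧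
      ∀ c₁ ∈ resonances D α τ δ, Module.finrank ℂ (resonantStates D α τ c₁) = 1 →
        ∃ (c : ℝ → ℂ) (ν ε₀ : ℝ), 0 < ν ∧ 0 < ε₀ ∧
          (∀ ε ∈ Ioo 0 ε₀,
            orrSommerfeldSpectrum a b U α ε ∩ Metric.ball c₁ ν = {c ε} ∧
            Module.finrank ℂ (orrSommerfeldEigenspace a b U α ε (c ε)) = 1) ∧
          ∃ κa κb : ℂ,
            κa ^ 2 = Complex.I * α * (U a - c₁) ∧ κa.re < 0 ∧
            κb ^ 2 = Complex.I * α * (U b - c₁) ∧ 0 < κb.re ∧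
            ∀ ψ₀ : ℝ → ℂ, (Icc a b).domRestrict ψ₀ ∈ resonantStates D α τ c₁ →
              (∃ x ∈ Icc a b, ψ₀ x ≠ 0) →
              graphIntegral a b (D.height τ) (fun x =>
                ψ₀ x * (curveLaplace a b (D.height τ) α ψ₀ x / (D.profile τ x - c₁))) ≠ 0 ∧
              (fun ε : ℝ => c ε - (c₁ +
                  (κa⁻¹ * (curveDeriv a b (D.height τ) ψ₀ a) ^ 2
                    - κb⁻¹ * (curveDeriv a b (D.height τ) ψ₀ b) ^ 2) /
                  graphIntegral a b (D.height τ) (fun x =>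
                    ψ₀ x * (curveLaplace a b (D.height τ) α ψ₀ x / (D.profile τ x - c₁)))
                  * (ε : ℂ)))
                =O[𝓝[>] (0 : ℝ)] fun ε : ℝ => ε ^ 2 := by
  have hUc : ContDiffOn ℝ ∞ (fun x => (U x : ℂ)) (Icc a b) :=
    Complex.ofRealCLM.contDiff.comp_contDiffOn hU
  obtain ⟨R, hR, d⟩ := D.exists_isDeformation
  obtain ⟨τ₀, hτ₀, hsub⟩ := mem_nhdsGT_iff_exists_Ioo_subset.1
    (D.eventually_elliptic hab hU hc₀ hα hR d)
  refine ⟨τ₀, hτ₀, fun τ hτ => ?_⟩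
  obtain ⟨hball, δ, hδ, hUa, hUb, hell⟩ := hsub hτ
  have hne : ∀ c ∈ halfStrip c₀ δ, ∀ x ∈ Icc a b, D.profile τ x - c ≠ 0 := fun c hc x hx h =>
    Complex.slitPlane_ne_zero (hell c hc x hx) (by rw [h]; ring)
  refine ⟨δ, hδ, fun c hc x hx => sub_ne_zero.1 (hne c hc x hx), hUa, hUb, fun c₁ hc₁ hfin => ?_⟩
  have hm : ContDiff ℝ ∞ (D.height τ) := contDiff_const.mul D.m₀_smooth
  have hm0 : ∀ x, (x = a ∨ x = b) → D.height τ =ᶠ[𝓝 x] 0 := fun x hx => by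
    filter_upwards [D.m₀_eventuallyEq_zero hx] with y hy
    simp [DeformationData.height, hy]
  have hW : ContDiffOn ℝ ∞ (D.profile τ) (Icc a b) :=
    (d.contDiffOn D.isExtension hUc hball).congr fun x _ => D.profile_eq τ x
  obtain ⟨ψ₀, hψ₀, hbc, heqn, hnz, hI, hspan⟩ := exists_state_of_finrank_eq_one hab hα hm
    (hm0 a (Or.inl rfl)).self_of_nhds (hm0 b (Or.inr rfl)).self_of_nhds hW (hne c₁ hc₁.1) hfin
  let S : RayleighResonance :=
    { a := a, b := b, α := α, hab := hab, hα := hα, m := D.height τ, hm := hm,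
      hma := hm0 a (Or.inl rfl), hmb := hm0 b (Or.inr rfl), W := D.profile τ, hW := hW, c₁ := c₁,
      slit := hell c₁ hc₁.1, ψ₀ := ψ₀, hψ₀ := hψ₀, bc := hbc, eqn := heqn, ne_zero := hnz,
      pairing_ne := hI }
  have hend : ∀ x ∈ Icc a b, (x = a ∨ x = b) → D.profile τ x = U x := fun x hx h => by
    rw [D.profile_eq, (D.m₀_eventuallyEq_zero h).self_of_nhds]
    simpa using D.V_eq x hx
  obtain ⟨c, ν, ε₀, hν, hε₀, hc, hexp⟩ := S.exists_orrSommerfeld_eigenvalue hU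
    fun ε c Y Y₀ hY hY₀ h => d.pairSystem_monodromy hab D.isExtension hUc hball
      (fun x _ => D.profile_eq τ x) α _ c hY hY₀ h
  obtain ⟨κa, κb, h1, h2, h3, h4⟩ := S.exists_layer_exponents
  have hexp := hexp κa κb (S.isLayerExponent_left h1 h2) (S.isLayerExponent_right h3 h4)
  refine ⟨c, ν, ε₀, hν, hε₀, hc, κa, κb, ?_, h2, ?_, h4, fun ψ hψ hψ0 => ?_⟩
  · rw [← hend a (left_mem_Icc.2 hab.le) (Or.inl rfl)]
    exact h1
  · rw [← hend b (right_mem_Icc.2 hab.le) (Or.inr rfl)]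
    exact h3
  · obtain ⟨k, hk⟩ := hspan ψ hψ
    have hk0 : k ≠ 0 := by
      rintro rfl
      obtain ⟨x, hx, hx0⟩ := hψ0
      exact hx0 (by rw [hk x hx, zero_mul])
    obtain ⟨h5, h6⟩ := S.slope_of_eq_smul (κa := κa) (κb := κb) hk0 hk
    refine ⟨h5, ?_⟩
    rw [← h6] at hexp
    exact hexp

end
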